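/- Let $n\ge 1$ and $\mu_0,\dots,\mu_n\in(0,1)$, and put $|\mu|=\mu_0+\cdots+\mu_n$ and $w_k=e^{\pi\sqrt{-1}(\mu_0+\cdots+\mu_{k-1})}$ for $k=1,\dots,n+1$. Let $(\mathbb C^{n+1})^\circ$ be the space of $(n+1)$-tuples $z=(z_0,\dots,z_n)$ of pairwise distinct complex numbers, with base point $[n]=(0,1,\dots,n)$. For $z$ near $[n]$ let $F=(F_1,\dots,F_n)$ be given by $$F_k(z)=\int_{z_{k-1}}^{z_k}\prod_{j<k}(\zeta-z_j)^{-\mu_j}\prod_{j\ge k}(z_j-\zeta)^{-\mu_j}\,d\zeta,$$ the integral being taken over the straight segment, with principal branches. The germ of $F$ at $[n]$ can be continued analytically along every path in $(\mathbb C^{n+1})^\circ$ that starts at $[n]$, and for every loop $\alpha$ in $(\mathbb C^{n+1})^\circ$ at $[n]$ its continuation along $\alpha$ is $TF$ for some $T\in GL_n(\mathbb C)$. The matrices $T\in GL_n(\mathbb C)$ so obtained from all loops generate the monodromy group $\Gamma$, which acts on $\mathbb C^n$. A value of $F$ over $z$ is the value at $z$ of the continuation of $F$ along some path from $[n]$ to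 $z$. On $\mathbb C^{n+1}$ consider the sesquilinear form $$\tilde H(F,G)=\sum_{1\le j<k\le n+1}\mathrm{Im}(w_j\bar w_k)\,F_k\bar G_j$$ and the hyperplane $\tilde A=\{\sum_{k=1}^{n+1}\mathrm{Im}(w_k)F_k=0\}$; let $A\subset\mathbb C^n$ be the hyperplane $\sum_{k=1}^{n}\mathrm{Im}(w_k)F_k=0$. The projection that forgets the last coordinate maps $\tilde A$ isomorphically onto $\mathbb C^n$ if $|\mu|\notin\mathbb Z$; if $|\mu|\in\mathbb Z$, it maps $\tilde A$ onto $A$, with kernel spanned by the last basis vector. In both cases the restriction of $\tilde H$ to $\tilde A$ induces a form $H$ on the image, that is, on $\mathbb C^n$ if $|\mu|\notin\mathbb Z$ and on $A$ if $|\mu|\in\mathbb Z$. Then: 1. $H$ is Hermitian and $\Gamma$-invariant for all such $\mu$ (if $|\mu|\in\mathbb Z$, then $\Gamma$ preserves $A$ and the form $H$ on $A$). 2. If $|\mu|<1$, then $H$ is positive definite on $\mathbb C^n$. 3. If $|\mu|=1$, then $H$ is positive definite on $A$. 4. If $1<|\mu|<2$, then $H$ has signature $(n-1,1)$ on $\mathbb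 C^n$, and for every $z\in(\mathbb C^{n+1})^\circ$ and every value $v$ of $F$ over $z$ one has $$H(v,v)=N(z):=-\int_{\mathbb C}|z_0-\zeta|^{-2\mu_0}\cdots|z_n-\zeta|^{-2\mu_n}\,d(\mathrm{area})<0,$$ where the integral converges. -/

import Mathlib

open scoped ComplexConjugate Topology

noncomputable section

namespace Lauricella

/-- The total weight `|μ| = μ₀ + ⋯ + μₙ`. -/
def totalWeight {n : ℕ} (μ : Fin (n + 1) → ℝ) : ℝ := ∑ i, μ i

/-- The configuration space of `(n+1)`-tuples of pairwise distinct complex numbers. -/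
def configSpace (n : ℕ) : Set (Fin (n + 1) → ℂ) := {z | Function.Injective z}

/-- The base point `[n] = (0, 1, …, n)` of the configuration space. -/
def basePoint (n : ℕ) : Fin (n + 1) → ℂ := fun k => ((k : ℕ) : ℂ)

/-- The numbers `w₁, …, wₙ₊₁`, `w_k = exp (π √-1 (μ₀ + ⋯ + μ_{k-1}))`. Indices are shifted by one:
`w μ k` for `k = 0, …, n` is the number usually called `w_{k+1}`. -/
def w {n : ℕ} (μ : Fin (n + 1) → ℝ) (k : Fin (n + 1)) : ℂ :=
  Complex.exp ((Real.pi * ∑ j ∈ Finset.Iic k, μ j : ℝ) * Complex.I)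

/-- The integrand of the `(k+1)`-st Lauricella function, along the arc from `z_k` to `z_{k+1}`:
`(ζ - z₀)^{-μ₀} ⋯ (ζ - z_k)^{-μ_k} (z_{k+1} - ζ)^{-μ_{k+1}} ⋯ (zₙ - ζ)^{-μₙ}`
(`k = 0, …, n - 1`, principal branches). -/
def integrand {n : ℕ} (μ : Fin (n + 1) → ℝ) (k : Fin n) (z : Fin (n + 1) → ℂ) (ζ : ℂ) : ℂ :=
  ∏ j, (if j ≤ k.castSucc then ζ - z j else z j - ζ) ^ (-(μ j : ℂ))

/-- The basic Lauricella functions `F₁, …, Fₙ` near the base point: the integral over the straight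
segment `δ_k` from `z_k` to `z_{k+1}`. For `z` near the base point, the bases of all the powers have
positive real part on the interior of the segment, and for real `z₀ < ⋯ < zₙ` the integrand is
positive there. Only the germ of this map at the base point is used. -/
def baseF {n : ℕ} (μ : Fin (n + 1) → ℝ) (z : Fin (n + 1) → ℂ) (k : Fin n) : ℂ :=
  ∫ t in (0 : ℝ)..1,
    integrand μ k z (z k.castSucc + (t : ℂ) * (z k.succ - z k.castSucc)) *
      (z k.succ - z k.castSucc)

/-- `Φ` is an analytic continuation along the path `γ`: for every time `t`, `Φ t` is analytic at
`γ t`, and for `s` near `t` the maps `Φ s` and `Φ t` have the same germ at `γ s`. -/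
def IsAnalyticContinuation {n : ℕ} {a b : Fin (n + 1) → ℂ} (γ : Path a b)
    (Φ : unitInterval → (Fin (n + 1) → ℂ) → (Fin n → ℂ)) : Prop :=
  (∀ t, AnalyticAt ℂ (Φ t) (γ t)) ∧ ∀ t, ∀ᶠ s in 𝓝 t, Φ s =ᶠ[𝓝 (γ s)] Φ t

/-- `G` is the result of continuing the germ at the base point of `F = (F₁, …, Fₙ)` analytically
along the path `γ`, which starts at the base point and stays in the configuration space. -/
def IsContinuationOfF {n : ℕ} (μ : Fin (n + 1) → ℝ) {z : Fin (n + 1) → ℂ}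
    (γ : Path (basePoint n) z) (G : (Fin (n + 1) → ℂ) → (Fin n → ℂ)) : Prop :=
  (∀ t, γ t ∈ configSpace n) ∧
    ∃ Φ, IsAnalyticContinuation γ Φ ∧ Φ 0 =ᶠ[𝓝 (basePoint n)] baseF μ ∧ Φ 1 = G

/-- The monodromy matrices: the `T` in `GL n ℂ` such that the continuation of `F` along some loop at
the base point is `T F`. -/
def monodromyMatrices {n : ℕ} (μ : Fin (n + 1) → ℝ) : Set (GL (Fin n) ℂ) :=
  {T | ∃ (γ : Path (basePoint n) (basePoint n)) (G : (Fin (n + 1) → ℂ) → (Fin n → ℂ)),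
    IsContinuationOfF μ γ G ∧ G =ᶠ[𝓝 (basePoint n)] fun z => T.val.mulVec (baseF μ z)}

/-- The monodromy group, acting on `ℂⁿ`. -/
def monodromyGroup {n : ℕ} (μ : Fin (n + 1) → ℝ) : Subgroup (GL (Fin n) ℂ) :=
  Subgroup.closure (monodromyMatrices μ)

/-- The sesquilinear form `H̃(F, G) = ∑_{j < k} Im (w_j w̄_k) F_k Ḡ_j` on `ℂⁿ⁺¹`, linear in the first
and conjugate-linear in the second variable. -/
def tildeH {n : ℕ} (μ : Fin (n + 1) → ℝ) :
    (Fin (n + 1) → ℂ) →ₗ[ℂ] (Fin (n + 1) → ℂ) →ₗ⋆[ℂ] ℂ :=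
  LinearMap.mk₂'ₛₗ (RingHom.id ℂ) (starRingEnd ℂ)
    (fun F G => ∑ j, ∑ k, if j < k then
      ((w μ j * conj (w μ k)).im : ℂ) * F k * conj (G j) else 0)
    (fun F F' G => by
      simp only [← Finset.sum_add_distrib]
      refine Finset.sum_congr rfl fun j _ => Finset.sum_congr rfl fun k _ => ?_
      split_ifs <;> simp; ring)
    (fun c F G => by
      simp only [Finset.smul_sum]
      refine Finset.sum_congr rfl fun j _ => Finset.sum_congr rfl fun k _ => ?_
      split_ifs <;> simp; ring)
    (fun F G G' => by
      simp only [← Finset.sum_add_distrib]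
      refine Finset.sum_congr rfl fun j _ => Finset.sum_congr rfl fun k _ => ?_
      split_ifs <;> simp; ring)
    (fun c F G => by
      simp only [Finset.smul_sum]
      refine Finset.sum_congr rfl fun j _ => Finset.sum_congr rfl fun k _ => ?_
      split_ifs <;> simp; ring)

/-- The linear form `∑_{k ≤ n} Im (w_k) F_k` on `ℂⁿ`. -/
def imForm {n : ℕ} (μ : Fin (n + 1) → ℝ) : (Fin n → ℂ) →ₗ[ℂ] ℂ :=
  ∑ k : Fin n, ((w μ k.castSucc).im : ℂ) • LinearMap.proj k

/-- The linear form `∑_{k ≤ n + 1} Im (w_k) F_k` on `ℂⁿ⁺¹`. -/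
def tildeImForm {n : ℕ} (μ : Fin (n + 1) → ℝ) : (Fin (n + 1) → ℂ) →ₗ[ℂ] ℂ :=
  ∑ k : Fin (n + 1), ((w μ k).im : ℂ) • LinearMap.proj k

/-- The hyperplane `A` of `ℂⁿ`: `∑_{k ≤ n} Im (w_k) F_k = 0`. -/
def hyperplaneA {n : ℕ} (μ : Fin (n + 1) → ℝ) : Submodule ℂ (Fin n → ℂ) :=
  LinearMap.ker (imForm μ)

/-- The hyperplane `Ã` of `ℂⁿ⁺¹`: `∑_{k ≤ n + 1} Im (w_k) F_k = 0`. -/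
def hyperplaneTildeA {n : ℕ} (μ : Fin (n + 1) → ℝ) : Submodule ℂ (Fin (n + 1) → ℂ) :=
  LinearMap.ker (tildeImForm μ)

open Classical in
/-- A section `ℂⁿ → ℂⁿ⁺¹` of the projection that forgets the last coordinate. If `Im wₙ₊₁ ≠ 0` (that
is, `|μ|` is not an integer), it is the inverse of the isomorphism `Ã ≅ ℂⁿ`; otherwise the last
coordinate is `0`, and `A` is sent into `Ã`. -/
def lift {n : ℕ} (μ : Fin (n + 1) → ℝ) : (Fin n → ℂ) →ₗ[ℂ] (Fin (n + 1) → ℂ) :=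
  LinearMap.pi (Fin.snoc (α := fun _ => (Fin n → ℂ) →ₗ[ℂ] ℂ) (fun k => LinearMap.proj k)
    (if (w μ (Fin.last n)).im = 0 then 0
      else (-((w μ (Fin.last n)).im : ℂ)⁻¹) • imForm μ))

/-- The form `H`: the form that `H̃`, restricted to `Ã`, induces on `ℂⁿ` if `|μ|` is not an integer,
and on the hyperplane `A` of `ℂⁿ` if `|μ|` is an integer (in the latter case only the values on `A`
have a meaning). -/
def formH {n : ℕ} (μ : Fin (n + 1) → ℝ) : (Fin n → ℂ) →ₗ[ℂ] (Fin n → ℂ) →ₗ⋆[ℂ] ℂ :=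
  ((tildeH μ).comp (lift μ)).compl₂ (lift μ)

/-- The form `H` is Hermitian on the subspace `W`. -/
def IsHermitianOn {n : ℕ} (H : (Fin n → ℂ) →ₗ[ℂ] (Fin n → ℂ) →ₗ⋆[ℂ] ℂ)
    (W : Submodule ℂ (Fin n → ℂ)) : Prop :=
  ∀ x ∈ W, ∀ y ∈ W, conj (H y x) = H x y

/-- The form `H` is positive definite Hermitian on the subspace `W`. -/
def IsPosDefOn {n : ℕ} (H : (Fin n → ℂ) →ₗ[ℂ] (Fin n → ℂ) →ₗ⋆[ℂ] ℂ)
    (W : Submodule ℂ (Fin n → ℂ)) : Prop :=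
  IsHermitianOn H W ∧ ∀ x ∈ W, x ≠ 0 → 0 < (H x x).re

/-- The form `H` on `ℂⁿ` is Hermitian of signature `(n - 1, 1)`: it has an orthogonal basis whose
vectors have square norm `1`, except for a single one with square norm `-1`. -/
def IsHyperbolic {n : ℕ} (H : (Fin n → ℂ) →ₗ[ℂ] (Fin n → ℂ) →ₗ⋆[ℂ] ℂ) : Prop :=
  ∃ (b : Module.Basis (Fin n) ℂ (Fin n → ℂ)) (i₀ : Fin n), ∀ i j,
    H (b i) (b j) = if i = j then (if i = i₀ then -1 else 1) else 0

/-- The subgroup `Γ` preserves the subspace `W` and the form `H` on it. -/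
def PreservesOn {n : ℕ} (Γ : Subgroup (GL (Fin n) ℂ))
    (H : (Fin n → ℂ) →ₗ[ℂ] (Fin n → ℂ) →ₗ⋆[ℂ] ℂ) (W : Submodule ℂ (Fin n → ℂ)) : Prop :=
  ∀ T ∈ Γ, (∀ x ∈ W, T.val.mulVec x ∈ W) ∧
    ∀ x ∈ W, ∀ y ∈ W, H (T.val.mulVec x) (T.val.mulVec y) = H x y

/-- The density `|∏ (z_k - ζ)^{-μ_k}|²` of the area form `(√-1 / 2) η ∧ η̄`. -/
def density {n : ℕ} (μ : Fin (n + 1) → ℝ) (z : Fin (n + 1) → ℂ) (ζ : ℂ) : ℝ :=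
  ∏ k, ‖z k - ζ‖ ^ (-2 * μ k)

/-- `N(z) = - ∫_ℂ |z₀ - ζ|^{-2μ₀} ⋯ |zₙ - ζ|^{-2μₙ} d(area)`. -/
def areaN {n : ℕ} (μ : Fin (n + 1) → ℝ) (z : Fin (n + 1) → ℂ) : ℝ :=
  -∫ ζ : ℂ, density μ z ζ

end Lauricella

end

/-! ### Parameter integrals, and complex powers as analytic maps on C(X, ℂ) -/

noncomputable section

namespace Lauricella

open MeasureTheory Filter Set

/-! Continuation. The functions F_k are treated together with all `period m S k`, the integrals of
the same integrand multiplied by the factors ζ - z_l, l ∈ S. Such families satisfy linear relations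
(`IsSol`): ∂_j removes j from S, exchanging one element of S changes the integral by a multiple of a
smaller one, and a total derivative gives one relation at the top. So a family without its top
member is determined at a point by n numbers (`IsSol.eq_zero_of_initSet`), and by Grönwall it
vanishes on a convex set if it vanishes at one point (`IsSol.eq_zero_of_convex`). The n segments
give independent families: at [n] a dependence would produce a nonzero polynomial of degree less
than n with a root in each of n disjoint intervals (`eq_zero_of_sum_period_basePoint`). The
configuration space is covered by convex charts, obtained by turning the plane by a unit number u
until the real parts are distinct and sorting them by σ. Two charts therefore differ by a constant
invertible matrix (`exists_transition`), whence continuation and monodromy.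

Area. Let |μ| > 1 and draw the polygon through z_0, …, z_n, prolonged horizontally. Above it the
integrand has a single-valued branch with a primitive that tends to 0 far to the left and right.
Stokes expresses the area above the polygon by boundary values (`upper_area`); reflection does the
same below, with conjugate phases on the strips between consecutive vertices. In the sum, the
interaction of a strip with itself cancels and a sesquilinear form in the strip periods remains. The
integrals along the whole polygon vanish for both branches; this places the periods in Ã and
identifies the form with a multiple of H̃ (`exists_extended_period`). So H(F, F) = N(z) near the
base point, and likewise in every chart, since area does not see the turning and sorting. As N does
not depend on a branch, polarization shows for 1 < |μ| < 2 that transition matrices carry form to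
form (`isTransfer_of_hyperbolic`).

Other weights. Periods are real analytic in μ, and sin(π|μ|) H extends analytically over integral
|μ| (`regForm`). The identity theorem along a segment of weights starting at |μ| = 3/2 gives
invariance of this form for all μ. For integral |μ| its value shows that A is preserved, and its
first derivative along the segment shows that H on A is (`isTransfer_of_transition`). If |μ| ≥ 2 is
an integer, the F_k satisfy one linear relation up to scalars, so T is not unique; but all choices
of T agree on A (`IsRel.sum_eq_zero`).

Signs. With θ_k the argument π(μ_0 + ⋯ + μ_k) and S_k the partial sums of sin θ_i x_i, Abel
summation gives H(x, x) = ∑ (cot θ_k - cot θ_{k+1}) |S_{k+1}|² when no sine vanishes. A coefficient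
is positive unless π lies between θ_k and θ_{k+1}. For |μ| ≤ 1 no crossing occurs; for 1 < |μ| < 2
there is one, so H is positive on a hyperplane, and F([n]) supplies a negative vector because its
norm is minus an area. -/

/-- Holomorphic dependence on a parameter of an integral with a uniform integrable bound. -/
theorem hasDerivAt_integral_of_holomorphic {α : Type*} [MeasurableSpace α] {ν : Measure α}
    {q : ℂ → α → ℂ} {s₀ : ℂ} {r : ℝ} (hr : 0 < r) {bound : α → ℝ} (hb : Integrable bound ν)
    (hmeas : ∀ s ∈ Metric.ball s₀ r, AEStronglyMeasurable (q s) ν)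
    (hd : ∀ᵐ a ∂ν, DifferentiableOn ℂ (fun s => q s a) (Metric.ball s₀ r))
    (hle : ∀ᵐ a ∂ν, ∀ s ∈ Metric.ball s₀ r, ‖q s a‖ ≤ bound a) :
    Integrable (fun a => deriv (fun s => q s a) s₀) ν ∧
      HasDerivAt (fun s => ∫ a, q s a ∂ν) (∫ a, deriv (fun s => q s a) s₀ ∂ν) s₀ := by
  have h0 : s₀ ∈ Metric.ball s₀ r := Metric.mem_ball_self hr
  have hsub : ∀ s ∈ Metric.ball s₀ (r / 2), Metric.closedBall s (r / 3) ⊆ Metric.ball s₀ r := by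
    intro s hs x hx
    rw [Metric.mem_ball] at *
    rw [Metric.mem_closedBall] at hx
    linarith [dist_triangle x s s₀]
  refine hasDerivAt_integral_of_dominated_loc_of_deriv_le (s := Metric.ball s₀ (r / 2))
    (F' := fun s a => deriv (fun s => q s a) s) (bound := fun a => bound a / (r / 3))
    (Metric.ball_mem_nhds _ (by positivity)) ?_ ?_ ?_ ?_ (hb.div_const _) ?_
  · filter_upwards [Metric.ball_mem_nhds s₀ hr] with s hs using hmeas s hs
  · refine hb.mono' (hmeas _ h0) ?_
    filter_upwards [hle] with a ha using ha _ h0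
  -- The derivative is measurable as the limit of difference quotients along a null sequence of
  -- increments inside the ball.
  · let h : ℕ → ℂ := fun k => ((r / 2 / ((k : ℝ) + 1) : ℝ) : ℂ)
    have hpos : ∀ k : ℕ, 0 < r / 2 / ((k : ℝ) + 1) := fun k => by positivity
    have hnorm : ∀ k, ‖h k‖ = r / 2 / ((k : ℝ) + 1) := fun k => by
      simp only [h, Complex.norm_real, Real.norm_eq_abs, abs_of_pos (hpos k)]
    have hlim : Tendsto h atTop (𝓝 0) := by
      rw [tendsto_zero_iff_norm_tendsto_zero]
      simp only [hnorm]
      exact tendsto_const_div_atTop_nhds_zero_nat (r / 2) |>.comp (tendsto_add_atTop_nat 1)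
        |>.congr fun k => by simp
    have hmem : ∀ k, s₀ + h k ∈ Metric.ball s₀ r := fun k => by
      rw [mem_ball_iff_norm, add_sub_cancel_left, hnorm, div_lt_iff₀ (by positivity)]
      nlinarith [(Nat.cast_nonneg k : (0 : ℝ) ≤ k)]
    refine aestronglyMeasurable_of_tendsto_ae atTop
      (f := fun k a => (h k)⁻¹ • (q (s₀ + h k) a - q s₀ a))
      (fun k => ((hmeas _ (hmem k)).sub (hmeas _ h0)).const_smul ((h k)⁻¹)) ?_
    filter_upwards [hd] with a ha
    have h1 : HasDerivAt (fun s => q s a) (deriv (fun s => q s a) s₀) s₀ :=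
      (ha.differentiableAt (Metric.ball_mem_nhds _ hr)).hasDerivAt
    refine (hasDerivAt_iff_tendsto_slope_zero.1 h1).comp (tendsto_nhdsWithin_iff.2 ⟨hlim, ?_⟩)
    refine Eventually.of_forall fun k => ?_
    have : 0 < ‖h k‖ := by rw [hnorm]; exact hpos k
    simpa using norm_pos_iff.1 this
  · filter_upwards [hd, hle] with a ha hla s hs
    refine Complex.norm_deriv_le_of_forall_mem_sphere_norm_le (by positivity) ?_ fun z hz => ?_
    · refine DifferentiableOn.diffContOnCl ?_
      rw [closure_ball _ (by positivity)]
      exact ha.mono (hsub s hs)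
    · exact hla z (hsub s hs (Metric.sphere_subset_closedBall hz))
  · filter_upwards [hd] with a ha s hs
    refine (ha.differentiableAt (Metric.isOpen_ball.mem_nhds ?_)).hasDerivAt
    exact hsub s hs (Metric.mem_closedBall_self (by positivity))

/-- Both arguments lie in (-π/2, π/2), so their sum stays in the principal range. -/
theorem mul_cpow_of_re_pos {a b p : ℂ} (ha : 0 < a.re) (hb : 0 < b.re) :
    (a * b) ^ p = a ^ p * b ^ p := by
  have ha0 : a ≠ 0 := fun h => by simp [h] at ha
  have hb0 : b ≠ 0 := fun h => by simp [h] at hb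
  have h1 := abs_lt.1 (Complex.abs_arg_lt_pi_div_two_iff.2 (Or.inl ha))
  have h2 := abs_lt.1 (Complex.abs_arg_lt_pi_div_two_iff.2 (Or.inl hb))
  rw [Complex.cpow_def_of_ne_zero (mul_ne_zero ha0 hb0), Complex.cpow_def_of_ne_zero ha0,
    Complex.cpow_def_of_ne_zero hb0, Complex.log_mul ha0 hb0 ⟨by linarith, by linarith⟩, add_mul,
    Complex.exp_add]

section Superposition

variable {X : Type*} [TopologicalSpace X] [CompactSpace X]

open Classical in
/-- The pointwise complex power of a continuous function (zero if it is not continuous). -/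
def cpowMap (p : ℂ) (u : C(X, ℂ)) : C(X, ℂ) :=
  if h : Continuous (fun x => u x ^ p) then ⟨_, h⟩ else 0

omit [CompactSpace X] in
theorem cpowMap_apply {p : ℂ} {u : C(X, ℂ)} (hu : ∀ x, 0 < (u x).re) (x : X) :
    cpowMap p u x = u x ^ p := by
  have h : Continuous (fun x => u x ^ p) :=
    u.continuous.cpow continuous_const fun x => Or.inl (hu x)
  simp [cpowMap, h]

/-- In positive degree, the terms on the Banach algebra C(X, ℂ) are bounded by the scalar
coefficients; the term of degree 0 is put into the constant separately. Only some positive radius is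
needed. -/
theorem le_radius_ofScalars_continuousMap {c : ℕ → ℂ} (hc : 1 ≤ (FormalMultilinearSeries.ofScalars ℂ c).radius) :
    ENNReal.ofReal (1 / 2) ≤
      (FormalMultilinearSeries.ofScalars C(X, ℂ) c : FormalMultilinearSeries ℂ _ _).radius := by
  have h1 : ((1 / 2 : NNReal) : ENNReal) < (FormalMultilinearSeries.ofScalars ℂ c).radius := by
    refine lt_of_lt_of_le ?_ hc
    norm_cast
    rw [← NNReal.coe_lt_coe]; push_cast; norm_num
  obtain ⟨C, hC, h⟩ := FormalMultilinearSeries.norm_mul_pow_le_of_lt_radius _ h1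
  have h2 : ENNReal.ofReal (1 / 2) = ((1 / 2 : NNReal) : ENNReal) := by
    rw [ENNReal.ofReal]; congr 1; ext; simp
  rw [h2]
  refine FormalMultilinearSeries.le_radius_of_bound _
    (C + ‖FormalMultilinearSeries.ofScalars C(X, ℂ) c 0‖) fun k => ?_
  rcases Nat.eq_zero_or_pos k with rfl | hk
  · simp only [pow_zero, mul_one]; linarith
  · have h3 := h k
    rw [FormalMultilinearSeries.ofScalars_norm] at h3
    have h4 := FormalMultilinearSeries.ofScalars_norm_le C(X, ℂ) c k hk
    have h5 : (0 : ℝ) ≤ ((1 / 2 : NNReal) : ℝ) ^ k := by positivity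
    nlinarith [norm_nonneg (FormalMultilinearSeries.ofScalars C(X, ℂ) c 0)]

/-- Substitution of a small continuous function into a power series with radius at least one. -/
theorem exists_analyticAt_superposition {f : ℂ → ℂ} {c : ℕ → ℂ}
    (hf : HasFPowerSeriesOnBall f (FormalMultilinearSeries.ofScalars ℂ c) 0 1) :
    ∃ F : C(X, ℂ) → C(X, ℂ), AnalyticAt ℂ F 0 ∧ ∀ᶠ u in 𝓝 0, ∀ x, F u x = f (u x) := by
  set p : FormalMultilinearSeries ℂ C(X, ℂ) C(X, ℂ) := FormalMultilinearSeries.ofScalars _ c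
  have hr : ENNReal.ofReal (1 / 2) ≤ p.radius := le_radius_ofScalars_continuousMap hf.r_le
  have hpos : 0 < p.radius := lt_of_lt_of_le (by simp) hr
  have hp := p.hasFPowerSeriesOnBall hpos
  refine ⟨p.sum, hp.analyticAt, ?_⟩
  filter_upwards [Metric.ball_mem_nhds (0 : C(X, ℂ)) (by norm_num : (0 : ℝ) < 1 / 2)] with u hu x
  have hu' : u ∈ Metric.eball (0 : C(X, ℂ)) p.radius := by
    refine Metric.eball_subset_eball hr ?_
    rwa [Metric.eball_ofReal]
  have hun : ‖u‖ < 1 / 2 := by simpa using hu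
  have h1 := hp.hasSum hu'
  rw [zero_add] at h1
  have h2 := h1.map (ContinuousMap.evalCLM ℂ x : C(X, ℂ) →L[ℂ] ℂ)
    (ContinuousMap.evalCLM ℂ x).continuous
  have hux : u x ∈ Metric.eball (0 : ℂ) 1 := by
    rw [← ENNReal.ofReal_one, Metric.eball_ofReal]
    simpa using (u.norm_coe_le_norm x).trans_lt (hun.trans (by norm_num))
  have h3 := hf.hasSum hux
  rw [zero_add] at h3
  have h4 : ((ContinuousMap.evalCLM ℂ x : C(X, ℂ) →L[ℂ] ℂ) ∘ fun k => p k fun _ => u) =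
      fun k => (FormalMultilinearSeries.ofScalars ℂ c k) fun _ => u x := by
    funext k
    simp [p, FormalMultilinearSeries.ofScalars]
  rw [h4] at h2
  exact h2.unique h3

/-- Write u = u₀ (1 + g) with g = u / u₀ - 1 small and substitute g into the binomial series.
Analyticity between Banach spaces is what later makes the periods jointly analytic in z. -/
theorem analyticAt_cpowMap {p : ℂ} {u₀ : C(X, ℂ)} (hu : ∀ x, 0 < (u₀ x).re) :
    AnalyticAt ℂ (cpowMap p) u₀ := by
  obtain ⟨F, hF, hFx⟩ := exists_analyticAt_superposition (X := X)
    (Complex.one_add_cpow_hasFPowerSeriesOnBall_zero (a := p))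
  have hne : ∀ x, u₀ x ≠ 0 := fun x h => by simpa [h] using hu x
  let v : C(X, ℂ) := ⟨fun x => (u₀ x)⁻¹, u₀.continuous.inv₀ hne⟩
  let g : C(X, ℂ) → C(X, ℂ) := fun u => u * v - 1
  have hg0 : g u₀ = 0 := by
    ext x; simp [g, v, hne x]
  have hg : AnalyticAt ℂ g u₀ := by
    have : AnalyticAt ℂ (fun u : C(X, ℂ) => u) u₀ := analyticAt_id
    exact (this.mul analyticAt_const).sub analyticAt_const
  have hFg : AnalyticAt ℂ (fun u => cpowMap p u₀ * F (g u)) u₀ :=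
    analyticAt_const.mul (AnalyticAt.comp (by rwa [hg0]) hg)
  refine hFg.congr ?_
  have hev1 : ∀ᶠ u in 𝓝 u₀, ∀ x, F (g u) x = (1 + g u x) ^ p := by
    have := hg.continuousAt
    rw [ContinuousAt, hg0] at this
    exact this.eventually hFx
  have hev2 : ∀ᶠ u in 𝓝 u₀, ‖g u‖ < 1 := by
    have := hg.continuousAt.norm
    rw [ContinuousAt, hg0, norm_zero] at this
    exact this.eventually_lt_const one_pos
  have hev3 : ∀ᶠ u in 𝓝 u₀, ∀ x, 0 < (u x).re := by
    rcases isEmpty_or_nonempty X with hX | hX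
    · exact Eventually.of_forall fun u x => (hX.false x).elim
    obtain ⟨x₀, -, hx₀⟩ := isCompact_univ.exists_isMinOn univ_nonempty
      (Complex.continuous_re.comp u₀.continuous).continuousOn
    filter_upwards [Metric.ball_mem_nhds u₀ (hu x₀)] with u hmem x
    have h1 : ‖(u₀ - u) x‖ < (u₀ x₀).re := by
      refine (ContinuousMap.norm_coe_le_norm _ x).trans_lt ?_
      rwa [← dist_eq_norm, dist_comm]
    have h2 : (u₀ x₀).re ≤ (u₀ x).re := hx₀ (mem_univ x)
    have h3 := (Complex.re_le_norm _).trans_lt h1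
    simp only [ContinuousMap.sub_apply, Complex.sub_re] at h3
    linarith
  filter_upwards [hev1, hev2, hev3] with u h1 h2 h3
  ext x
  rw [ContinuousMap.mul_apply, cpowMap_apply hu, cpowMap_apply h3, h1]
  have hgx : u₀ x * (1 + g u x) = u x := by
    simp [g, v]; field_simp [hne x]
  have hre : 0 < (1 + g u x).re := by
    have := (abs_le.1 (Complex.abs_re_le_norm (g u x))).1
    have := (g u).norm_coe_le_norm x
    simp only [Complex.add_re, Complex.one_re]
    linarith
  rw [← hgx, mul_cpow_of_re_pos (hu x) hre]

end Superposition
end Lauricella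
end

/-! ### Polarization, and continuation of germs along paths -/

noncomputable section

namespace Lauricella

open MeasureTheory Filter Set

theorem eqOn_zero_of_forall_real {H : ℂ → ℂ} {R : ℝ} (hR : 0 < R)
    (hH : DifferentiableOn ℂ H (Metric.ball 0 R)) (h0 : ∀ x : ℝ, |x| < R → H x = 0) :
    ∀ x ∈ Metric.ball (0 : ℂ) R, H x = 0 := by
  have ha : AnalyticOnNhd ℂ H (Metric.ball 0 R) := hH.analyticOnNhd Metric.isOpen_ball
  refine ha.eqOn_zero_of_preconnected_of_frequently_eq_zero
    (convex_ball _ _).isPreconnected (Metric.mem_ball_self hR) ?_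
  have h1 : Tendsto (fun k : ℕ => ((R / 2 / ((k : ℝ) + 1) : ℝ) : ℂ)) atTop (𝓝[≠] 0) := by
    refine tendsto_nhdsWithin_iff.2 ⟨?_, Eventually.of_forall fun k => ?_⟩
    · rw [← Complex.ofReal_zero]
      refine (Complex.continuous_ofReal.tendsto 0).comp ?_
      exact tendsto_const_div_atTop_nhds_zero_nat (R / 2) |>.comp (tendsto_add_atTop_nat 1)
        |>.congr fun k => by simp
    · have : R / 2 / ((k : ℝ) + 1) ≠ 0 := by positivity
      exact Complex.ofReal_ne_zero.2 this
  refine h1.frequently (Eventually.frequently (Eventually.of_forall fun k => h0 _ ?_))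
  rw [abs_of_pos (by positivity), div_lt_iff₀ (by positivity)]
  nlinarith [(Nat.cast_nonneg k : (0 : ℝ) ≤ k)]

/-- Polarization: a sesquiholomorphic expression that vanishes on the diagonal vanishes. -/
theorem polarization {E ι : Type*} [NormedAddCommGroup E] [NormedSpace ℂ E] [Fintype ι]
    {φ f : ι → E → ℂ} {z₀ : E} (hφ : ∀ l, AnalyticAt ℂ (φ l) z₀) (hf : ∀ l, AnalyticAt ℂ (f l) z₀)
    (h : ∀ᶠ z in 𝓝 z₀, ∑ l, φ l z * conj (f l z) = 0) :
    ∃ r > 0, ∀ z ∈ Metric.ball z₀ r, ∀ w ∈ Metric.ball z₀ r, ∑ l, φ l z * conj (f l w) = 0 := by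
  have h1 : ∀ᶠ z in 𝓝 z₀, (∀ l, DifferentiableAt ℂ (φ l) z) ∧ (∀ l, DifferentiableAt ℂ (f l) z) ∧
      ∑ l, φ l z * conj (f l z) = 0 := by
    refine ((eventually_all.2 fun l => ?_).and ((eventually_all.2 fun l => ?_).and h))
    · exact (hφ l).eventually_analyticAt.mono fun z hz => hz.differentiableAt
    · exact (hf l).eventually_analyticAt.mono fun z hz => hz.differentiableAt
  obtain ⟨R, hR, hball⟩ := Metric.eventually_nhds_iff_ball.1 h1
  refine ⟨R / 8, by positivity, fun z hz w hw => ?_⟩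
  rw [mem_ball_iff_norm] at hz hw
  -- The points z = a + b and w = a - b lie on the complex line s ↦ a + s b. Replacing s by x + iy
  -- in the φ's and by conj (x - iy) in the f's gives a function holomorphic in x and in y, which
  -- for real x, y is the given sum at one point. It vanishes for real x, y, hence identically.
  set a : E := (1 / 2 : ℂ) • (z + w) with ha
  set b : E := (1 / 2 : ℂ) • (z - w) with hb
  have han : ‖a - z₀‖ < R / 8 := by
    have : a - z₀ = (1 / 2 : ℂ) • ((z - z₀) + (w - z₀)) := by rw [ha]; module
    rw [this, norm_smul]
    have := norm_add_le (z - z₀) (w - z₀)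
    norm_num
    linarith
  have hbn : ‖b‖ < R / 8 := by
    have : b = (1 / 2 : ℂ) • ((z - z₀) - (w - z₀)) := by rw [hb]; module
    rw [this, norm_smul, show ‖(1 / 2 : ℂ)‖ = 1 / 2 by norm_num]
    have := norm_sub_le (z - z₀) (w - z₀)
    linarith
  have hmem : ∀ s : ℂ, ‖s‖ ≤ 6 → a + s • b ∈ Metric.ball z₀ R := by
    intro s hs
    rw [mem_ball_iff_norm, show a + s • b - z₀ = (a - z₀) + s • b by abel]
    refine (norm_add_le _ _).trans_lt ?_
    rw [norm_smul]
    nlinarith [norm_nonneg b]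
  have hline : ∀ s : ℂ, DifferentiableAt ℂ (fun s : ℂ => a + s • b) s := fun s => by fun_prop
  have hφd : ∀ l (s : ℂ), ‖s‖ ≤ 6 → DifferentiableAt ℂ (fun s : ℂ => φ l (a + s • b)) s :=
    fun l s hs => ((hball _ (hmem s hs)).1 l).comp s (hline s)
  have hfd : ∀ l (s : ℂ), ‖s‖ ≤ 6 →
      DifferentiableAt ℂ (fun s : ℂ => conj (f l (a + conj s • b))) s := by
    intro l s hs
    have hs' : ‖conj s‖ ≤ 6 := by simpa using hs
    have : DifferentiableAt ℂ (fun s : ℂ => f l (a + s • b)) (conj s) :=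
      ((hball _ (hmem _ hs')).2.1 l).comp (conj s) (hline _)
    simpa [Function.comp_def] using this.conj_conj
  have hnorm : ∀ x y : ℂ, ‖x‖ < 3 → ‖y‖ < 3 →
      ‖x + Complex.I * y‖ ≤ 6 ∧ ‖x - Complex.I * y‖ ≤ 6 := by
    intro x y hx hy
    have h1 := norm_add_le x (Complex.I * y)
    have h2 := norm_sub_le x (Complex.I * y)
    simp only [norm_mul, Complex.norm_I, one_mul] at h1 h2
    constructor <;> linarith
  let G : ℂ → ℂ → ℂ := fun x y => ∑ l, φ l (a + (x + Complex.I * y) • b) *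
    conj (f l (a + conj (x - Complex.I * y) • b))
  have hG1 : ∀ y : ℂ, ‖y‖ < 3 → DifferentiableOn ℂ (fun x => G x y) (Metric.ball 0 3) := by
    intro y hy x hx
    rw [mem_ball_zero_iff] at hx
    refine DifferentiableAt.differentiableWithinAt ?_
    refine DifferentiableAt.fun_sum fun l _ => DifferentiableAt.mul ?_ ?_
    · exact (hφd l _ (hnorm x y hx hy).1).comp x (f := fun x => x + Complex.I * y) (by fun_prop)
    · exact (hfd l _ (hnorm x y hx hy).2).comp x (f := fun x => x - Complex.I * y) (by fun_prop)
  have hG2 : ∀ x : ℂ, ‖x‖ < 3 → DifferentiableOn ℂ (fun y => G x y) (Metric.ball 0 3) := by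
    intro x hx y hy
    rw [mem_ball_zero_iff] at hy
    refine DifferentiableAt.differentiableWithinAt ?_
    refine DifferentiableAt.fun_sum fun l _ => DifferentiableAt.mul ?_ ?_
    · exact (hφd l _ (hnorm x y hx hy).1).comp y (f := fun y => x + Complex.I * y) (by fun_prop)
    · exact (hfd l _ (hnorm x y hx hy).2).comp y (f := fun y => x - Complex.I * y) (by fun_prop)
  have hG0 : ∀ x y : ℝ, |x| < 3 → |y| < 3 → G x y = 0 := by
    intro x y hx hy
    have := (hball _ (hmem _ (hnorm x y (by simpa using hx) (by simpa using hy)).1)).2.2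
    simpa [G] using this
  have hG3 : ∀ x ∈ Metric.ball (0 : ℂ) 3, ∀ y : ℝ, |y| < 3 → G x y = 0 := fun x hx y hy =>
    eqOn_zero_of_forall_real (by norm_num) (hG1 y (by simpa using hy))
      (fun x hx => hG0 x y hx hy) x hx
  -- At (x, y) = (0, -i) one has x + iy = 1 and x - iy = -1, which are the parameters of z and w.
  have hG4 : G 0 (-Complex.I) = 0 :=
    eqOn_zero_of_forall_real (by norm_num) (hG2 0 (by simp))
      (fun y hy => hG3 0 (by simp) y hy) (-Complex.I) (by simp)
  have e1 : a + b = z := by rw [ha, hb]; module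
  have e2 : a - b = w := by rw [ha, hb]; module
  simpa [G, e1, ← sub_eq_add_neg, e2] using hG4

section Paths

variable {E V : Type*} [TopologicalSpace E]

/-- `Φ` continues germs with property `good` along `γ` between the times `a` and `b`. -/
def ContinuesOn (γ : unitInterval → E) (good : E → (E → V) → Prop) (a b : unitInterval)
    (Φ : unitInterval → E → V) : Prop :=
  (∀ t ∈ Icc a b, good (γ t) (Φ t)) ∧ ∀ t ∈ Icc a b, ∀ᶠ s in 𝓝[Icc a b] t, Φ s =ᶠ[𝓝 (γ s)] Φ t

theorem ContinuesOn.glue {γ : unitInterval → E} (hγ : Continuous γ) {good : E → (E → V) → Prop}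
    {a b c : unitInterval} {Φ Ψ : unitInterval → E → V} (hab : a ≤ b) (hbc : b ≤ c)
    (hΦ : ContinuesOn γ good a b Φ) (hΨ : ContinuesOn γ good b c Ψ)
    (hb : Ψ b =ᶠ[𝓝 (γ b)] Φ b) :
    ContinuesOn γ good a c (fun t => if t < b then Φ t else Ψ t) := by
  refine ⟨fun t ht => ?_, fun t ht => ?_⟩
  · show good (γ t) (if t < b then Φ t else Ψ t)
    split_ifs with h
    · exact hΦ.1 t ⟨ht.1, h.le⟩
    · exact hΨ.1 t ⟨not_lt.1 h, ht.2⟩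
  · have hcov : Icc a c = Icc a b ∪ Icc b c := (Icc_union_Icc_eq_Icc hab hbc).symm
    rw [hcov, nhdsWithin_union, eventually_sup]
    rcases lt_trichotomy t b with h | rfl | h
    · constructor
      · filter_upwards [hΦ.2 t ⟨ht.1, h.le⟩, nhdsWithin_le_nhds (Iio_mem_nhds h)] with s hs hsb
        simpa [h, show s < b from hsb] using hs
      · have : t ∉ closure (Icc b c) := by rw [isClosed_Icc.closure_eq]; exact fun h' => h.not_ge h'.1
        rw [notMem_closure_iff_nhdsWithin_eq_bot.1 this]; exact eventually_bot
    · constructor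
      · have h1 := hγ.continuousAt.eventually hb.eventually_nhds
        filter_upwards [hΦ.2 t ⟨hab, le_rfl⟩, nhdsWithin_le_nhds h1, self_mem_nhdsWithin]
          with s hs hs' hsm
        rcases hsm.2.lt_or_eq with h | rfl
        · simp only [h, if_true, lt_irrefl, if_false]
          exact hs.trans (EventuallyEq.symm hs')
        · exact EventuallyEq.rfl
      · filter_upwards [hΨ.2 t ⟨le_rfl, hbc⟩, self_mem_nhdsWithin] with s hs hsm
        simpa [hsm.1.not_gt] using hs
    · constructor
      · have : t ∉ closure (Icc a b) := by rw [isClosed_Icc.closure_eq]; exact fun h' => h.not_ge h'.2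
        rw [notMem_closure_iff_nhdsWithin_eq_bot.1 this]; exact eventually_bot
      · filter_upwards [hΨ.2 t ⟨h.le, ht.2⟩, self_mem_nhdsWithin] with s hs hsm
        simpa [hsm.1.not_gt, h.not_gt] using hs

/-- Germs that extend locally to good germs can be continued along every path. -/
theorem exists_continuation {γ : unitInterval → E} (hγ : Continuous γ)
    {good : E → (E → V) → Prop}
    (hloc : ∀ t, ∃ U ∈ 𝓝 (γ t), ∀ z₁ ∈ U, ∀ g, good z₁ g → ∃ g', g' =ᶠ[𝓝 z₁] g ∧
      ∀ z ∈ U, good z g')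
    {g : E → V} (hg : good (γ 0) g) :
    ∃ Φ : unitInterval → E → V, Φ 0 =ᶠ[𝓝 (γ 0)] g ∧ ContinuesOn γ good 0 1 Φ := by
  choose U hU hext using hloc
  -- Subdivide so finely that each piece of the path lies in one of the neighbourhoods, and continue
  -- piece by piece.
  obtain ⟨τ, hτ0, hτm, ⟨N, hN⟩, hτ⟩ := exists_monotone_Icc_subset_open_cover_unitInterval
    (c := fun t => interior (γ ⁻¹' U t)) (fun t => isOpen_interior)
    (fun t _ => mem_iUnion.2 ⟨t, mem_interior_iff_mem_nhds.2 (hγ.continuousAt (hU t))⟩)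
  have key : ∀ k, ∃ Φ : unitInterval → E → V, Φ 0 =ᶠ[𝓝 (γ 0)] g ∧
      ContinuesOn γ good 0 (τ k) Φ := by
    intro k
    induction k with
    | zero =>
      refine ⟨fun _ => g, EventuallyEq.rfl, fun t ht => ?_, fun t _ => ?_⟩
      · rw [hτ0, Icc_self, mem_singleton_iff] at ht
        rw [ht]; exact hg
      · exact Eventually.of_forall fun s => EventuallyEq.rfl
    | succ k ih =>
      obtain ⟨Φ, h0, hΦ⟩ := ih
      obtain ⟨t₀, ht₀⟩ := hτ k
      have hsub : ∀ t ∈ Icc (τ k) (τ (k + 1)), γ t ∈ U t₀ := fun t ht =>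
        (interior_subset (ht₀ ht) : t ∈ γ ⁻¹' U t₀)
      obtain ⟨g', hg', hgood⟩ := hext t₀ (γ (τ k))
        (hsub _ ⟨le_rfl, hτm k.le_succ⟩) (Φ (τ k)) (hΦ.1 _ ⟨unitInterval.nonneg', le_rfl⟩)
      have hΨ : ContinuesOn γ good (τ k) (τ (k + 1)) (fun _ => g') :=
        ⟨fun t ht => hgood _ (hsub t ht), fun t _ => Eventually.of_forall fun s => EventuallyEq.rfl⟩
      refine ⟨_, ?_, hΦ.glue hγ unitInterval.nonneg' (hτm k.le_succ) hΨ hg'⟩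
      -- If τ k = 0, the glued family already starts with the new germ g', which agrees with g
      -- there.
      split_ifs with h
      · exact h0
      · have h2 : τ k = 0 := le_antisymm (not_lt.1 h) unitInterval.nonneg'
        rw [h2] at hg'
        exact hg'.trans h0
  obtain ⟨Φ, h0, hΦ⟩ := key N
  rw [hN N le_rfl] at hΦ
  exact ⟨Φ, h0, hΦ⟩

end Paths

/-- Uniqueness of analytic continuation along a path. -/
theorem IsAnalyticContinuation.unique {n : ℕ} {a b : Fin (n + 1) → ℂ} {γ : Path a b}
    {Φ Ψ : unitInterval → (Fin (n + 1) → ℂ) → (Fin n → ℂ)}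
    (hΦ : IsAnalyticContinuation γ Φ) (hΨ : IsAnalyticContinuation γ Ψ)
    (h0 : Φ 0 =ᶠ[𝓝 (γ 0)] Ψ 0) (t : unitInterval) : Φ t =ᶠ[𝓝 (γ t)] Ψ t := by
  have hop : ∀ t, Φ t =ᶠ[𝓝 (γ t)] Ψ t → ∀ᶠ s in 𝓝 t, Φ s =ᶠ[𝓝 (γ s)] Ψ s := by
    intro t ht
    filter_upwards [hΦ.2 t, hΨ.2 t, γ.continuous.continuousAt.eventually ht.eventually_nhds]
      with s h1 h2 h3
    exact h1.trans (EventuallyEq.trans h3 h2.symm)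
  -- The set of times of agreement is closed: equality of germs at some γ s in a ball around γ t
  -- spreads over the ball by the identity theorem.
  have hcl : ∀ t, (∃ᶠ s in 𝓝 t, Φ s =ᶠ[𝓝 (γ s)] Ψ s) → Φ t =ᶠ[𝓝 (γ t)] Ψ t := by
    intro t ht
    obtain ⟨r, hr, hball⟩ := Metric.eventually_nhds_iff_ball.1
      ((hΦ.1 t).eventually_analyticAt.and (hΨ.1 t).eventually_analyticAt)
    obtain ⟨s, hs, h1, h2, h3⟩ := (ht.and_eventually ((hΦ.2 t).and ((hΨ.2 t).and
      (γ.continuous.continuousAt.eventually (Metric.ball_mem_nhds _ hr))))).exists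
    have h4 : Φ t =ᶠ[𝓝 (γ s)] Ψ t := h1.symm.trans (hs.trans h2)
    have h5 := AnalyticOnNhd.eqOn_of_preconnected_of_eventuallyEq
      (fun z hz => (hball z hz).1) (fun z hz => (hball z hz).2) (convex_ball _ _).isPreconnected h3 h4
    exact h5.eventuallyEq_of_mem (Metric.ball_mem_nhds _ hr)
  have hclopen : IsClopen {t | Φ t =ᶠ[𝓝 (γ t)] Ψ t} :=
    ⟨isClosed_iff_frequently.2 fun t ht => hcl t ht, isOpen_iff_mem_nhds.2 fun t ht => hop t ht⟩
  have := hclopen.eq_univ ⟨0, h0⟩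
  exact this.ge (mem_univ t)

end Lauricella
end

/-! ### The chamber of increasing real parts and the integrands of the periods -/

noncomputable section

namespace Lauricella

open MeasureTheory Filter Set

variable {n : ℕ}

/-- The configurations whose points have increasing real parts. -/
def chamber (n : ℕ) : Set (Fin (n + 1) → ℂ) := {z | ∀ i j, i < j → (z i).re < (z j).re}

theorem isOpen_chamber : IsOpen (chamber n) := by
  simp only [chamber, ofPred_forall]
  refine isOpen_iInter_of_finite fun i => isOpen_iInter_of_finite fun j =>
    isOpen_iInter_of_finite fun _ => isOpen_lt ?_ ?_ <;> fun_prop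

theorem convex_chamber : Convex ℝ (chamber n) := by
  intro x hx y hy a b ha hb hab i j hij
  have h1 := hx i j hij
  have h2 := hy i j hij
  simp only [Pi.add_apply, Pi.smul_apply, Complex.add_re, Complex.smul_re, smul_eq_mul]
  rcases ha.eq_or_lt with rfl | ha
  · have : b = 1 := by linarith
    subst this; linarith
  · nlinarith

theorem chamber_subset_configSpace : chamber n ⊆ configSpace n := by
  intro z hz i j hij
  by_contra h
  rcases lt_or_gt_of_ne h with h | h
  · exact absurd (hz i j h) (by rw [hij]; exact lt_irrefl _)
  · exact absurd (hz j i h) (by rw [hij]; exact lt_irrefl _)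

theorem basePoint_mem_chamber : basePoint n ∈ chamber n := by
  intro i j hij
  simpa [basePoint] using hij

/-- The difference of `ζ` and `z_j`, with the sign that makes its real part positive between `z_k`
and `z_{k+1}`. -/
def side (k : Fin n) (z : Fin (n + 1) → ℂ) (ζ : ℂ) (j : Fin (n + 1)) : ℂ :=
  if j ≤ k.castSucc then ζ - z j else z j - ζ

/-- The integrand with weights `m`, multiplied by the linear factors with index in `S`. -/
def phi (m : Fin (n + 1) → ℂ) (S : Finset (Fin (n + 1))) (k : Fin n) (z : Fin (n + 1) → ℂ)
    (ζ : ℂ) : ℂ :=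
  (∏ l ∈ S, (ζ - z l)) * ∏ j, side k z ζ j ^ (-m j)

/-- The point with parameter `t` on the segment from `z_k` to `z_{k+1}`. -/
def seg (k : Fin n) (z : Fin (n + 1) → ℂ) (t : ℂ) : ℂ :=
  z k.castSucc + t * (z k.succ - z k.castSucc)

/-- The period of `phi m S k z` along the segment from `z_k` to `z_{k+1}`. -/
def period (m : Fin (n + 1) → ℂ) (S : Finset (Fin (n + 1))) (k : Fin n)
    (z : Fin (n + 1) → ℂ) : ℂ :=
  ∫ t in (0 : ℝ)..1, phi m S k z (seg k z t) * (z k.succ - z k.castSucc)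

theorem baseF_eq_period (μ : Fin (n + 1) → ℝ) (z : Fin (n + 1) → ℂ) (k : Fin n) :
    baseF μ z k = period (fun j => (μ j : ℂ)) ∅ k z := by
  simp [baseF, period, integrand, phi, side, seg]

theorem seg_sub_left (k : Fin n) (z : Fin (n + 1) → ℂ) (t : ℂ) :
    seg k z t - z k.castSucc = t * (z k.succ - z k.castSucc) := by
  simp [seg]

theorem seg_sub_right (k : Fin n) (z : Fin (n + 1) → ℂ) (t : ℂ) :
    z k.succ - seg k z t = (1 - t) * (z k.succ - z k.castSucc) := by
  simp [seg]; ring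

theorem chamber_le_re {z : Fin (n + 1) → ℂ} (hz : z ∈ chamber n) {i j : Fin (n + 1)}
    (h : i ≤ j) : (z i).re ≤ (z j).re := by
  rcases h.eq_or_lt with rfl | h
  · exact le_rfl
  · exact (hz i j h).le

theorem delta_re_pos {z : Fin (n + 1) → ℂ} (hz : z ∈ chamber n) (k : Fin n) :
    0 < (z k.succ - z k.castSucc).re := by
  simpa using hz _ _ (Fin.castSucc_lt_succ (i := k))

theorem succ_le_of_not_le_castSucc {k : Fin n} {j : Fin (n + 1)} (h : ¬ j ≤ k.castSucc) :
    k.succ ≤ j := by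
  simpa [Fin.le_def, Fin.lt_def, Nat.succ_le_iff] using h

theorem side_re_pos {z : Fin (n + 1) → ℂ} (hz : z ∈ chamber n) (k : Fin n) {t : ℝ}
    (ht : t ∈ Ioo (0 : ℝ) 1) (j : Fin (n + 1)) : 0 < (side k z (seg k z t) j).re := by
  have hd := delta_re_pos hz k
  have h1 := congrArg Complex.re (seg_sub_left k z t)
  have h2 := congrArg Complex.re (seg_sub_right k z t)
  rw [Complex.re_ofReal_mul] at h1
  rw [← Complex.ofReal_one, ← Complex.ofReal_sub, Complex.re_ofReal_mul] at h2
  have p1 := mul_pos ht.1 hd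
  have p2 := mul_pos (sub_pos.2 ht.2) hd
  simp only [Complex.sub_re] at *
  unfold side
  split_ifs with h
  · have := chamber_le_re hz h
    simp only [Complex.sub_re]; linarith
  · have := chamber_le_re hz (succ_le_of_not_le_castSucc h)
    simp only [Complex.sub_re]; linarith

theorem side_re_pos_of_ne {z : Fin (n + 1) → ℂ} (hz : z ∈ chamber n) (k : Fin n) {t : ℝ}
    (ht : t ∈ Icc (0 : ℝ) 1) {j : Fin (n + 1)} (ha : j ≠ k.castSucc) (hb : j ≠ k.succ) :
    0 < (side k z (seg k z t) j).re := by
  have hd := (delta_re_pos hz k).le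
  have h1 := congrArg Complex.re (seg_sub_left k z t)
  have h2 := congrArg Complex.re (seg_sub_right k z t)
  rw [Complex.re_ofReal_mul] at h1
  rw [← Complex.ofReal_one, ← Complex.ofReal_sub, Complex.re_ofReal_mul] at h2
  have p1 := mul_nonneg ht.1 hd
  have p2 := mul_nonneg (sub_nonneg.2 ht.2) hd
  simp only [Complex.sub_re] at *
  unfold side
  split_ifs with h
  · have := hz _ _ (lt_of_le_of_ne h ha)
    simp only [Complex.sub_re]; linarith
  · have := hz _ _ (lt_of_le_of_ne (succ_le_of_not_le_castSucc h) hb.symm)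
    simp only [Complex.sub_re]; linarith

theorem ne_zero_of_re_pos {a : ℂ} (h : 0 < a.re) : a ≠ 0 := fun h0 => by simp [h0] at h

theorem sub_ne_zero_of_side {k : Fin n} {z : Fin (n + 1) → ℂ} {ζ : ℂ} {j : Fin (n + 1)}
    (h : 0 < (side k z ζ j).re) : ζ - z j ≠ 0 := by
  intro h0
  apply ne_zero_of_re_pos h
  unfold side
  split_ifs
  · exact h0
  · rw [← neg_sub, h0, neg_zero]

theorem hasDerivAt_prod_of_logDeriv {ι : Type*} (s : Finset ι) {f : ι → ℂ → ℂ}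
    {g : ι → ℂ} {τ : ℂ} (h : ∀ i ∈ s, HasDerivAt (f i) (f i τ * g i) τ) :
    HasDerivAt (fun τ => ∏ i ∈ s, f i τ) ((∏ i ∈ s, f i τ) * ∑ i ∈ s, g i) τ := by
  classical
  induction s using Finset.induction_on with
  | empty => simpa using hasDerivAt_const τ (1 : ℂ)
  | insert a s ha ih =>
    simp only [Finset.prod_insert ha, Finset.sum_insert ha]
    refine ((h a (Finset.mem_insert_self _ _)).mul
      (ih fun i hi => h i (Finset.mem_insert_of_mem hi))).congr_deriv ?_
    ring

/-- The extra factor is ζ - z_j and not `side`, so its sign does not depend on the segment. This is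
why the relations between periods have the same coefficients for all k. -/
theorem phi_insert (m : Fin (n + 1) → ℂ) {S : Finset (Fin (n + 1))} {j : Fin (n + 1)} (hj : j ∉ S)
    (k : Fin n) (z : Fin (n + 1) → ℂ) (ζ : ℂ) :
    phi m (insert j S) k z ζ = (ζ - z j) * phi m S k z ζ := by
  simp [phi, Finset.prod_insert hj, mul_assoc]

/-- The derivative of `phi` along a curve. -/
theorem hasDerivAt_phi (m : Fin (n + 1) → ℂ) (S : Finset (Fin (n + 1))) (k : Fin n)
    {z : ℂ → Fin (n + 1) → ℂ} {ζ : ℂ → ℂ} {z' : Fin (n + 1) → ℂ} {ζ' τ : ℂ}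
    (hz : ∀ j, HasDerivAt (fun τ => z τ j) (z' j) τ) (hζ : HasDerivAt ζ ζ' τ)
    (hpos : ∀ j, 0 < (side k (z τ) (ζ τ) j).re) :
    HasDerivAt (fun τ => phi m S k (z τ) (ζ τ))
      (phi m S k (z τ) (ζ τ) *
        ∑ l, ((if l ∈ S then 1 else 0) - m l) * ((ζ' - z' l) / (ζ τ - z τ l))) τ := by
  have hne : ∀ j, ζ τ - z τ j ≠ 0 := fun j => sub_ne_zero_of_side (hpos j)
  have h1 : HasDerivAt (fun τ => ∏ l ∈ S, (ζ τ - z τ l))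
      ((∏ l ∈ S, (ζ τ - z τ l)) * ∑ l ∈ S, (ζ' - z' l) / (ζ τ - z τ l)) τ := by
    refine hasDerivAt_prod_of_logDeriv S fun l _ => ?_
    refine (hζ.sub (hz l)).congr_deriv ?_
    have := hne l
    field_simp
  have h2 : HasDerivAt (fun τ => ∏ j, side k (z τ) (ζ τ) j ^ (-m j))
      ((∏ j, side k (z τ) (ζ τ) j ^ (-m j)) *
        ∑ l, (-m l) * ((ζ' - z' l) / (ζ τ - z τ l))) τ := by
    refine hasDerivAt_prod_of_logDeriv Finset.univ (f := fun j τ => side k (z τ) (ζ τ) j ^ (-m j))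
      fun l _ => ?_
    have hl := hpos l
    have hs0 := ne_zero_of_re_pos hl
    have hs : HasDerivAt (fun τ => side k (z τ) (ζ τ) l)
        (side k (z τ) (ζ τ) l * ((ζ' - z' l) / (ζ τ - z τ l))) τ := by
      have := hne l
      unfold side
      split_ifs with h
      · refine (hζ.sub (hz l)).congr_deriv ?_
        field_simp
      · refine ((hz l).sub hζ).congr_deriv ?_
        field_simp
        ring
    refine (hs.cpow_const (Or.inl hl)).congr_deriv ?_
    rw [Complex.cpow_sub _ _ hs0, Complex.cpow_one]
    field_simp
  refine (h1.mul h2).congr_deriv ?_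
  have h3 : ∑ l, ((if l ∈ S then 1 else 0) - m l) * ((ζ' - z' l) / (ζ τ - z τ l)) =
      ∑ l ∈ S, (ζ' - z' l) / (ζ τ - z τ l) + ∑ l, (-m l) * ((ζ' - z' l) / (ζ τ - z τ l)) := by
    have h4 : ∑ l ∈ S, (ζ' - z' l) / (ζ τ - z τ l) =
        ∑ l, if l ∈ S then (ζ' - z' l) / (ζ τ - z τ l) else 0 := by simp
    rw [h4, ← Finset.sum_add_distrib]
    refine Finset.sum_congr rfl fun l _ => ?_
    split_ifs <;> ring
  rw [h3]
  simp only [phi]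
  ring

end Lauricella
end

/-! ### Analyticity of the periods in the configuration -/

noncomputable section

namespace Lauricella

open MeasureTheory Filter Set

variable {n : ℕ}

/-- The inclusion of the unit interval into the complex numbers. -/
def paramC : C(unitInterval, ℂ) := ⟨fun t => ((t : ℝ) : ℂ), by fun_prop⟩

/-- The segment from `z_k` to `z_{k+1}` as a continuous function. -/
def segC (k : Fin n) (z : Fin (n + 1) → ℂ) : C(unitInterval, ℂ) :=
  z k.castSucc • (1 : C(unitInterval, ℂ)) + (z k.succ - z k.castSucc) • paramC

/-- The bases of the powers, divided by the parameters `t` and `1 - t` at the end points. -/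
def baseC (k : Fin n) (z : Fin (n + 1) → ℂ) (j : Fin (n + 1)) : C(unitInterval, ℂ) :=
  if j = k.castSucc ∨ j = k.succ then (z k.succ - z k.castSucc) • 1
  else if j ≤ k.castSucc then segC k z - z j • 1 else z j • 1 - segC k z

/-- The regular part of the integrand of a period. -/
def regC (m : Fin (n + 1) → ℂ) (S : Finset (Fin (n + 1))) (k : Fin n) (z : Fin (n + 1) → ℂ) :
    C(unitInterval, ℂ) :=
  (∏ l ∈ S, (segC k z - z l • 1)) * ∏ j, cpowMap (-m j) (baseC k z j)

theorem segC_apply (k : Fin n) (z : Fin (n + 1) → ℂ) (t : unitInterval) :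
    segC k z t = seg k z (t : ℝ) := by
  simp [segC, seg, paramC, mul_comm]

theorem baseC_re_pos {z : Fin (n + 1) → ℂ} (hz : z ∈ chamber n) (k : Fin n) (j : Fin (n + 1))
    (t : unitInterval) : 0 < (baseC k z j t).re := by
  unfold baseC
  by_cases h : j = k.castSucc ∨ j = k.succ
  · simpa [h] using delta_re_pos hz k
  · rw [if_neg h]
    rw [not_or] at h
    have := side_re_pos_of_ne hz k t.2 h.1 h.2
    unfold side at this
    split_ifs at this ⊢ <;> simpa [segC_apply] using this

theorem analyticAt_coord (z : Fin (n + 1) → ℂ) (j : Fin (n + 1)) :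
    AnalyticAt ℂ (fun z : Fin (n + 1) → ℂ => z j) z :=
  (ContinuousLinearMap.proj (R := ℂ) (φ := fun _ : Fin (n + 1) => ℂ) j).analyticAt z

theorem analyticAt_segC (k : Fin n) (z : Fin (n + 1) → ℂ) : AnalyticAt ℂ (segC k) z :=
  ((analyticAt_coord z _).smul analyticAt_const).add
    (((analyticAt_coord z _).sub (analyticAt_coord z _)).smul analyticAt_const)

theorem analyticAt_baseC (k : Fin n) (z : Fin (n + 1) → ℂ) (j : Fin (n + 1)) :
    AnalyticAt ℂ (fun z => baseC k z j) z := by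
  unfold baseC
  split_ifs
  · exact ((analyticAt_coord z _).sub (analyticAt_coord z _)).smul analyticAt_const
  · exact (analyticAt_segC k z).sub ((analyticAt_coord z _).smul analyticAt_const)
  · exact ((analyticAt_coord z _).smul analyticAt_const).sub (analyticAt_segC k z)

theorem analyticAt_regC (m : Fin (n + 1) → ℂ) (S : Finset (Fin (n + 1))) (k : Fin n)
    {z : Fin (n + 1) → ℂ} (hz : z ∈ chamber n) : AnalyticAt ℂ (regC m S k) z := by
  refine AnalyticAt.mul ?_ ?_
  · exact Finset.analyticAt_fun_prod _ fun l _ =>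
      (analyticAt_segC k z).sub ((analyticAt_coord z _).smul analyticAt_const)
  · refine Finset.analyticAt_fun_prod _ fun j _ => ?_
    exact AnalyticAt.comp (g := cpowMap (-m j)) (f := fun z => baseC k z j)
      (analyticAt_cpowMap (baseC_re_pos hz k j)) (analyticAt_baseC k z j)

theorem ofReal_mul_cpow {t : ℝ} (ht : 0 < t) {b : ℂ} (hb : 0 < b.re) (p : ℂ) :
    ((t : ℂ) * b) ^ p = (t : ℂ) ^ p * b ^ p :=
  mul_cpow_of_re_pos (by simpa using ht) hb

/-- The singular factor of the integrand of a period. -/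
def weight (m : Fin (n + 1) → ℂ) (k : Fin n) (t : ℝ) : ℂ :=
  (t : ℂ) ^ (-m k.castSucc) * (1 - (t : ℂ)) ^ (-m k.succ)

/-- With Δ = z_{k+1} - z_k, the bases at the two end points are tΔ and (1 - t)Δ. The singularities
thus split off as a factor independent of z, and the rest is continuous on the closed interval. -/
theorem phi_eq_weight_mul (m : Fin (n + 1) → ℂ) (S : Finset (Fin (n + 1))) (k : Fin n)
    {z : Fin (n + 1) → ℂ} (hz : z ∈ chamber n) {t : ℝ} (ht : t ∈ Ioo (0 : ℝ) 1) :
    phi m S k z (seg k z t) = weight m k t * regC m S k z ⟨t, Ioo_subset_Icc_self ht⟩ := by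
  have hd := delta_re_pos hz k
  have hab : k.castSucc ≠ k.succ := (Fin.castSucc_lt_succ (i := k)).ne
  have hev : ∀ j, cpowMap (-m j) (baseC k z j) ⟨t, Ioo_subset_Icc_self ht⟩ =
      baseC k z j ⟨t, Ioo_subset_Icc_self ht⟩ ^ (-m j) := fun j =>
    cpowMap_apply (baseC_re_pos hz k j) _
  have hside : ∀ j, side k z (seg k z t) j ^ (-m j) =
      (if j = k.castSucc then (t : ℂ) ^ (-m k.castSucc) else 1) *
      (if j = k.succ then (1 - (t : ℂ)) ^ (-m k.succ) else 1) *
        baseC k z j ⟨t, Ioo_subset_Icc_self ht⟩ ^ (-m j) := by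
    intro j
    by_cases h1 : j = k.castSucc
    · subst h1
      rw [if_pos rfl, if_neg hab, mul_one, ← ofReal_mul_cpow ht.1 (baseC_re_pos hz k _ _)]
      simp [side, seg_sub_left, baseC]
    by_cases h2 : j = k.succ
    · subst h2
      have h3 : (1 - (t : ℂ)) = ((1 - t : ℝ) : ℂ) := by push_cast; rfl
      rw [if_pos rfl, if_neg hab.symm, one_mul, h3,
        ← ofReal_mul_cpow (sub_pos.2 ht.2) (baseC_re_pos hz k _ _), ← h3]
      have : ¬ k.succ ≤ k.castSucc := not_le.2 (Fin.castSucc_lt_succ (i := k))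
      simp only [side, this, if_false, seg_sub_right, baseC]
      simp
    · simp only [h1, h2, if_false, one_mul, side, baseC, or_self]
      split_ifs <;> simp [segC_apply]
  simp only [phi, hside, Finset.prod_mul_distrib, Finset.prod_ite_eq', Finset.mem_univ, if_true,
    regC, ContinuousMap.mul_apply, ContinuousMap.prod_apply, hev, weight]
  simp only [ContinuousMap.sub_apply, segC_apply, ContinuousMap.smul_apply, ContinuousMap.one_apply,
    smul_eq_mul, mul_one]
  ring

theorem norm_weight (m : Fin (n + 1) → ℂ) (k : Fin n) {t : ℝ} (ht : t ∈ Ioo (0 : ℝ) 1) :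
    ‖weight m k t‖ = t ^ (-(m k.castSucc).re) * (1 - t) ^ (-(m k.succ).re) := by
  have h3 : (1 - (t : ℂ)) = ((1 - t : ℝ) : ℂ) := by push_cast; rfl
  rw [weight, norm_mul, h3, Complex.norm_cpow_eq_rpow_re_of_pos ht.1,
    Complex.norm_cpow_eq_rpow_re_of_pos (sub_pos.2 ht.2), Complex.neg_re, Complex.neg_re]

theorem integrable_weight {m : Fin (n + 1) → ℂ} (hm : ∀ j, (m j).re < 1) (k : Fin n) :
    IntegrableOn (weight m k) (Ioo 0 1) := by
  have h := Complex.betaIntegral_convergent (u := 1 - m k.castSucc) (v := 1 - m k.succ)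
    (by simpa using hm _) (by simpa using hm _)
  rw [intervalIntegrable_iff_integrableOn_Ioo_of_le zero_le_one] at h
  refine h.congr_fun (fun t _ => ?_) measurableSet_Ioo
  simp [weight]

theorem period_eq_integral_Ioo (m : Fin (n + 1) → ℂ) (S : Finset (Fin (n + 1))) (k : Fin n)
    (z : Fin (n + 1) → ℂ) : period m S k z =
      ∫ t in Ioo (0 : ℝ) 1, phi m S k z (seg k z t) * (z k.succ - z k.castSucc) := by
  rw [period, intervalIntegral.integral_of_le zero_le_one, integral_Ioc_eq_integral_Ioo]

/-- Integration against an integrable weight, as a continuous linear functional. -/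
theorem exists_clm_integral {w : ℝ → ℂ} (hw : IntegrableOn w (Ioo 0 1)) :
    ∃ L : C(unitInterval, ℂ) →L[ℂ] ℂ, ∀ u,
      L u = ∫ t in Ioo (0 : ℝ) 1, w t * u (projIcc 0 1 zero_le_one t) := by
  have hint : ∀ u : C(unitInterval, ℂ),
      IntegrableOn (fun t => w t * u (projIcc 0 1 zero_le_one t)) (Ioo 0 1) := fun u =>
    hw.mul_bdd (c := ‖u‖)
      ((u.continuous.comp continuous_projIcc).aestronglyMeasurable.restrict)
      (Eventually.of_forall fun t => u.norm_coe_le_norm _)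
  refine ⟨LinearMap.mkContinuous
    { toFun := fun u => ∫ t in Ioo (0 : ℝ) 1, w t * u (projIcc 0 1 zero_le_one t)
      map_add' := fun u v => ?_
      map_smul' := fun c u => ?_ } (∫ t in Ioo (0 : ℝ) 1, ‖w t‖) fun u => ?_, fun u => rfl⟩
  · rw [← integral_add (hint u) (hint v)]
    simp [mul_add]
  · rw [RingHom.id_apply, ← integral_smul]
    congr 1
    ext t
    simp
    ring
  · refine (norm_integral_le_of_norm_le (hw.norm.mul_const ‖u‖) ?_).trans_eq ?_
    · refine Eventually.of_forall fun t => ?_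
      rw [norm_mul]
      gcongr
      exact u.norm_coe_le_norm _
    · rw [integral_mul_const]

/-- `regC` is analytic in z with values in C([0, 1], ℂ), and integration against the singular weight
is a continuous linear functional on that space. Joint analyticity in all coordinates follows by
composition. -/
theorem analyticAt_period {m : Fin (n + 1) → ℂ} (hm : ∀ j, (m j).re < 1)
    (S : Finset (Fin (n + 1))) (k : Fin n) {z : Fin (n + 1) → ℂ} (hz : z ∈ chamber n) :
    AnalyticAt ℂ (period m S k) z := by
  obtain ⟨L, hL⟩ := exists_clm_integral (integrable_weight hm k)
  have h1 : AnalyticAt ℂ (fun z => L (regC m S k z) * (z k.succ - z k.castSucc)) z :=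
    ((L.analyticAt _).comp (analyticAt_regC m S k hz)).mul
      ((analyticAt_coord z _).sub (analyticAt_coord z _))
  refine h1.congr ?_
  filter_upwards [isOpen_chamber.mem_nhds hz] with z hz
  rw [hL, period_eq_integral_Ioo, ← integral_mul_const]
  refine setIntegral_congr_fun measurableSet_Ioo fun t ht => ?_
  rw [phi_eq_weight_mul m S k hz ht, projIcc_of_mem zero_le_one (Ioo_subset_Icc_self ht)]

/-- The integrand of a period is locally uniformly dominated by the weight. -/
theorem norm_phi_seg_le (m : Fin (n + 1) → ℂ) (S : Finset (Fin (n + 1))) (k : Fin n)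
    {z : Fin (n + 1) → ℂ} (hz : z ∈ chamber n) {t : ℝ} (ht : t ∈ Ioo (0 : ℝ) 1) :
    ‖phi m S k z (seg k z t)‖ ≤ ‖weight m k t‖ * ‖regC m S k z‖ := by
  rw [phi_eq_weight_mul m S k hz ht, norm_mul]
  gcongr
  exact (regC m S k z).norm_coe_le_norm _

theorem aestronglyMeasurable_phi_seg {m : Fin (n + 1) → ℂ} (hm : ∀ j, (m j).re < 1)
    (S : Finset (Fin (n + 1))) (k : Fin n) {z : Fin (n + 1) → ℂ} (hz : z ∈ chamber n) :
    AEStronglyMeasurable (fun t : ℝ => phi m S k z (seg k z t))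
      (volume.restrict (Ioo (0 : ℝ) 1)) := by
  have h1 : AEStronglyMeasurable
      (fun t : ℝ => weight m k t * regC m S k z (projIcc 0 1 zero_le_one t))
      (volume.restrict (Ioo (0 : ℝ) 1)) :=
    (integrable_weight hm k).aestronglyMeasurable.mul
      ((regC m S k z).continuous.comp continuous_projIcc).aestronglyMeasurable
  refine h1.congr ?_
  filter_upwards [ae_restrict_mem measurableSet_Ioo] with t ht
  rw [phi_eq_weight_mul m S k hz ht, projIcc_of_mem zero_le_one (Ioo_subset_Icc_self ht)]

theorem integrableOn_phi_seg {m : Fin (n + 1) → ℂ} (hm : ∀ j, (m j).re < 1)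
    (S : Finset (Fin (n + 1))) (k : Fin n) {z : Fin (n + 1) → ℂ} (hz : z ∈ chamber n) :
    IntegrableOn (fun t : ℝ => phi m S k z (seg k z t)) (Ioo (0 : ℝ) 1) := by
  refine ((integrable_weight hm k).norm.mul_const ‖regC m S k z‖).mono'
    (aestronglyMeasurable_phi_seg hm S k hz) ?_
  filter_upwards [ae_restrict_mem measurableSet_Ioo] with t ht
  exact norm_phi_seg_le m S k hz ht

/-- Near an end point the product is of order t^(1 - Re m) with Re m < 1. It is the shape of every
boundary term met in the integrations by parts below. -/
theorem tendsto_mul_phi_seg_zero {m : Fin (n + 1) → ℂ} (hm : ∀ j, (m j).re < 1)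
    (S : Finset (Fin (n + 1))) (k : Fin n) {z : Fin (n + 1) → ℂ} (hz : z ∈ chamber n) :
    Tendsto (fun t : ℝ => (t : ℂ) * (1 - t) * phi m S k z (seg k z t)) (𝓝[>] 0) (𝓝 0) ∧
    Tendsto (fun t : ℝ => (t : ℂ) * (1 - t) * phi m S k z (seg k z t)) (𝓝[<] 1) (𝓝 0) := by
  have hle : ∀ t ∈ Ioo (0 : ℝ) 1, ‖(t : ℂ) * (1 - t) * phi m S k z (seg k z t)‖ ≤
      t ^ (1 - (m k.castSucc).re) * (1 - t) ^ (1 - (m k.succ).re) * ‖regC m S k z‖ := by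
    intro t ht
    have h1 := norm_phi_seg_le m S k hz ht
    rw [norm_weight m k ht] at h1
    have h3 : (1 - (t : ℂ)) = ((1 - t : ℝ) : ℂ) := by push_cast; rfl
    rw [norm_mul, norm_mul, h3, Complex.norm_real, Complex.norm_real, Real.norm_of_nonneg ht.1.le,
      Real.norm_of_nonneg (sub_pos.2 ht.2).le, sub_eq_add_neg 1 (m k.castSucc).re,
      sub_eq_add_neg 1 (m k.succ).re, Real.rpow_add ht.1, Real.rpow_add (sub_pos.2 ht.2),
      Real.rpow_one, Real.rpow_one]
    have h4 : 0 ≤ t * (1 - t) := mul_nonneg ht.1.le (sub_pos.2 ht.2).le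
    calc t * (1 - t) * ‖phi m S k z (seg k z t)‖ ≤ t * (1 - t) * _ :=
          mul_le_mul_of_nonneg_left h1 h4
      _ = _ := by ring
  have hcont : Continuous fun t : ℝ =>
      t ^ (1 - (m k.castSucc).re) * (1 - t) ^ (1 - (m k.succ).re) * ‖regC m S k z‖ := by
    refine ((continuous_id.rpow_const fun t => Or.inr ?_).mul
      ((continuous_const.sub continuous_id).rpow_const fun t => Or.inr ?_)).mul continuous_const
    · linarith [hm k.castSucc]
    · linarith [hm k.succ]
  constructor
  · refine squeeze_zero_norm' (a := fun t : ℝ =>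
      t ^ (1 - (m k.castSucc).re) * (1 - t) ^ (1 - (m k.succ).re) * ‖regC m S k z‖) ?_ ?_
    · filter_upwards [Ioo_mem_nhdsGT (zero_lt_one' ℝ)] with t ht using hle t ht
    · refine tendsto_nhdsWithin_of_tendsto_nhds ?_
      have := hcont.tendsto 0
      rwa [Real.zero_rpow (by linarith [hm k.castSucc]), zero_mul, zero_mul] at this
  · refine squeeze_zero_norm' (a := fun t : ℝ =>
      t ^ (1 - (m k.castSucc).re) * (1 - t) ^ (1 - (m k.succ).re) * ‖regC m S k z‖) ?_ ?_
    · filter_upwards [Ioo_mem_nhdsLT (zero_lt_one' ℝ)] with t ht using hle t ht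
    · refine tendsto_nhdsWithin_of_tendsto_nhds ?_
      have := hcont.tendsto 1
      rwa [sub_self, Real.zero_rpow (by linarith [hm k.succ]), mul_zero, zero_mul] at this

end Lauricella
end

/-! ### Relations between the periods: derivatives, exchange, total derivative, homogeneity -/

noncomputable section

namespace Lauricella

open MeasureTheory Filter Set

variable {n : ℕ}

theorem integral_Ioo_eq_zero {G g : ℝ → ℂ} (hG : ∀ t ∈ Ioo (0 : ℝ) 1, HasDerivAt G (g t) t)
    (hg : IntegrableOn g (Ioo 0 1)) (h0 : Tendsto G (𝓝[>] 0) (𝓝 0))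
    (h1 : Tendsto G (𝓝[<] 1) (𝓝 0)) : ∫ t in Ioo (0 : ℝ) 1, g t = 0 := by
  have := intervalIntegral.integral_eq_sub_of_hasDerivAt_of_tendsto (zero_lt_one' ℝ) hG
    ((intervalIntegrable_iff_integrableOn_Ioo_of_le zero_le_one).2 hg) h0 h1
  rwa [intervalIntegral.integral_of_le zero_le_one, integral_Ioc_eq_integral_Ioo, sub_zero] at this

theorem hasDerivAt_seg (k : Fin n) (z : Fin (n + 1) → ℂ) (t : ℂ) :
    HasDerivAt (seg k z) (z k.succ - z k.castSucc) t := by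
  unfold seg
  simpa using ((hasDerivAt_id t).mul_const (z k.succ - z k.castSucc)).const_add
    (z k.castSucc)

theorem hasDerivAt_phi_seg (m : Fin (n + 1) → ℂ) (S : Finset (Fin (n + 1))) (k : Fin n)
    {z : Fin (n + 1) → ℂ} (hz : z ∈ chamber n) {t : ℝ} (ht : t ∈ Ioo (0 : ℝ) 1) :
    HasDerivAt (fun t : ℂ => phi m S k z (seg k z t))
      (phi m S k z (seg k z t) * ∑ l, ((if l ∈ S then 1 else 0) - m l) *
        ((z k.succ - z k.castSucc) / (seg k z t - z l))) (t : ℂ) := by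
  have := hasDerivAt_phi m S k (z := fun _ => z) (ζ := seg k z) (z' := 0) (τ := t)
    (fun j => hasDerivAt_const _ _) (hasDerivAt_seg k z t) (side_re_pos hz k ht)
  simpa using this

/-- The derivative of the integrand of a period in a coordinate direction is a multiple of an
integrand up to a total derivative. -/
theorem hasDerivAt_period_direction {m : Fin (n + 1) → ℂ} (hm : ∀ j, (m j).re < 1)
    {S : Finset (Fin (n + 1))} {j : Fin (n + 1)} (hj : j ∉ S) (k : Fin n)
    {z : Fin (n + 1) → ℂ} (hz : z ∈ chamber n) :
    HasDerivAt (fun s : ℂ => period m (insert j S) k (z + s • Pi.single j 1))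
      ((m j - 1) * period m S k z) 0 := by
  set e : Fin (n + 1) → ℂ := Pi.single j 1 with he
  let q : ℂ → ℝ → ℂ := fun s t => phi m (insert j S) k (z + s • e) (seg k (z + s • e) t) *
    ((z + s • e) k.succ - (z + s • e) k.castSucc)
  let Δ : ℂ := z k.succ - z k.castSucc
  have hline : Continuous fun s : ℂ => z + s • e := by fun_prop
  have hz0 : z + (0 : ℂ) • e = z := by simp
  have hcoord : ∀ l s, HasDerivAt (fun s : ℂ => (z + s • e) l) (e l) s := fun l s => by
    simpa using ((hasDerivAt_id s).mul_const (e l)).const_add (z l)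
  have hsegd : ∀ (t : ℝ) s, HasDerivAt (fun s : ℂ => seg k (z + s • e) t) (seg k e t) s := by
    intro t s
    exact (hcoord _ s).add (((hcoord _ s).sub (hcoord _ s)).const_mul (t : ℂ))
  have hΔd : ∀ s, HasDerivAt (fun s : ℂ => (z + s • e) k.succ - (z + s • e) k.castSucc)
      (e k.succ - e k.castSucc) s := fun s => (hcoord _ s).sub (hcoord _ s)
  have hqd : ∀ t ∈ Ioo (0 : ℝ) 1, ∀ s, z + s • e ∈ chamber n →
      HasDerivAt (fun s => q s t)
        (phi m (insert j S) k (z + s • e) (seg k (z + s • e) t) *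
          (∑ l, ((if l ∈ insert j S then 1 else 0) - m l) *
            ((seg k e t - e l) / (seg k (z + s • e) t - (z + s • e) l))) *
          ((z + s • e) k.succ - (z + s • e) k.castSucc) +
        phi m (insert j S) k (z + s • e) (seg k (z + s • e) t) * (e k.succ - e k.castSucc)) s := by
    intro t ht s hs
    exact (hasDerivAt_phi m (insert j S) k (z := fun s => z + s • e)
      (fun l => hcoord l s) (hsegd t s) (side_re_pos hs k ht)).mul (hΔd s)
  have hnhds : ∀ᶠ s : ℂ in 𝓝 0, z + s • e ∈ chamber n ∧
      ‖regC m (insert j S) k (z + s • e)‖ * ‖(z + s • e) k.succ - (z + s • e) k.castSucc‖ ≤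
        ‖regC m (insert j S) k z‖ * ‖Δ‖ + 1 := by
    have hc : Tendsto (fun s : ℂ => z + s • e) (𝓝 0) (𝓝 z) := by
      simpa only [hz0] using hline.tendsto 0
    have h1 : ContinuousAt (fun z : Fin (n + 1) → ℂ =>
        ‖regC m (insert j S) k z‖ * ‖z k.succ - z k.castSucc‖) z :=
      (analyticAt_regC m _ k hz).continuousAt.norm.mul (by fun_prop)
    have h2 : ∀ᶠ z' in 𝓝 z, z' ∈ chamber n ∧ ‖regC m (insert j S) k z'‖ *
        ‖z' k.succ - z' k.castSucc‖ ≤ ‖regC m (insert j S) k z‖ * ‖Δ‖ + 1 := by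
      filter_upwards [isOpen_chamber.mem_nhds hz, h1.eventually_lt_const (lt_add_one _)]
        with z' hz' hlt using ⟨hz', hlt.le⟩
    exact hc.eventually h2
  obtain ⟨r, hr, hball⟩ := Metric.eventually_nhds_iff_ball.1 hnhds
  have hmain := hasDerivAt_integral_of_holomorphic (ν := volume.restrict (Ioo (0 : ℝ) 1)) (q := q)
    (s₀ := 0) hr ((integrable_weight hm k).norm.mul_const (‖regC m (insert j S) k z‖ * ‖Δ‖ + 1))
    (fun s hs => (aestronglyMeasurable_phi_seg hm _ k (hball s hs).1).mul_const _)
    (by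
      filter_upwards [ae_restrict_mem measurableSet_Ioo] with t ht s hs
      exact (hqd t ht s (hball s hs).1).differentiableAt.differentiableWithinAt)
    (by
      filter_upwards [ae_restrict_mem measurableSet_Ioo] with t ht s hs
      obtain ⟨h1, h2⟩ := hball s hs
      calc ‖q s t‖ ≤ ‖weight m k t‖ * ‖regC m (insert j S) k (z + s • e)‖ *
            ‖(z + s • e) k.succ - (z + s • e) k.castSucc‖ := by
            simp only [q, norm_mul]
            gcongr
            exact norm_phi_seg_le m _ k h1 ht
        _ ≤ _ := by
            rw [mul_assoc]
            gcongr)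
  have hperiod : (fun s : ℂ => period m (insert j S) k (z + s • e)) =
      fun s => ∫ t in Ioo (0 : ℝ) 1, q s t := by
    funext s; exact period_eq_integral_Ioo _ _ _ _
  rw [hperiod]
  refine hmain.2.congr_deriv ?_
  -- As z moves in direction e, the point with parameter t moves by `seg k e t`. The part of the
  -- derivative due to this motion is the t-derivative g of G, so it integrates to boundary terms.
  let G : ℂ → ℂ := fun t => phi m (insert j S) k z (seg k z t) * seg k e t
  let g : ℝ → ℂ := fun t => phi m (insert j S) k z (seg k z t) *
      (∑ l, ((if l ∈ insert j S then 1 else 0) - m l) * (Δ / (seg k z t - z l))) * seg k e t +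
      phi m (insert j S) k z (seg k z t) * (e k.succ - e k.castSucc)
  have hG : ∀ t ∈ Ioo (0 : ℝ) 1, HasDerivAt (fun t : ℝ => G t) (g t) t := fun t ht =>
    ((hasDerivAt_phi_seg m (insert j S) k hz ht).mul (hasDerivAt_seg k e t)).comp_ofReal
  have hderiv : ∀ t ∈ Ioo (0 : ℝ) 1, deriv (fun s => q s t) 0 =
      (m j - 1) * (phi m S k z (seg k z t) * Δ) + g t := by
    intro t ht
    have h := (hqd t ht 0 (by rwa [hz0])).deriv
    rw [hz0] at h
    rw [h]
    have hne : ∀ l, seg k z t - z l ≠ 0 := fun l => sub_ne_zero_of_side (side_re_pos hz k ht l)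
    have hsum : ∑ l, ((if l ∈ insert j S then 1 else 0) - m l) *
          ((seg k e t - e l) / (seg k z t - z l)) =
        (∑ l, ((if l ∈ insert j S then 1 else 0) - m l) * (1 / (seg k z t - z l))) * seg k e t -
          (1 - m j) * (1 / (seg k z t - z j)) := by
      rw [Finset.sum_mul, eq_sub_iff_add_eq]
      have : (1 - m j) * (1 / (seg k z t - z j)) = ∑ l, ((if l ∈ insert j S then 1 else 0) - m l) *
          (e l / (seg k z t - z l)) := by
        rw [Finset.sum_eq_single j]
        · simp [he]
        · intro l _ hl
          simp [he, hl]
        · simp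
      rw [this, ← Finset.sum_add_distrib]
      refine Finset.sum_congr rfl fun l _ => ?_
      ring
    have hsum2 : ∑ l, ((if l ∈ insert j S then 1 else 0) - m l) * (Δ / (seg k z t - z l)) =
        Δ * ∑ l, ((if l ∈ insert j S then 1 else 0) - m l) * (1 / (seg k z t - z l)) := by
      rw [Finset.mul_sum]
      refine Finset.sum_congr rfl fun l _ => ?_
      ring
    simp only [g]
    rw [hsum, hsum2]
    have hins := phi_insert m hj k z (seg k z t)
    have hj' := hne j
    have hkey : phi m (insert j S) k z (seg k z t) * (1 / (seg k z t - z j)) =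
        phi m S k z (seg k z t) := by
      rw [hins]; field_simp
    linear_combination (m j - 1) * Δ * hkey
  -- No direct estimate of g is needed: it is the difference of the derivative of the integrand,
  -- integrable by the parameter lemma, and a multiple of an integrand.
  have hgint : IntegrableOn g (Ioo 0 1) := by
    have h1 := hmain.1.sub (((integrableOn_phi_seg hm S k hz).mul_const Δ).const_mul (m j - 1))
    refine IntegrableOn.congr_fun h1 (fun t ht => ?_) measurableSet_Ioo
    simp only [Pi.sub_apply]
    rw [hderiv t ht]
    ring
  -- If j is the left end, `seg k e t` is 1 - t and the new factor is tΔ; if it is the right end,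
  -- they are t and -(1 - t)Δ; otherwise the end points do not move. In all cases G carries the
  -- factor t (1 - t) and vanishes at both ends.
  obtain ⟨κ, hκ⟩ : ∃ κ : ℂ, ∀ t : ℝ, G t = κ * ((t : ℂ) * (1 - t) * phi m S k z (seg k z t)) := by
    have hab : k.castSucc ≠ k.succ := (Fin.castSucc_lt_succ (i := k)).ne
    by_cases h1 : j = k.castSucc
    · refine ⟨Δ, fun t => ?_⟩
      have hc : seg k e t = 1 - t := by simp [seg, he, h1, hab.symm]; ring
      show phi m (insert j S) k z (seg k z t) * seg k e t = _
      rw [phi_insert m hj, hc, h1, seg_sub_left]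
      ring
    by_cases h2 : j = k.succ
    · refine ⟨-Δ, fun t => ?_⟩
      have hc : seg k e t = t := by simp [seg, he, h2, hab]
      show phi m (insert j S) k z (seg k z t) * seg k e t = _
      rw [phi_insert m hj, hc, h2, ← neg_sub (z k.succ), seg_sub_right]
      ring
    · refine ⟨0, fun t => ?_⟩
      simp [G, he, seg, Ne.symm h1, Ne.symm h2]
  obtain ⟨hl0, hl1⟩ := tendsto_mul_phi_seg_zero hm S k hz
  have hzero : ∫ t in Ioo (0 : ℝ) 1, g t = 0 := by
    refine integral_Ioo_eq_zero hG hgint ?_ ?_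
    · simp only [hκ]; simpa using hl0.const_mul κ
    · simp only [hκ]; simpa using hl1.const_mul κ
  rw [setIntegral_congr_fun measurableSet_Ioo hderiv, integral_add, hzero, add_zero,
    integral_const_mul, period_eq_integral_Ioo]
  · exact ((integrableOn_phi_seg hm S k hz).mul_const Δ).const_mul (m j - 1)
  · exact hgint

theorem fderiv_period {m : Fin (n + 1) → ℂ} (hm : ∀ j, (m j).re < 1)
    {S : Finset (Fin (n + 1))} {j : Fin (n + 1)} (hj : j ∉ S) (k : Fin n)
    {z : Fin (n + 1) → ℂ} (hz : z ∈ chamber n) :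
    fderiv ℂ (period m (insert j S) k) z (Pi.single j 1) = (m j - 1) * period m S k z := by
  have h1 : HasFDerivAt (period m (insert j S) k) (fderiv ℂ (period m (insert j S) k) z)
      (z + (0 : ℂ) • Pi.single j (1 : ℂ)) := by
    simpa using (analyticAt_period hm _ k hz).differentiableAt.hasFDerivAt
  have h2 : HasDerivAt (fun s : ℂ => z + s • (Pi.single j 1 : Fin (n + 1) → ℂ))
      (Pi.single j 1) 0 := by
    simpa using ((hasDerivAt_id (0 : ℂ)).smul_const (Pi.single j 1 : Fin (n + 1) → ℂ)).const_add z
  have h3 : HasDerivAt (fun s : ℂ => period m (insert j S) k (z + s • Pi.single j 1))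
      (fderiv ℂ (period m (insert j S) k) z (Pi.single j 1)) 0 :=
    HasFDerivAt.comp_hasDerivAt (f := fun s : ℂ => z + s • (Pi.single j 1 : Fin (n + 1) → ℂ))
      (0 : ℂ) h1 h2
  exact h3.unique (hasDerivAt_period_direction hm hj k hz)

/-- Integrate (ζ - z_j) - (ζ - z_l) = z_l - z_j. -/
theorem period_exchange {m : Fin (n + 1) → ℂ} (hm : ∀ j, (m j).re < 1)
    {S : Finset (Fin (n + 1))} {j l : Fin (n + 1)} (hj : j ∉ S) (hl : l ∉ S) (k : Fin n)
    {z : Fin (n + 1) → ℂ} (hz : z ∈ chamber n) :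
    period m (insert j S) k z - period m (insert l S) k z = (z l - z j) * period m S k z := by
  simp only [period_eq_integral_Ioo]
  rw [← integral_sub ((integrableOn_phi_seg hm _ k hz).mul_const _)
    ((integrableOn_phi_seg hm _ k hz).mul_const _), ← integral_const_mul]
  congr 1
  funext t
  rw [phi_insert m hj, phi_insert m hl]
  ring

/-- The integral of the derivative of the integrand with all factors ζ - z_l. This function has zero
boundary values, since its factors at the two end points of the segment contribute t (1 - t). -/
theorem sum_period_erase {m : Fin (n + 1) → ℂ} (hm : ∀ j, (m j).re < 1) (k : Fin n)
    {z : Fin (n + 1) → ℂ} (hz : z ∈ chamber n) :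
    ∑ l, (1 - m l) * period m (Finset.univ.erase l) k z = 0 := by
  let Δ : ℂ := z k.succ - z k.castSucc
  have hint : ∀ l, IntegrableOn (fun t : ℝ => (1 - m l) *
      (phi m (Finset.univ.erase l) k z (seg k z t) * Δ)) (Ioo 0 1) := fun l =>
    ((integrableOn_phi_seg hm _ k hz).mul_const _).const_mul _
  have hG : ∀ t ∈ Ioo (0 : ℝ) 1, HasDerivAt (fun t : ℝ => phi m Finset.univ k z (seg k z t))
      (∑ l, (1 - m l) * (phi m (Finset.univ.erase l) k z (seg k z t) * Δ)) t := by
    intro t ht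
    refine (hasDerivAt_phi_seg m Finset.univ k hz ht).comp_ofReal.congr_deriv ?_
    rw [Finset.mul_sum]
    refine Finset.sum_congr rfl fun l _ => ?_
    have hne : seg k z t - z l ≠ 0 := sub_ne_zero_of_side (side_re_pos hz k ht l)
    have h1 := phi_insert m (Finset.notMem_erase l Finset.univ) k z (seg k z t)
    rw [Finset.insert_erase (Finset.mem_univ l)] at h1
    rw [h1, if_pos (Finset.mem_univ l)]
    simp only [Δ]
    field_simp
  have hab : k.castSucc ≠ k.succ := (Fin.castSucc_lt_succ (i := k)).ne
  set S : Finset (Fin (n + 1)) := (Finset.univ.erase k.castSucc).erase k.succ with hS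
  have hκ : ∀ t : ℝ, phi m Finset.univ k z (seg k z t) =
      (-Δ * Δ) * ((t : ℂ) * (1 - t) * phi m S k z (seg k z t)) := by
    intro t
    have h1 := phi_insert m (Finset.notMem_erase k.castSucc Finset.univ) k z (seg k z t)
    rw [Finset.insert_erase (Finset.mem_univ _)] at h1
    have h2 := phi_insert m (Finset.notMem_erase k.succ (Finset.univ.erase k.castSucc)) k z
      (seg k z t)
    rw [Finset.insert_erase (by simp [hab.symm])] at h2
    rw [h1, h2, seg_sub_left, ← neg_sub (z k.succ), seg_sub_right]
    simp only [Δ]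
    ring
  obtain ⟨hl0, hl1⟩ := tendsto_mul_phi_seg_zero hm S k hz
  have hzero := integral_Ioo_eq_zero hG (integrable_finsetSum _ fun l _ => hint l)
    (by simp only [hκ]; simpa using hl0.const_mul (-Δ * Δ))
    (by simp only [hκ]; simpa using hl1.const_mul (-Δ * Δ))
  rw [integral_finsetSum _ fun l _ => hint l] at hzero
  simpa only [integral_const_mul, ← period_eq_integral_Ioo, Δ] using hzero

theorem prod_cpow {ι : Type*} {s : Finset ι} {c : ℂ} (hc : c ≠ 0) (f : ι → ℂ) :
    ∏ i ∈ s, c ^ f i = c ^ ∑ i ∈ s, f i := by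
  simp only [Complex.cpow_def_of_ne_zero hc, ← Complex.exp_sum, Finset.mul_sum]

/-- Scaling by a positive number keeps every branch. The degree vanishes only for |S| + 1 = ∑ m_j,
which is where constant periods, and hence linear relations, can occur. -/
theorem period_smul (m : Fin (n + 1) → ℂ) (S : Finset (Fin (n + 1))) (k : Fin n)
    {z : Fin (n + 1) → ℂ} (hz : z ∈ chamber n) {c : ℝ} (hc : 0 < c) :
    period m S k ((c : ℂ) • z) = (c : ℂ) ^ ((S.card : ℂ) + 1 - ∑ j, m j) * period m S k z := by
  have hc0 : (c : ℂ) ≠ 0 := by exact_mod_cast hc.ne'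
  simp only [period_eq_integral_Ioo]
  rw [← integral_const_mul]
  refine setIntegral_congr_fun measurableSet_Ioo fun t ht => ?_
  have hseg : seg k ((c : ℂ) • z) t = c * seg k z t := by simp [seg]; ring
  have hside : ∀ j, side k ((c : ℂ) • z) (c * seg k z t) j ^ (-m j) =
      (c : ℂ) ^ (-m j) * side k z (seg k z t) j ^ (-m j) := by
    intro j
    rw [← ofReal_mul_cpow hc (side_re_pos hz k ht j)]
    congr 1
    simp only [side, Pi.smul_apply, smul_eq_mul]
    split_ifs <;> ring
  have hS : ∏ l ∈ S, ((c : ℂ) * seg k z t - c * z l) =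
      (c : ℂ) ^ S.card * ∏ l ∈ S, (seg k z t - z l) := by
    rw [← Finset.prod_const, ← Finset.prod_mul_distrib]
    refine Finset.prod_congr rfl fun l _ => ?_
    ring
  have hpow : (c : ℂ) ^ ((S.card : ℂ) + 1 - ∑ j, m j) =
      (c : ℂ) ^ S.card * c * ∏ j, (c : ℂ) ^ (-m j) := by
    rw [prod_cpow hc0, sub_eq_add_neg, Complex.cpow_add _ _ hc0,
      Complex.cpow_add _ _ hc0, Complex.cpow_natCast, Complex.cpow_one, Finset.sum_neg_distrib]
  simp only [phi, hseg, hside, Finset.prod_mul_distrib, hpow, Pi.smul_apply, smul_eq_mul]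
  rw [hS]
  ring

end Lauricella
end

/-! ### Abstract families with the relations of periods: determination by n values, Grönwall -/

noncomputable section

namespace Lauricella

open MeasureTheory Filter Set

variable {n : ℕ}

/-- Families of functions indexed by sets of points that satisfy on `U` the relations of the
periods `∫ ∏_{l ∈ S} (ζ - z_l) ∏_j (ζ - z_j)^{-m_j} dζ`. -/
structure IsSol (m : Fin (n + 1) → ℂ) (U : Set (Fin (n + 1) → ℂ))
    (K : Finset (Fin (n + 1)) → (Fin (n + 1) → ℂ) → ℂ) : Prop where
  analytic : ∀ S, ∀ z ∈ U, AnalyticAt ℂ (K S) z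
  deriv : ∀ S j, j ∉ S → ∀ z ∈ U,
    fderiv ℂ (K (insert j S)) z (Pi.single j 1) = (m j - 1) * K S z
  exchange : ∀ S j l, j ∉ S → l ∉ S → ∀ z ∈ U,
    K (insert j S) z - K (insert l S) z = (z l - z j) * K S z
  top : ∀ z ∈ U, ∑ l, (1 - m l) * K (Finset.univ.erase l) z = 0

theorem isSol_period {m : Fin (n + 1) → ℂ} (hm : ∀ j, (m j).re < 1) (k : Fin n) :
    IsSol m (chamber n) (fun S => period m S k) where
  analytic S _ hz := analyticAt_period hm S k hz
  deriv _ _ hj _ hz := fderiv_period hm hj k hz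
  exchange _ _ _ hj hl _ hz := period_exchange hm hj hl k hz
  top _ hz := sum_period_erase hm k hz

namespace IsSol

variable {m : Fin (n + 1) → ℂ} {U : Set (Fin (n + 1) → ℂ)}
  {K : Finset (Fin (n + 1)) → (Fin (n + 1) → ℂ) → ℂ}

theorem mono (hK : IsSol m U K) {V : Set (Fin (n + 1) → ℂ)} (hV : V ⊆ U) : IsSol m V K where
  analytic S z hz := hK.analytic S z (hV hz)
  deriv S j hj z hz := hK.deriv S j hj z (hV hz)
  exchange S j l hj hl z hz := hK.exchange S j l hj hl z (hV hz)
  top z hz := hK.top z (hV hz)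

theorem sum {ι : Type*} [Fintype ι] {K : ι → Finset (Fin (n + 1)) → (Fin (n + 1) → ℂ) → ℂ}
    (hK : ∀ i, IsSol m U (K i)) (a : ι → ℂ) : IsSol m U (fun S z => ∑ i, a i * K i S z) where
  analytic S z hz := Finset.analyticAt_fun_sum _ fun i _ =>
    analyticAt_const.mul ((hK i).analytic S z hz)
  deriv S j hj z hz := by
    rw [fderiv_fun_sum fun i _ => ((hK i).analytic _ z hz).differentiableAt.const_mul _,
      sum_apply, Finset.mul_sum]
    refine Finset.sum_congr rfl fun i _ => ?_
    rw [fderiv_const_mul ((hK i).analytic _ z hz).differentiableAt,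
      smul_apply, (hK i).deriv S j hj z hz, smul_eq_mul]
    ring
  exchange S j l hj hl z hz := by
    rw [← Finset.sum_sub_distrib, Finset.mul_sum]
    refine Finset.sum_congr rfl fun i _ => ?_
    rw [← mul_sub, (hK i).exchange S j l hj hl z hz]
    ring
  top z hz := by
    simp only [Finset.mul_sum]
    rw [Finset.sum_comm]
    refine Finset.sum_eq_zero fun i _ => ?_
    have := (hK i).top z hz
    calc _ = a i * ∑ l, (1 - m l) * K i (Finset.univ.erase l) z := by
          rw [Finset.mul_sum]
          exact Finset.sum_congr rfl fun l _ => by ring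
      _ = 0 := by rw [this, mul_zero]

theorem sub {L : Finset (Fin (n + 1)) → (Fin (n + 1) → ℂ) → ℂ} (hK : IsSol m U K)
    (hL : IsSol m U L) : IsSol m U (fun S z => K S z - L S z) := by
  have := IsSol.sum (ι := Bool) (K := fun b => if b then K else L)
    (fun b => by cases b <;> simpa) (fun b => if b then 1 else -1)
  simpa [sub_eq_add_neg] using this

end IsSol

/-- Pass from S to T through sets of equal size, each time exchanging an element of S \ T for one of
T \ S. -/
theorem eq_of_card_eq_of_exchange {α β : Type*} [DecidableEq α] {f : Finset α → β} {c : ℕ}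
    (h : ∀ R : Finset α, R.card + 1 = c → ∀ j l, j ∉ R → l ∉ R → f (insert j R) = f (insert l R))
    {S T : Finset α} (hS : S.card = c) (hT : T.card = c) : f S = f T := by
  induction hd : (S \ T).card using Nat.strong_induction_on generalizing S with
  | _ d ih =>
    rcases (S \ T).eq_empty_or_nonempty with h0 | ⟨j, hj⟩
    · rw [Finset.eq_of_subset_of_card_le (Finset.sdiff_eq_empty_iff_subset.1 h0) (by omega)]
    · have hcard : (T \ S).card = (S \ T).card := Finset.card_sdiff_comm (hT.trans hS.symm)
      have : 0 < (T \ S).card := by rw [hcard]; exact Finset.card_pos.2 ⟨j, hj⟩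
      obtain ⟨l, hl⟩ := Finset.card_pos.1 this
      rw [Finset.mem_sdiff] at hj hl
      have hlR : l ∉ S.erase j := fun h => hl.2 (Finset.mem_of_mem_erase h)
      have hR : (S.erase j).card + 1 = c := by rw [Finset.card_erase_add_one hj.1, hS]
      have h1 := h (S.erase j) hR j l (Finset.notMem_erase j S) hlR
      rw [Finset.insert_erase hj.1] at h1
      rw [h1]
      refine ih _ ?_ (by rw [Finset.card_insert_of_notMem hlR, hR]) rfl
      rw [← hd, Finset.insert_sdiff_of_mem _ hl.1, Finset.erase_sdiff_comm]
      exact Finset.card_erase_lt_of_mem (Finset.mem_sdiff.2 hj)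

/-- The set of the first `i` indices. -/
def initSet (n i : ℕ) : Finset (Fin (n + 1)) := Finset.univ.filter fun l => l.val < i

theorem card_initSet {i : ℕ} (hi : i ≤ n + 1) : (initSet n i).card = i := by
  rw [initSet, Fin.card_filter_val_lt]
  omega

namespace IsSol

variable {m : Fin (n + 1) → ℂ} {U : Set (Fin (n + 1) → ℂ)}
  {K : Finset (Fin (n + 1)) → (Fin (n + 1) → ℂ) → ℂ}

/-- If all members of size c vanish at z, the exchange relations make those of size c + 1 equal, so
one value decides about the whole level. At size n no value is needed: the top relation reads (∑ (1
- m_l)) K = 0. Hence n numbers determine the family at a point. -/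
theorem eq_zero_of_initSet (hK : IsSol m U K) (hm : ∑ l, (1 - m l) ≠ 0) {z : Fin (n + 1) → ℂ}
    (hz : z ∈ U) (h0 : ∀ i < n, K (initSet n i) z = 0) :
    ∀ S ≠ Finset.univ, K S z = 0 := by
  have key : ∀ c ≤ n, ∀ S : Finset (Fin (n + 1)), S.card = c → K S z = 0 := by
    intro c
    induction c with
    | zero =>
      intro _ S hS
      have := eq_of_card_eq_of_exchange (f := fun S => K S z) (c := 0)
        (fun R hR => absurd hR (by omega)) hS (card_initSet (Nat.zero_le (n + 1)))
      rcases Nat.eq_zero_or_pos n with hn | hn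
      · subst hn
        have h1 := hK.top z hz
        simp only [Fin.sum_univ_succ, Finset.univ_eq_empty, Finset.sum_empty, add_zero] at h1 hm
        have h2 : (Finset.univ.erase (0 : Fin (0 + 1))) = S := by
          rw [Finset.card_eq_zero.1 hS]; decide
        rw [h2] at h1
        exact (mul_eq_zero.1 h1).resolve_left hm
      · exact this.trans (h0 0 hn)
    | succ c ih =>
      intro hc S hS
      have hex : ∀ R : Finset (Fin (n + 1)), R.card + 1 = c + 1 → ∀ j l, j ∉ R → l ∉ R →
          K (insert j R) z = K (insert l R) z := by
        intro R hR j l hj hl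
        have := hK.exchange R j l hj hl z hz
        rw [ih (by omega) R (by omega), mul_zero] at this
        exact sub_eq_zero.1 this
      have heq : ∀ S T : Finset (Fin (n + 1)), S.card = c + 1 → T.card = c + 1 →
          K S z = K T z := fun S T hS hT =>
        eq_of_card_eq_of_exchange (f := fun S => K S z) hex hS hT
      rcases hc.lt_or_eq with hlt | rfl
      · rw [heq S _ hS (card_initSet (by omega)), h0 _ hlt]
      · have h1 := hK.top z hz
        have h2 : ∀ l, K (Finset.univ.erase l) z = K S z := fun l => heq _ _ (by simp) hS
        simp only [h2, ← Finset.sum_mul] at h1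
        exact (mul_eq_zero.1 h1).resolve_left hm
  intro S hS
  refine key S.card ?_ S rfl
  have h1 := Finset.card_lt_card (Finset.ssubset_univ_iff.2 hS)
  rw [Finset.card_univ, Fintype.card_fin] at h1
  omega

/-- The sum of the absolute values of the functions of a family, except the top one. -/
def total (K : Finset (Fin (n + 1)) → (Fin (n + 1) → ℂ) → ℂ) (z : Fin (n + 1) → ℂ) : ℝ :=
  ∑ S ∈ Finset.univ.erase Finset.univ, ‖K S z‖

theorem norm_le_total {S : Finset (Fin (n + 1))} (hS : S ≠ Finset.univ) (z : Fin (n + 1) → ℂ) :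
    ‖K S z‖ ≤ total K z :=
  Finset.single_le_sum (f := fun S => ‖K S z‖) (fun _ _ => norm_nonneg _) (by simp [hS])

/-- Differentiate the top relation by z_j. All terms but the one without j are given by the
derivative relation, and one can divide by 1 - m_j. -/
theorem fderiv_erase (hK : IsSol m U K) (hU : IsOpen U) {j : Fin (n + 1)} (hj : m j ≠ 1)
    {z : Fin (n + 1) → ℂ} (hz : z ∈ U) :
    fderiv ℂ (K (Finset.univ.erase j)) z (Pi.single j 1) =
      ∑ l ∈ Finset.univ.erase j, (1 - m l) * K ((Finset.univ.erase l).erase j) z := by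
  have h1 : (fun z => ∑ l, (1 - m l) * K (Finset.univ.erase l) z) =ᶠ[𝓝 z] fun _ => 0 := by
    filter_upwards [hU.mem_nhds hz] with z hz using hK.top z hz
  have h2 := h1.fderiv_eq (𝕜 := ℂ)
  rw [fderiv_fun_sum fun l _ => (hK.analytic _ z hz).differentiableAt.const_mul _] at h2
  have h3 := congrArg (fun L => L (Pi.single j 1)) h2
  simp only [fderiv_fun_const, Pi.zero_apply, zero_apply, sum_apply] at h3
  have h4 : ∀ l, fderiv ℂ (fun z => (1 - m l) * K (Finset.univ.erase l) z) z (Pi.single j 1) =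
      (1 - m l) * fderiv ℂ (K (Finset.univ.erase l)) z (Pi.single j 1) := by
    intro l
    rw [fderiv_const_mul (hK.analytic _ z hz).differentiableAt, smul_apply, smul_eq_mul]
  simp only [h4] at h3
  rw [← Finset.add_sum_erase _ _ (Finset.mem_univ j)] at h3
  have h5 : ∀ l ∈ Finset.univ.erase j,
      (1 - m l) * fderiv ℂ (K (Finset.univ.erase l)) z (Pi.single j 1) =
      (m j - 1) * ((1 - m l) * K ((Finset.univ.erase l).erase j) z) := by
    intro l hl
    have hlj : j ∈ Finset.univ.erase l := by
      simpa using (Finset.ne_of_mem_erase hl).symm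
    have := hK.deriv _ j (Finset.notMem_erase j (Finset.univ.erase l)) z hz
    rw [Finset.insert_erase hlj] at this
    rw [this]; ring
  rw [Finset.sum_congr rfl h5, ← Finset.mul_sum] at h3
  have h6 : 1 - m j ≠ 0 := sub_ne_zero.2 hj.symm
  have h7 : (1 - m j) * (fderiv ℂ (K (Finset.univ.erase j)) z (Pi.single j 1) -
      ∑ l ∈ Finset.univ.erase j, (1 - m l) * K ((Finset.univ.erase l).erase j) z) = 0 := by
    linear_combination h3
  exact sub_eq_zero.1 ((mul_eq_zero.1 h7).resolve_left h6)

/-- Differentiate the exchange relation by z_j. This reduces ∂_j K S to ∂_j of a larger set, at the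
price of dividing by z_l - z_j. -/
theorem fderiv_of_notMem (hK : IsSol m U K) (hU : IsOpen U) {S : Finset (Fin (n + 1))}
    {j l : Fin (n + 1)} (hj : j ∉ S) (hl : l ∉ S) (hjl : j ≠ l) {z : Fin (n + 1) → ℂ}
    (hz : z ∈ U) :
    (z l - z j) * fderiv ℂ (K S) z (Pi.single j 1) =
      m j * K S z - fderiv ℂ (K (insert l S)) z (Pi.single j 1) := by
  have h1 : (fun z => K (insert j S) z - K (insert l S) z) =ᶠ[𝓝 z]
      fun z => (z l - z j) * K S z := by
    filter_upwards [hU.mem_nhds hz] with z hz using hK.exchange S j l hj hl z hz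
  have hd : ∀ S, DifferentiableAt ℂ (K S) z := fun S => (hK.analytic S z hz).differentiableAt
  have hcoord : ∀ i, HasFDerivAt (fun z : Fin (n + 1) → ℂ => z i)
      (ContinuousLinearMap.proj (R := ℂ) (φ := fun _ : Fin (n + 1) => ℂ) i) z := fun i =>
    (ContinuousLinearMap.proj (R := ℂ) (φ := fun _ : Fin (n + 1) => ℂ) i).hasFDerivAt
  have h2 := h1.fderiv_eq (𝕜 := ℂ)
  have h4 := ((hcoord l).fun_sub (hcoord j)).fun_mul (hd S).hasFDerivAt
  rw [fderiv_fun_sub (hd _) (hd _), h4.fderiv] at h2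
  have h3 := congrArg (fun L => L (Pi.single j 1)) h2
  simp only [sub_apply, add_apply, smul_apply, ContinuousLinearMap.proj_apply, Pi.single_eq_same,
    Pi.single_eq_of_ne hjl.symm, smul_eq_mul, hK.deriv S j hj z hz] at h3
  linear_combination -h3

/-- The two preceding lemmas express ∂_j K S through values of the family when j ∉ S, by descending
induction on |S| starting from the complement of a point; for j ∈ S the derivative relation is
direct. The constant depends only on the weights and on the separation δ, so the system is a linear
differential system with bounded coefficients away from collisions. -/
theorem exists_bound_fderiv (hm : ∀ j, m j ≠ 1) (hU : IsOpen U) {δ : ℝ} (hδ : 0 < δ) :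
    ∃ C ≥ 0, ∀ K, IsSol m U K → ∀ z ∈ U, (∀ i j, i ≠ j → δ ≤ ‖z i - z j‖) →
      ∀ S ≠ Finset.univ, ∀ j, ‖fderiv ℂ (K S) z (Pi.single j 1)‖ ≤ C * total K z := by
  set B : ℝ := ∑ l, (‖1 - m l‖ + ‖m l‖) with hB
  have hBl : ∀ l, ‖1 - m l‖ ≤ B ∧ ‖m l‖ ≤ B := by
    intro l
    have := Finset.single_le_sum (f := fun l => ‖1 - m l‖ + ‖m l‖)
      (fun _ _ => by positivity) (Finset.mem_univ l)
    constructor <;> linarith [norm_nonneg (1 - m l), norm_nonneg (m l)]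
  have hB0 : 0 ≤ B := Finset.sum_nonneg fun _ _ => by positivity
  have htot : ∀ (K : Finset (Fin (n + 1)) → (Fin (n + 1) → ℂ) → ℂ) z, 0 ≤ total K z :=
    fun K z => Finset.sum_nonneg fun _ _ => norm_nonneg _
  have hmem : ∀ K, IsSol m U K → ∀ z ∈ U, ∀ S ≠ Finset.univ, ∀ j ∈ S,
      ‖fderiv ℂ (K S) z (Pi.single j 1)‖ ≤ B * total K z := by
    intro K hK z hz S hS j hj
    have h1 := hK.deriv _ j (Finset.notMem_erase j S) z hz
    rw [Finset.insert_erase hj] at h1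
    rw [h1, norm_mul, norm_sub_rev]
    refine mul_le_mul (hBl j).1 (norm_le_total ?_ z) (norm_nonneg _) hB0
    exact fun h => Finset.notMem_erase j S (h ▸ Finset.mem_univ j)
  have key : ∀ d : ℕ, ∃ C ≥ 0, ∀ K, IsSol m U K → ∀ z ∈ U, (∀ i j, i ≠ j → δ ≤ ‖z i - z j‖) →
      ∀ S : Finset (Fin (n + 1)), S.card + (d + 1) = n + 1 → ∀ j,
        ‖fderiv ℂ (K S) z (Pi.single j 1)‖ ≤ C * total K z := by
    intro d
    induction d with
    | zero =>
      refine ⟨B, hB0, fun K hK z hz hsep S hS j => ?_⟩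
      have hSu : S ≠ Finset.univ := by
        rintro rfl
        rw [Finset.card_univ, Fintype.card_fin] at hS
        omega
      by_cases hj : j ∈ S
      · exact hmem K hK z hz S hSu j hj
      have hSj : S = Finset.univ.erase j := by
        refine Finset.eq_of_subset_of_card_le (fun x hx => ?_) ?_
        · simp only [Finset.mem_erase, Finset.mem_univ, and_true]
          rintro rfl; exact hj hx
        · simp; omega
      rw [hSj, hK.fderiv_erase hU (hm j) hz]
      calc ‖∑ l ∈ Finset.univ.erase j, (1 - m l) * K ((Finset.univ.erase l).erase j) z‖
          ≤ ∑ l ∈ Finset.univ.erase j, ‖1 - m l‖ * total K z := by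
            refine norm_sum_le_of_le _ fun l _ => ?_
            rw [norm_mul]
            gcongr
            refine norm_le_total ?_ z
            exact fun h => Finset.notMem_erase j _ (h ▸ Finset.mem_univ j)
        _ = (∑ l ∈ Finset.univ.erase j, ‖1 - m l‖) * total K z := by rw [Finset.sum_mul]
        _ ≤ B * total K z := by
            refine mul_le_mul_of_nonneg_right ?_ (htot K z)
            refine (Finset.sum_le_sum_of_subset_of_nonneg (Finset.subset_univ _)
              fun _ _ _ => norm_nonneg _).trans ?_
            exact Finset.sum_le_sum fun l _ => by linarith [norm_nonneg (m l)]
    | succ d ih =>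
      obtain ⟨C, hC, ih⟩ := ih
      refine ⟨B + (B + C) / δ, by positivity, fun K hK z hz hsep S hS j => ?_⟩
      have hSu : S ≠ Finset.univ := by
        rintro rfl
        rw [Finset.card_univ, Fintype.card_fin] at hS
        omega
      by_cases hj : j ∈ S
      · refine (hmem K hK z hz S hSu j hj).trans ?_
        have : 0 ≤ (B + C) / δ * total K z := mul_nonneg (by positivity) (htot K z)
        linarith
      obtain ⟨l, hl⟩ : ∃ l, l ∉ insert j S := by
        by_contra! h
        have h1 := Finset.card_le_card (fun x _ => h x : Finset.univ ⊆ insert j S)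
        rw [Finset.card_insert_of_notMem hj, Finset.card_univ, Fintype.card_fin] at h1
        omega
      rw [Finset.mem_insert, not_or] at hl
      have h1 := hK.fderiv_of_notMem hU hj hl.2 (Ne.symm hl.1) hz
      have h2 := ih K hK z hz hsep (insert l S)
        (by rw [Finset.card_insert_of_notMem hl.2]; omega) j
      have h3 : ‖z l - z j‖ * ‖fderiv ℂ (K S) z (Pi.single j 1)‖ ≤ (B + C) * total K z := by
        rw [← norm_mul, h1]
        refine (norm_sub_le _ _).trans ?_
        rw [norm_mul, add_mul]
        refine add_le_add (mul_le_mul (hBl j).2 (norm_le_total hSu z) (norm_nonneg _) hB0) h2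
      have h4 : δ * ‖fderiv ℂ (K S) z (Pi.single j 1)‖ ≤ (B + C) * total K z :=
        (mul_le_mul_of_nonneg_right (hsep l j hl.1) (norm_nonneg _)).trans h3
      have h5 : ‖fderiv ℂ (K S) z (Pi.single j 1)‖ ≤ (B + C) / δ * total K z := by
        rw [div_mul_eq_mul_div, le_div_iff₀ hδ]; linarith
      have : 0 ≤ B * total K z := mul_nonneg hB0 (htot K z)
      linarith
  choose C hC hCb using key
  refine ⟨∑ d ∈ Finset.range (n + 1), C d, Finset.sum_nonneg fun d _ => hC d,
    fun K hK z hz hsep S hS j => ?_⟩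
  have h1 := Finset.card_lt_card (Finset.ssubset_univ_iff.2 hS)
  rw [Finset.card_univ, Fintype.card_fin] at h1
  refine (hCb (n - S.card) K hK z hz hsep S (by omega) j).trans ?_
  refine mul_le_mul_of_nonneg_right ?_ (htot K z)
  exact Finset.single_le_sum (f := C) (fun d _ => hC d) (Finset.mem_range.2 (by omega))

/-- A solution that vanishes at a point of a convex open set vanishes identically. -/
theorem eq_zero_of_convex (hK : IsSol m U K) (hU : IsOpen U) (hconv : Convex ℝ U)
    (hconf : U ⊆ configSpace n) (hm : ∀ j, m j ≠ 1) {z₁ : Fin (n + 1) → ℂ} (hz₁ : z₁ ∈ U)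
    (h0 : ∀ S ≠ Finset.univ, K S z₁ = 0) {z : Fin (n + 1) → ℂ} (hz : z ∈ U) :
    ∀ S ≠ Finset.univ, K S z = 0 := by
  set v : Fin (n + 1) → ℂ := z - z₁ with hv
  let c : ℝ → Fin (n + 1) → ℂ := fun t => z₁ + (t : ℂ) • v
  have hc : Continuous c := by fun_prop
  have hcU : ∀ t ∈ Icc (0 : ℝ) 1, c t ∈ U := by
    intro t ht
    have := hconv hz₁ hz (sub_nonneg.2 ht.2) ht.1 (by ring)
    convert this using 1
    funext i
    simp [c, hv]
    ring
  obtain ⟨δ, hδ, hsep⟩ : ∃ δ > 0, ∀ t ∈ Icc (0 : ℝ) 1, ∀ i j, i ≠ j → δ ≤ ‖c t i - c t j‖ := by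
    have h1 : ∀ p : Fin (n + 1) × Fin (n + 1), ∀ᶠ δ in 𝓝[>] (0 : ℝ), ∀ t ∈ Icc (0 : ℝ) 1,
        p.1 ≠ p.2 → δ ≤ ‖c t p.1 - c t p.2‖ := by
      intro p
      by_cases hp : p.1 = p.2
      · exact Eventually.of_forall fun δ t _ h => absurd hp h
      have hcont : ContinuousOn (fun t => ‖c t p.1 - c t p.2‖) (Icc 0 1) := by fun_prop
      obtain ⟨t₀, ht₀, hmin⟩ := isCompact_Icc.exists_isMinOn (nonempty_Icc.2 zero_le_one) hcont
      have hpos : 0 < ‖c t₀ p.1 - c t₀ p.2‖ :=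
        norm_pos_iff.2 (sub_ne_zero.2 fun h => hp (hconf (hcU _ ht₀) h))
      filter_upwards [Ioo_mem_nhdsGT hpos] with δ hδ t ht _
      exact hδ.2.le.trans (hmin ht)
    obtain ⟨δ, hδ, hδ0⟩ := ((eventually_all.2 h1).and self_mem_nhdsWithin).exists
    exact ⟨δ, hδ0, fun t ht i j hij => hδ (i, j) t ht hij⟩
  obtain ⟨C, hC, hbound⟩ := exists_bound_fderiv hm hU hδ
  -- Grönwall is applied to the vector of all members except the top one, which need not vanish at
  -- z₁ and is replaced by 0.
  let f : ℝ → Finset (Fin (n + 1)) → ℂ := fun t S => if S = Finset.univ then 0 else K S (c t)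
  let f' : ℝ → Finset (Fin (n + 1)) → ℂ := fun t S =>
    if S = Finset.univ then 0 else fderiv ℂ (K S) (c t) v
  have hcd : ∀ t, HasDerivAt c v t := by
    intro t
    have h1 : HasDerivAt (fun t : ℝ => (t : ℂ) • v) ((1 : ℂ) • v) t :=
      ((hasDerivAt_id (t : ℂ)).comp_ofReal).smul_const v
    simpa [c] using h1.const_add z₁
  have hfd : ∀ t ∈ Icc (0 : ℝ) 1, HasDerivAt f (f' t) t := by
    intro t ht
    rw [hasDerivAt_pi]
    intro S
    by_cases hS : S = Finset.univ
    · simpa [f, f', hS] using hasDerivAt_const t (0 : ℂ)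
    · simp only [f, f', hS, if_false]
      exact (((hK.analytic S _ (hcU t ht)).differentiableAt.hasFDerivAt).restrictScalars
        ℝ).comp_hasDerivAt t (hcd t)
  have hvsum : v = ∑ j, v j • (Pi.single j 1 : Fin (n + 1) → ℂ) := by
    funext i
    simp [Finset.sum_apply, Pi.single_apply]
  have htotal : ∀ t, total K (c t) ≤ (Fintype.card (Finset (Fin (n + 1))) : ℝ) * ‖f t‖ := by
    intro t
    have h1 : ∀ S ∈ Finset.univ.erase (Finset.univ : Finset (Fin (n + 1))),
        ‖K S (c t)‖ ≤ ‖f t‖ := by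
      intro S hS
      have := norm_le_pi_norm (f t) S
      simpa [f, Finset.ne_of_mem_erase hS] using this
    refine (Finset.sum_le_sum h1).trans ?_
    rw [Finset.sum_const, nsmul_eq_mul]
    gcongr
    exact Finset.card_le_univ _
  have hf0 : ∀ t ∈ Icc (0 : ℝ) 1, f t = 0 := by
    refine eq_zero_of_abs_deriv_le_mul_abs_self_of_eq_zero_right (f' := f')
      (K := (∑ j, ‖v j‖) * C * Fintype.card (Finset (Fin (n + 1))))
      (fun t ht => (hfd t ht).continuousAt.continuousWithinAt)
      (fun t ht => (hfd t (Ico_subset_Icc_self ht)).hasDerivWithinAt) ?_ ?_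
    · funext S
      by_cases hS : S = Finset.univ
      · simp [f, hS]
      · simp [f, c, hS, h0 S hS]
    · intro t ht
      have ht' := Ico_subset_Icc_self ht
      refine (pi_norm_le_iff_of_nonneg (by positivity)).2 fun S => ?_
      by_cases hS : S = Finset.univ
      · simp only [f', hS, if_true, norm_zero]; positivity
      · simp only [f', hS, if_false]
        have h1 : fderiv ℂ (K S) (c t) v = ∑ j, v j * fderiv ℂ (K S) (c t) (Pi.single j 1) := by
          conv_lhs => rw [hvsum]
          simp only [map_sum, map_smul, smul_eq_mul]
        rw [h1]
        calc ‖∑ j, v j * fderiv ℂ (K S) (c t) (Pi.single j 1)‖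
            ≤ ∑ j, ‖v j‖ * (C * total K (c t)) := by
              refine norm_sum_le_of_le _ fun j _ => ?_
              rw [norm_mul]
              gcongr
              exact hbound K hK _ (hcU t ht') (hsep t ht') S hS j
          _ = (∑ j, ‖v j‖) * C * total K (c t) := by rw [← Finset.sum_mul]; ring
          _ ≤ _ := by
              rw [mul_assoc _ _ ‖f t‖]
              exact mul_le_mul_of_nonneg_left (htotal t) (by positivity)
  intro S hS
  have h1 := congrFun (hf0 1 ⟨zero_le_one, le_rfl⟩) S
  simpa [f, hS, c, hv] using h1

end IsSol

end Lauricella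
end

/-! ### Independence of the periods at the base point; charts of the configuration space -/

noncomputable section

namespace Lauricella

open MeasureTheory Filter Set

variable {n : ℕ}

/-- The integrand of the `k`-th period at the base point. -/
def baseDensity (μ : Fin (n + 1) → ℝ) (k : Fin n) (t : ℝ) : ℝ :=
  ∏ j : Fin (n + 1), (if j ≤ k.castSucc then (k : ℝ) + t - j else (j : ℝ) - (k + t)) ^ (-μ j)

theorem seg_basePoint (k : Fin n) (t : ℝ) : seg k (basePoint n) t = (((k : ℝ) + t : ℝ) : ℂ) := by
  simp [seg, basePoint]

theorem baseDensity_factor_pos (k : Fin n) {t : ℝ} (ht : t ∈ Ioo (0 : ℝ) 1) (j : Fin (n + 1)) :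
    0 < (if j ≤ k.castSucc then (k : ℝ) + t - j else (j : ℝ) - (k + t)) := by
  have h := side_re_pos basePoint_mem_chamber k ht j
  rw [seg_basePoint] at h
  unfold side at h
  split_ifs at h ⊢ <;> simpa [basePoint] using h

theorem baseDensity_pos (μ : Fin (n + 1) → ℝ) (k : Fin n) {t : ℝ} (ht : t ∈ Ioo (0 : ℝ) 1) :
    0 < baseDensity μ k t :=
  Finset.prod_pos fun j _ => Real.rpow_pos_of_pos (baseDensity_factor_pos k ht j) _

theorem phi_basePoint (μ : Fin (n + 1) → ℝ) (S : Finset (Fin (n + 1))) (k : Fin n) {t : ℝ}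
    (ht : t ∈ Ioo (0 : ℝ) 1) :
    phi (fun j => (μ j : ℂ)) S k (basePoint n) (seg k (basePoint n) t) =
      (((∏ l ∈ S, ((k : ℝ) + t - (l : ℕ))) * baseDensity μ k t : ℝ) : ℂ) := by
  rw [phi, baseDensity]
  push_cast
  congr 1
  · refine Finset.prod_congr rfl fun l _ => ?_
    rw [seg_basePoint]
    simp [basePoint]
  · refine Finset.prod_congr rfl fun j _ => ?_
    rw [← Complex.ofReal_neg, Complex.ofReal_cpow (baseDensity_factor_pos k ht j).le]
    congr 1
    rw [seg_basePoint]
    unfold side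
    split_ifs <;> simp [basePoint]

/-- Without a zero, g would have a constant sign on the interval, and so would g ρ. -/
theorem exists_root_of_integral_eq_zero {g ρ : ℝ → ℝ} (hg : Continuous g)
    (hρ : ∀ t ∈ Ioo (0 : ℝ) 1, 0 < ρ t) (hint : IntegrableOn (fun t => g t * ρ t) (Ioo 0 1))
    (h0 : ∫ t in Ioo (0 : ℝ) 1, g t * ρ t = 0) : ∃ t ∈ Ioo (0 : ℝ) 1, g t = 0 := by
  by_contra! hne
  have key : ∀ f : ℝ → ℝ, (∀ t ∈ Ioo (0 : ℝ) 1, 0 < f t) → IntegrableOn f (Ioo 0 1) →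
      ∫ t in Ioo (0 : ℝ) 1, f t ≠ 0 := by
    intro f hf hi h
    have h1 : 0 ≤ᵐ[volume.restrict (Ioo (0 : ℝ) 1)] f := by
      filter_upwards [ae_restrict_mem measurableSet_Ioo] with t ht using (hf t ht).le
    have h2 := (integral_eq_zero_iff_of_nonneg_ae h1 hi).1 h
    have h3 : ∀ᵐ t ∂(volume.restrict (Ioo (0 : ℝ) 1)), False := by
      filter_upwards [ae_restrict_mem measurableSet_Ioo, h2] with t ht h2
      exact (hf t ht).ne' h2
    rw [eventually_false_iff_eq_bot, ae_eq_bot, Measure.restrict_eq_zero] at h3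
    simp at h3
  have hsign : (∀ t ∈ Ioo (0 : ℝ) 1, 0 < g t) ∨ ∀ t ∈ Ioo (0 : ℝ) 1, g t < 0 := by
    by_contra! h
    obtain ⟨⟨a, ha, hga⟩, b, hb, hgb⟩ := h
    have := isPreconnected_Ioo.intermediate_value ha hb hg.continuousOn
    obtain ⟨c, hc, hgc⟩ := this ⟨hga, hgb⟩
    exact hne c hc hgc
  rcases hsign with h | h
  · exact key _ (fun t ht => mul_pos (h t ht) (hρ t ht)) hint h0
  · refine key (fun t => -(g t * ρ t)) (fun t ht => ?_) hint.neg ?_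
    · exact neg_pos.2 (mul_neg_of_neg_of_pos (h t ht) (hρ t ht))
    · rw [integral_neg, h0, neg_zero]

/-- A polynomial of degree less than `n` with a root in each of `n` consecutive intervals, written
in the Newton basis. -/
theorem eq_zero_of_newton_roots {b : Fin n → ℝ} {r : Fin n → ℝ}
    (hr : ∀ k, r k ∈ Ioo (0 : ℝ) 1)
    (h : ∀ k : Fin n, ∑ i, b i * ∏ l ∈ initSet n i, ((k : ℝ) + r k - (l : ℕ)) = 0) : b = 0 := by
  let p : Polynomial ℝ := ∑ i, Polynomial.C (b i) * ∏ l ∈ initSet n i,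
    (Polynomial.X - Polynomial.C ((l : ℕ) : ℝ))
  have hev : ∀ x, p.eval x = ∑ i, b i * ∏ l ∈ initSet n i, (x - (l : ℕ)) := by
    intro x
    simp [p, Polynomial.eval_finsetSum, Polynomial.eval_prod]
  have hp : p = 0 := by
    have hinj : Function.Injective fun k : Fin n => (k : ℝ) + r k := by
      have : StrictMono fun k : Fin n => (k : ℝ) + r k := by
        intro i j hij
        have : ((i : ℕ) : ℝ) + 1 ≤ (j : ℕ) := by exact_mod_cast hij
        have h1 := (hr i).2
        have h2 := (hr j).1
        show ((i : ℕ) : ℝ) + r i < (j : ℕ) + r j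
        linarith
      exact this.injective
    refine Polynomial.eq_zero_of_degree_lt_of_eval_finset_eq_zero
      (Finset.univ.image fun k : Fin n => (k : ℝ) + r k) ?_ ?_
    · rw [Finset.card_image_of_injective _ hinj, Finset.card_univ, Fintype.card_fin]
      rw [← Polynomial.mem_degreeLT]
      refine Submodule.sum_mem _ fun i _ => ?_
      rw [Polynomial.mem_degreeLT]
      rw [← Polynomial.smul_eq_C_mul]
      refine (Polynomial.degree_smul_le _ _).trans_lt ?_
      rw [Polynomial.degree_prod]
      simp only [Polynomial.degree_X_sub_C, Finset.sum_const, card_initSet (i.2.le.trans (Nat.le_succ n))]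
      rw [nsmul_eq_mul, mul_one]
      exact_mod_cast i.2
    · intro x hx
      obtain ⟨k, _, rfl⟩ := Finset.mem_image.1 hx
      rw [hev, h k]
  have hval : ∀ j : Fin n, ∑ i, b i * ∏ l ∈ initSet n i, ((j : ℝ) - (l : ℕ)) = 0 := by
    intro j
    rw [← hev, hp, Polynomial.eval_zero]
  -- The Newton basis is triangular at the integers: at x = j all products with more than j factors
  -- vanish, and the one with exactly j factors does not.
  have key : ∀ N : ℕ, ∀ j : Fin n, j.val = N → b j = 0 := by
    intro N
    induction N using Nat.strong_induction_on with
    | _ N ih =>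
      rintro j rfl
      have h1 := hval j
      rw [Finset.sum_eq_single j] at h1
      · refine (mul_eq_zero.1 h1).resolve_right (Finset.prod_ne_zero_iff.2 fun l hl => ?_)
        simp only [initSet, Finset.mem_filter, Finset.mem_univ, true_and] at hl
        refine sub_ne_zero.2 fun h => ?_
        have : (j : ℕ) = (l : ℕ) := by exact_mod_cast h
        omega
      · intro i _ hij
        rcases lt_or_gt_of_ne hij with hlt | hlt
        · rw [ih i hlt i rfl, zero_mul]
        · refine mul_eq_zero_of_right _ (Finset.prod_eq_zero (i := j.castSucc) ?_ ?_)
          · simpa [initSet] using hlt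
          · simp
      · intro h; exact absurd (Finset.mem_univ j) h
  funext j
  exact key j j rfl

/-- At [n] the integrands are a positive density times the Newton polynomials. A dependence is thus
a polynomial of degree less than n that is orthogonal to a positive density on each interval (k, k +
1); it has a root in each of these n intervals. Real and imaginary parts of b are treated
separately. -/
theorem eq_zero_of_sum_period_basePoint {μ : Fin (n + 1) → ℝ} (hμ : ∀ j, μ j < 1) {b : Fin n → ℂ}
    (h : ∀ k : Fin n, ∑ i : Fin n, b i * period (fun j => (μ j : ℂ)) (initSet n i) k (basePoint n) = 0) :
    b = 0 := by
  have hm : ∀ j, ((μ j : ℂ)).re < 1 := by simpa using hμ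
  let g : ℕ → Fin n → ℝ → ℝ := fun i k t => ∏ l ∈ initSet n i, ((k : ℝ) + t - (l : ℕ))
  have hint : ∀ i k, IntegrableOn (fun t => g i k t * baseDensity μ k t) (Ioo 0 1) := by
    intro i k
    have := (integrableOn_phi_seg hm (initSet n i) k basePoint_mem_chamber).re
    refine IntegrableOn.congr_fun this (fun t ht => ?_) measurableSet_Ioo
    simp only [phi_basePoint μ _ k ht]
    exact Complex.ofReal_re _
  have hper : ∀ (i : ℕ) k, period (fun j => (μ j : ℂ)) (initSet n i) k (basePoint n) =
      ((∫ t in Ioo (0 : ℝ) 1, g i k t * baseDensity μ k t : ℝ) : ℂ) := by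
    intro i k
    rw [period_eq_integral_Ioo, ← integral_complex_ofReal]
    refine setIntegral_congr_fun measurableSet_Ioo fun t ht => ?_
    simp only [phi_basePoint μ _ k ht]
    have : basePoint n k.succ - basePoint n k.castSucc = 1 := by simp [basePoint]
    rw [this, mul_one]
  have real : ∀ c : Fin n → ℝ,
      (∀ k : Fin n, ∑ i : Fin n, c i * ∫ t in Ioo (0 : ℝ) 1, g i k t * baseDensity μ k t = 0) →
        c = 0 := by
    intro c hc
    have hroot : ∀ k : Fin n, ∃ t ∈ Ioo (0 : ℝ) 1, ∑ i : Fin n, c i * g i k t = 0 := by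
      intro k
      have heq : ∀ t, (∑ i : Fin n, c i * g i k t) * baseDensity μ k t =
          ∑ i : Fin n, c i * (g i k t * baseDensity μ k t) := fun t => by
        rw [Finset.sum_mul]
        exact Finset.sum_congr rfl fun i _ => by ring
      refine exists_root_of_integral_eq_zero (ρ := baseDensity μ k) (by fun_prop)
        (fun t ht => baseDensity_pos μ k ht) ?_ ?_
      · simp only [heq]
        exact integrable_finsetSum _ fun (i : Fin n) _ => (hint i k).const_mul _
      · simp only [heq]
        rw [integral_finsetSum _ fun (i : Fin n) _ => (hint i k).const_mul _]
        simp only [integral_const_mul]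
        exact hc k
    choose r hr hr0 using hroot
    exact eq_zero_of_newton_roots hr hr0
  simp only [hper] at h
  have hre := real (fun i => (b i).re) fun k => by
    have := congrArg Complex.re (h k)
    simpa using this
  have him := real (fun i => (b i).im) fun k => by
    have := congrArg Complex.im (h k)
    simpa using this
  funext i
  exact Complex.ext (congrFun hre i) (congrFun him i)

/-- The linear change of coordinates that turns a configuration by `u` and orders it by `σ`. -/
def turn (u : ℂ) (σ : Equiv.Perm (Fin (n + 1))) (z : Fin (n + 1) → ℂ) : Fin (n + 1) → ℂ :=
  fun j => u * z (σ j)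

/-- The configurations whose points, turned by `u`, have real parts in the order `σ`. -/
def chart (u : ℂ) (σ : Equiv.Perm (Fin (n + 1))) : Set (Fin (n + 1) → ℂ) :=
  turn u σ ⁻¹' chamber n

/-- The periods in the coordinates of a chart. -/
def chartPeriod (m : Fin (n + 1) → ℂ) (u : ℂ) (σ : Equiv.Perm (Fin (n + 1))) (k : Fin n)
    (S : Finset (Fin (n + 1))) (z : Fin (n + 1) → ℂ) : ℂ :=
  (u ^ S.card)⁻¹ * period (m ∘ σ) (S.map σ.symm.toEmbedding) k (turn u σ z)

/-- `turn` as a continuous linear map. -/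
def turnL (u : ℂ) (σ : Equiv.Perm (Fin (n + 1))) :
    (Fin (n + 1) → ℂ) →L[ℂ] (Fin (n + 1) → ℂ) :=
  ContinuousLinearMap.pi fun j => u • ContinuousLinearMap.proj (R := ℂ) (σ j)

theorem turnL_apply (u : ℂ) (σ : Equiv.Perm (Fin (n + 1))) (z : Fin (n + 1) → ℂ) :
    turnL u σ z = turn u σ z := rfl

theorem isOpen_chart (u : ℂ) (σ : Equiv.Perm (Fin (n + 1))) : IsOpen (chart u σ) :=
  isOpen_chamber.preimage (turnL u σ).continuous

theorem convex_chart (u : ℂ) (σ : Equiv.Perm (Fin (n + 1))) : Convex ℝ (chart u σ) :=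
  convex_chamber.linear_preimage ((turnL u σ).restrictScalars ℝ).toLinearMap

theorem chart_subset_configSpace (u : ℂ) (σ : Equiv.Perm (Fin (n + 1))) :
    chart u σ ⊆ configSpace n := by
  intro z hz i j hij
  have := chamber_subset_configSpace hz (a₁ := σ.symm i) (a₂ := σ.symm j) (by simp [turn, hij])
  simpa using this

theorem chart_one_refl : chart (n := n) 1 (Equiv.refl _) = chamber n := by
  ext z
  simp [chart, turn, chamber]

theorem exists_mem_chart {z : Fin (n + 1) → ℂ} (hz : z ∈ configSpace n) :
    ∃ u : ℂ, ‖u‖ = 1 ∧ ∃ σ, z ∈ chart u σ := by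
  -- The real part of (1 + s i)(z_i - z_j) is Re - s Im of the difference, so each pair excludes at
  -- most one value of s.
  obtain ⟨s, hs⟩ : ∃ s : ℝ, ∀ i j, i ≠ j →
      (z i - z j).re - s * (z i - z j).im ≠ 0 := by
    have hfin : (⋃ p : Fin (n + 1) × Fin (n + 1),
        {((z p.1 - z p.2).re / (z p.1 - z p.2).im : ℝ)}).Finite :=
      Set.finite_iUnion fun _ => Set.finite_singleton _
    obtain ⟨s, hs⟩ := hfin.infinite_compl.nonempty
    refine ⟨s, fun i j hij h => ?_⟩
    by_cases him : (z i - z j).im = 0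
    · rw [him, mul_zero, sub_zero] at h
      exact hij (hz (sub_eq_zero.1 (Complex.ext h him)))
    · refine hs (mem_iUnion.2 ⟨(i, j), ?_⟩)
      rw [mem_singleton_iff, eq_div_iff him]
      linarith
  set a : ℂ := 1 + s * Complex.I with ha
  have ha0 : a ≠ 0 := fun h => by simpa [ha] using congrArg Complex.re h
  have hna : 0 < ‖a‖ := norm_pos_iff.2 ha0
  refine ⟨((‖a‖⁻¹ : ℝ) : ℂ) * a, ?_, ?_⟩
  · rw [norm_mul, Complex.norm_real, norm_inv, norm_norm, inv_mul_cancel₀ hna.ne']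
  let f : Fin (n + 1) → ℝ := fun i => (((‖a‖⁻¹ : ℝ) : ℂ) * a * z i).re
  have hf : ∀ i, f i = ‖a‖⁻¹ * ((z i).re - s * (z i).im) := by
    intro i
    simp only [f]
    rw [mul_assoc, Complex.re_ofReal_mul]
    simp [ha]
  have hinj : Function.Injective f := by
    intro i j hij
    by_contra hne
    rw [hf, hf] at hij
    have := mul_left_cancel₀ (inv_ne_zero hna.ne') hij
    refine hs i j hne ?_
    simp only [Complex.sub_re, Complex.sub_im]
    linarith
  refine ⟨Tuple.sort f, fun i j hij => ?_⟩
  have h1 := (Tuple.monotone_sort f).strictMono_of_injective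
    (hinj.comp (Tuple.sort f).injective) hij
  exact h1

theorem map_insert_perm (σ : Equiv.Perm (Fin (n + 1))) (S : Finset (Fin (n + 1)))
    (j : Fin (n + 1)) : (insert j S).map σ.symm.toEmbedding =
      insert (σ.symm j) (S.map σ.symm.toEmbedding) := by
  rw [Finset.map_insert]; rfl

theorem turn_single (u : ℂ) (σ : Equiv.Perm (Fin (n + 1))) (j : Fin (n + 1)) :
    turn u σ (Pi.single j 1) = u • (Pi.single (σ.symm j) 1 : Fin (n + 1) → ℂ) := by
  funext i
  by_cases h : i = σ.symm j
  · subst h; simp [turn]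
  · have : σ i ≠ j := fun h' => h (by rw [← h', Equiv.symm_apply_apply])
    simp [turn, h, this]

/-- Turning multiplies every factor ζ - z_l and every ∂_j by u. The power of u in `chartPeriod`
compensates both, so the relations hold with the original coordinates and weights, and families from
different charts can be compared. -/
theorem isSol_chartPeriod {m : Fin (n + 1) → ℂ} (hm : ∀ j, (m j).re < 1) {u : ℂ} (hu : u ≠ 0)
    (σ : Equiv.Perm (Fin (n + 1))) (k : Fin n) :
    IsSol m (chart u σ) (chartPeriod m u σ k) := by
  have hm' : ∀ j, ((m ∘ σ) j).re < 1 := fun j => hm _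
  have hs := isSol_period hm' k
  have hnot : ∀ {S : Finset (Fin (n + 1))} {j}, j ∉ S → σ.symm j ∉ S.map σ.symm.toEmbedding := by
    intro S j hj h
    obtain ⟨i, hi, hij⟩ := Finset.mem_map.1 h
    exact hj (σ.symm.injective hij ▸ hi)
  refine ⟨fun S z hz => ?_, fun S j hj z hz => ?_, fun S j l hj hl z hz => ?_, fun z hz => ?_⟩
  · exact analyticAt_const.mul (AnalyticAt.comp (g := period _ _ k) (f := turn u σ)
      (hs.analytic _ _ hz) ((turnL u σ).analyticAt z))
  · have h1 := (hs.analytic (insert (σ.symm j) (S.map σ.symm.toEmbedding)) _ hz).differentiableAt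
    have h2 : HasFDerivAt (chartPeriod m u σ k (insert j S)) _ z :=
      (h1.hasFDerivAt.comp z (turnL u σ).hasFDerivAt).const_mul ((u ^ (insert j S).card)⁻¹)
        |>.congr_of_eventuallyEq (Eventually.of_forall fun z => by
          simp only [chartPeriod, map_insert_perm, Function.comp_apply])
    rw [h2.fderiv, smul_apply, ContinuousLinearMap.comp_apply, turnL_apply, turn_single, map_smul,
      hs.deriv _ _ (hnot hj) _ hz, chartPeriod, Finset.card_insert_of_notMem hj]
    simp only [Function.comp_apply, Equiv.apply_symm_apply, smul_eq_mul]
    field_simp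
    ring
  · have h1 := hs.exchange _ _ _ (hnot hj) (hnot hl) _ hz
    simp only [chartPeriod, map_insert_perm, Finset.card_insert_of_notMem hj,
      Finset.card_insert_of_notMem hl]
    rw [← mul_sub, h1]
    simp only [turn, Equiv.apply_symm_apply]
    field_simp
    ring
  · have h1 := hs.top _ hz
    rw [← Equiv.sum_comp σ.symm] at h1
    have h2 : ∀ l, (1 - m l) * chartPeriod m u σ k (Finset.univ.erase l) z =
        (u ^ n)⁻¹ * ((1 - (m ∘ σ) (σ.symm l)) *
          period (m ∘ σ) (Finset.univ.erase (σ.symm l)) k (turn u σ z)) := by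
      intro l
      have : (Finset.univ.erase l).map σ.symm.toEmbedding = Finset.univ.erase (σ.symm l) := by
        rw [Finset.map_erase]; simp
      simp only [chartPeriod, this, Function.comp_apply, Equiv.apply_symm_apply]
      rw [Finset.card_erase_of_mem (Finset.mem_univ l), Finset.card_univ, Fintype.card_fin,
        Nat.add_sub_cancel]
      ring
    rw [Finset.sum_congr rfl fun l _ => h2 l, ← Finset.mul_sum, h1, mul_zero]

end Lauricella
end

/-! ### Nonsingular period matrices, constant transition matrices, linear relations between the F_k
-/

noncomputable section

namespace Lauricella

open MeasureTheory Filter Set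

variable {n : ℕ}

/-- Real weights as complex exponents. -/
def cw (μ : Fin (n + 1) → ℝ) : Fin (n + 1) → ℂ := fun j => (μ j : ℂ)

theorem cw_re_lt {μ : Fin (n + 1) → ℝ} (hμ : ∀ j, μ j < 1) (j : Fin (n + 1)) :
    (cw μ j).re < 1 := by simpa [cw] using hμ j

theorem cw_ne_one {μ : Fin (n + 1) → ℝ} (hμ : ∀ j, μ j < 1) (j : Fin (n + 1)) : cw μ j ≠ 1 := by
  intro h
  have := cw_re_lt hμ j
  rw [h] at this
  simp at this

theorem sum_one_sub_cw_ne_zero {μ : Fin (n + 1) → ℝ} (hμ : ∀ j, μ j < 1) :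
    ∑ l, (1 - cw μ l) ≠ 0 := by
  have : ∑ l, (1 - cw μ l) = ((∑ l, (1 - μ l) : ℝ) : ℂ) := by push_cast; rfl
  rw [this, Complex.ofReal_ne_zero]
  exact (Finset.sum_pos (fun l _ => sub_pos.2 (hμ l)) Finset.univ_nonempty).ne'

theorem chartPeriod_one_refl (m : Fin (n + 1) → ℂ) (k : Fin n) (S : Finset (Fin (n + 1)))
    (z : Fin (n + 1) → ℂ) : chartPeriod m 1 (Equiv.refl _) k S z = period m S k z := by
  have h1 : S.map (Equiv.refl (Fin (n + 1))).symm.toEmbedding = S := by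
    ext; simp
  have h2 : turn 1 (Equiv.refl _) z = z := by funext j; simp [turn]
  rw [chartPeriod, h1, h2]
  simp

/-- The matrix of periods of the forms indexed by the initial sets. -/
def periodMatrix (m : Fin (n + 1) → ℂ) (u : ℂ) (σ : Equiv.Perm (Fin (n + 1)))
    (z : Fin (n + 1) → ℂ) : Matrix (Fin n) (Fin n) ℂ :=
  Matrix.of fun k i => chartPeriod m u σ k (initSet n i) z

theorem initSet_ne_univ {i : ℕ} (hi : i < n) : initSet n i ≠ Finset.univ := by
  intro h
  have h1 := card_initSet (n := n) (i := i) (by omega)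
  rw [h, Finset.card_univ, Fintype.card_fin] at h1
  omega

/-- The combination with coefficients a is again a solution. It vanishes at z, hence throughout the
convex chart, in particular where the turned configuration is [n]; there the period matrix is
nonsingular. -/
theorem eq_zero_of_vecMul_chartPeriod {μ : Fin (n + 1) → ℝ} (hμ : ∀ j, μ j < 1) {u : ℂ}
    (hu : u ≠ 0) (σ : Equiv.Perm (Fin (n + 1))) {z : Fin (n + 1) → ℂ} (hz : z ∈ chart u σ)
    {a : Fin n → ℂ}
    (ha : ∀ i < n, ∑ k, a k * chartPeriod (cw μ) u σ k (initSet n i) z = 0) : a = 0 := by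
  have hsol := IsSol.sum (fun k => isSol_chartPeriod (cw_re_lt hμ) hu σ k) a
  have h1 := hsol.eq_zero_of_initSet (sum_one_sub_cw_ne_zero hμ) hz ha
  set z₁ : Fin (n + 1) → ℂ := fun j => u⁻¹ * basePoint n (σ.symm j) with hz₁
  have hturn : turn u σ z₁ = basePoint n := by
    funext j
    simp [turn, hz₁, hu]
  have hz₁c : z₁ ∈ chart u σ := by
    show turn u σ z₁ ∈ chamber n
    rw [hturn]; exact basePoint_mem_chamber
  have h2 := hsol.eq_zero_of_convex (isOpen_chart u σ) (convex_chart u σ)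
    (chart_subset_configSpace u σ) (cw_ne_one hμ) hz h1 hz₁c
  let Q : Matrix (Fin n) (Fin n) ℂ :=
    Matrix.of fun k i => period (cw (μ ∘ σ)) (initSet n i) k (basePoint n)
  have h3 : Matrix.vecMul a Q = 0 := by
    funext i
    have h4 := h2 ((initSet n i).map σ.toEmbedding) (fun h => initSet_ne_univ i.2 (by
      have := congrArg (Finset.map σ.symm.toEmbedding) h
      rw [Finset.map_map] at this
      ext x
      have h5 := congrArg (x ∈ ·) this
      simpa using h5))
    have h5 : ((initSet n i).map σ.toEmbedding).map σ.symm.toEmbedding = initSet n i := by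
      ext x; simp
    simp only [chartPeriod, h5, hturn] at h4
    have h6 : (u ^ ((initSet n i).map σ.toEmbedding).card)⁻¹ ≠ 0 := inv_ne_zero (pow_ne_zero _ hu)
    have h7 : (u ^ ((initSet n i).map σ.toEmbedding).card)⁻¹ * Matrix.vecMul a Q i = 0 := by
      rw [← h4, Matrix.vecMul, dotProduct, Finset.mul_sum]
      exact Finset.sum_congr rfl fun k _ => by
        simp only [Q, Matrix.of_apply]
        rw [mul_left_comm]
        rfl
    exact (mul_eq_zero.1 h7).resolve_left h6
  by_contra ha0
  -- Independence at the base point is known for the columns (the forms) and wanted for the rows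
  -- (the segments); the determinant passes from one to the other.
  have h4 := Matrix.exists_vecMul_eq_zero_iff.1 ⟨a, ha0, h3⟩
  obtain ⟨b, hb, h5⟩ := Matrix.exists_mulVec_eq_zero_iff.2 h4
  refine hb (eq_zero_of_sum_period_basePoint (μ := μ ∘ σ) (fun j => hμ _) fun k => ?_)
  have := congrFun h5 k
  rw [Matrix.mulVec, dotProduct] at this
  exact (Finset.sum_congr rfl fun i _ => mul_comm _ _).trans this

theorem det_periodMatrix_ne_zero {μ : Fin (n + 1) → ℝ} (hμ : ∀ j, μ j < 1) {u : ℂ}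
    (hu : u ≠ 0) (σ : Equiv.Perm (Fin (n + 1))) {z : Fin (n + 1) → ℂ} (hz : z ∈ chart u σ) :
    (periodMatrix (cw μ) u σ z).det ≠ 0 := by
  intro h
  obtain ⟨a, ha, h1⟩ := Matrix.exists_vecMul_eq_zero_iff.2 h
  refine ha (eq_zero_of_vecMul_chartPeriod hμ hu σ hz fun i hi => ?_)
  exact congrFun h1 ⟨i, hi⟩

/-- Two charts are related by a constant matrix on their intersection. -/
theorem exists_transition {μ : Fin (n + 1) → ℝ} (hμ : ∀ j, μ j < 1) {u u' : ℂ} (hu : u ≠ 0)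
    (hu' : u' ≠ 0) (σ σ' : Equiv.Perm (Fin (n + 1))) {z₁ : Fin (n + 1) → ℂ} (hz : z₁ ∈ chart u σ)
    (hz' : z₁ ∈ chart u' σ') :
    ∃ M : Matrix (Fin n) (Fin n) ℂ, M.det ≠ 0 ∧ ∀ z ∈ chart u σ ∩ chart u' σ',
      ∀ S ≠ Finset.univ, ∀ k, chartPeriod (cw μ) u σ k S z =
        ∑ l, M k l * chartPeriod (cw μ) u' σ' l S z := by
  set P := periodMatrix (cw μ) u σ z₁ with hP
  set P' := periodMatrix (cw μ) u' σ' z₁ with hP'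
  have hPd : P.det ≠ 0 := det_periodMatrix_ne_zero hμ hu σ hz
  have hPd' : P'.det ≠ 0 := det_periodMatrix_ne_zero hμ hu' σ' hz'
  -- The matrix is read off at z₁ on the initial sets. The difference of the two sides then vanishes
  -- at z₁, and the intersection of two charts is convex.
  refine ⟨P * P'⁻¹, ?_, fun z hzz S hS k => ?_⟩
  · rw [Matrix.det_mul, Matrix.det_nonsing_inv, Ring.inverse_eq_inv']
    exact mul_ne_zero hPd (inv_ne_zero hPd')
  · have hsol := ((isSol_chartPeriod (cw_re_lt hμ) hu σ k).mono inter_subset_left).sub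
      ((IsSol.sum (fun l => isSol_chartPeriod (cw_re_lt hμ) hu' σ' l)
        (fun l => (P * P'⁻¹) k l)).mono (V := chart u σ ∩ chart u' σ') inter_subset_right)
    have hP2 : P * P'⁻¹ * P' = P := by
      rw [Matrix.mul_assoc, Matrix.nonsing_inv_mul _ (Ne.isUnit hPd'), Matrix.mul_one]
    have h0 := hsol.eq_zero_of_initSet (sum_one_sub_cw_ne_zero hμ) ⟨hz, hz'⟩ fun i hi => by
      have := congrFun (congrFun hP2 k) ⟨i, hi⟩
      rw [Matrix.mul_apply] at this
      exact sub_eq_zero.2 this.symm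
    have h1 := hsol.eq_zero_of_convex ((isOpen_chart u σ).inter (isOpen_chart u' σ'))
      ((convex_chart u σ).inter (convex_chart u' σ'))
      (inter_subset_left.trans (chart_subset_configSpace u σ)) (cw_ne_one hμ) ⟨hz, hz'⟩ h0 hzz S hS
    exact sub_eq_zero.1 h1

/-- A linear relation between the Lauricella functions. -/
def IsRel (μ : Fin (n + 1) → ℝ) (a : Fin n → ℂ) : Prop :=
  ∀ z ∈ chamber n, ∑ k, a k * baseF μ z k = 0

theorem smul_mem_chamber {z : Fin (n + 1) → ℂ} (hz : z ∈ chamber n) {c : ℝ} (hc : 0 < c) :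
    (c : ℂ) • z ∈ chamber n := by
  intro i j hij
  simp only [Pi.smul_apply, smul_eq_mul, Complex.re_ofReal_mul]
  exact mul_lt_mul_of_pos_left (hz i j hij) hc

/-- By exchange all members of size i + 1 coincide. For any j one may therefore use a set containing
j, whose ∂_j is a multiple of a member of size i, that is, zero. -/
theorem IsSol.exists_const_of_zero {m : Fin (n + 1) → ℂ}
    {K : Finset (Fin (n + 1)) → (Fin (n + 1) → ℂ) → ℂ} (hK : IsSol m (chamber n) K) {i : ℕ}
    (h0 : ∀ S : Finset (Fin (n + 1)), S.card = i → ∀ z ∈ chamber n, K S z = 0) (hi : i < n) :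
    ∀ S : Finset (Fin (n + 1)), S.card = i + 1 → ∀ z ∈ chamber n,
      K S z = K (initSet n (i + 1)) (basePoint n) := by
  have hex : ∀ z ∈ chamber n, ∀ S T : Finset (Fin (n + 1)), S.card = i + 1 → T.card = i + 1 →
      K S z = K T z := by
    intro z hz S T hS hT
    refine eq_of_card_eq_of_exchange (f := fun S => K S z) (fun R hR j l hj hl => ?_) hS hT
    have := hK.exchange R j l hj hl z hz
    rw [h0 R (by omega) z hz, mul_zero] at this
    exact sub_eq_zero.1 this
  intro S hS z hz
  rw [hex z hz S _ hS (card_initSet (by omega))]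
  set T := initSet n (i + 1) with hT
  have hTc : T.card = i + 1 := card_initSet (by omega)
  refine isOpen_chamber.is_const_of_fderiv_eq_zero (𝕜 := ℂ) convex_chamber.isPreconnected
    (fun z hz => (hK.analytic T z hz).differentiableAt.differentiableWithinAt) (fun z hz => ?_) hz
    basePoint_mem_chamber
  have hj : ∀ j, fderiv ℂ (K T) z (Pi.single j 1) = 0 := by
    intro j
    obtain ⟨R, hR, hRj⟩ : ∃ R : Finset (Fin (n + 1)), R.card = i ∧ j ∉ R := by
      obtain ⟨R, hR, hRc⟩ := Finset.exists_subset_card_eq (s := Finset.univ.erase j) (n := i)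
        (by simp; omega)
      exact ⟨R, hRc, fun h => Finset.notMem_erase j _ (hR h)⟩
    have h1 : K T =ᶠ[𝓝 z] K (insert j R) := by
      filter_upwards [isOpen_chamber.mem_nhds hz] with z hz
      exact hex z hz _ _ hTc (by rw [Finset.card_insert_of_notMem hRj, hR])
    rw [h1.fderiv_eq, hK.deriv R j hRj z hz, h0 R hR z hz, mul_zero]
  ext v
  have hv : v = ∑ j, v j • (Pi.single j 1 : Fin (n + 1) → ℂ) := by
    funext i
    simp [Finset.sum_apply, Pi.single_apply]
  rw [hv, map_sum]
  simp [hj]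

/-- Climb the levels |S| = i. If level i vanishes, level i + 1 is one constant; it is also
homogeneous of degree i + 2 - |μ|, hence zero unless this degree is 0. The exceptional level is
excluded by assumption, so all levels vanish, and the families are independent. -/
theorem IsRel.eq_zero {μ : Fin (n + 1) → ℝ} (hμ : ∀ j, μ j < 1) {a : Fin n → ℂ}
    (ha : IsRel μ a) (h : ∀ i < n, (i : ℝ) + 1 = totalWeight μ → 1 ≤ i →
      ∑ k, a k * period (cw μ) (initSet n i) k (basePoint n) = 0) : a = 0 := by
  have hsol := IsSol.sum (fun k => isSol_period (cw_re_lt hμ) k) a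
  have key : ∀ i < n, ∀ S : Finset (Fin (n + 1)), S.card = i → ∀ z ∈ chamber n,
      ∑ k, a k * period (cw μ) S k z = 0 := by
    intro i
    induction i with
    | zero =>
      intro _ S hS z hz
      rw [Finset.card_eq_zero.1 hS]
      have h1 := ha z hz
      simp only [baseF_eq_period] at h1
      exact h1
    | succ i ih =>
      intro hi
      have hc := hsol.exists_const_of_zero (ih (by omega)) (by omega)
      by_cases hd : ((i + 1 : ℕ) : ℝ) + 1 = totalWeight μ
      · intro S hS z hz
        have h1 := hc S hS z hz
        rw [h1, h (i + 1) hi hd (by omega)]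
      -- Compare the constant at [n] and at 2[n].
      · set κ := ∑ k, a k * period (cw μ) (initSet n (i + 1)) k (basePoint n) with hκ
        have hκ0 : κ = 0 := by
          have h1 := hc (initSet n (i + 1)) (card_initSet (by omega)) _
            (smul_mem_chamber basePoint_mem_chamber (zero_lt_two (α := ℝ)))
          have h2 : ((2 : ℝ) : ℂ) ^ ((((initSet n (i + 1)).card : ℂ)) + 1 - ∑ j, cw μ j) * κ = κ := by
            rw [hκ]
            conv_rhs => rw [← hκ, ← h1]
            rw [Finset.mul_sum]
            refine Finset.sum_congr rfl fun k _ => ?_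
            rw [period_smul _ _ _ basePoint_mem_chamber (zero_lt_two (α := ℝ))]
            ring
          by_contra hne
          have h3 := mul_right_cancel₀ hne (h2.trans (one_mul κ).symm)
          have h4 : (((initSet n (i + 1)).card : ℂ)) + 1 - ∑ j, cw μ j =
              (((i + 1 : ℕ) + 1 - totalWeight μ : ℝ) : ℂ) := by
            rw [card_initSet (by omega)]
            simp [totalWeight, cw]
          rw [h4, ← Complex.ofReal_cpow zero_le_two, Complex.ofReal_eq_one] at h3
          rw [← Real.rpow_zero 2, Real.rpow_right_inj (by norm_num) (by norm_num)] at h3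
          exact hd (by linarith)
        intro S hS z hz
        exact (hc S hS z hz).trans hκ0
  refine eq_zero_of_vecMul_chartPeriod hμ one_ne_zero (Equiv.refl _) (z := basePoint n)
    (by rw [chart_one_refl]; exact basePoint_mem_chamber) fun i hi => ?_
  simp only [chartPeriod_one_refl]
  exact key i hi _ (card_initSet (by omega)) _ basePoint_mem_chamber

/-- The Lauricella functions satisfy at most one linear relation. -/
theorem IsRel.eq_smul {μ : Fin (n + 1) → ℝ} (hμ : ∀ j, μ j < 1) {a b : Fin n → ℂ}
    (ha : IsRel μ a) (hb : IsRel μ b) (hb0 : b ≠ 0) : ∃ c : ℂ, a = c • b := by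
  let κ : ℕ → (Fin n → ℂ) → ℂ := fun i a => ∑ k, a k * period (cw μ) (initSet n i) k (basePoint n)
  -- At most one level satisfies i + 1 = |μ|, so a relation is determined by the single number κ i;
  -- subtract the multiple of b that makes it vanish.
  by_cases hM : ∃ i < n, (i : ℝ) + 1 = totalWeight μ ∧ κ i b ≠ 0
  · obtain ⟨i, hi, hiM, hκ⟩ := hM
    refine ⟨κ i a / κ i b, sub_eq_zero.1 (IsRel.eq_zero hμ (fun z hz => ?_) fun l hl hlM _ => ?_)⟩
    · have h1 := ha z hz
      have h2 := hb z hz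
      calc _ = ∑ k, a k * baseF μ z k - κ i a / κ i b * ∑ k, b k * baseF μ z k := by
            rw [Finset.mul_sum, ← Finset.sum_sub_distrib]
            exact Finset.sum_congr rfl fun k _ => by simp; ring
        _ = 0 := by rw [h1, h2]; simp
    · have : l = i := by
        have : (l : ℝ) = i := by linarith
        exact_mod_cast this
      subst this
      calc _ = κ l a - κ l a / κ l b * κ l b := by
            simp only [κ]
            rw [Finset.mul_sum, ← Finset.sum_sub_distrib]
            exact Finset.sum_congr rfl fun k _ => by simp; ring
        _ = 0 := by field_simp; simp
  · push Not at hM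
    exact absurd (IsRel.eq_zero hμ hb fun i hi hiM _ => hM i hi hiM) hb0

end Lauricella
end

/-! ### A branch of the integrand on the plane cut along downward rays, and its primitive -/

noncomputable section

namespace Lauricella

open MeasureTheory Filter Set

variable {n : ℕ}

/-- The branch of `∏ (ζ - z_j)^{-μ_j}`, up to a constant, that is holomorphic away from the
vertical rays that go down from the points `z_j`. -/
def upPhi (μ : Fin (n + 1) → ℝ) (z : Fin (n + 1) → ℂ) (ζ : ℂ) : ℂ :=
  ∏ j, (-Complex.I * (ζ - z j)) ^ (-(μ j : ℂ))

/-- The complement of the vertical rays that go down from the points `z_j`. -/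
def upDomain (z : Fin (n + 1) → ℂ) : Set ℂ :=
  {ζ | ∀ j, -Complex.I * (ζ - z j) ∈ Complex.slitPlane}

/-- A primitive of `upPhi`. -/
def upPsi (μ : Fin (n + 1) → ℝ) (z : Fin (n + 1) → ℂ) (ζ : ℂ) : ℂ :=
  -Complex.I * ∫ t in Ioi (0 : ℝ), upPhi μ z (ζ + t * Complex.I)

theorem norm_upPhi (μ : Fin (n + 1) → ℝ) (z : Fin (n + 1) → ℂ) (ζ : ℂ) :
    ‖upPhi μ z ζ‖ = ∏ j, ‖ζ - z j‖ ^ (-μ j) := by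
  rw [upPhi, norm_prod]
  refine Finset.prod_congr rfl fun j _ => ?_
  rw [← Complex.ofReal_neg, Complex.norm_cpow_real, norm_mul, norm_neg, Complex.norm_I, one_mul]

theorem density_eq_norm_upPhi_sq (μ : Fin (n + 1) → ℝ) (z : Fin (n + 1) → ℂ) (ζ : ℂ) :
    density μ z ζ = ‖upPhi μ z ζ‖ ^ 2 := by
  rw [norm_upPhi, density, ← Finset.prod_pow]
  refine Finset.prod_congr rfl fun j _ => ?_
  rw [norm_sub_rev, ← Real.rpow_natCast, ← Real.rpow_mul (norm_nonneg _)]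
  congr 1
  push_cast
  ring

theorem isOpen_upDomain (z : Fin (n + 1) → ℂ) : IsOpen (upDomain z) := by
  simp only [upDomain, ofPred_forall]
  exact isOpen_iInter_of_finite fun j => Complex.isOpen_slitPlane.preimage (by fun_prop)

theorem upDomain_iff {z : Fin (n + 1) → ℂ} {ζ : ℂ} :
    ζ ∈ upDomain z ↔ ∀ j, (z j).im < ζ.im ∨ ζ.re ≠ (z j).re := by
  refine forall_congr' fun j => ?_
  rw [Complex.mem_slitPlane_iff]
  simp [sub_eq_zero, eq_comm]

/-- Moving to the right from a point off the cut never meets 0, and the distance to 0 grows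
linearly; the constant comes from the real part if it is positive, otherwise from the imaginary
part. -/
theorem exists_lower_bound_slitPlane {b : ℂ} (hb : b ∈ Complex.slitPlane) :
    ∃ c > 0, ∀ t : ℝ, 0 ≤ t → c * (1 + t) ≤ ‖b + t‖ := by
  rcases (Complex.mem_slitPlane_iff.1 hb) with h | h
  · refine ⟨min b.re 1, lt_min h one_pos, fun t ht => ?_⟩
    have h1 := Complex.re_le_norm (b + t)
    have h2 := min_le_left b.re 1
    have h3 := mul_le_mul_of_nonneg_right (min_le_right b.re 1) ht
    simp at h1
    linarith
  · have h0 : 0 < |b.im| := abs_pos.2 h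
    set A := (1 + |b.re|) / |b.im| with hA
    have hA0 : 0 < 1 + A := by positivity
    refine ⟨(1 + A)⁻¹, inv_pos.2 hA0, fun t ht => ?_⟩
    rw [inv_mul_le_iff₀ hA0]
    have h1 : |b.im| ≤ ‖b + t‖ := by simpa using Complex.abs_im_le_norm (b + t)
    have h2 : b.re + t ≤ ‖b + t‖ := by simpa using Complex.re_le_norm (b + t)
    have h3 : 1 + |b.re| ≤ A * ‖b + t‖ := by
      calc 1 + |b.re| = A * |b.im| := by rw [hA]; field_simp
        _ ≤ _ := mul_le_mul_of_nonneg_left h1 (by positivity)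
    have := neg_abs_le b.re
    linarith

/-- Going up by t adds t to each base -i(ζ - z_j), which moves it away from the cut. The bound is
uniform for ζ' near ζ, as needed to differentiate under the integral. -/
theorem exists_ball_upDomain {z : Fin (n + 1) → ℂ} {ζ : ℂ} (hζ : ζ ∈ upDomain z) :
    ∃ r > 0, ∃ c > 0, ∀ ζ' ∈ Metric.ball ζ r, ∀ t : ℝ, 0 ≤ t →
      ζ' + t * Complex.I ∈ upDomain z ∧ ∀ j, c * (1 + t) ≤ ‖ζ' + t * Complex.I - z j‖ := by
  have hshift : ∀ (ζ' : ℂ) (t : ℝ) j, -Complex.I * (ζ' + t * Complex.I - z j) =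
      -Complex.I * (ζ' - z j) + t := fun ζ' t j => by
    linear_combination (-t : ℂ) * Complex.I_sq
  obtain ⟨r, hr, hball⟩ := Metric.isOpen_iff.1 (isOpen_upDomain z) ζ hζ
  choose c hc hcb using fun j => exists_lower_bound_slitPlane (hζ j)
  obtain ⟨c₀, hc₀, hcc⟩ : ∃ c₀ > 0, ∀ j, c₀ ≤ c j :=
    ⟨Finset.univ.inf' Finset.univ_nonempty c, (Finset.lt_inf'_iff _).2 fun j _ => hc j,
      fun j => Finset.inf'_le _ (Finset.mem_univ j)⟩
  refine ⟨min r (c₀ / 2), by positivity, c₀ / 2, by positivity, fun ζ' hζ' t ht => ⟨?_, fun j => ?_⟩⟩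
  · have h1 := hball (Metric.ball_subset_ball (min_le_left _ _) hζ')
    intro j
    rw [hshift, Complex.mem_slitPlane_iff]
    rcases Complex.mem_slitPlane_iff.1 (h1 j) with h | h
    · left; rw [Complex.add_re, Complex.ofReal_re]; linarith
    · right; simpa using h
  · have h1 := hcb j t ht
    rw [← hshift] at h1
    have h2 : ‖ζ' - ζ‖ < c₀ / 2 := by
      rw [← dist_eq_norm]; exact (Metric.mem_ball.1 hζ').trans_le (min_le_right _ _)
    have h3 : ‖ζ + t * Complex.I - z j‖ ≤ ‖ζ' + t * Complex.I - z j‖ + ‖ζ' - ζ‖ := by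
      have : ζ + t * Complex.I - z j = (ζ' + t * Complex.I - z j) - (ζ' - ζ) := by ring
      rw [this]; exact norm_sub_le _ _
    rw [norm_mul, norm_neg, Complex.norm_I, one_mul] at h1
    have h4 := mul_le_mul_of_nonneg_right (hcc j) (by linarith : 0 ≤ 1 + t)
    have h5 : c₀ / 2 ≤ c₀ / 2 * (1 + t) := by nlinarith
    linarith

theorem differentiableAt_upPhi (μ : Fin (n + 1) → ℝ) {z : Fin (n + 1) → ℂ} {ζ : ℂ}
    (hζ : ζ ∈ upDomain z) : DifferentiableAt ℂ (upPhi μ z) ζ := by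
  unfold upPhi
  refine DifferentiableAt.fun_finsetProd fun j _ => ?_
  refine DifferentiableAt.cpow_const (by fun_prop) (hζ j)

theorem upPhi_le_of_lower_bound {μ : Fin (n + 1) → ℝ} (hμ : ∀ j, 0 < μ j) {z : Fin (n + 1) → ℂ}
    {ζ : ℂ} {d : ℝ} (hd : 0 < d) (h : ∀ j, d ≤ ‖ζ - z j‖) :
    ‖upPhi μ z ζ‖ ≤ d ^ (-totalWeight μ) := by
  rw [norm_upPhi, totalWeight, ← Finset.sum_neg_distrib, Real.rpow_sum_of_pos hd]
  exact Finset.prod_le_prod (fun j _ => by positivity) fun j _ =>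
    Real.rpow_le_rpow_of_nonpos hd (h j) (by linarith [hμ j])

theorem exists_far_bound {μ : Fin (n + 1) → ℝ} (hμ : ∀ j, 0 < μ j) (z : Fin (n + 1) → ℂ) :
    ∃ C ≥ 0, ∃ R ≥ 1, ∀ ζ : ℂ, R ≤ ‖ζ‖ → ‖upPhi μ z ζ‖ ≤ C * ‖ζ‖ ^ (-totalWeight μ) := by
  refine ⟨2 ^ totalWeight μ, by positivity, 2 * ∑ j, ‖z j‖ + 1, ?_, fun ζ hζ => ?_⟩
  · have : 0 ≤ ∑ j, ‖z j‖ := Finset.sum_nonneg fun _ _ => norm_nonneg _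
    linarith
  · have h0 : 0 ≤ ∑ j, ‖z j‖ := Finset.sum_nonneg fun _ _ => norm_nonneg _
    have h1 : 0 < ‖ζ‖ := by linarith
    have h2 := upPhi_le_of_lower_bound hμ (z := z) (ζ := ζ) (d := ‖ζ‖ / 2) (by positivity)
      fun j => by
        have := Finset.single_le_sum (f := fun j => ‖z j‖) (fun _ _ => norm_nonneg _)
          (Finset.mem_univ j)
        have h3 := norm_sub_norm_le ζ (z j)
        linarith
    refine h2.trans_eq ?_
    rw [div_eq_mul_inv, Real.mul_rpow h1.le (by norm_num), Real.inv_rpow zero_le_two,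
      ← Real.rpow_neg zero_le_two, neg_neg, mul_comm]

/-- A bound for `upPhi` far to the left and far to the right. -/
theorem exists_side_bound {μ : Fin (n + 1) → ℝ} (hμ : ∀ j, 0 < μ j) (hM : 1 < totalWeight μ)
    (z : Fin (n + 1) → ℂ) : ∃ C ≥ 0, ∃ R ≥ 1, ∃ a > (0 : ℝ), ∀ ζ : ℂ, R ≤ |ζ.re| →
      ‖upPhi μ z ζ‖ ≤ C * |ζ.re| ^ (-a) * (1 + ‖ζ.im‖) ^ (-(1 + a)) := by
  obtain ⟨C, hC, R, hR, h⟩ := exists_far_bound hμ z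
  -- Split |μ| = a + (1 + a): the part a gives decay in the real part, and 1 + a leaves
  -- integrability in the vertical direction.
  set a := (totalWeight μ - 1) / 2 with ha
  have ha0 : 0 < a := by linarith
  refine ⟨C * 2 ^ (1 + a), by positivity, R, hR, a, ha0, fun ζ hζ => ?_⟩
  have h1 : |ζ.re| ≤ ‖ζ‖ := Complex.abs_re_le_norm ζ
  have h2 : |ζ.im| ≤ ‖ζ‖ := Complex.abs_im_le_norm ζ
  have hx : 0 < |ζ.re| := by linarith
  have h3 : (1 + ‖ζ.im‖) / 2 ≤ ‖ζ‖ := by rw [Real.norm_eq_abs]; linarith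
  have hpos : 0 < ‖ζ‖ := by linarith
  refine (h ζ (hζ.trans h1)).trans ?_
  have h4 : -totalWeight μ = -a + -(1 + a) := by rw [ha]; ring
  rw [h4, Real.rpow_add hpos]
  have h5 : ‖ζ‖ ^ (-a) ≤ |ζ.re| ^ (-a) := Real.rpow_le_rpow_of_nonpos hx h1 (by linarith)
  have h6 : ‖ζ‖ ^ (-(1 + a)) ≤ 2 ^ (1 + a) * (1 + ‖ζ.im‖) ^ (-(1 + a)) := by
    refine (Real.rpow_le_rpow_of_nonpos (by positivity) h3 (by linarith)).trans_eq ?_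
    rw [div_eq_mul_inv, Real.mul_rpow (by positivity) (by norm_num), Real.inv_rpow zero_le_two,
      ← Real.rpow_neg zero_le_two, neg_neg, mul_comm]
  calc C * (‖ζ‖ ^ (-a) * ‖ζ‖ ^ (-(1 + a)))
      ≤ C * (|ζ.re| ^ (-a) * (2 ^ (1 + a) * (1 + ‖ζ.im‖) ^ (-(1 + a)))) := by gcongr
    _ = _ := by ring

theorem integrable_one_add_norm_real {a : ℝ} (ha : 1 < a) :
    Integrable fun t : ℝ => (1 + ‖t‖) ^ (-a) :=
  integrable_one_add_norm (by simpa using ha)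

section

variable {μ : Fin (n + 1) → ℝ} {z : Fin (n + 1) → ℂ}

theorem vertical_mem_upDomain {ζ : ℂ} (hζ : ζ ∈ upDomain z) {t : ℝ} (ht : 0 ≤ t) :
    ζ + t * Complex.I ∈ upDomain z := by
  obtain ⟨r, hr, c, hc, h⟩ := exists_ball_upDomain hζ
  exact (h ζ (Metric.mem_ball_self hr) t ht).1

theorem hasDerivAt_vertical {ζ : ℂ} (hζ : ζ ∈ upDomain z) {t : ℝ} (ht : 0 ≤ t) :
    HasDerivAt (fun t : ℝ => upPhi μ z (ζ + t * Complex.I))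
      (deriv (upPhi μ z) (ζ + t * Complex.I) * Complex.I) t := by
  have h1 := (differentiableAt_upPhi μ (vertical_mem_upDomain hζ ht)).hasDerivAt
  have h2 : HasDerivAt (fun t : ℝ => ζ + t * Complex.I) (1 * Complex.I) t :=
    (((hasDerivAt_id (t : ℂ)).comp_ofReal).mul_const Complex.I).const_add ζ
  have h3 := HasDerivAt.comp_of_eq t h1 h2 rfl
  rw [one_mul] at h3
  exact h3

/-- Differentiate under the integral and use the fundamental theorem along the vertical ray. The
integral converges and the value at infinity is 0 because |μ| > 1. -/
theorem hasDerivAt_upPsi (hμ : ∀ j, 0 < μ j) (hM : 1 < totalWeight μ) {ζ : ℂ}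
    (hζ : ζ ∈ upDomain z) : HasDerivAt (upPsi μ z) (upPhi μ z ζ) ζ := by
  obtain ⟨r, hr, c, hc, h⟩ := exists_ball_upDomain hζ
  have hbd : ∀ ζ' ∈ Metric.ball ζ r, ∀ t : ℝ, 0 < t →
      ‖upPhi μ z (ζ' + t * Complex.I)‖ ≤ c ^ (-totalWeight μ) * (1 + ‖t‖) ^ (-totalWeight μ) := by
    intro ζ' hζ' t ht
    rw [← Real.mul_rpow hc.le (by positivity), Real.norm_of_nonneg ht.le]
    exact upPhi_le_of_lower_bound hμ (by positivity) (h ζ' hζ' t ht.le).2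
  have hI := (integrable_one_add_norm_real hM).const_mul (c ^ (-totalWeight μ))
  have hmeas : ∀ s ∈ Metric.ball ζ r, AEStronglyMeasurable
      (fun t : ℝ => upPhi μ z (s + t * Complex.I)) (volume.restrict (Ioi (0 : ℝ))) := by
    intro s hs
    refine ContinuousOn.aestronglyMeasurable (fun t ht => ?_) measurableSet_Ioi
    have hs' : s ∈ upDomain z := by simpa using (h s hs 0 le_rfl).1
    exact (hasDerivAt_vertical hs' (le_of_lt ht)).continuousAt.continuousWithinAt
  have hd : ∀ᵐ t : ℝ ∂(volume.restrict (Ioi (0 : ℝ))),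
      DifferentiableOn ℂ (fun s => upPhi μ z (s + t * Complex.I)) (Metric.ball ζ r) := by
    filter_upwards [ae_restrict_mem measurableSet_Ioi] with t ht
    intro s hs
    have := (differentiableAt_upPhi μ (h s hs t (le_of_lt ht)).1)
    exact (differentiableAt_comp_add_const.2 this).differentiableWithinAt
  have hle : ∀ᵐ t : ℝ ∂(volume.restrict (Ioi (0 : ℝ))), ∀ s ∈ Metric.ball ζ r,
      ‖upPhi μ z (s + t * Complex.I)‖ ≤
        c ^ (-totalWeight μ) * (1 + ‖t‖) ^ (-totalWeight μ) := by
    filter_upwards [ae_restrict_mem measurableSet_Ioi] with t ht s hs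
    exact hbd s hs t ht
  obtain ⟨h1, h2⟩ := hasDerivAt_integral_of_holomorphic hr hI.integrableOn hmeas hd hle
  have h3 : ∫ t in Ioi (0 : ℝ), deriv (upPhi μ z) (ζ + t * Complex.I) * Complex.I =
      0 - upPhi μ z (ζ + (0 : ℝ) * Complex.I) := by
    refine integral_Ioi_of_hasDerivAt_of_tendsto
      (f := fun t : ℝ => upPhi μ z (ζ + t * Complex.I))
      (hasDerivAt_vertical hζ le_rfl).continuousAt.continuousWithinAt
      (fun t ht => hasDerivAt_vertical hζ (le_of_lt ht)) ?_ ?_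
    · have := h1.mul_const Complex.I
      simp only [deriv_comp_add_const] at this
      exact this
    · rw [tendsto_zero_iff_norm_tendsto_zero]
      refine squeeze_zero' (Eventually.of_forall fun _ => norm_nonneg _)
        ((eventually_gt_atTop 0).mono fun t ht => hbd ζ (Metric.mem_ball_self hr) t ht) ?_
      have : Tendsto (fun t : ℝ => 1 + ‖t‖) atTop atTop :=
        tendsto_atTop_add_const_left _ _ tendsto_norm_atTop_atTop
      have h4 := (tendsto_rpow_neg_atTop (by linarith : 0 < totalWeight μ)).comp this
      simpa using h4.const_mul (c ^ (-totalWeight μ))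
  have h5 := h2.const_mul (-Complex.I)
  refine h5.congr_deriv ?_
  rw [integral_mul_const] at h3
  simp only [deriv_comp_add_const]
  simp only [Complex.ofReal_zero, zero_mul, add_zero] at h3
  linear_combination (-1 : ℂ) * h3

theorem exists_side_bound_upPsi (hμ : ∀ j, 0 < μ j) (hM : 1 < totalWeight μ)
    (z : Fin (n + 1) → ℂ) : ∃ C ≥ 0, ∃ R ≥ 1, ∃ a > (0 : ℝ), ∀ ζ : ℂ, R ≤ |ζ.re| →
      ‖upPsi μ z ζ‖ ≤ C * |ζ.re| ^ (-a) := by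
  obtain ⟨C, hC, R, hR, a, ha, h⟩ := exists_side_bound hμ hM z
  have hI := integrable_one_add_norm_real (a := 1 + a) (by linarith)
  set J := ∫ t : ℝ, (1 + ‖t‖) ^ (-(1 + a)) with hJ
  have hJ0 : 0 ≤ J := integral_nonneg fun t => by positivity
  refine ⟨C * J, by positivity, R, hR, a, ha, fun ζ hζ => ?_⟩
  rw [upPsi, norm_mul, norm_neg, Complex.norm_I, one_mul]
  have hI2 : Integrable fun t : ℝ => (1 + ‖ζ.im + t‖) ^ (-(1 + a)) := hI.comp_add_left ζ.im
  calc ‖∫ t in Ioi (0 : ℝ), upPhi μ z (ζ + t * Complex.I)‖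
      ≤ ∫ t in Ioi (0 : ℝ), C * |ζ.re| ^ (-a) * (1 + ‖ζ.im + t‖) ^ (-(1 + a)) := by
        refine norm_integral_le_of_norm_le (hI2.const_mul _).integrableOn
          (Eventually.of_forall fun t => ?_)
        have := h (ζ + t * Complex.I) (by simpa using hζ)
        simpa using this
    _ ≤ ∫ t : ℝ, C * |ζ.re| ^ (-a) * (1 + ‖ζ.im + t‖) ^ (-(1 + a)) :=
        setIntegral_le_integral (hI2.const_mul _) (Eventually.of_forall fun t => by positivity)
    _ = C * J * |ζ.re| ^ (-a) := by
        rw [integral_const_mul, integral_add_left_eq_self (fun t : ℝ => (1 + ‖t‖) ^ (-(1 + a)))]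
        ring

end

end Lauricella
end

/-! ### An integrable majorant in the real part, and the polygon through the vertices -/

noncomputable section

namespace Lauricella

open MeasureTheory Filter Set

variable {n : ℕ}

theorem integrable_abs_rpow_mul {p M : ℝ} (hp0 : 0 < p) (hp1 : p < 1) (hM : 1 < M) :
    Integrable fun t : ℝ => |t| ^ (-p) * (1 + |t|) ^ (-(M - p)) := by
  set f : ℝ → ℝ := fun t => |t| ^ (-p) * (1 + |t|) ^ (-(M - p)) with hf
  have hmeas : Measurable f := by fun_prop
  have h1 : IntegrableOn f (Ioc 0 1) := by
    have h := (intervalIntegrable_iff_integrableOn_Ioc_of_le zero_le_one).1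
      (intervalIntegral.intervalIntegrable_rpow' (a := 0) (b := 1) (by linarith : -1 < -p))
    refine h.mono' hmeas.aestronglyMeasurable ?_
    filter_upwards [ae_restrict_mem measurableSet_Ioc] with t ht
    have h2 : (1 + |t|) ^ (-(M - p)) ≤ 1 :=
      Real.rpow_le_one_of_one_le_of_nonpos (by linarith [abs_nonneg t]) (by linarith)
    rw [Real.norm_of_nonneg (by positivity)]
    calc f t ≤ |t| ^ (-p) * 1 := mul_le_mul_of_nonneg_left h2 (by positivity)
      _ = t ^ (-p) := by rw [abs_of_pos ht.1, mul_one]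
  have h2 : IntegrableOn f (Ioi 1) := by
    refine (integrableOn_Ioi_rpow_of_lt (a := -M) (by linarith) one_pos).mono'
      hmeas.aestronglyMeasurable ?_
    filter_upwards [ae_restrict_mem measurableSet_Ioi] with t ht
    have ht0 : (0 : ℝ) < t := lt_trans one_pos ht
    rw [Real.norm_of_nonneg (by positivity)]
    have h3 : (1 + |t|) ^ (-(M - p)) ≤ t ^ (-(M - p)) :=
      Real.rpow_le_rpow_of_nonpos ht0 (by rw [abs_of_pos ht0]; linarith) (by linarith)
    calc f t ≤ |t| ^ (-p) * t ^ (-(M - p)) := mul_le_mul_of_nonneg_left h3 (by positivity)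
      _ = t ^ (-M) := by rw [abs_of_pos ht0, ← Real.rpow_add ht0]; ring_nf
  have h3 : IntegrableOn f (Ioi 0) := by
    rw [← Ioc_union_Ioi_eq_Ioi zero_le_one]
    exact h1.union h2
  have h4 : IntegrableOn f (Iic 0) := by
    have h5 := (integrableOn_Ici_iff_integrableOn_Ioi).2 h3
    have h6 := (integrable_indicator_iff measurableSet_Ici).2 h5
    have h7 := h6.comp_neg
    rw [← integrable_indicator_iff measurableSet_Iic]
    refine h7.congr (Eventually.of_forall fun t => ?_)
    beta_reduce
    by_cases ht : t ≤ 0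
    · rw [indicator_of_mem (show -t ∈ Ici (0 : ℝ) from neg_nonneg.2 ht),
        indicator_of_mem (show t ∈ Iic (0 : ℝ) from ht)]
      simp [hf]
    · rw [indicator_of_notMem (show -t ∉ Ici (0 : ℝ) by simpa using ht),
        indicator_of_notMem (show t ∉ Iic (0 : ℝ) from ht)]
  rw [← integrableOn_univ, ← Iic_union_Ioi (a := (0 : ℝ))]
  exact h4.union h3

/-- A bound for `upPhi` in terms of the real part. -/
def rho (μ : Fin (n + 1) → ℝ) (z : Fin (n + 1) → ℂ) (x : ℝ) : ℝ :=
  ∏ j, |x - (z j).re| ^ (-μ j)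

theorem rho_nonneg (μ : Fin (n + 1) → ℝ) (z : Fin (n + 1) → ℂ) (x : ℝ) : 0 ≤ rho μ z x :=
  Finset.prod_nonneg fun _ _ => by positivity

theorem norm_upPhi_le_rho {μ : Fin (n + 1) → ℝ} (hμ : ∀ j, 0 < μ j) {z : Fin (n + 1) → ℂ} {ζ : ℂ}
    (hζ : ∀ j, ζ.re ≠ (z j).re) : ‖upPhi μ z ζ‖ ≤ rho μ z ζ.re := by
  rw [norm_upPhi]
  refine Finset.prod_le_prod (fun _ _ => by positivity) fun j _ => ?_
  refine Real.rpow_le_rpow_of_nonpos (abs_pos.2 (sub_ne_zero.2 (hζ j))) ?_ (by linarith [hμ j])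
  simpa using Complex.abs_re_le_norm (ζ - z j)

/-- Near the abscissa of z_j only one factor is singular, with exponent μ_j < 1; at infinity the
decay is that of |x|^(-|μ|) with |μ| > 1. -/
theorem integrable_rho {μ : Fin (n + 1) → ℝ} (hμ : ∀ j, μ j ∈ Ioo (0 : ℝ) 1)
    (hM : 1 < totalWeight μ) {z : Fin (n + 1) → ℂ} (hz : z ∈ chamber n) :
    Integrable (rho μ z) := by
  obtain ⟨δ, hδ, hδ1, hgap⟩ : ∃ δ > 0, δ ≤ 1 ∧
      ∀ i j, i ≠ j → 2 * δ ≤ |(z i).re - (z j).re| := by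
    have h1 : ∀ p : Fin (n + 1) × Fin (n + 1), ∀ᶠ δ in 𝓝[>] (0 : ℝ),
        p.1 ≠ p.2 → 2 * δ ≤ |(z p.1).re - (z p.2).re| := by
      intro p
      by_cases hp : p.1 = p.2
      · exact Eventually.of_forall fun δ h => absurd hp h
      have hpos : 0 < |(z p.1).re - (z p.2).re| := by
        refine abs_pos.2 (sub_ne_zero.2 fun h => ?_)
        rcases lt_or_gt_of_ne hp with h' | h'
        · exact (hz _ _ h').ne h
        · exact (hz _ _ h').ne' h
      filter_upwards [Ioo_mem_nhdsGT (half_pos hpos)] with δ hδ _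
      linarith [hδ.2]
    have h2 : ∀ᶠ δ in 𝓝[>] (0 : ℝ), δ ∈ Ioo (0 : ℝ) 1 := Ioo_mem_nhdsGT zero_lt_one
    obtain ⟨δ, hδ, hδ0, hδ1⟩ := ((eventually_all.2 h1).and h2).exists
    exact ⟨δ, hδ0, hδ1.le, fun i j hij => hδ (i, j) hij⟩
  set M := totalWeight μ
  let g : Fin (n + 1) → ℝ → ℝ := fun j t => |t| ^ (-μ j) * (1 + |t|) ^ (-(M - μ j))
  have hg : ∀ j, Integrable (g j) := fun j => integrable_abs_rpow_mul (hμ j).1 (hμ j).2 hM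
  have hG : Integrable fun x => ∑ j, (δ / 2) ^ (-(M - μ j)) * g j (x - (z j).re) :=
    integrable_finsetSum _ fun j _ => ((hg j).comp_sub_right (z j).re).const_mul _
  have hmeas : Measurable (rho μ z) := by unfold rho; fun_prop
  refine hG.mono' hmeas.aestronglyMeasurable (Eventually.of_forall fun x => ?_)
  rw [Real.norm_of_nonneg (rho_nonneg μ z x)]
  -- With j the index of the nearest abscissa, all the others are at distance at least δ/2 (1 + |x -
  -- Re z_j|). So the product is dominated by the model function centred at z_j, and summing over j
  -- removes the dependence on x.
  obtain ⟨j, -, hj⟩ := Finset.exists_min_image Finset.univ (fun j => |x - (z j).re|)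
    Finset.univ_nonempty
  have hfar : ∀ i, i ≠ j → δ / 2 * (1 + |x - (z j).re|) ≤ |x - (z i).re| := by
    intro i hij
    have h1 := hj i (Finset.mem_univ i)
    have h2 := hgap i j hij
    have h3 : |(z i).re - (z j).re| ≤ |x - (z i).re| + |x - (z j).re| := by
      have : (z i).re - (z j).re = (x - (z j).re) - (x - (z i).re) := by ring
      rw [this, add_comm]; exact abs_sub _ _
    have h4 : δ ≤ |x - (z i).re| := by linarith
    have h5 : δ * |x - (z j).re| ≤ |x - (z i).re| :=
      (mul_le_of_le_one_left (abs_nonneg _) hδ1).trans h1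
    linarith
  have hpos : 0 < δ / 2 * (1 + |x - (z j).re|) := by positivity
  have hexp : -(M - μ j) = ∑ i ∈ Finset.univ.erase j, -μ i := by
    have := Finset.add_sum_erase Finset.univ μ (Finset.mem_univ j)
    rw [Finset.sum_neg_distrib]
    simp only [M, totalWeight]
    linarith
  have hle : rho μ z x ≤ (δ / 2) ^ (-(M - μ j)) * g j (x - (z j).re) := by
    unfold rho
    rw [← Finset.mul_prod_erase _ _ (Finset.mem_univ j)]
    have h1 : ∏ i ∈ Finset.univ.erase j, |x - (z i).re| ^ (-μ i) ≤
        (δ / 2 * (1 + |x - (z j).re|)) ^ (-(M - μ j)) := by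
      rw [hexp, Real.rpow_sum_of_pos hpos]
      refine Finset.prod_le_prod (fun _ _ => by positivity) fun i hi => ?_
      exact Real.rpow_le_rpow_of_nonpos hpos (hfar i (Finset.ne_of_mem_erase hi))
        (by linarith [(hμ i).1])
    refine (mul_le_mul_of_nonneg_left h1 (by positivity)).trans_eq ?_
    rw [Real.mul_rpow (by positivity) (by positivity)]
    simp only [g]
    ring
  exact hle.trans (Finset.single_le_sum
    (f := fun j => (δ / 2) ^ (-(M - μ j)) * g j (x - (z j).re))
    (fun i _ => by simp only [g]; positivity) (Finset.mem_univ j))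

/-- The part of `[a, b]` to the left of `x`, as a length. -/
def ramp (a b x : ℝ) : ℝ := max a (min x b) - a

/-- The slope of the segment from `z_k` to `z_{k+1}`. -/
def slope (z : Fin (n + 1) → ℂ) (k : Fin n) : ℝ :=
  (z k.succ - z k.castSucc).im / (z k.succ - z k.castSucc).re

/-- The piecewise linear function whose graph is the polygon with vertices `z_0, …, z_n`, continued
horizontally. -/
def height (z : Fin (n + 1) → ℂ) (x : ℝ) : ℝ :=
  (z 0).im + ∑ k : Fin n, slope z k * ramp (z k.castSucc).re (z k.succ).re x

theorem continuous_height (z : Fin (n + 1) → ℂ) : Continuous (height z) := by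
  unfold height ramp; fun_prop

/-- The only break points are a and b. The slope is 0 or 1, which bounds all slopes of `height` by
the sum of the |slope z k|. -/
theorem ramp_affine {a b c d : ℝ} (hab : a ≤ b) (ha : a ∉ Ioo c d) (hb : b ∉ Ioo c d) :
    ∃ m, 0 ≤ m ∧ m ≤ 1 ∧ ∀ x ∈ Icc c d, ramp a b x = ramp a b c + m * (x - c) := by
  unfold ramp
  rcases le_total d c with hcd | hcd
  · refine ⟨0, le_rfl, zero_le_one, fun x hx => ?_⟩
    have : x = c := le_antisymm (hx.2.trans hcd) hx.1
    subst this; ring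
  have ha' : a ≤ c ∨ d ≤ a := by by_contra! h; exact ha h
  have hb' : b ≤ c ∨ d ≤ b := by by_contra! h; exact hb h
  rcases ha' with ha | ha
  · rcases hb' with hb | hb
    · refine ⟨0, le_rfl, zero_le_one, fun x hx => ?_⟩
      rw [min_eq_right (hb.trans hx.1), min_eq_right hb]; ring
    · refine ⟨1, zero_le_one, le_rfl, fun x hx => ?_⟩
      rw [min_eq_left (hx.2.trans hb), min_eq_left (hcd.trans hb), max_eq_right (ha.trans hx.1),
        max_eq_right ha]; ring
  · refine ⟨0, le_rfl, zero_le_one, fun x hx => ?_⟩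
    have h1 : x ≤ b := hx.2.trans (ha.trans hab)
    rw [min_eq_left h1, min_eq_left (hcd.trans (ha.trans hab)), max_eq_left (hx.2.trans ha),
      max_eq_left (hcd.trans ha)]; ring

theorem height_affine {z : Fin (n + 1) → ℂ} (hz : z ∈ chamber n) {c d : ℝ}
    (h : ∀ j, (z j).re ∉ Ioo c d) :
    ∃ m, |m| ≤ ∑ k, |slope z k| ∧ ∀ x ∈ Icc c d, height z x = height z c + m * (x - c) := by
  choose m hm0 hm1 hm using fun k : Fin n => ramp_affine
    (hz k.castSucc k.succ (Fin.castSucc_lt_succ (i := k))).le (h k.castSucc) (h k.succ)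
  refine ⟨∑ k, slope z k * m k, ?_, fun x hx => ?_⟩
  · refine (Finset.abs_sum_le_sum_abs _ _).trans (Finset.sum_le_sum fun k _ => ?_)
    rw [abs_mul]
    exact mul_le_of_le_one_right (abs_nonneg _) (by rw [abs_of_nonneg (hm0 k)]; exact hm1 k)
  · unfold height
    rw [add_assoc, Finset.sum_mul, ← Finset.sum_add_distrib]
    congr 1
    exact Finset.sum_congr rfl fun k _ => by rw [hm k x hx]; ring

theorem exists_abs_height_le {z : Fin (n + 1) → ℂ} (hz : z ∈ chamber n) :
    ∃ B, ∀ x, |height z x| ≤ B := by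
  refine ⟨|(z 0).im| + ∑ k, |slope z k| * ((z k.succ).re - (z k.castSucc).re), fun x => ?_⟩
  refine (abs_add_le _ _).trans (add_le_add_right ?_ _)
  refine (Finset.abs_sum_le_sum_abs _ _).trans (Finset.sum_le_sum fun k _ => ?_)
  rw [abs_mul]
  refine mul_le_mul_of_nonneg_left ?_ (abs_nonneg _)
  have h1 := (hz k.castSucc k.succ (Fin.castSucc_lt_succ (i := k))).le
  unfold ramp
  rw [abs_of_nonneg (sub_nonneg.2 (le_max_left _ _))]
  exact sub_le_sub_right (max_le h1 (min_le_right _ _)) _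

theorem height_eq_of_mem {z : Fin (n + 1) → ℂ} (hz : z ∈ chamber n) (k : Fin n) {x : ℝ}
    (hx : x ∈ Icc (z k.castSucc).re (z k.succ).re) :
    height z x = height z (z k.castSucc).re + slope z k * (x - (z k.castSucc).re) := by
  unfold height
  rw [add_assoc, ← Finset.add_sum_erase _ _ (Finset.mem_univ k),
    ← Finset.add_sum_erase _ _ (Finset.mem_univ k)]
  have h1 : ∀ j ∈ Finset.univ.erase k,
      slope z j * ramp (z j.castSucc).re (z j.succ).re x =
        slope z j * ramp (z j.castSucc).re (z j.succ).re (z k.castSucc).re := by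
    intro j hj
    congr 1
    unfold ramp
    rcases lt_or_gt_of_ne (Finset.ne_of_mem_erase hj) with h | h
    · have h2 : (z j.succ).re ≤ (z k.castSucc).re := chamber_le_re hz (by
        rw [Fin.le_def]; simpa using h)
      rw [min_eq_right (h2.trans hx.1), min_eq_right h2]
    · have h2 : (z k.succ).re ≤ (z j.castSucc).re := chamber_le_re hz (by
        rw [Fin.le_def]; simpa using h)
      have h3 := (hz j.castSucc j.succ (Fin.castSucc_lt_succ (i := j))).le
      have h4 := (hz k.castSucc k.succ (Fin.castSucc_lt_succ (i := k))).le
      rw [min_eq_left (hx.2.trans (h2.trans h3)), min_eq_left (h4.trans (h2.trans h3)),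
        max_eq_left (hx.2.trans h2), max_eq_left (h4.trans h2)]
  rw [Finset.sum_congr rfl h1]
  unfold ramp
  rw [min_eq_left hx.2, max_eq_right hx.1, min_eq_left (hx.1.trans hx.2), max_self]
  ring

theorem height_re {z : Fin (n + 1) → ℂ} (hz : z ∈ chamber n) (j : Fin (n + 1)) :
    height z (z j).re = (z j).im := by
  induction j using Fin.induction with
  | zero =>
    unfold height
    rw [Finset.sum_eq_zero, add_zero]
    intro k _
    have h1 : (z 0).re ≤ (z k.castSucc).re := chamber_le_re hz (Fin.zero_le _)
    unfold ramp
    rw [max_eq_left ((min_le_left _ _).trans h1), sub_self, mul_zero]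
  | succ k ih =>
    have h1 := hz k.castSucc k.succ (Fin.castSucc_lt_succ (i := k))
    rw [height_eq_of_mem hz k ⟨h1.le, le_rfl⟩, ih, slope]
    simp only [Complex.sub_im, Complex.sub_re]
    rw [div_mul_cancel₀ _ (sub_pos.2 h1).ne']
    ring

/-- Conjugation reflects the polygon, so the region below it is the region above the polygon of the
conjugate configuration. -/
theorem height_conj (z : Fin (n + 1) → ℂ) (x : ℝ) :
    height (fun j => conj (z j)) x = -height z x := by
  simp only [height, slope, Complex.conj_im, Complex.conj_re, Complex.sub_im, Complex.sub_re,
    neg_add, ← Finset.sum_neg_distrib]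
  congr 1
  refine Finset.sum_congr rfl fun k _ => ?_
  ring

theorem conj_mem_chamber {z : Fin (n + 1) → ℂ} (hz : z ∈ chamber n) :
    (fun j => conj (z j)) ∈ chamber n := fun i j hij => by simpa using hz i j hij

/-- A function that is constant between the points of a finite set, and up to these points, is
constant. -/
theorem eq_of_eq_on_gaps {E : Type*} {J : ℝ → E} (s : Finset ℝ)
    (h : ∀ a b, a ≤ b → (∀ x ∈ s, x ∉ Ioo a b) → J a = J b) {a b : ℝ} (hab : a ≤ b) :
    J a = J b := by
  induction hd : (s.filter (· ∈ Ioo a b)).card using Nat.strong_induction_on generalizing a b with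
  | _ d ih =>
    rcases (s.filter (· ∈ Ioo a b)).eq_empty_or_nonempty with h0 | ⟨c, hc⟩
    · exact h a b hab fun x hx hx' => by
        have : x ∈ s.filter (· ∈ Ioo a b) := Finset.mem_filter.2 ⟨hx, hx'⟩
        rw [h0] at this
        exact Finset.notMem_empty x this
    · have hc' := (Finset.mem_filter.1 hc).2
      have h1 : ∀ a' b', a ≤ a' → b' ≤ b → c ∉ Ioo a' b' →
          (s.filter (· ∈ Ioo a' b')).card < d := by
        intro a' b' ha hb hcc
        rw [← hd]
        refine Finset.card_lt_card (Finset.ssubset_iff_of_subset (fun x hx => ?_) |>.2 ⟨c, hc, ?_⟩)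
        · rw [Finset.mem_filter] at hx ⊢
          exact ⟨hx.1, lt_of_le_of_lt ha hx.2.1, lt_of_lt_of_le hx.2.2 hb⟩
        · intro h; exact hcc (Finset.mem_filter.1 h).2
      exact (ih _ (h1 a c le_rfl hc'.2.le fun h => lt_irrefl _ h.2) hc'.1.le rfl).trans
        (ih _ (h1 c b hc'.1.le le_rfl fun h => lt_irrefl _ h.1) hc'.2.le rfl)

end Lauricella
end

/-! ### Integrals of the branch along the polygon and its vertical translates -/

noncomputable section

namespace Lauricella

open MeasureTheory Filter Set

variable {n : ℕ}

/-- The point above `x` at distance `t` from the polygon. -/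
def lev (z : Fin (n + 1) → ℂ) (t x : ℝ) : ℂ := (x : ℂ) + ((height z x + t : ℝ) : ℂ) * Complex.I

@[simp] theorem lev_re (z : Fin (n + 1) → ℂ) (t x : ℝ) : (lev z t x).re = x := by simp [lev]

@[simp] theorem lev_im (z : Fin (n + 1) → ℂ) (t x : ℝ) : (lev z t x).im = height z x + t := by
  simp [lev]

theorem continuous_lev (z : Fin (n + 1) → ℂ) : Continuous fun p : ℝ × ℝ => lev z p.2 p.1 := by
  have := continuous_height z
  unfold lev; fun_prop

theorem continuous_lev_left (z : Fin (n + 1) → ℂ) (t : ℝ) : Continuous (lev z t) :=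
  (continuous_lev z).comp (by fun_prop : Continuous fun x : ℝ => (x, t))

theorem continuous_lev_right (z : Fin (n + 1) → ℂ) (x : ℝ) : Continuous fun t => lev z t x :=
  (continuous_lev z).comp (by fun_prop : Continuous fun t : ℝ => (x, t))

/-- The pull-back of the form `upPhi dζ` by the level curve. -/
def levForm (μ : Fin (n + 1) → ℝ) (z : Fin (n + 1) → ℂ) (t x : ℝ) : ℂ :=
  upPhi μ z (lev z t x) * (1 + deriv (height z) x * Complex.I)

section

variable {μ : Fin (n + 1) → ℝ} {z : Fin (n + 1) → ℂ}

theorem lev_mem_of_pos (hz : z ∈ chamber n) {t : ℝ} (ht : 0 < t) (x : ℝ) :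
    lev z t x ∈ upDomain z := by
  rw [upDomain_iff]
  intro j
  rw [lev_re, lev_im]
  by_cases h : x = (z j).re
  · left; rw [h, height_re hz]; linarith
  · exact Or.inr h

theorem lev_mem_of_ne {t x : ℝ} (hx : ∀ j, x ≠ (z j).re) : lev z t x ∈ upDomain z := by
  rw [upDomain_iff]
  exact fun j => Or.inr (by simpa using hx j)

theorem ae_ne_re (z : Fin (n + 1) → ℂ) : ∀ᵐ x : ℝ, ∀ j, x ≠ (z j).re :=
  ae_all_iff.2 fun j => by simp [ae_iff]

/-- A bound for the slopes of the polygon. -/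
def slopeBound (z : Fin (n + 1) → ℂ) : ℝ := ∑ k, |slope z k|

theorem slopeBound_nonneg (z : Fin (n + 1) → ℂ) : 0 ≤ slopeBound z :=
  Finset.sum_nonneg fun _ _ => abs_nonneg _

theorem hasDerivAt_height_of_gap (hz : z ∈ chamber n) {c d : ℝ} (h : ∀ j, (z j).re ∉ Ioo c d) :
    ∃ m, |m| ≤ slopeBound z ∧ (∀ x ∈ Icc c d, height z x = height z c + m * (x - c)) ∧
      ∀ x ∈ Ioo c d, HasDerivAt (height z) m x := by
  obtain ⟨m, hm, hm'⟩ := height_affine hz h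
  refine ⟨m, hm, hm', fun x hx => ?_⟩
  have h1 : HasDerivAt (fun x => height z c + m * (x - c)) m x := by
    simpa using (((hasDerivAt_id x).sub_const c).const_mul m).const_add (height z c)
  refine h1.congr_of_eventuallyEq ?_
  filter_upwards [Ioo_mem_nhds hx.1 hx.2] with y hy using hm' y (Ioo_subset_Icc_self hy)

theorem hasDerivAt_height (hz : z ∈ chamber n) {x : ℝ} (hx : ∀ j, x ≠ (z j).re) :
    HasDerivAt (height z) (deriv (height z) x) x ∧ |deriv (height z) x| ≤ slopeBound z := by
  have h1 : ∀ᶠ y in 𝓝 x, ∀ j, y ≠ (z j).re := eventually_all.2 fun j =>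
    isOpen_ne.mem_nhds (hx j)
  obtain ⟨ε, hε, hb⟩ := Metric.eventually_nhds_iff_ball.1 h1
  rw [Real.ball_eq_Ioo] at hb
  obtain ⟨m, hm, -, hd⟩ := hasDerivAt_height_of_gap hz (c := x - ε) (d := x + ε)
    fun j hj => hb _ hj j rfl
  have h2 := hd x ⟨by linarith, by linarith⟩
  rw [h2.deriv]
  exact ⟨h2, hm⟩

theorem measurable_upPhi (μ : Fin (n + 1) → ℝ) (z : Fin (n + 1) → ℂ) : Measurable (upPhi μ z) := by
  unfold upPhi; fun_prop

theorem measurable_levForm (μ : Fin (n + 1) → ℝ) (z : Fin (n + 1) → ℂ) (t : ℝ) :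
    Measurable (levForm μ z t) := by
  have h1 := (measurable_upPhi μ z).comp (continuous_lev_left z t).measurable
  have h2 := measurable_deriv (height z)
  unfold levForm
  exact h1.mul (by fun_prop)

/-- The bound does not depend on the height t, so it serves as majorant for all limits t → 0. -/
theorem norm_levForm_le (hμ : ∀ j, 0 < μ j) (hz : z ∈ chamber n) (t : ℝ) {x : ℝ}
    (hx : ∀ j, x ≠ (z j).re) : ‖levForm μ z t x‖ ≤ (1 + slopeBound z) * rho μ z x := by
  have h1 := norm_upPhi_le_rho hμ (ζ := lev z t x) (by simpa using hx)
  rw [lev_re] at h1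
  have h2 : ‖(1 : ℂ) + deriv (height z) x * Complex.I‖ ≤ 1 + slopeBound z := by
    refine (norm_add_le _ _).trans ?_
    rw [norm_one, norm_mul, Complex.norm_I, mul_one, Complex.norm_real, Real.norm_eq_abs]
    linarith [(hasDerivAt_height hz hx).2]
  rw [levForm, norm_mul, mul_comm]
  exact mul_le_mul h2 h1 (norm_nonneg _) (by linarith [slopeBound_nonneg z])

theorem ae_norm_levForm_le (hμ : ∀ j, 0 < μ j) (hz : z ∈ chamber n) (t : ℝ) :
    ∀ᵐ x, ‖levForm μ z t x‖ ≤ (1 + slopeBound z) * rho μ z x :=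
  (ae_ne_re z).mono fun _ hx => norm_levForm_le hμ hz t hx

theorem integrable_levForm (hμ : ∀ j, μ j ∈ Ioo (0 : ℝ) 1) (hM : 1 < totalWeight μ)
    (hz : z ∈ chamber n) (t : ℝ) : Integrable (levForm μ z t) :=
  ((integrable_rho hμ hM hz).const_mul _).mono' (measurable_levForm μ z t).aestronglyMeasurable
    (ae_norm_levForm_le (fun j => (hμ j).1) hz t)

theorem continuousOn_upPhi (μ : Fin (n + 1) → ℝ) (z : Fin (n + 1) → ℂ) :
    ContinuousOn (upPhi μ z) (upDomain z) := fun _ h =>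
  (differentiableAt_upPhi μ h).continuousAt.continuousWithinAt

theorem continuousOn_upPsi (hμ : ∀ j, 0 < μ j) (hM : 1 < totalWeight μ) :
    ContinuousOn (upPsi μ z) (upDomain z) := fun _ h =>
  (hasDerivAt_upPsi hμ hM h).continuousAt.continuousWithinAt

theorem hasDerivAt_upPsi_lev (hμ : ∀ j, 0 < μ j) (hM : 1 < totalWeight μ) (hz : z ∈ chamber n)
    (t : ℝ) {x : ℝ} (hx : ∀ j, x ≠ (z j).re) :
    HasDerivAt (fun x => upPsi μ z (lev z t x)) (levForm μ z t x) x := by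
  have h1 := hasDerivAt_upPsi hμ hM (lev_mem_of_ne (t := t) hx)
  have h2 : HasDerivAt (lev z t) (1 + deriv (height z) x * Complex.I) x := by
    unfold lev
    refine ((hasDerivAt_id x).ofReal_comp).add ?_
    exact (((hasDerivAt_height hz hx).1.add_const t).ofReal_comp).mul_const _
  exact h1.comp x h2

theorem integral_levForm (hμ : ∀ j, μ j ∈ Ioo (0 : ℝ) 1) (hM : 1 < totalWeight μ)
    (hz : z ∈ chamber n) {t : ℝ} (ht : 0 < t) (a b : ℝ) :
    ∫ x in a..b, levForm μ z t x = upPsi μ z (lev z t b) - upPsi μ z (lev z t a) := by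
  have hμ0 : ∀ j, 0 < μ j := fun j => (hμ j).1
  refine integral_eq_of_hasDerivAt_off_countable (fun x => upPsi μ z (lev z t x)) _
    (s := range fun j => (z j).re) (finite_range _).countable ?_ (fun x hx => ?_)
    (integrable_levForm hμ hM hz t).intervalIntegrable
  · exact ((continuousOn_upPsi hμ0 hM).comp_continuous (continuous_lev_left z t)
      (lev_mem_of_pos hz ht)).continuousOn
  · exact hasDerivAt_upPsi_lev hμ0 hM hz t fun j h => hx.2 ⟨j, h.symm⟩

/-- The defining integral of `upPsi` is not estimated near the vertices. Instead one starts far to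
the left, where it is small, and integrates along the level curve with the majorant `rho`, which is
uniform in t. -/
theorem exists_bound_upPsi (hμ : ∀ j, μ j ∈ Ioo (0 : ℝ) 1) (hM : 1 < totalWeight μ)
    (hz : z ∈ chamber n) : ∃ C, 0 ≤ C ∧ ∀ t > 0, ∀ x, ‖upPsi μ z (lev z t x)‖ ≤ C := by
  have hμ0 : ∀ j, 0 < μ j := fun j => (hμ j).1
  obtain ⟨C, hC, R, hR, a, ha, h⟩ := exists_side_bound_upPsi hμ0 hM z
  have hI := (integrable_rho hμ hM hz).const_mul (1 + slopeBound z)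
  have hs := slopeBound_nonneg z
  have hnn : ∀ x, 0 ≤ (1 + slopeBound z) * rho μ z x := fun x =>
    mul_nonneg (by linarith) (rho_nonneg μ z x)
  refine ⟨C + ∫ x, (1 + slopeBound z) * rho μ z x, add_nonneg hC (integral_nonneg hnn),
    fun t ht x => ?_⟩
  set y := min x (-R) with hy
  have hyR : R ≤ |y| := by
    have : y ≤ -R := min_le_right _ _
    rw [abs_of_nonpos (by linarith)]; linarith
  have h1 := integral_levForm hμ hM hz ht y x
  have h2 : ‖upPsi μ z (lev z t y)‖ ≤ C := by
    have := h (lev z t y) (by simpa using hyR)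
    rw [lev_re] at this
    refine this.trans (mul_le_of_le_one_right hC ?_)
    exact Real.rpow_le_one_of_one_le_of_nonpos (by linarith) (by linarith)
  have h3 : ‖∫ x in y..x, levForm μ z t x‖ ≤ ∫ x, (1 + slopeBound z) * rho μ z x := by
    refine (intervalIntegral.norm_integral_le_of_norm_le (min_le_left _ _)
      ((ae_norm_levForm_le hμ0 hz t).mono fun x hx _ => hx) hI.intervalIntegrable).trans ?_
    rw [intervalIntegral.integral_of_le (min_le_left _ _)]
    exact setIntegral_le_integral hI (Eventually.of_forall hnn)
  have h4 : upPsi μ z (lev z t x) = upPsi μ z (lev z t y) + ∫ x in y..x, levForm μ z t x := by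
    rw [h1]; ring
  rw [h4]
  exact (norm_add_le _ _).trans (add_le_add h2 h3)

theorem tendsto_upPsi_lev (hμ : ∀ j, 0 < μ j) (hM : 1 < totalWeight μ) (z : Fin (n + 1) → ℂ)
    {ι : Type*} {l : Filter ι} {x : ι → ℝ} (hx : Tendsto (fun i => |x i|) l atTop) (t : ℝ) :
    Tendsto (fun i => upPsi μ z (lev z t (x i))) l (𝓝 0) := by
  obtain ⟨C, hC, R, hR, a, ha, h⟩ := exists_side_bound_upPsi hμ hM z
  rw [tendsto_zero_iff_norm_tendsto_zero]
  refine squeeze_zero' (Eventually.of_forall fun _ => norm_nonneg _)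
    ((hx.eventually_ge_atTop R).mono fun i hi => ?_)
    (by simpa using ((tendsto_rpow_neg_atTop ha).comp hx).const_mul C)
  have := h (lev z t (x i)) (by simpa using hi)
  rwa [lev_re] at this

theorem setIntegral_levForm (hμ : ∀ j, μ j ∈ Ioo (0 : ℝ) 1) (hM : 1 < totalWeight μ)
    (hz : z ∈ chamber n) {t : ℝ} (ht : 0 < t) (x : ℝ) :
    ∫ x in Iic x, levForm μ z t x = upPsi μ z (lev z t x) := by
  have h1 := intervalIntegral_tendsto_integral_Iic x
    (integrable_levForm hμ hM hz t).integrableOn tendsto_id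
  have h2 := (tendsto_upPsi_lev (fun j => (hμ j).1) hM z
    (tendsto_abs_atBot_atTop (G := ℝ)) t).const_sub (upPsi μ z (lev z t x))
  rw [sub_zero] at h2
  refine tendsto_nhds_unique h1 (h2.congr fun a => ?_)
  rw [integral_levForm hμ hM hz ht, id]

theorem integral_levForm_eq_zero (hμ : ∀ j, μ j ∈ Ioo (0 : ℝ) 1) (hM : 1 < totalWeight μ)
    (hz : z ∈ chamber n) {t : ℝ} (ht : 0 < t) : ∫ x, levForm μ z t x = 0 := by
  have h1 := intervalIntegral_tendsto_integral (integrable_levForm hμ hM hz t)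
    tendsto_neg_atTop_atBot tendsto_id
  have h2 := (tendsto_upPsi_lev (fun j => (hμ j).1) hM z
    (tendsto_abs_atTop_atTop (G := ℝ)) t).sub (tendsto_upPsi_lev (fun j => (hμ j).1) hM z
    (tendsto_abs_atBot_atTop.comp (tendsto_neg_atTop_atBot (G := ℝ))) t)
  rw [sub_zero] at h2
  refine tendsto_nhds_unique h1 (h2.congr fun a => ?_)
  rw [integral_levForm hμ hM hz ht, id]

theorem tendsto_setIntegral_levForm (hμ : ∀ j, μ j ∈ Ioo (0 : ℝ) 1) (hM : 1 < totalWeight μ)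
    (hz : z ∈ chamber n) (s : Set ℝ) :
    Tendsto (fun t => ∫ x in s, levForm μ z t x) (𝓝[>] 0) (𝓝 (∫ x in s, levForm μ z 0 x)) := by
  refine tendsto_integral_filter_of_dominated_convergence
    (fun x => (1 + slopeBound z) * rho μ z x)
    (Eventually.of_forall fun t => (measurable_levForm μ z t).aestronglyMeasurable)
    (Eventually.of_forall fun t => ae_restrict_of_ae
      (ae_norm_levForm_le (fun j => (hμ j).1) hz t))
    ((integrable_rho hμ hM hz).const_mul _).integrableOn (ae_restrict_of_ae ?_)
  filter_upwards [ae_ne_re z] with x hx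
  refine Tendsto.mul_const _ ?_
  have h1 := (differentiableAt_upPhi μ (lev_mem_of_ne (t := 0) hx)).continuousAt
  exact (h1.tendsto.comp (continuous_lev_right z x).continuousAt).mono_left nhdsWithin_le_nhds

theorem setIntegral_levForm_zero (hμ : ∀ j, μ j ∈ Ioo (0 : ℝ) 1) (hM : 1 < totalWeight μ)
    (hz : z ∈ chamber n) {x : ℝ} (hx : ∀ j, x ≠ (z j).re) :
    ∫ x in Iic x, levForm μ z 0 x = upPsi μ z (lev z 0 x) := by
  refine tendsto_nhds_unique (tendsto_setIntegral_levForm hμ hM hz (Iic x)) ?_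
  have h1 := (hasDerivAt_upPsi (fun j => (hμ j).1) hM (lev_mem_of_ne (t := 0) hx)).continuousAt
  have h2 : Tendsto (fun t => upPsi μ z (lev z t x)) (𝓝[>] 0) (𝓝 (upPsi μ z (lev z 0 x))) :=
    (h1.tendsto.comp (continuous_lev_right z x).continuousAt).mono_left nhdsWithin_le_nhds
  refine h2.congr' ?_
  filter_upwards [self_mem_nhdsWithin] with t ht
  exact (setIntegral_levForm hμ hM hz ht x).symm

/-- On a level t > 0 the primitive tends to 0 at both ends; dominated convergence carries this to
the polygon. It is the source of the linear relations between the strip periods. -/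
theorem integral_levForm_zero (hμ : ∀ j, μ j ∈ Ioo (0 : ℝ) 1) (hM : 1 < totalWeight μ)
    (hz : z ∈ chamber n) : ∫ x, levForm μ z 0 x = 0 := by
  have h1 := tendsto_setIntegral_levForm hμ hM hz univ
  simp only [setIntegral_univ] at h1
  refine tendsto_nhds_unique h1 (tendsto_const_nhds.congr' ?_)
  filter_upwards [self_mem_nhdsWithin] with t ht
  exact (integral_levForm_eq_zero hμ hM hz ht).symm

end

end Lauricella
end

/-! ### Stokes' theorem above the polygon -/

noncomputable section

namespace Lauricella

open MeasureTheory Filter Set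

variable {n : ℕ}

/-- The function whose `∂̄`-derivative is the area density. -/
def levEnergy (μ : Fin (n + 1) → ℝ) (z : Fin (n + 1) → ℂ) (t x : ℝ) : ℂ :=
  upPhi μ z (lev z t x) * conj (upPsi μ z (lev z t x))

/-- The derivative of `lev` where the slope is `m`. -/
def levDeriv (m : ℝ) : ℝ × ℝ →L[ℝ] ℂ :=
  (ContinuousLinearMap.fst ℝ ℝ ℝ).smulRight (1 : ℂ) +
    (m • ContinuousLinearMap.fst ℝ ℝ ℝ + ContinuousLinearMap.snd ℝ ℝ ℝ).smulRight Complex.I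

theorem levDeriv_apply (m : ℝ) (v : ℝ × ℝ) :
    levDeriv m v = v.1 + (m * v.1 + v.2) * Complex.I := by
  simp [levDeriv]

theorem hasFDerivAt_lev {z : Fin (n + 1) → ℂ} {m : ℝ} {p : ℝ × ℝ}
    (h : HasDerivAt (height z) m p.1) :
    HasFDerivAt (fun p : ℝ × ℝ => lev z p.2 p.1) (levDeriv m) p := by
  have h1 : HasFDerivAt (fun p : ℝ × ℝ => height z p.1) (m • ContinuousLinearMap.fst ℝ ℝ ℝ) p :=
    h.comp_hasFDerivAt p hasFDerivAt_fst
  have h2 := ((hasFDerivAt_fst (𝕜 := ℝ) (p := p)).smul_const (1 : ℂ)).add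
    ((h1.add hasFDerivAt_snd).smul_const Complex.I)
  refine h2.congr_of_eventuallyEq (Eventually.of_forall fun p => ?_)
  simp [lev]

section

variable {μ : Fin (n + 1) → ℝ} {z : Fin (n + 1) → ℂ}

/-- Truncating the height by `max p.2 ε` gives a globally continuous function that agrees with the
original one where the height is at least ε. -/
theorem continuous_upPhi_lev_max (hz : z ∈ chamber n) {ε : ℝ} (hε : 0 < ε) :
    Continuous fun p : ℝ × ℝ => upPhi μ z (lev z (max p.2 ε) p.1) :=
  (continuousOn_upPhi μ z).comp_continuous
    ((continuous_lev z).comp (by fun_prop : Continuous fun p : ℝ × ℝ => (p.1, max p.2 ε)))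
    fun _ => lev_mem_of_pos hz (hε.trans_le (le_max_right _ _)) _

theorem continuous_levEnergy_max (hμ : ∀ j, 0 < μ j) (hM : 1 < totalWeight μ)
    (hz : z ∈ chamber n) {ε : ℝ} (hε : 0 < ε) :
    Continuous fun p : ℝ × ℝ => levEnergy μ z (max p.2 ε) p.1 := by
  refine (continuous_upPhi_lev_max hz hε).mul (Complex.continuous_conj.comp ?_)
  exact (continuousOn_upPsi hμ hM).comp_continuous
    ((continuous_lev z).comp (by fun_prop : Continuous fun p : ℝ × ℝ => (p.1, max p.2 ε)))
    fun _ => lev_mem_of_pos hz (hε.trans_le (le_max_right _ _)) _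

theorem continuous_levEnergy (hμ : ∀ j, 0 < μ j) (hM : 1 < totalWeight μ)
    (hz : z ∈ chamber n) {t : ℝ} (ht : 0 < t) : Continuous (levEnergy μ z t) := by
  have := (continuous_levEnergy_max hμ hM hz ht).comp
    (by fun_prop : Continuous fun x : ℝ => (x, t))
  simpa [Function.comp_def] using this

/-- Over an interval without vertices the polygon has a constant slope m, and in the coordinates (x,
t) the operator 2 ∂/∂ζ̄ is ∂_x + (i - m) ∂_t. It kills φ = `upPhi` and maps the conjugate of its
primitive to 2 φ̄, so it maps `levEnergy` to 2|φ|². The divergence theorem on the rectangle gives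
the formula. -/
theorem stokes_gap (hμ : ∀ j, 0 < μ j) (hM : 1 < totalWeight μ) (hz : z ∈ chamber n) {ε R : ℝ}
    (hε : 0 < ε) (hεR : ε ≤ R) {a b : ℝ} (hab : a ≤ b) (hgap : ∀ j, (z j).re ∉ Ioo a b) :
    ∫ x in a..b, ∫ t in ε..R, ((2 * ‖upPhi μ z (lev z t x)‖ ^ 2 : ℝ) : ℂ) =
      (∫ x in a..b, (Complex.I - deriv (height z) x) * (levEnergy μ z R x - levEnergy μ z ε x)) +
        (∫ t in ε..R, levEnergy μ z t b) - ∫ t in ε..R, levEnergy μ z t a := by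
  obtain ⟨m, -, -, hm⟩ := hasDerivAt_height_of_gap hz hgap
  let A : ℝ × ℝ → ℝ × ℝ →L[ℝ] ℂ := fun p =>
    (((ContinuousLinearMap.toSpanSingleton ℂ (deriv (upPhi μ z) (lev z p.2 p.1))) :
      ℂ →L[ℂ] ℂ).restrictScalars ℝ).comp (levDeriv m)
  let B : ℝ × ℝ → ℝ × ℝ →L[ℝ] ℂ := fun p =>
    (((ContinuousLinearMap.toSpanSingleton ℂ (upPhi μ z (lev z p.2 p.1))) :
      ℂ →L[ℂ] ℂ).restrictScalars ℝ).comp (levDeriv m)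
  let f : ℝ × ℝ → ℂ := fun p => levEnergy μ z p.2 p.1
  let f' : ℝ × ℝ → ℝ × ℝ →L[ℝ] ℂ := fun p =>
    upPhi μ z (lev z p.2 p.1) • (Complex.conjCLE : ℂ →L[ℝ] ℂ).comp (B p) +
      conj (upPsi μ z (lev z p.2 p.1)) • A p
  have hpos : ∀ p ∈ uIcc a b ×ˢ uIcc ε R, max p.2 ε = p.2 := by
    intro p hp
    rw [uIcc_of_le hεR] at hp
    exact max_eq_left hp.2.1
  have hcont : ContinuousOn f (uIcc a b ×ˢ uIcc ε R) :=
    (continuous_levEnergy_max hμ hM hz hε).continuousOn.congr fun p hp => by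
      simp only [hpos p hp, f]
  have hderiv : ∀ p ∈ Ioo (min a b) (max a b) ×ˢ Ioo (min ε R) (max ε R) \ ∅,
      HasFDerivAt f (f' p) p := by
    rintro p ⟨⟨hp1, hp2⟩, -⟩
    rw [min_eq_left hab, max_eq_right hab] at hp1
    rw [min_eq_left hεR, max_eq_right hεR] at hp2
    have hmem := lev_mem_of_pos hz (hε.trans hp2.1) p.1
    have hl := hasFDerivAt_lev (hm p.1 hp1)
    have hA : HasFDerivAt (fun p : ℝ × ℝ => upPhi μ z (lev z p.2 p.1)) (A p) p :=
      HasFDerivAt.comp (g := upPhi μ z) (f := fun p : ℝ × ℝ => lev z p.2 p.1) p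
        ((differentiableAt_upPhi μ hmem).hasDerivAt.hasFDerivAt.restrictScalars ℝ) hl
    have hB : HasFDerivAt (fun p : ℝ × ℝ => upPsi μ z (lev z p.2 p.1)) (B p) p :=
      HasFDerivAt.comp (g := upPsi μ z) (f := fun p : ℝ × ℝ => lev z p.2 p.1) p
        ((hasDerivAt_upPsi hμ hM hmem).hasFDerivAt.restrictScalars ℝ) hl
    have hC : HasFDerivAt (fun p : ℝ × ℝ => conj (upPsi μ z (lev z p.2 p.1)))
        ((Complex.conjCLE : ℂ →L[ℝ] ℂ).comp (B p)) p :=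
      Complex.conjCLE.hasFDerivAt.comp p hB
    exact hA.mul hC
  have hdiv : ∀ p, f' p (1, 0) + ((Complex.I - m) • f' p) (0, 1) =
      ((2 * ‖upPhi μ z (lev z p.2 p.1)‖ ^ 2 : ℝ) : ℂ) := by
    intro p
    have h1 := Complex.mul_conj' (upPhi μ z (lev z p.2 p.1))
    simp [f', A, B, levDeriv_apply]
    rw [← h1]
    ring_nf
    simp
    ring
  have h := integral2_divergence_prod_of_hasFDerivAt_off_countable f
    (fun p => (Complex.I - m) * f p) f' (fun p => (Complex.I - m) • f' p) a ε b R ∅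
    countable_empty hcont (continuousOn_const.mul hcont) hderiv
    (fun p hp => (hderiv p hp).const_mul (Complex.I - m)) (by
      simp only [hdiv]
      refine ContinuousOn.integrableOn_compact (isCompact_uIcc.prod isCompact_uIcc) ?_
      refine Continuous.continuousOn (f := fun p : ℝ × ℝ =>
        ((2 * ‖upPhi μ z (lev z (max p.2 ε) p.1)‖ ^ 2 : ℝ) : ℂ)) ?_ |>.congr fun p hp => by
          simp only [hpos p hp]
      have := continuous_upPhi_lev_max (μ := μ) hz hε
      fun_prop)
  simp only [hdiv] at h
  rw [h]
  congr 2
  have hc : ∀ {t : ℝ}, 0 < t → Continuous (levEnergy μ z t) := continuous_levEnergy hμ hM hz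
  have h5 := intervalIntegral.integral_sub (μ := volume) (a := a) (b := b)
    (((hc (hε.trans_le hεR)).const_mul (Complex.I - m)).intervalIntegrable _ _)
    (((hc hε).const_mul (Complex.I - m)).intervalIntegrable _ _)
  simp only [f]
  rw [← h5]
  refine intervalIntegral.integral_congr_ae ?_
  filter_upwards [(by simp [ae_iff] : ∀ᵐ x : ℝ, x ≠ b)] with x hxb hx
  rw [uIoc_of_le hab] at hx
  rw [(hm x ⟨hx.1, lt_of_le_of_ne hx.2 hxb⟩).deriv]
  ring

/-- Adding over the gaps: the difference of both sides, as a function of the right end, is constant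
on every interval without vertices in its interior, hence constant. The lateral terms at inner
vertices cancel automatically. -/
theorem stokes (hμ : ∀ j, 0 < μ j) (hM : 1 < totalWeight μ) (hz : z ∈ chamber n) {ε R : ℝ}
    (hε : 0 < ε) (hεR : ε ≤ R) {a b : ℝ} (hab : a ≤ b) :
    ∫ x in a..b, ∫ t in ε..R, ((2 * ‖upPhi μ z (lev z t x)‖ ^ 2 : ℝ) : ℂ) =
      (∫ x in a..b, (Complex.I - deriv (height z) x) * (levEnergy μ z R x - levEnergy μ z ε x)) +
        (∫ t in ε..R, levEnergy μ z t b) - ∫ t in ε..R, levEnergy μ z t a := by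
  set E : ℝ → ℂ := fun x => ∫ t in ε..R, ((2 * ‖upPhi μ z (lev z t x)‖ ^ 2 : ℝ) : ℂ) with hE
  set W : ℝ → ℂ := fun x =>
    (Complex.I - deriv (height z) x) * (levEnergy μ z R x - levEnergy μ z ε x) with hW
  have hEc : Continuous E := by
    have h1 : Continuous fun x => ∫ t in ε..R,
        ((2 * ‖upPhi μ z (lev z (max t ε) x)‖ ^ 2 : ℝ) : ℂ) := by
      refine intervalIntegral.continuous_parametric_intervalIntegral_of_continuous' ?_ ε R
      have := continuous_upPhi_lev_max (μ := μ) hz hε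
      simp only [Function.uncurry_def]
      fun_prop
    convert h1 using 2 with x
    refine intervalIntegral.integral_congr fun t ht => ?_
    rw [uIcc_of_le hεR] at ht
    simp only [max_eq_left ht.1]
  have hWi : ∀ a b, IntervalIntegrable W volume a b := by
    intro a b
    have hc : Continuous fun x => levEnergy μ z R x - levEnergy μ z ε x :=
      (continuous_levEnergy hμ hM hz (hε.trans_le hεR)).sub (continuous_levEnergy hμ hM hz hε)
    have hd := measurable_deriv (height z)
    refine ((hc.norm.const_mul (1 + slopeBound z)).intervalIntegrable a b).mono_fun'
      (Measurable.aestronglyMeasurable (by have := hc.measurable; fun_prop))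
      (ae_restrict_of_ae ?_)
    filter_upwards [ae_ne_re z] with x hx
    rw [hW, norm_mul]
    refine mul_le_mul_of_nonneg_right ?_ (norm_nonneg _)
    refine (norm_sub_le _ _).trans ?_
    rw [Complex.norm_I, Complex.norm_real, Real.norm_eq_abs]
    linarith [(hasDerivAt_height hz hx).2]
  have key := eq_of_eq_on_gaps (Finset.univ.image fun j => (z j).re)
    (J := fun x => (∫ u in (0 : ℝ)..x, (E u - W u)) - ∫ t in ε..R, levEnergy μ z t x)
    (fun a b hab hgap => by
      have h1 := stokes_gap hμ hM hz hε hεR hab fun j hj =>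
        hgap _ (Finset.mem_image_of_mem _ (Finset.mem_univ j)) hj
      have h2 := intervalIntegral.integral_add_adjacent_intervals
        ((hEc.intervalIntegrable 0 a).sub (hWi 0 a)) ((hEc.intervalIntegrable a b).sub (hWi a b))
      have h3 := intervalIntegral.integral_sub (hEc.intervalIntegrable a b) (hWi a b)
      rw [← h2, h3]
      linear_combination (-1 : ℂ) * h1) hab
  have h2 := intervalIntegral.integral_add_adjacent_intervals
    ((hEc.intervalIntegrable 0 a).sub (hWi 0 a)) ((hEc.intervalIntegrable a b).sub (hWi a b))
  have h3 := intervalIntegral.integral_sub (hEc.intervalIntegrable a b) (hWi a b)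
  beta_reduce at key
  rw [← h2, h3] at key
  linear_combination (-1 : ℂ) * key

end

end Lauricella
end

/-! ### The area above the polygon as an integral of boundary values -/

noncomputable section

namespace Lauricella

open MeasureTheory Filter Set

variable {n : ℕ}

section

variable {μ : Fin (n + 1) → ℝ} {z : Fin (n + 1) → ℂ}

theorem norm_I_sub_deriv_height_le (hz : z ∈ chamber n) {x : ℝ} (hx : ∀ j, x ≠ (z j).re) :
    ‖Complex.I - deriv (height z) x‖ ≤ 1 + slopeBound z := by
  refine (norm_sub_le _ _).trans ?_
  rw [Complex.norm_I, Complex.norm_real, Real.norm_eq_abs]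
  linarith [(hasDerivAt_height hz hx).2]

theorem norm_levEnergy_le {C : ℝ}
    (hC : ∀ t > 0, ∀ x, ‖upPsi μ z (lev z t x)‖ ≤ C) {t : ℝ} (ht : 0 < t) (x : ℝ) :
    ‖levEnergy μ z t x‖ ≤ ‖upPhi μ z (lev z t x)‖ * C := by
  rw [levEnergy, norm_mul, RCLike.norm_conj]
  exact mul_le_mul_of_nonneg_left (hC t ht x) (norm_nonneg _)

/-- The integrand is O(R^(-|μ|)) on an interval of length 2R, and |μ| > 1. -/
theorem tendsto_integral_top (hμ : ∀ j, μ j ∈ Ioo (0 : ℝ) 1) (hM : 1 < totalWeight μ)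
    (hz : z ∈ chamber n) :
    Tendsto (fun R : ℝ => ∫ x in -R..R, (Complex.I - deriv (height z) x) * levEnergy μ z R x)
      atTop (𝓝 0) := by
  have hμ0 : ∀ j, 0 < μ j := fun j => (hμ j).1
  obtain ⟨C, hC0, hC⟩ := exists_bound_upPsi hμ hM hz
  obtain ⟨C₁, hC₁, R₀, hR₀, hfar⟩ := exists_far_bound hμ0 z
  obtain ⟨B, hB⟩ := exists_abs_height_le hz
  have hs := slopeBound_nonneg z
  set K := (1 + slopeBound z) * (C₁ * 2 ^ totalWeight μ * C) with hK
  have hK0 : 0 ≤ K := by positivity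
  have hlim : Tendsto (fun R : ℝ => 2 * K * R ^ (-(totalWeight μ - 1))) atTop (𝓝 0) := by
    simpa using (tendsto_rpow_neg_atTop (by linarith : 0 < totalWeight μ - 1)).const_mul (2 * K)
  rw [tendsto_zero_iff_norm_tendsto_zero]
  refine squeeze_zero' (Eventually.of_forall fun _ => norm_nonneg _) ?_ hlim
  filter_upwards [eventually_ge_atTop (2 * R₀), eventually_ge_atTop (2 * B)] with R h1 h2
  have hR : 0 < R := by linarith
  have hbd : ∀ x, ‖upPhi μ z (lev z R x)‖ ≤ C₁ * 2 ^ totalWeight μ * R ^ (-totalWeight μ) := by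
    intro x
    have h3 : R / 2 ≤ ‖lev z R x‖ := by
      have h4 := Complex.im_le_norm (lev z R x)
      rw [lev_im] at h4
      have := neg_le_of_abs_le (hB x)
      linarith
    refine (hfar _ (by linarith)).trans ?_
    rw [mul_assoc]
    refine mul_le_mul_of_nonneg_left ?_ hC₁
    refine (Real.rpow_le_rpow_of_nonpos (by positivity) h3 (by linarith)).trans_eq ?_
    rw [div_eq_mul_inv, Real.mul_rpow hR.le (by norm_num), Real.inv_rpow zero_le_two,
      ← Real.rpow_neg zero_le_two, neg_neg, mul_comm]
  have h3 : ∀ᵐ x, x ∈ uIoc (-R) R →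
      ‖(Complex.I - deriv (height z) x) * levEnergy μ z R x‖ ≤ K * R ^ (-totalWeight μ) := by
    filter_upwards [ae_ne_re z] with x hx _
    rw [norm_mul]
    refine (mul_le_mul (norm_I_sub_deriv_height_le hz hx)
      ((norm_levEnergy_le hC hR x).trans (mul_le_mul_of_nonneg_right (hbd x) hC0))
      (norm_nonneg _) (by linarith)).trans_eq ?_
    rw [hK]; ring
  refine (intervalIntegral.norm_integral_le_of_norm_le_const_ae h3).trans_eq ?_
  rw [abs_of_nonneg (by linarith)]
  have : -(totalWeight μ - 1) = -totalWeight μ + 1 := by ring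
  rw [this, Real.rpow_add hR, Real.rpow_one]
  ring

theorem tendsto_integral_bottom (hμ : ∀ j, μ j ∈ Ioo (0 : ℝ) 1) (hM : 1 < totalWeight μ)
    (hz : z ∈ chamber n) :
    Tendsto (fun R : ℝ => ∫ x in -R..R, (Complex.I - deriv (height z) x) * levEnergy μ z R⁻¹ x)
      atTop (𝓝 (∫ x, (Complex.I - deriv (height z) x) * levEnergy μ z 0 x)) := by
  have hμ0 : ∀ j, 0 < μ j := fun j => (hμ j).1
  obtain ⟨C, hC0, hC⟩ := exists_bound_upPsi hμ hM hz
  have hs := slopeBound_nonneg z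
  have hd := measurable_deriv (height z)
  have hlim : Tendsto (fun R : ℝ => ∫ x, (Ioc (-R) R).indicator
      (fun x => (Complex.I - deriv (height z) x) * levEnergy μ z R⁻¹ x) x) atTop
      (𝓝 (∫ x, (Complex.I - deriv (height z) x) * levEnergy μ z 0 x)) := by
    refine tendsto_integral_filter_of_dominated_convergence
      (fun x => (1 + slopeBound z) * (rho μ z x * C)) ?_ ?_
      (((integrable_rho hμ hM hz).mul_const _).const_mul _) ?_
    · filter_upwards [eventually_gt_atTop 0] with R hR
      have hc := (continuous_levEnergy hμ0 hM hz (inv_pos.2 hR)).measurable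
      exact ((by fun_prop : Measurable fun x => (Complex.I - deriv (height z) x) *
        levEnergy μ z R⁻¹ x).indicator measurableSet_Ioc).aestronglyMeasurable
    · filter_upwards [eventually_gt_atTop 0] with R hR
      filter_upwards [ae_ne_re z] with x hx
      refine (norm_indicator_le_norm_self _ _).trans ?_
      rw [norm_mul]
      have h1 := norm_upPhi_le_rho hμ0 (ζ := lev z R⁻¹ x) (by simpa using hx)
      rw [lev_re] at h1
      exact mul_le_mul (norm_I_sub_deriv_height_le hz hx)
        ((norm_levEnergy_le hC (inv_pos.2 hR) x).trans (mul_le_mul_of_nonneg_right h1 hC0))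
        (norm_nonneg _) (by linarith)
    · filter_upwards [ae_ne_re z] with x hx
      have h0 := lev_mem_of_ne (z := z) (t := 0) hx
      have h1 : ContinuousAt (fun t => levEnergy μ z t x) 0 := by
        have hl := (continuous_lev_right z x).continuousAt (x := 0)
        have hp := ContinuousAt.comp (g := upPhi μ z) (f := fun t => lev z t x)
          (differentiableAt_upPhi μ h0).continuousAt hl
        have hq := ContinuousAt.comp (g := upPsi μ z) (f := fun t => lev z t x)
          (hasDerivAt_upPsi hμ0 hM h0).continuousAt hl
        exact hp.mul (Complex.continuous_conj.continuousAt.comp hq)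
      have h2 := (h1.tendsto.comp (tendsto_inv_atTop_zero (𝕜 := ℝ))).const_mul
        (Complex.I - deriv (height z) x)
      refine h2.congr' ?_
      filter_upwards [eventually_gt_atTop |x|] with R hR
      have := abs_lt.1 hR
      rw [indicator_of_mem (show x ∈ Ioc (-R) R from ⟨this.1, this.2.le⟩)]
      rfl
  refine hlim.congr' ?_
  filter_upwards [eventually_gt_atTop 0] with R hR
  rw [integral_indicator measurableSet_Ioc, intervalIntegral.integral_of_le (by linarith)]

/-- The side bound gives the factor R^(-a) times an integrable function of the height. The map s
covers both x = R and x = -R. -/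
theorem tendsto_integral_side (hμ : ∀ j, μ j ∈ Ioo (0 : ℝ) 1) (hM : 1 < totalWeight μ)
    (hz : z ∈ chamber n) {s : ℝ → ℝ} (hs : ∀ R, |s R| = |R|) :
    Tendsto (fun R : ℝ => ∫ t in R⁻¹..R, levEnergy μ z t (s R)) atTop (𝓝 0) := by
  have hμ0 : ∀ j, 0 < μ j := fun j => (hμ j).1
  obtain ⟨C, hC0, hC⟩ := exists_bound_upPsi hμ hM hz
  obtain ⟨C₁, hC₁, R₀, hR₀, a, ha, hside⟩ := exists_side_bound hμ0 hM z
  have hI := integrable_one_add_norm_real (a := 1 + a) (by linarith)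
  set J := ∫ t : ℝ, (1 + ‖t‖) ^ (-(1 + a)) with hJ
  have hlim : Tendsto (fun R : ℝ => C₁ * C * J * R ^ (-a)) atTop (𝓝 0) := by
    simpa using (tendsto_rpow_neg_atTop ha).const_mul (C₁ * C * J)
  rw [tendsto_zero_iff_norm_tendsto_zero]
  refine squeeze_zero' (Eventually.of_forall fun _ => norm_nonneg _) ?_ hlim
  filter_upwards [eventually_ge_atTop R₀] with R h1
  have hR : 0 < R := by linarith
  have hle : R⁻¹ ≤ R := (inv_le_one_of_one_le₀ (by linarith)).trans (by linarith)
  have hsR : |s R| = R := by rw [hs, abs_of_pos hR]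
  have hI2 : Integrable fun t : ℝ => (1 + ‖height z (s R) + t‖) ^ (-(1 + a)) :=
    hI.comp_add_left _
  have hI3 := hI2.const_mul (C₁ * R ^ (-a) * C)
  have h2 : ∀ᵐ t, t ∈ Ioc R⁻¹ R → ‖levEnergy μ z t (s R)‖ ≤
      C₁ * R ^ (-a) * C * (1 + ‖height z (s R) + t‖) ^ (-(1 + a)) := by
    refine Eventually.of_forall fun t ht => ?_
    have ht0 : 0 < t := (inv_pos.2 hR).trans ht.1
    have h3 := hside (lev z t (s R)) (by rw [lev_re, hsR]; exact h1)
    rw [lev_re, lev_im, hsR] at h3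
    refine (norm_levEnergy_le hC ht0 _).trans ((mul_le_mul_of_nonneg_right h3 hC0).trans_eq ?_)
    ring
  refine (intervalIntegral.norm_integral_le_of_norm_le hle h2 hI3.intervalIntegrable).trans ?_
  rw [intervalIntegral.integral_of_le hle]
  refine (setIntegral_le_integral hI3 (Eventually.of_forall fun t => by positivity)).trans_eq ?_
  rw [integral_const_mul,
    integral_add_left_eq_self (fun t : ℝ => (1 + ‖t‖) ^ (-(1 + a)))]
  ring

/-- The area above the polygon, in terms of the boundary values. -/
theorem upper_area (hμ : ∀ j, μ j ∈ Ioo (0 : ℝ) 1) (hM : 1 < totalWeight μ)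
    (hz : z ∈ chamber n) :
    IntegrableOn (fun p : ℝ × ℝ => ‖upPhi μ z (lev z p.2 p.1)‖ ^ 2) (univ ×ˢ Ioi 0) ∧
    ((2 * ∫ p in univ ×ˢ Ioi (0 : ℝ), ‖upPhi μ z (lev z p.2 p.1)‖ ^ 2 : ℝ) : ℂ) =
      -Complex.I * ∫ x, levForm μ z 0 x * conj (∫ y in Iic x, levForm μ z 0 y) := by
  have hμ0 : ∀ j, 0 < μ j := fun j => (hμ j).1
  set D : ℝ × ℝ → ℝ := fun p => ‖upPhi μ z (lev z p.2 p.1)‖ ^ 2 with hD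
  set Z : ℂ := ∫ x, levForm μ z 0 x * conj (∫ y in Iic x, levForm μ z 0 y) with hZ
  let φ : ℝ → Set (ℝ × ℝ) := fun R => Icc (-R) R ×ˢ Icc R⁻¹ R
  have hS : MeasurableSet (univ ×ˢ Ioi 0 : Set (ℝ × ℝ)) := MeasurableSet.univ.prod measurableSet_Ioi
  have hcover : AECover (volume.restrict (univ ×ˢ Ioi 0 : Set (ℝ × ℝ))) atTop φ := by
    refine ⟨?_, fun R => measurableSet_Icc.prod measurableSet_Icc⟩
    filter_upwards [ae_restrict_mem hS] with p hp
    have hp2 : (0 : ℝ) < p.2 := hp.2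
    filter_upwards [eventually_ge_atTop |p.1|, eventually_ge_atTop p.2,
      eventually_ge_atTop p.2⁻¹] with R h1 h2 h3
    have := abs_le.1 h1
    exact ⟨⟨this.1, this.2⟩, inv_le_of_inv_le₀ hp2 h3, h2⟩
  have hsub : ∀ R > 0, φ R ⊆ univ ×ˢ Ioi 0 := fun R hR p hp =>
    ⟨mem_univ _, (inv_pos.2 hR).trans_le hp.2.1⟩
  have hcont : ∀ R > 0, ContinuousOn D (φ R) := by
    intro R hR
    have h1 := continuous_upPhi_lev_max (μ := μ) hz (inv_pos.2 hR)
    refine Continuous.continuousOn (f := fun p : ℝ × ℝ =>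
      ‖upPhi μ z (lev z (max p.2 R⁻¹) p.1)‖ ^ 2) (by fun_prop) |>.congr fun p hp => ?_
    simp only [hD, max_eq_left hp.2.1]
  have hint : ∀ R > 0, IntegrableOn D (φ R) := fun R hR =>
    (hcont R hR).integrableOn_compact (isCompact_Icc.prod isCompact_Icc)
  have hval : ∀ R ≥ 1, ((2 * ∫ p in φ R, D p ∂(volume.restrict (univ ×ˢ Ioi 0)) : ℝ) : ℂ) =
      (∫ x in -R..R, (Complex.I - deriv (height z) x) * levEnergy μ z R x) -
      (∫ x in -R..R, (Complex.I - deriv (height z) x) * levEnergy μ z R⁻¹ x) +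
        (∫ t in R⁻¹..R, levEnergy μ z t R) - ∫ t in R⁻¹..R, levEnergy μ z t (-R) := by
    intro R hR
    have hR0 : 0 < R := by linarith
    have hle : R⁻¹ ≤ R := (inv_le_one_of_one_le₀ hR).trans hR
    have hle2 : -R ≤ R := by linarith
    have hWi : ∀ t > 0, IntervalIntegrable
        (fun x => (Complex.I - deriv (height z) x) * levEnergy μ z t x) volume (-R) R := by
      intro t ht
      have hc := continuous_levEnergy hμ0 hM hz ht
      have hd := measurable_deriv (height z)
      refine ((hc.norm.const_mul (1 + slopeBound z)).intervalIntegrable (-R) R).mono_fun'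
        (Measurable.aestronglyMeasurable (by have := hc.measurable; fun_prop))
        (ae_restrict_of_ae ?_)
      filter_upwards [ae_ne_re z] with x hx
      rw [norm_mul]
      exact mul_le_mul_of_nonneg_right (norm_I_sub_deriv_height_le hz hx) (norm_nonneg _)
    have h1 := stokes hμ0 hM hz (inv_pos.2 hR0) hle hle2
    simp only [mul_sub] at h1
    rw [intervalIntegral.integral_sub (hWi R hR0) (hWi R⁻¹ (inv_pos.2 hR0))] at h1
    rw [← h1, Measure.restrict_restrict (measurableSet_Icc.prod measurableSet_Icc),
      inter_eq_left.2 (hsub R hR0)]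
    have h2 : ∫ p in φ R, D p = ∫ x in -R..R, ∫ t in R⁻¹..R, D (x, t) := by
      rw [intervalIntegral.integral_of_le hle2, ← integral_Icc_eq_integral_Ioc]
      simp only [φ]
      rw [Measure.volume_eq_prod, setIntegral_prod _ (hint R hR0)]
      refine setIntegral_congr_fun measurableSet_Icc fun x _ => ?_
      rw [intervalIntegral.integral_of_le hle, ← integral_Icc_eq_integral_Ioc]
    rw [h2, ← intervalIntegral.integral_const_mul, ← intervalIntegral.integral_ofReal]
    refine intervalIntegral.integral_congr fun x _ => ?_
    rw [← intervalIntegral.integral_const_mul, ← intervalIntegral.integral_ofReal]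
  have hlim : Tendsto (fun R => ((2 * ∫ p in φ R, D p ∂(volume.restrict (univ ×ˢ Ioi 0)) : ℝ) : ℂ))
      atTop (𝓝 (-Complex.I * Z)) := by
    have h1 := (((tendsto_integral_top hμ hM hz).sub (tendsto_integral_bottom hμ hM hz)).add
      (tendsto_integral_side hμ hM hz (s := id) fun R => rfl)).sub
      (tendsto_integral_side hμ hM hz (s := Neg.neg) fun R => abs_neg R)
    -- Since i - h' = i (1 + i h'), the factor from Stokes is i times the derivative of the boundary
    -- curve, which turns `upPhi` into `levForm`.
    have h2 : ∫ x, (Complex.I - deriv (height z) x) * levEnergy μ z 0 x = Complex.I * Z := by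
      rw [hZ, ← integral_const_mul]
      refine integral_congr_ae ?_
      filter_upwards [ae_ne_re z] with x hx
      rw [setIntegral_levForm_zero hμ hM hz hx, levEnergy, levForm]
      linear_combination (upPhi μ z (lev z 0 x) * ((deriv (height z) x : ℝ) : ℂ) *
        conj (upPsi μ z (lev z 0 x))) * (-1 : ℂ) * Complex.I_sq
    rw [h2] at h1
    have h3 : (0 : ℂ) - Complex.I * Z + 0 - 0 = -Complex.I * Z := by ring
    rw [h3] at h1
    refine h1.congr' ?_
    filter_upwards [eventually_ge_atTop 1] with R hR
    rw [hval R hR]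
    rfl
  have hre : Tendsto (fun R => ∫ p in φ R, D p ∂(volume.restrict (univ ×ˢ Ioi 0))) atTop
      (𝓝 ((-Complex.I * Z).re / 2)) := by
    have := ((Complex.continuous_re.tendsto _).comp hlim).div_const 2
    refine this.congr fun R => ?_
    simp only [Function.comp_apply, Complex.ofReal_re]
    ring
  have hInt : Integrable D (volume.restrict (univ ×ˢ Ioi 0)) := by
    refine hcover.integrable_of_integral_tendsto_of_nonneg_ae _ (φ := φ) ?_ ?_ hre
    · intro R
      rcases lt_or_ge 0 R with hR | hR
      · exact (hint R hR).mono_measure Measure.restrict_le_self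
      -- For R < 0 the rectangle is empty, and for R = 0 the convention 0⁻¹ = 0 leaves a single
      -- point.
      · have h0 : φ R ⊆ {(0, 0)} := by
          rintro ⟨x, t⟩ ⟨⟨h1, h2⟩, h3, h4⟩
          have hR0 : R = 0 := by
            simp only at h1 h2
            linarith
          subst hR0
          simp only [neg_zero, inv_zero] at h1 h2 h3 h4
          rw [mem_singleton_iff, le_antisymm h2 h1, le_antisymm h4 h3]
        exact ((integrableOn_singleton (hx := isCompact_singleton.measure_lt_top)).mono_set h0).mono_measure
          Measure.restrict_le_self
    · exact Eventually.of_forall fun p => by positivity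
  refine ⟨hInt, ?_⟩
  have h1 := hcover.integral_tendsto_of_countably_generated hInt
  have h2 : Tendsto (fun R => ((2 * ∫ p in φ R, D p ∂(volume.restrict (univ ×ˢ Ioi 0)) : ℝ) : ℂ))
      atTop (𝓝 ((2 * ∫ p in univ ×ˢ Ioi (0 : ℝ), D p : ℝ) : ℂ)) :=
    (Complex.continuous_ofReal.tendsto _).comp (h1.const_mul 2)
  exact tendsto_nhds_unique h2 hlim

end

end Lauricella
end

/-! ### Strips and phases: the two boundary integrals as a form in the strip periods -/

noncomputable section

namespace Lauricella

open MeasureTheory Filter Set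

variable {n : ℕ}

theorem setIntegral_fibers {N : ℕ} {κ : ℝ → Fin N} (hκ : Measurable κ) (G : Fin N → ℂ) {r : ℝ → ℂ}
    (hr : Integrable r) (s : Set ℝ) :
    ∫ x in s, G (κ x) * r x = ∑ k, G k * ∫ x in s ∩ κ ⁻¹' {k}, r x := by
  have hm : ∀ k, MeasurableSet (κ ⁻¹' {k}) := fun k => hκ (measurableSet_singleton k)
  have h1 : ∀ x, G (κ x) * r x = ∑ k, (κ ⁻¹' {k}).indicator (fun x => G k * r x) x := by
    intro x
    rw [Finset.sum_eq_single (κ x)]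
    · rw [indicator_of_mem (by simp)]
    · intro k _ hk
      rw [indicator_of_notMem (by simpa using hk.symm)]
    · simp
  simp only [h1]
  rw [integral_finsetSum _ fun k _ => ((hr.const_mul _).indicator (hm k)).integrableOn]
  refine Finset.sum_congr rfl fun k _ => ?_
  rw [setIntegral_indicator (hm k), integral_const_mul]

theorem integral_fibers {N : ℕ} {κ : ℝ → Fin N} (hκ : Measurable κ) (G : Fin N → ℂ) {r : ℝ → ℂ}
    (hr : Integrable r) : ∫ x, G (κ x) * r x = ∑ k, G k * ∫ x in κ ⁻¹' {k}, r x := by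
  simpa using setIntegral_fibers hκ G hr univ

theorem integrable_mul_conj_primitive {q : ℝ → ℂ} (hq : Integrable q) :
    Integrable fun x => q x * conj (∫ y in Iic x, q y) := by
  have hc : Continuous fun x => ∫ y in Iic x, q y := by
    have h1 : (fun x => ∫ y in Iic x, q y) = fun x => (∫ y in Iic 0, q y) + ∫ y in (0 : ℝ)..x, q y := by
      funext x
      rw [← intervalIntegral.integral_Iic_sub_Iic hq.integrableOn hq.integrableOn]
      ring
    rw [h1]
    exact continuous_const.add
      (intervalIntegral.continuous_primitive (fun _ _ => hq.intervalIntegrable) 0)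
  refine hq.mul_bdd (c := ∫ y, ‖q y‖) (Complex.continuous_conj.comp hc).aestronglyMeasurable
    (Eventually.of_forall fun x => ?_)
  rw [RCLike.norm_conj]
  exact (norm_integral_le_integral_norm _).trans
    (setIntegral_le_integral hq.norm (Eventually.of_forall fun y => norm_nonneg _))

/-- The difference of the two energies of a function with locally constant phases. -/
theorem energy_sub_energy {N : ℕ} {κ : ℝ → Fin N} (hκ : Measurable κ) (hmono : Monotone κ)
    (p : Fin N → ℂ) {r : ℝ → ℂ} (hr : Integrable r)
    (hq : Integrable fun x => p (κ x) * r x) (hq' : Integrable fun x => conj (p (κ x)) * r x) :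
    (∫ x, p (κ x) * r x * conj (∫ y in Iic x, p (κ y) * r y)) -
      ∫ x, conj (p (κ x)) * r x * conj (∫ y in Iic x, conj (p (κ y)) * r y) =
    ∑ k, ∑ j, if j < k then (p k * conj (p j) - conj (p k) * p j) *
      (∫ x in κ ⁻¹' {k}, r x) * conj (∫ x in κ ⁻¹' {j}, r x) else 0 := by
  set f : Fin N → ℂ := fun k => ∫ x in κ ⁻¹' {k}, r x with hf
  rw [← integral_sub (integrable_mul_conj_primitive hq) (integrable_mul_conj_primitive hq')]
  let g : Fin N → ℂ := fun k => ∑ j, if j < k then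
    (p k * conj (p j) - conj (p k) * p j) * conj (f j) else 0
  have hpt : ∀ x, p (κ x) * r x * conj (∫ y in Iic x, p (κ y) * r y) -
      conj (p (κ x)) * r x * conj (∫ y in Iic x, conj (p (κ y)) * r y) = g (κ x) * r x := by
    intro x
    rw [setIntegral_fibers hκ p hr (Iic x),
      setIntegral_fibers hκ (fun k => conj (p k)) hr (Iic x)]
    simp only [map_sum, map_mul, Complex.conj_conj, Finset.mul_sum, g, Finset.sum_mul]
    rw [← Finset.sum_sub_distrib]
    refine Finset.sum_congr rfl fun j _ => ?_
    rcases lt_trichotomy j (κ x) with h | h | h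
    · have h1 : Iic x ∩ κ ⁻¹' {j} = κ ⁻¹' {j} := by
        refine inter_eq_right.2 fun y hy => ?_
        by_contra hxy
        have := hmono (not_le.1 hxy).le
        rw [show κ y = j from hy] at this
        exact absurd h (not_lt.2 this)
      rw [h1, if_pos h]
      simp only [f]
      ring
    -- On the strip of x itself, the integral to the left of x covers only part of the strip and is
    -- not a period. It occurs with p p̄ in one energy and p̄ p in the other and cancels, which is
    -- why the two halves of the plane must be taken together.
    · rw [if_neg (by rw [h]; exact lt_irrefl _), h]
      ring
    · have h1 : Iic x ∩ κ ⁻¹' {j} = ∅ := by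
        refine eq_empty_of_forall_notMem fun y hy => ?_
        have := hmono hy.1
        rw [show κ y = j from hy.2] at this
        exact absurd h (not_lt.2 this)
      rw [h1, if_neg (not_lt.2 h.le)]
      simp
  simp only [hpt]
  rw [integral_fibers hκ g hr]
  refine Finset.sum_congr rfl fun k _ => ?_
  rw [Finset.sum_mul]
  refine Finset.sum_congr rfl fun j _ => ?_
  split_ifs
  · simp only [f]; ring
  · simp

/-- The number of vertices to the left of `x`. -/
def strip (z : Fin (n + 1) → ℂ) (x : ℝ) : Fin (n + 2) :=
  ⟨(Finset.univ.filter fun j => (z j).re < x).card, by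
    refine Nat.lt_succ_of_le ((Finset.card_le_univ _).trans ?_)
    rw [Fintype.card_fin]⟩

theorem lt_strip_iff {z : Fin (n + 1) → ℂ} (hz : z ∈ chamber n) {x : ℝ} {j : Fin (n + 1)} :
    j.val < (strip z x).val ↔ (z j).re < x := by
  set S := Finset.univ.filter fun j => (z j).re < x with hS
  show j.val < S.card ↔ _
  constructor
  · intro h
    by_contra hj
    have h1 : S ⊆ Finset.Iio j := by
      intro i hi
      rw [hS, Finset.mem_filter] at hi
      rw [Finset.mem_Iio]
      by_contra hij
      exact hj ((chamber_le_re hz (not_lt.1 hij)).trans_lt hi.2)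
    have h2 := Finset.card_le_card h1
    rw [Fin.card_Iio] at h2
    omega
  · intro h
    have h1 : Finset.Iic j ⊆ S := by
      intro i hi
      rw [hS, Finset.mem_filter]
      exact ⟨Finset.mem_univ _, (chamber_le_re hz (Finset.mem_Iic.1 hi)).trans_lt h⟩
    have h2 := Finset.card_le_card h1
    rw [Fin.card_Iic] at h2
    omega

theorem monotone_strip (z : Fin (n + 1) → ℂ) : Monotone (strip z) := by
  intro x y hxy
  have h : (Finset.univ.filter fun j => (z j).re < x) ⊆ Finset.univ.filter fun j => (z j).re < y := by
    intro j hj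
    rw [Finset.mem_filter] at hj ⊢
    exact ⟨hj.1, hj.2.trans_le hxy⟩
  exact Finset.card_le_card h

theorem strip_preimage_succ {z : Fin (n + 1) → ℂ} (hz : z ∈ chamber n) (k : Fin n) :
    strip z ⁻¹' {k.castSucc.succ} = Ioc (z k.castSucc).re (z k.succ).re := by
  ext x
  have h1 := lt_strip_iff hz (x := x) (j := k.castSucc)
  have h2 := lt_strip_iff hz (x := x) (j := k.succ)
  rw [mem_preimage, mem_singleton_iff, mem_Ioc, ← h1, ← not_lt, ← h2, Fin.ext_iff]
  simp only [Fin.val_succ, Fin.val_castSucc]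
  omega

/-- The phases of `upPhi` on the strips. -/
def phase (μ : Fin (n + 1) → ℝ) (k : ℕ) : ℂ :=
  Complex.exp ((Real.pi / 2 * ∑ j : Fin (n + 1), (if j.val < k then μ j else -μ j) : ℝ) *
    Complex.I)

theorem phase_mul_conj (μ : Fin (n + 1) → ℝ) (k : ℕ) : phase μ k * conj (phase μ k) = 1 := by
  rw [Complex.mul_conj', phase, Complex.norm_exp_ofReal_mul_I]
  simp

theorem norm_phase (μ : Fin (n + 1) → ℝ) (k : ℕ) : ‖phase μ k‖ = 1 := by
  rw [phase, Complex.norm_exp_ofReal_mul_I]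

/-- The branch that is positive on the `k`-th strip for real configurations. -/
def stripPhi (μ : Fin (n + 1) → ℝ) (k : ℕ) (z : Fin (n + 1) → ℂ) (ζ : ℂ) : ℂ :=
  ∏ j : Fin (n + 1), (if j.val < k then ζ - z j else z j - ζ) ^ (-(μ j : ℂ))

/-- The argument of b lies in (-π/2, π/2), so adding ±π/2 stays in the principal range. -/
theorem I_mul_cpow {b : ℂ} (hb : 0 < b.re) (s : ℝ) :
    (Complex.I * b) ^ (-(s : ℂ)) =
        Complex.exp ((Real.pi / 2 * -s : ℝ) * Complex.I) * b ^ (-(s : ℂ)) ∧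
      (-Complex.I * b) ^ (-(s : ℂ)) =
        Complex.exp ((Real.pi / 2 * s : ℝ) * Complex.I) * b ^ (-(s : ℂ)) := by
  have hb0 := ne_zero_of_re_pos hb
  have h := abs_lt.1 (Complex.abs_arg_lt_pi_div_two_iff.2 (Or.inl hb))
  have hpi := Real.pi_pos
  constructor
  · rw [Complex.cpow_def_of_ne_zero (mul_ne_zero Complex.I_ne_zero hb0),
      Complex.cpow_def_of_ne_zero hb0, Complex.log_mul Complex.I_ne_zero hb0
        (by rw [Complex.arg_I]; exact ⟨by linarith, by linarith⟩), Complex.log_I, ← Complex.exp_add]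
    congr 1
    push_cast
    ring
  · rw [Complex.cpow_def_of_ne_zero (mul_ne_zero (neg_ne_zero.2 Complex.I_ne_zero) hb0),
      Complex.cpow_def_of_ne_zero hb0, Complex.log_mul (neg_ne_zero.2 Complex.I_ne_zero) hb0
        (by rw [Complex.arg_neg_I]; exact ⟨by linarith, by linarith⟩), Complex.log_neg_I,
      ← Complex.exp_add]
    congr 1
    push_cast
    ring

section

variable {μ : Fin (n + 1) → ℝ} {z : Fin (n + 1) → ℂ}

theorem strip_side_re_pos (hz : z ∈ chamber n) {ζ : ℂ} (hζ : ∀ j, ζ.re ≠ (z j).re)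
    (j : Fin (n + 1)) :
    0 < (if j.val < (strip z ζ.re).val then ζ - z j else z j - ζ).re := by
  split_ifs with h
  · simpa using (lt_strip_iff hz).1 h
  · rw [lt_strip_iff hz] at h
    simpa using lt_of_le_of_ne (not_lt.1 h) (hζ j)

/-- To the right of z_j the base is -i(ζ - z_j), to its left it is i(z_j - ζ), in both cases ∓i
times a number with positive real part. The powers of ∓i make up the phase, which is constant on a
strip. -/
theorem upPhi_eq_phase_mul (hz : z ∈ chamber n) {ζ : ℂ} (hζ : ∀ j, ζ.re ≠ (z j).re) :
    upPhi μ z ζ = phase μ (strip z ζ.re) * stripPhi μ (strip z ζ.re) z ζ := by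
  rw [upPhi, stripPhi, phase, Finset.mul_sum, Complex.ofReal_sum, Finset.sum_mul, Complex.exp_sum,
    ← Finset.prod_mul_distrib]
  refine Finset.prod_congr rfl fun j _ => ?_
  have h := strip_side_re_pos hz hζ j
  split_ifs at h ⊢
  · exact (I_mul_cpow h (μ j)).2
  · rw [← (I_mul_cpow h (μ j)).1]
    congr 1
    ring

theorem stripPhi_conj (hz : z ∈ chamber n) {ζ : ℂ} (hζ : ∀ j, ζ.re ≠ (z j).re) :
    stripPhi μ (strip z ζ.re) (fun j => conj (z j)) (conj ζ) =
      conj (stripPhi μ (strip z ζ.re) z ζ) := by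
  rw [stripPhi, stripPhi, map_prod]
  refine Finset.prod_congr rfl fun j _ => ?_
  have h := strip_side_re_pos hz hζ j
  have harg := Complex.slitPlane_arg_ne_pi (Complex.mem_slitPlane_iff.2 (Or.inl h))
  have h1 : conj (-(μ j : ℂ)) = -(μ j : ℂ) := by simp
  have h2 := Complex.conj_cpow _ (-(μ j : ℂ)) harg
  rw [h1] at h2
  rw [← h2]
  congr 1
  split_ifs <;> simp

theorem strip_conj (z : Fin (n + 1) → ℂ) (x : ℝ) : strip (fun j => conj (z j)) x = strip z x := by
  simp [strip]

theorem lev_conj (z : Fin (n + 1) → ℂ) (x : ℝ) :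
    lev (fun j => conj (z j)) 0 x = conj (lev z 0 x) := by
  simp [lev, height_conj]

/-- The form on the polygon, without its phases. -/
def stripForm (μ : Fin (n + 1) → ℝ) (z : Fin (n + 1) → ℂ) (x : ℝ) : ℂ :=
  conj (phase μ (strip z x)) * levForm μ z 0 x

theorem levForm_eq_phase_mul (μ : Fin (n + 1) → ℝ) (z : Fin (n + 1) → ℂ) (x : ℝ) :
    levForm μ z 0 x = phase μ (strip z x) * stripForm μ z x := by
  rw [stripForm, ← mul_assoc, phase_mul_conj, one_mul]

theorem stripForm_eq (hz : z ∈ chamber n) {x : ℝ} (hx : ∀ j, x ≠ (z j).re) :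
    stripForm μ z x = stripPhi μ (strip z x) z (lev z 0 x) *
      (1 + deriv (height z) x * Complex.I) := by
  have h := upPhi_eq_phase_mul (μ := μ) hz (ζ := lev z 0 x) (by simpa using hx)
  rw [lev_re] at h
  rw [stripForm, levForm, h, ← mul_assoc, ← mul_assoc, mul_comm (conj _), phase_mul_conj, one_mul]

/-- Without phases the form is compatible with reflection, so the upper and the lower half of the
plane differ only by conjugating the phases. -/
theorem stripForm_conj (hz : z ∈ chamber n) {x : ℝ} (hx : ∀ j, x ≠ (z j).re) :
    stripForm μ (fun j => conj (z j)) x = conj (stripForm μ z x) := by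
  have h := stripPhi_conj (μ := μ) hz (ζ := lev z 0 x) (by simpa using hx)
  rw [lev_re] at h
  have h1 : height (fun j => conj (z j)) = fun x => -height z x := funext (height_conj z)
  rw [stripForm_eq (conj_mem_chamber hz) (by simpa using hx), stripForm_eq hz hx, strip_conj,
    lev_conj, h, h1, deriv.fun_neg]
  simp

theorem measurable_strip (z : Fin (n + 1) → ℂ) : Measurable (strip z) :=
  (monotone_strip z).measurable

theorem integrable_stripForm (hμ : ∀ j, μ j ∈ Ioo (0 : ℝ) 1) (hM : 1 < totalWeight μ)
    (hz : z ∈ chamber n) : Integrable (stripForm μ z) := by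
  refine (integrable_levForm hμ hM hz 0).bdd_mul (c := 1) ?_
    (Eventually.of_forall fun x => ?_)
  · have h1 : Measurable fun k : Fin (n + 2) => conj (phase μ k) := measurable_of_countable _
    exact (h1.comp (measurable_strip z)).aestronglyMeasurable
  · rw [RCLike.norm_conj, norm_phase]

/-- The integrals over the strips. -/
def stripPeriod (μ : Fin (n + 1) → ℝ) (z : Fin (n + 1) → ℂ) (k : Fin (n + 2)) : ℂ :=
  ∫ x in strip z ⁻¹' {k}, stripForm μ z x

theorem ae_levForm_conj (hz : z ∈ chamber n) :
    ∀ᵐ x, levForm μ (fun j => conj (z j)) 0 x = conj (conj (phase μ (strip z x)) * stripForm μ z x) := by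
  filter_upwards [ae_ne_re z] with x hx
  rw [levForm_eq_phase_mul, stripForm_conj hz hx, strip_conj]
  simp

theorem integral_levForm_conj (hz : z ∈ chamber n) (s : Set ℝ) :
    ∫ x in s, conj (phase μ (strip z x)) * stripForm μ z x =
      conj (∫ x in s, levForm μ (fun j => conj (z j)) 0 x) := by
  rw [← integral_conj]
  refine integral_congr_ae (ae_restrict_of_ae ?_)
  filter_upwards [ae_levForm_conj (μ := μ) hz] with x hx
  rw [hx, Complex.conj_conj]

/-- The integral along the whole polygon vanishes for the branch continued from above, and, by
reflection, for the one from below. -/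
theorem sum_phase_mul_stripPeriod (hμ : ∀ j, μ j ∈ Ioo (0 : ℝ) 1) (hM : 1 < totalWeight μ)
    (hz : z ∈ chamber n) :
    ∑ k : Fin (n + 2), phase μ k * stripPeriod μ z k = 0 ∧
      ∑ k : Fin (n + 2), conj (phase μ k) * stripPeriod μ z k = 0 := by
  have hr := integrable_stripForm hμ hM hz
  constructor
  · have h := integral_fibers (measurable_strip z) (fun k => phase μ k) hr
    simp only [← levForm_eq_phase_mul] at h
    rw [integral_levForm_zero hμ hM hz] at h
    exact h.symm
  · have h := integral_fibers (measurable_strip z) (fun k => conj (phase μ k)) hr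
    have h1 := integral_levForm_conj (μ := μ) hz univ
    simp only [setIntegral_univ] at h1
    rw [h1, integral_levForm_zero hμ hM (conj_mem_chamber hz), map_zero] at h
    exact h.symm

/-- Conjugating the formula for the reflected configuration reverses the sign of the factor -i, so
the sum of the areas is -i times the difference of two energies with conjugate phases. -/
theorem upper_add_lower_area (hμ : ∀ j, μ j ∈ Ioo (0 : ℝ) 1) (hM : 1 < totalWeight μ)
    (hz : z ∈ chamber n) :
    ((2 * ((∫ p in univ ×ˢ Ioi (0 : ℝ), ‖upPhi μ z (lev z p.2 p.1)‖ ^ 2) +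
      ∫ p in univ ×ˢ Ioi (0 : ℝ), ‖upPhi μ (fun j => conj (z j))
        (lev (fun j => conj (z j)) p.2 p.1)‖ ^ 2) : ℝ) : ℂ) =
      -Complex.I * ∑ k : Fin (n + 2), ∑ j : Fin (n + 2), if j < k then
        (phase μ k * conj (phase μ j) - conj (phase μ k) * phase μ j) *
          stripPeriod μ z k * conj (stripPeriod μ z j) else 0 := by
  have hr := integrable_stripForm hμ hM hz
  have h1 := (upper_area hμ hM hz).2
  have h2 := congrArg conj (upper_area hμ hM (conj_mem_chamber hz)).2
  rw [Complex.conj_ofReal, map_mul, ← integral_conj] at h2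
  have hq : Integrable fun x => phase μ (strip z x) * stripForm μ z x := by
    simpa only [← levForm_eq_phase_mul] using integrable_levForm hμ hM hz 0
  have hq' : Integrable fun x => conj (phase μ (strip z x)) * stripForm μ z x := by
    refine hr.bdd_mul (c := 1) ?_ (Eventually.of_forall fun x => ?_)
    · have h : Measurable fun k : Fin (n + 2) => conj (phase μ k) := measurable_of_countable _
      exact (h.comp (measurable_strip z)).aestronglyMeasurable
    · rw [RCLike.norm_conj, norm_phase]
  have h3 := energy_sub_energy (measurable_strip z) (monotone_strip z) (fun k => phase μ k) hr hq hq'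
  have h4 : ∫ x, conj (levForm μ (fun j => conj (z j)) 0 x *
      conj (∫ y in Iic x, levForm μ (fun j => conj (z j)) 0 y)) =
      ∫ x, conj (phase μ (strip z x)) * stripForm μ z x *
        conj (∫ y in Iic x, conj (phase μ (strip z y)) * stripForm μ z y) := by
    refine integral_congr_ae ?_
    filter_upwards [ae_levForm_conj (μ := μ) hz] with x hx
    rw [integral_levForm_conj hz, map_mul, hx]
    simp
  simp only [← levForm_eq_phase_mul] at h3
  rw [h4] at h2
  simp only [stripPeriod]
  rw [← h3, mul_sub, ← h1]
  have h5 : conj (-Complex.I) = Complex.I := by simp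
  rw [h5] at h2
  rw [neg_mul, sub_neg_eq_add, ← h2]
  push_cast
  ring

/-- Substitute x = Re z_k + δ t. Over the strip the polygon is the segment δ_k and the phase-free
branch is the integrand of F_k. The index is shifted by one because strip 0 is the unbounded strip
on the left. -/
theorem stripPeriod_succ (hz : z ∈ chamber n) (k : Fin n) :
    stripPeriod μ z k.castSucc.succ = baseF μ z k := by
  set δ := (z k.succ - z k.castSucc).re with hδ
  have hδ0 : 0 < δ := delta_re_pos hz k
  have hle : (z k.castSucc).re ≤ (z k.succ).re := chamber_le_re hz (Fin.castSucc_lt_succ (i := k)).le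
  rw [stripPeriod, strip_preimage_succ hz, ← intervalIntegral.integral_of_le hle]
  have h1 := intervalIntegral.smul_integral_comp_add_mul (a := 0) (b := 1) (stripForm μ z) δ
    (z k.castSucc).re
  have h2 : (z k.castSucc).re + δ * 1 = (z k.succ).re := by rw [hδ, Complex.sub_re]; ring
  rw [mul_zero, add_zero, h2] at h1
  rw [← h1, baseF, ← intervalIntegral.integral_smul]
  refine intervalIntegral.integral_congr_ae ?_
  filter_upwards [(by simp [ae_iff] : ∀ᵐ t : ℝ, t ≠ 1)] with t ht1 ht
  rw [uIoc_of_le zero_le_one] at ht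
  have htI : t ∈ Ioo (0 : ℝ) 1 := ⟨ht.1, lt_of_le_of_ne ht.2 ht1⟩
  set x := (z k.castSucc).re + δ * t with hx
  have hx1 : (z k.castSucc).re < x := by rw [hx]; nlinarith [htI.1]
  have hx2 : x < (z k.succ).re := by rw [← h2, hx]; nlinarith [htI.2]
  have hgap : ∀ j, (z j).re ∉ Ioo (z k.castSucc).re (z k.succ).re := by
    rintro j ⟨h3, h4⟩
    by_cases hj : j ≤ k.castSucc
    · exact absurd h3 (not_lt.2 (chamber_le_re hz hj))
    · exact absurd h4 (not_lt.2 (chamber_le_re hz (succ_le_of_not_le_castSucc hj)))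
  have hxne : ∀ j, x ≠ (z j).re := fun j h => hgap j (h ▸ ⟨hx1, hx2⟩)
  have hheight := height_eq_of_mem hz k (x := x) ⟨hx1.le, hx2.le⟩
  have hder : deriv (height z) x = slope z k := by
    have h3 : HasDerivAt (fun y => height z (z k.castSucc).re + slope z k *
        (y - (z k.castSucc).re)) (slope z k) x := by
      simpa using (((hasDerivAt_id x).sub_const (z k.castSucc).re).const_mul
        (slope z k)).const_add (height z (z k.castSucc).re)
    refine (h3.congr_of_eventuallyEq ?_).deriv
    filter_upwards [Ioo_mem_nhds hx1 hx2] with y hy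
    exact height_eq_of_mem hz k ⟨hy.1.le, hy.2.le⟩
  have hslope : slope z k * δ = (z k.succ - z k.castSucc).im := by
    rw [slope, ← hδ, div_mul_cancel₀ _ hδ0.ne']
  have hlev : lev z 0 x = z k.castSucc + (t : ℂ) * (z k.succ - z k.castSucc) := by
    refine Complex.ext ?_ ?_
    · rw [lev_re, Complex.add_re, Complex.re_ofReal_mul, hx]
      ring
    · rw [lev_im, hheight, height_re hz, Complex.add_im, Complex.im_ofReal_mul, ← hslope, hx]
      ring
  have hstrip : strip z x = k.castSucc.succ := by
    have : x ∈ strip z ⁻¹' {k.castSucc.succ} := by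
      rw [strip_preimage_succ hz]; exact ⟨hx1, hx2.le⟩
    exact this
  rw [stripForm_eq hz hxne, hder, hstrip, hlev]
  have h5 : stripPhi μ (k.castSucc.succ : Fin (n + 2)) z
      (z k.castSucc + (t : ℂ) * (z k.succ - z k.castSucc)) =
      integrand μ k z (z k.castSucc + (t : ℂ) * (z k.succ - z k.castSucc)) := by
    refine Finset.prod_congr rfl fun j _ => ?_
    have : j.val < (k.castSucc.succ : Fin (n + 2)).val ↔ j ≤ k.castSucc := by
      simp [Fin.le_def]
    simp only [this]
  rw [h5, Complex.real_smul]
  have h6 : z k.succ - z k.castSucc = δ * (1 + slope z k * Complex.I) := by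
    refine Complex.ext ?_ ?_
    · rw [Complex.re_ofReal_mul]; simp [hδ]
    · rw [Complex.im_ofReal_mul, ← hslope]; simp; ring
  linear_combination -integrand μ k z (z k.castSucc + (t : ℂ) * (z k.succ - z k.castSucc)) * h6

end

end Lauricella
end

/-! ### The area of the plane is minus the Hermitian form at the vector of periods -/

noncomputable section

namespace Lauricella

open MeasureTheory Filter Set

variable {n : ℕ}

/-- The coordinates of the plane given by the levels above the polygon. -/
def levEquiv (z : Fin (n + 1) → ℂ) : ℝ × ℝ ≃ᵐ ℂ where
  toFun p := lev z p.2 p.1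
  invFun ζ := (ζ.re, ζ.im - height z ζ.re)
  left_inv p := by simp
  right_inv ζ := by
    refine Complex.ext (by simp) (by simp)
  measurable_toFun := (continuous_lev z).measurable
  measurable_invFun := by
    have := continuous_height z
    have h : Continuous fun ζ : ℂ => (ζ.re, ζ.im - height z ζ.re) := by fun_prop
    exact h.measurable

theorem measurePreserving_levEquiv (z : Fin (n + 1) → ℂ) : MeasurePreserving (levEquiv z) := by
  have h1 : MeasurePreserving (fun p : ℝ × ℝ => (p.1, height z p.1 + p.2))
      (volume.prod volume) (volume.prod volume) := by
    refine (MeasurePreserving.id volume).skew_product (g := fun x t => height z x + t) ?_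
      (Eventually.of_forall fun x => (measurePreserving_add_left volume (height z x)).map_eq)
    have := continuous_height z
    exact Continuous.measurable (by unfold Function.uncurry; fun_prop)
  have h2 : ⇑(levEquiv z) = Complex.measurableEquivRealProd.symm ∘
      fun p : ℝ × ℝ => (p.1, height z p.1 + p.2) := by
    funext p
    refine Complex.ext ?_ ?_
    · exact lev_re z p.2 p.1
    · exact lev_im z p.2 p.1
  rw [h2]
  exact Complex.volume_preserving_equiv_real_prod.symm.comp h1

theorem density_lev_neg (μ : Fin (n + 1) → ℝ) (z : Fin (n + 1) → ℂ) (x t : ℝ) :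
    density μ z (lev z (-t) x) = density μ (fun j => conj (z j)) (lev (fun j => conj (z j)) t x) := by
  have h : lev (fun j => conj (z j)) t x = conj (lev z (-t) x) := by
    refine Complex.ext (by simp) ?_
    rw [lev_im, Complex.conj_im, lev_im, height_conj]
    ring
  rw [h, density, density]
  refine Finset.prod_congr rfl fun k _ => ?_
  rw [← map_sub, RCLike.norm_conj]

section

variable {μ : Fin (n + 1) → ℝ} {z : Fin (n + 1) → ℂ}

/-- The coordinates (x, t) are an area-preserving shear of the plane and the polygon is a null set;
the half t < 0 is reflected to the upper half of the conjugate configuration. -/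
theorem integrable_density_and_integral (hμ : ∀ j, μ j ∈ Ioo (0 : ℝ) 1) (hM : 1 < totalWeight μ)
    (hz : z ∈ chamber n) :
    Integrable (density μ z) ∧ ∫ ζ, density μ z ζ =
      (∫ p in univ ×ˢ Ioi (0 : ℝ), ‖upPhi μ z (lev z p.2 p.1)‖ ^ 2) +
      ∫ p in univ ×ˢ Ioi (0 : ℝ), ‖upPhi μ (fun j => conj (z j))
        (lev (fun j => conj (z j)) p.2 p.1)‖ ^ 2 := by
  set g : ℝ × ℝ → ℝ := fun p => density μ z (lev z p.2 p.1) with hg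
  have hpres := measurePreserving_levEquiv z
  have hemb := (levEquiv z).measurableEmbedding
  have hup := (upper_area hμ hM hz).1
  have hlo := (upper_area hμ hM (conj_mem_chamber hz)).1
  simp only [← density_eq_norm_upPhi_sq] at hup hlo ⊢
  have hneg : MeasurePreserving (fun p : ℝ × ℝ => (p.1, -p.2)) :=
    (MeasurePreserving.id volume).prod (Measure.measurePreserving_neg volume)
  have hnege : MeasurableEmbedding (fun p : ℝ × ℝ => (p.1, -p.2)) :=
    ((Homeomorph.refl ℝ).prodCongr (Homeomorph.neg ℝ)).measurableEmbedding
  have hpre : (fun p : ℝ × ℝ => (p.1, -p.2)) ⁻¹' (univ ×ˢ Iio 0) = univ ×ˢ Ioi 0 := by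
    ext p; simp
  have hcomp : (g ∘ fun p : ℝ × ℝ => (p.1, -p.2)) = fun p : ℝ × ℝ =>
      density μ (fun j => conj (z j)) (lev (fun j => conj (z j)) p.2 p.1) := by
    funext p
    exact density_lev_neg μ z p.1 p.2
  have hlo' : IntegrableOn g (univ ×ˢ Iio 0) := by
    rw [← hneg.integrableOn_comp_preimage hnege, hpre, hcomp]
    exact hlo
  have hlo'' := hneg.setIntegral_preimage_emb hnege g (univ ×ˢ Iio 0)
  rw [hpre] at hlo''
  have hae : (univ ×ˢ Ioi 0 ∪ univ ×ˢ Iio 0 : Set (ℝ × ℝ)) =ᵐ[volume] univ := by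
    have h0 : (univ ×ˢ Ioi 0 ∪ univ ×ˢ Iio 0 : Set (ℝ × ℝ)) = univ ×ˢ {0}ᶜ := by
      ext p
      simp only [mem_union, mem_prod, mem_univ, true_and, mem_Ioi, mem_Iio, mem_compl_iff,
        mem_singleton_iff]
      exact ⟨fun h => h.elim ne_of_gt ne_of_lt, fun h => (lt_or_gt_of_ne h).symm⟩
    rw [h0]
    conv_rhs => rw [← univ_prod_univ]
    refine Measure.set_prod_ae_eq (ae_eq_refl _) ?_
    rw [ae_eq_univ, compl_compl]
    simp
  have hdisj : Disjoint (univ ×ˢ Ioi 0 : Set (ℝ × ℝ)) (univ ×ˢ Iio 0) := by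
    rw [Set.disjoint_left]
    rintro p ⟨-, h1⟩ ⟨-, h2⟩
    exact lt_asymm (mem_Ioi.1 h1) (mem_Iio.1 h2)
  have hgi : Integrable g := by
    rw [← integrableOn_univ, ← integrableOn_congr_set_ae hae]
    exact hup.union hlo'
  constructor
  · exact (hpres.integrable_comp_emb hemb).1 hgi
  · rw [← hpres.integral_comp hemb]
    change ∫ p, g p = _
    rw [← setIntegral_univ, ← setIntegral_congr_set hae,
      setIntegral_union hdisj (MeasurableSet.univ.prod measurableSet_Iio) hup hlo', ← hlo'']
    congr 2

/-- Passing z_j replaces -μ_j by μ_j in the phase, that is, multiplies it by exp(πiμ_j); the product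
of these factors over j ≤ k is `w μ k`. -/
theorem phase_succ (μ : Fin (n + 1) → ℝ) (k : Fin (n + 1)) :
    phase μ (k.val + 1) = phase μ 0 * w μ k := by
  rw [phase, phase, w, ← Complex.exp_add, ← add_mul, ← Complex.ofReal_add]
  have h : ∑ j : Fin (n + 1), (if j.val < k.val + 1 then μ j else -μ j) =
      ∑ j : Fin (n + 1), (if j.val < 0 then μ j else -μ j) + 2 * ∑ j ∈ Finset.Iic k, μ j := by
    have h1 : Finset.Iic k = Finset.univ.filter (· ≤ k) := by ext; simp
    rw [h1, Finset.sum_filter, Finset.mul_sum, ← Finset.sum_add_distrib]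
    refine Finset.sum_congr rfl fun j _ => ?_
    have h2 : j.val < k.val + 1 ↔ j ≤ k := by rw [Fin.le_def]; omega
    simp only [h2, Nat.not_lt_zero, if_false]
    split_ifs <;> ring
  rw [h]
  congr 3
  ring

theorem tildeH_apply (μ : Fin (n + 1) → ℝ) (x y : Fin (n + 1) → ℂ) :
    tildeH μ x y = ∑ j, ∑ k, if j < k then
      ((w μ j * conj (w μ k)).im : ℂ) * x k * conj (y j) else 0 := rfl

theorem tildeImForm_apply (μ : Fin (n + 1) → ℝ) (x : Fin (n + 1) → ℂ) :
    tildeImForm μ x = ∑ k, ((w μ k).im : ℂ) * x k := by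
  simp [tildeImForm]

theorem imForm_apply (μ : Fin (n + 1) → ℝ) (x : Fin n → ℂ) :
    imForm μ x = ∑ k : Fin n, ((w μ k.castSucc).im : ℂ) * x k := by
  simp [imForm]

theorem sub_conj_eq (a : ℂ) : a - conj a = 2 * Complex.I * a.im := by
  rw [Complex.sub_conj]
  push_cast
  ring

/-- The area of the plane for the flat metric is minus the value of the form on the vector of
periods, completed by the period of the unbounded strip on the right. -/
theorem exists_extended_period (hμ : ∀ j, μ j ∈ Ioo (0 : ℝ) 1) (hM : 1 < totalWeight μ)
    (hz : z ∈ chamber n) :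
    ∃ v ∈ hyperplaneTildeA μ, Fin.init v = baseF μ z ∧ tildeH μ v v = areaN μ z := by
  have hs := sum_phase_mul_stripPeriod hμ hM hz
  have hA := upper_add_lower_area hμ hM hz
  rw [← (integrable_density_and_integral hμ hM hz).2] at hA
  set s := stripPeriod μ z
  set c := phase μ 0 with hc
  have hcc : c * conj c = 1 := phase_mul_conj μ 0
  have hc0 : c ≠ 0 := left_ne_zero_of_mul_eq_one hcc
  have hc0' : conj c ≠ 0 := right_ne_zero_of_mul_eq_one hcc
  let v : Fin (n + 1) → ℂ := fun k => s k.succ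
  have h1 : s 0 + ∑ k, w μ k * v k = 0 := by
    have h := hs.1
    rw [Fin.sum_univ_succ] at h
    simp only [Fin.val_succ, phase_succ, Fin.val_zero, mul_assoc, ← Finset.mul_sum, ← mul_add] at h
    exact (mul_eq_zero.1 h).resolve_left hc0
  have h2 : s 0 + ∑ k, conj (w μ k) * v k = 0 := by
    have h := hs.2
    rw [Fin.sum_univ_succ] at h
    simp only [Fin.val_succ, phase_succ, Fin.val_zero, map_mul, mul_assoc, ← Finset.mul_sum,
      ← mul_add] at h
    exact (mul_eq_zero.1 h).resolve_left hc0'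
  -- Eliminating the left unbounded strip from the two relations leaves exactly the equation of Ã.
  have h3 : ∑ k, ((w μ k).im : ℂ) * v k = 0 := by
    have h : ∑ k, 2 * Complex.I * (((w μ k).im : ℂ) * v k) = 0 := by
      have h4 : ∑ k, 2 * Complex.I * (((w μ k).im : ℂ) * v k) =
          (s 0 + ∑ k, w μ k * v k) - (s 0 + ∑ k, conj (w μ k) * v k) := by
        rw [add_sub_add_left_eq_sub, ← Finset.sum_sub_distrib]
        refine Finset.sum_congr rfl fun k _ => ?_
        rw [← sub_mul, sub_conj_eq]
        ring
      rw [h4, h1, h2, sub_zero]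
    rw [← Finset.mul_sum] at h
    exact (mul_eq_zero.1 h).resolve_left (by simp)
  refine ⟨v, ?_, ?_, ?_⟩
  · rw [hyperplaneTildeA, LinearMap.mem_ker, tildeImForm_apply]
    exact h3
  · funext k
    exact stripPeriod_succ hz k
  -- The pairs involving strip 0 sum to a multiple of the equation of Ã and drop out. The other
  -- phase differences are -2i Im(w_j w̄_k), which are the coefficients of H̃.
  · have h5 : ∑ k : Fin (n + 2), ∑ j : Fin (n + 2), (if j < k then
        (phase μ k * conj (phase μ j) - conj (phase μ k) * phase μ j) * s k * conj (s j) else 0) =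
        -2 * Complex.I * tildeH μ v v := by
      rw [Fin.sum_univ_succ]
      have h6 : ∀ j : Fin (n + 2), ¬ j < 0 := fun j => Fin.not_lt_zero j
      simp only [h6, if_false, Finset.sum_const_zero, zero_add]
      have h7 : ∀ k j : Fin (n + 1), phase μ (k.val + 1) * conj (phase μ (j.val + 1)) -
          conj (phase μ (k.val + 1)) * phase μ (j.val + 1) =
          -2 * Complex.I * ((w μ j * conj (w μ k)).im : ℂ) := by
        intro k j
        have h8 := sub_conj_eq (w μ j * conj (w μ k))
        rw [map_mul, Complex.conj_conj] at h8
        rw [phase_succ, phase_succ, map_mul, map_mul]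
        linear_combination (w μ k * conj (w μ j) - conj (w μ k) * w μ j) * hcc - h8
      have h9 : ∀ k : Fin (n + 1), phase μ (k.val + 1) * conj (phase μ 0) -
          conj (phase μ (k.val + 1)) * phase μ 0 = 2 * Complex.I * ((w μ k).im : ℂ) := by
        intro k
        rw [phase_succ, map_mul]
        linear_combination (w μ k - conj (w μ k)) * hcc + sub_conj_eq (w μ k)
      have h10 : ∀ k : Fin (n + 1), ∑ j : Fin (n + 2), (if j < k.succ then
          (phase μ k.succ * conj (phase μ j) - conj (phase μ k.succ) * phase μ j) * s k.succ *
            conj (s j) else 0) =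
          2 * Complex.I * conj (s 0) * (((w μ k).im : ℂ) * v k) + ∑ j, if j < k then
            -2 * Complex.I * (((w μ j * conj (w μ k)).im : ℂ) * v k * conj (v j)) else 0 := by
        intro k
        rw [Fin.sum_univ_succ, if_pos (Fin.succ_pos k)]
        simp only [Fin.val_succ, Fin.val_zero, Fin.succ_lt_succ_iff, h7, h9]
        congr 1
        · ring
        · refine Finset.sum_congr rfl fun j _ => ?_
          split_ifs
          · simp only [v]; ring
          · rfl
      rw [Finset.sum_congr rfl fun k _ => h10 k, Finset.sum_add_distrib, ← Finset.mul_sum, h3,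
        mul_zero, zero_add, Finset.sum_comm, tildeH_apply, Finset.mul_sum]
      refine Finset.sum_congr rfl fun j _ => ?_
      rw [Finset.mul_sum]
      refine Finset.sum_congr rfl fun k _ => ?_
      rw [mul_ite, mul_zero]
    rw [h5] at hA
    rw [areaN]
    push_cast at hA ⊢
    linear_combination hA / 2 + tildeH μ v v * Complex.I_mul_I

theorem density_pos {ζ : ℂ} (h : ∀ k, z k ≠ ζ) : 0 < density μ z ζ :=
  Finset.prod_pos fun k _ => Real.rpow_pos_of_pos (norm_pos_iff.2 (sub_ne_zero.2 (h k))) _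

/-- The density is positive off finitely many points. -/
theorem areaN_neg (h : Integrable (density μ z)) : areaN μ z < 0 := by
  have hnn : 0 ≤ density μ z := fun ζ =>
    Finset.prod_nonneg fun k _ => Real.rpow_nonneg (norm_nonneg _) _
  rw [areaN, neg_lt_zero, integral_pos_iff_support_of_nonneg hnn h]
  have h1 : (range z)ᶜ ⊆ Function.support (density μ z) := fun ζ hζ =>
    (density_pos fun k hk => hζ ⟨k, hk⟩).ne'
  refine lt_of_lt_of_le ?_ (measure_mono h1)
  rw [measure_compl (finite_range z).measurableSet (by simp [(finite_range z).measure_zero]),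
    (finite_range z).measure_zero]
  simp

end

end Lauricella
end

/-! ### Linear algebra of the forms: the hyperplanes, the lift, Hermitian symmetry -/

noncomputable section

namespace Lauricella

open MeasureTheory Filter Set

variable {n : ℕ}

section

variable {μ : Fin (n + 1) → ℝ}

/-- The sum of the first weights. -/
def partialWeight (μ : Fin (n + 1) → ℝ) (k : ℕ) : ℝ :=
  ∑ j : Fin (n + 1), if j.val ≤ k then μ j else 0

theorem w_eq (μ : Fin (n + 1) → ℝ) (k : Fin (n + 1)) :
    w μ k = Complex.exp ((Real.pi * partialWeight μ k : ℝ) * Complex.I) := by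
  have h1 : Finset.Iic k = Finset.univ.filter (· ≤ k) := by ext; simp
  rw [w, h1, Finset.sum_filter]
  rfl

theorem w_im (μ : Fin (n + 1) → ℝ) (k : Fin (n + 1)) :
    (w μ k).im = Real.sin (Real.pi * partialWeight μ k) := by
  rw [w_eq, Complex.exp_ofReal_mul_I_im]

theorem w_re (μ : Fin (n + 1) → ℝ) (k : Fin (n + 1)) :
    (w μ k).re = Real.cos (Real.pi * partialWeight μ k) := by
  rw [w_eq, Complex.exp_ofReal_mul_I_re]

theorem partialWeight_last (μ : Fin (n + 1) → ℝ) : partialWeight μ n = totalWeight μ :=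
  Finset.sum_congr rfl fun j _ => if_pos (Nat.lt_succ_iff.1 j.2)

theorem partialWeight_zero (μ : Fin (n + 1) → ℝ) : partialWeight μ 0 = μ 0 := by
  rw [partialWeight, Fin.sum_univ_succ]
  simp

theorem partialWeight_succ (μ : Fin (n + 1) → ℝ) {k : ℕ} (hk : k + 1 < n + 1) :
    partialWeight μ (k + 1) = partialWeight μ k + μ ⟨k + 1, hk⟩ := by
  have h : μ ⟨k + 1, hk⟩ = ∑ j : Fin (n + 1), if j = ⟨k + 1, hk⟩ then μ j else 0 := by simp
  rw [h, partialWeight, partialWeight, ← Finset.sum_add_distrib]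
  refine Finset.sum_congr rfl fun j _ => ?_
  have h1 : j = ⟨k + 1, hk⟩ ↔ j.val = k + 1 := Fin.ext_iff
  simp only [h1]
  split_ifs <;> first | omega | simp

theorem w_last_im (μ : Fin (n + 1) → ℝ) :
    (w μ (Fin.last n)).im = Real.sin (Real.pi * totalWeight μ) := by
  rw [w_im, Fin.val_last, partialWeight_last]

theorem w_last_im_eq_zero_iff (μ : Fin (n + 1) → ℝ) :
    (w μ (Fin.last n)).im = 0 ↔ ∃ m : ℤ, totalWeight μ = m := by
  rw [w_last_im, Real.sin_eq_zero_iff]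
  refine exists_congr fun m => ?_
  rw [mul_comm, mul_right_inj' Real.pi_ne_zero, eq_comm]

theorem lift_castSucc (μ : Fin (n + 1) → ℝ) (x : Fin n → ℂ) (k : Fin n) :
    lift μ x k.castSucc = x k := by
  simp [lift]

theorem init_lift (μ : Fin (n + 1) → ℝ) (x : Fin n → ℂ) : Fin.init (lift μ x) = x :=
  funext fun k => lift_castSucc μ x k

theorem lift_last (μ : Fin (n + 1) → ℝ) (x : Fin n → ℂ) : lift μ x (Fin.last n) =
    if (w μ (Fin.last n)).im = 0 then 0 else -((w μ (Fin.last n)).im : ℂ)⁻¹ * imForm μ x := by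
  rw [lift, LinearMap.pi_apply, Fin.snoc_last]
  split_ifs <;> simp

theorem tildeImForm_eq (μ : Fin (n + 1) → ℝ) (x : Fin (n + 1) → ℂ) :
    tildeImForm μ x = imForm μ (Fin.init x) + (w μ (Fin.last n)).im * x (Fin.last n) := by
  rw [tildeImForm_apply, imForm_apply, Fin.sum_univ_castSucc]
  rfl

theorem mem_hyperplaneA {x : Fin n → ℂ} : x ∈ hyperplaneA μ ↔ imForm μ x = 0 := Iff.rfl

theorem mem_hyperplaneTildeA {x : Fin (n + 1) → ℂ} :
    x ∈ hyperplaneTildeA μ ↔ tildeImForm μ x = 0 := Iff.rfl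

/-- The subspace on which the form `formH μ` is meaningful. -/
def support (μ : Fin (n + 1) → ℝ) : Submodule ℂ (Fin n → ℂ) :=
  (hyperplaneTildeA μ).comap (lift μ)

theorem mem_support {x : Fin n → ℂ} : x ∈ support μ ↔ tildeImForm μ (lift μ x) = 0 := Iff.rfl

theorem support_eq_top (h : ¬ ∃ m : ℤ, totalWeight μ = m) : support μ = ⊤ := by
  rw [← w_last_im_eq_zero_iff] at h
  refine eq_top_iff.2 fun x _ => ?_
  rw [mem_support, tildeImForm_eq, init_lift, lift_last, if_neg h]
  have : ((w μ (Fin.last n)).im : ℂ) ≠ 0 := Complex.ofReal_ne_zero.2 h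
  field_simp
  ring

theorem support_eq_hyperplaneA (h : ∃ m : ℤ, totalWeight μ = m) : support μ = hyperplaneA μ := by
  rw [← w_last_im_eq_zero_iff] at h
  ext x
  rw [mem_support, mem_hyperplaneA, tildeImForm_eq, init_lift, h]
  simp

theorem init_mem_support {x : Fin (n + 1) → ℂ} (hx : x ∈ hyperplaneTildeA μ) :
    Fin.init x ∈ support μ := by
  by_cases h : ∃ m : ℤ, totalWeight μ = m
  · rw [support_eq_hyperplaneA h, mem_hyperplaneA]
    rw [← w_last_im_eq_zero_iff] at h
    rw [mem_hyperplaneTildeA, tildeImForm_eq, h] at hx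
    simpa using hx
  · rw [support_eq_top h]
    trivial

theorem w_mul_conj_im (μ : Fin (n + 1) → ℝ) (j k : Fin (n + 1)) :
    (w μ j * conj (w μ k)).im = (w μ j).im * (w μ k).re - (w μ j).re * (w μ k).im := by
  rw [Complex.mul_im, Complex.conj_re, Complex.conj_im]
  ring

theorem w_re_sq_of_im_eq_zero {k : Fin (n + 1)} (h : (w μ k).im = 0) : (w μ k).re ≠ 0 := by
  intro h0
  exact Complex.exp_ne_zero _ (Complex.ext h0 h : w μ k = 0)

/-- If w_{n+1} is real, pairing with the last basis vector is Re(w_{n+1}) times the conjugate of the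
equation of Ã. -/
theorem tildeH_single_last_left (h : (w μ (Fin.last n)).im = 0) {y : Fin (n + 1) → ℂ}
    (hy : y ∈ hyperplaneTildeA μ) : tildeH μ (Pi.single (Fin.last n) 1) y = 0 := by
  have h1 : tildeH μ (Pi.single (Fin.last n) 1) y =
      (w μ (Fin.last n)).re * conj (tildeImForm μ y) := by
    rw [tildeH_apply, tildeImForm_apply, map_sum, Finset.mul_sum]
    refine Finset.sum_congr rfl fun j _ => ?_
    rw [Finset.sum_eq_single (Fin.last n)]
    · rw [Pi.single_eq_same, w_mul_conj_im, h]
      split_ifs with hj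
      · push_cast
        simp only [map_mul, Complex.conj_ofReal]
        ring
      · rw [Fin.not_lt, Fin.last_le_iff] at hj
        rw [hj, h]
        simp
    · intro k _ hk
      rw [Pi.single_eq_of_ne hk]
      simp
    · simp
  rw [h1, mem_hyperplaneTildeA.1 hy]
  simp

/-- The last coordinate of the second argument never occurs, since j < k excludes j = n. -/
theorem tildeH_single_last_right (x : Fin (n + 1) → ℂ) :
    tildeH μ x (Pi.single (Fin.last n) 1) = 0 := by
  rw [tildeH_apply]
  refine Finset.sum_eq_zero fun j _ => Finset.sum_eq_zero fun k _ => ?_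
  split_ifs with hjk
  · rw [Pi.single_eq_of_ne (fun h => by rw [h] at hjk; exact absurd hjk (Fin.le_last k).not_gt)]
    simp
  · rfl

theorem eq_lift_init_add {x : Fin (n + 1) → ℂ} (hx : x ∈ hyperplaneTildeA μ) :
    (x = lift μ (Fin.init x)) ∨ ((w μ (Fin.last n)).im = 0 ∧
      x = lift μ (Fin.init x) + x (Fin.last n) • Pi.single (Fin.last n) 1) := by
  by_cases h : (w μ (Fin.last n)).im = 0
  · refine Or.inr ⟨h, funext fun k => ?_⟩
    refine Fin.lastCases ?_ (fun k => ?_) k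
    · simp [lift_last, h]
    · rw [Pi.add_apply, lift_castSucc, Pi.smul_apply,
        Pi.single_eq_of_ne (Fin.castSucc_lt_last k).ne]
      simp [Fin.init]
  · refine Or.inl (funext fun k => ?_)
    refine Fin.lastCases ?_ (fun k => ?_) k
    · rw [lift_last, if_neg h]
      have h1 := mem_hyperplaneTildeA.1 hx
      rw [tildeImForm_eq] at h1
      have h2 : ((w μ (Fin.last n)).im : ℂ) ≠ 0 := Complex.ofReal_ne_zero.2 h
      field_simp
      linear_combination h1
    · rw [lift_castSucc]
      rfl

theorem formH_apply (μ : Fin (n + 1) → ℝ) (x y : Fin n → ℂ) :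
    formH μ x y = tildeH μ (lift μ x) (lift μ y) := rfl

theorem formH_init {x y : Fin (n + 1) → ℂ} (hx : x ∈ hyperplaneTildeA μ)
    (hy : y ∈ hyperplaneTildeA μ) : formH μ (Fin.init x) (Fin.init y) = tildeH μ x y := by
  rw [formH_apply]
  have h1 : tildeH μ (lift μ (Fin.init x)) (lift μ (Fin.init y)) =
      tildeH μ x (lift μ (Fin.init y)) := by
    rcases eq_lift_init_add hx with h | ⟨h, h'⟩
    · rw [← h]
    · conv_rhs => rw [h']
      rw [map_add, LinearMap.add_apply, map_smul, LinearMap.smul_apply,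
        tildeH_single_last_left h (init_mem_support hy), smul_zero, add_zero]
  rw [h1]
  rcases eq_lift_init_add hy with h | ⟨h, h'⟩
  · rw [← h]
  · conv_rhs => rw [h']
    rw [map_add, map_smulₛₗ, tildeH_single_last_right, smul_zero, add_zero]

/-- The defect of symmetry is the full double sum over j, k of Im(w_j w̄_k) x_k ȳ_j. By the addition
theorem each of its two terms has the linear form of Ã in x or in y as a factor. -/
theorem tildeH_conj_symm {x y : Fin (n + 1) → ℂ} (hx : x ∈ hyperplaneTildeA μ)
    (hy : y ∈ hyperplaneTildeA μ) : conj (tildeH μ y x) = tildeH μ x y := by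
  rw [mem_hyperplaneTildeA, tildeImForm_apply] at hx hy
  have h1 : tildeH μ x y - conj (tildeH μ y x) =
      ∑ j, ∑ k, ((w μ j * conj (w μ k)).im : ℂ) * x k * conj (y j) := by
    rw [tildeH_apply, tildeH_apply, map_sum]
    simp only [map_sum]
    rw [Finset.sum_comm (f := fun j k => conj (if j < k then
      ((w μ j * conj (w μ k)).im : ℂ) * y k * conj (x j) else 0)), ← Finset.sum_sub_distrib]
    refine Finset.sum_congr rfl fun j _ => ?_
    rw [← Finset.sum_sub_distrib]
    refine Finset.sum_congr rfl fun k _ => ?_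
    have h2 := w_mul_conj_im μ j k
    have h3 := w_mul_conj_im μ k j
    rcases lt_trichotomy j k with h | h | h
    · rw [if_pos h, if_neg h.le.not_gt]
      simp
    · rw [h]
      simp only [lt_irrefl, if_false, map_zero]
      rw [w_mul_conj_im, mul_comm (w μ k).im, sub_self]
      simp
    · rw [if_neg h.le.not_gt, if_pos h, h2, h3]
      simp only [map_mul, Complex.conj_ofReal, Complex.conj_conj]
      push_cast
      ring
  have h2 : ∑ j, ∑ k, ((w μ j * conj (w μ k)).im : ℂ) * x k * conj (y j) =
      conj (∑ j, ((w μ j).im : ℂ) * y j) * (∑ k, (w μ k).re * x k) -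
        conj (∑ j, ((w μ j).re : ℂ) * y j) * ∑ k, (w μ k).im * x k := by
    rw [map_sum, map_sum, Finset.sum_mul_sum, Finset.sum_mul_sum, ← Finset.sum_sub_distrib]
    refine Finset.sum_congr rfl fun j _ => ?_
    rw [← Finset.sum_sub_distrib]
    refine Finset.sum_congr rfl fun k _ => ?_
    rw [w_mul_conj_im]
    simp only [map_mul, Complex.conj_ofReal]
    push_cast
    ring
  rw [h2, hx, hy, map_zero, zero_mul, mul_zero, sub_zero, sub_eq_zero] at h1
  exact h1.symm

theorem isHermitianOn_support (μ : Fin (n + 1) → ℝ) : IsHermitianOn (formH μ) (support μ) :=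
  fun _ hx _ hy => tildeH_conj_symm hx hy

end

end Lauricella
end

/-! ### Orthogonal bases of Lorentzian Hermitian spaces -/

noncomputable section

namespace Lauricella

open MeasureTheory Filter Set

variable {n : ℕ}

/-- A Hermitian form with a negative vector that is positive on a hyperplane has an orthogonal basis
of signature `(n - 1, 1)`. -/
theorem exists_basis_of_neg_of_pos {V : Type*} [AddCommGroup V] [Module ℂ V] [FiniteDimensional ℂ V]
    {N : ℕ} (hN : Module.finrank ℂ V = N) (i₀ : Fin N) (H : V →ₗ[ℂ] V →ₗ⋆[ℂ] ℂ)
    (hH : ∀ x y, conj (H y x) = H x y) (v : V) (hv : (H v v).re < 0) (l : V →ₗ[ℂ] ℂ)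
    (hl : ∀ x, l x = 0 → x ≠ 0 → 0 < (H x x).re) :
    ∃ b : Module.Basis (Fin N) ℂ V, ∀ i j,
      H (b i) (b j) = if i = j then (if i = i₀ then -1 else 1) else 0 := by
  have hreal : ∀ x, H x x = ((H x x).re : ℂ) := fun x => (Complex.conj_eq_iff_re.1 (hH x x)).symm
  have hv' : H v v ≠ 0 := fun h => by rw [h] at hv; exact lt_irrefl _ hv
  have hperp : ∀ x, H x v = 0 → x ≠ 0 → 0 < (H x x).re := by
    intro x hx hx0
    have hx' : H v x = 0 := by rw [← hH, hx, map_zero]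
    have hexp : ∀ a b : ℂ, H (a • v + b • x) (a • v + b • x) =
        a * conj a * H v v + b * conj b * H x x := by
      intro a b
      simp only [map_add, LinearMap.add_apply, map_smul, LinearMap.smul_apply, map_smulₛₗ, hx, hx',
        smul_eq_mul]
      ring
    have h1 : l (l x • v + (-l v) • x) = 0 := by
      simp only [map_add, map_smul, smul_eq_mul]
      ring
    have h2 : l v ≠ 0 := by
      intro h
      have := hl v h (fun h => hv' (by rw [h]; simp))
      linarith
    have h3 : l x • v + (-l v) • x ≠ 0 := by
      intro h
      have h4 := congrArg (fun y => H y v) h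
      simp only [map_add, LinearMap.add_apply, map_smul, LinearMap.smul_apply, hx, map_zero,
        LinearMap.zero_apply, smul_eq_mul, mul_zero, add_zero] at h4
      rw [(mul_eq_zero.1 h4).resolve_right hv', zero_smul, zero_add] at h
      exact (smul_ne_zero (neg_ne_zero.2 h2) hx0) h
    have h4 := hl _ h1 h3
    rw [hexp, Complex.mul_conj, Complex.mul_conj, Complex.add_re, Complex.re_ofReal_mul,
      Complex.re_ofReal_mul] at h4
    have h5 := Complex.normSq_nonneg (l x)
    have h6 := Complex.normSq_nonneg (-l v)
    nlinarith
  -- P is H with the sign reversed along v, hence positive definite. The arguments are swapped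
  -- because an inner product is conjugate-linear in the first variable. An orthonormal basis for P
  -- that contains the normalized v is the wanted basis for H.
  let P : V → V → ℂ := fun x y => H y x - 2 * H y v * H v x / H v v
  have hPv : ∀ x, P v x = -H x v := fun x => by simp only [P]; field_simp; ring
  have hPpos : ∀ x, x ≠ 0 → 0 < (P x x).re := by
    intro x hx
    set c := H x v / H v v with hc
    have h1 : H (x - c • v) v = 0 := by
      rw [map_sub, LinearMap.sub_apply, map_smul, LinearMap.smul_apply, smul_eq_mul, hc,
        div_mul_cancel₀ _ hv', sub_self]
    have hvx : H v x = conj c * H v v := by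
      rw [← hH v x, hc, map_div₀, hH v v, div_mul_cancel₀ _ hv']
    have hxv : H x v = c * H v v := by rw [hc, div_mul_cancel₀ _ hv']
    have h2 : H (x - c • v) (x - c • v) = H x x - c * conj c * H v v := by
      simp only [map_sub, LinearMap.sub_apply, map_smul, LinearMap.smul_apply, map_smulₛₗ,
        smul_eq_mul, hxv, hvx]
      ring
    have h3 : P x x = H (x - c • v) (x - c • v) - c * conj c * H v v := by
      simp only [P]
      rw [h2, hvx, hxv]
      field_simp
      ring
    rw [h3, Complex.sub_re, Complex.mul_conj, Complex.re_ofReal_mul]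
    by_cases h4 : x - c • v = 0
    · have hc0 : c ≠ 0 := by
        rintro h
        rw [h, zero_smul, sub_zero] at h4
        exact hx h4
      have := Complex.normSq_pos.2 hc0
      rw [h4]
      simp only [map_zero, Complex.zero_re]
      nlinarith
    · have := hperp _ h1 h4
      have := Complex.normSq_nonneg c
      nlinarith
  let core : InnerProductSpace.Core ℂ V :=
    { inner := P
      conj_inner_symm := fun x y => by
        simp only [P, map_sub, map_div₀, map_mul, hH]
        rw [show conj (2 : ℂ) = 2 from Complex.conj_ofNat 2]
        ring
      re_inner_nonneg := fun x => by
        by_cases hx : x = 0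
        · simp [P, hx]
        · exact (hPpos x hx).le
      add_left := fun x y z => by
        simp only [P, map_add]
        ring
      smul_left := fun x y r => by
        simp only [P, map_smulₛₗ, smul_eq_mul]
        ring
      definite := fun x hx => by
        by_contra h
        have := hPpos x h
        rw [hx] at this
        exact lt_irrefl _ this }
  let _ : NormedAddCommGroup V := core.toNormedAddCommGroup
  let _ : InnerProductSpace ℂ V := InnerProductSpace.ofCore core.toCore
  have hinner : ∀ x y : V, inner ℂ x y = P x y := fun _ _ => rfl
  set a := Real.sqrt (-(H v v).re) with ha
  have ha0 : 0 < a := Real.sqrt_pos.2 (by linarith)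
  have haa : a * a = -(H v v).re := Real.mul_self_sqrt (by linarith)
  set e : V := ((a⁻¹ : ℝ) : ℂ) • v with he
  have hPe : ∀ x, inner ℂ e x = -H x e := by
    intro x
    rw [he, inner_smul_left, hinner, hPv, map_smulₛₗ]
    simp
  have hee : H e e = -1 := by
    rw [he, map_smulₛₗ, map_smul, LinearMap.smul_apply, hreal v, show (H v v).re = -(a * a) by
      linarith]
    simp only [smul_eq_mul, Complex.conj_ofReal]
    have : (a : ℂ) ≠ 0 := Complex.ofReal_ne_zero.2 ha0.ne'
    push_cast
    field_simp
  have horth : Orthonormal ℂ (({i₀} : Set (Fin N)).domRestrict fun _ => e) := by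
    rw [orthonormal_iff_ite]
    rintro ⟨i, hi⟩ ⟨j, hj⟩
    rw [mem_singleton_iff] at hi hj
    subst hi hj
    change inner ℂ e e = _
    rw [if_pos rfl, hPe, hee, neg_neg]
  obtain ⟨b, hb⟩ := horth.exists_orthonormalBasis_extension_of_card_eq (by simp [hN])
  have hbe : b i₀ = e := hb i₀ rfl
  have hHe : ∀ j, H (b j) e = if j = i₀ then -1 else 0 := by
    intro j
    have h1 := orthonormal_iff_ite.1 b.orthonormal i₀ j
    rw [hbe, hPe, neg_eq_iff_eq_neg] at h1
    rw [h1]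
    by_cases h : j = i₀
    · rw [if_pos h.symm, if_pos h]
    · rw [if_neg (Ne.symm h), if_neg h, neg_zero]
  have hve : v = (a : ℂ) • e := by
    rw [he, smul_smul, ← Complex.ofReal_mul, mul_inv_cancel₀ ha0.ne', Complex.ofReal_one, one_smul]
  refine ⟨b.toBasis, fun i j => ?_⟩
  rw [OrthonormalBasis.coe_toBasis]
  by_cases hj : j = i₀
  · rw [hj, hbe, hHe]
    split_ifs <;> rfl
  · have h1 : inner ℂ (b j) (b i) = H (b i) (b j) - 2 * H (b i) v * H v (b j) / H v v := rfl
    have h2 : H v (b j) = 0 := by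
      rw [← hH, hve, map_smulₛₗ, hHe, if_neg hj]
      simp
    rw [h2, mul_zero, zero_div, sub_zero, orthonormal_iff_ite.1 b.orthonormal] at h1
    rw [← h1]
    by_cases h : i = j
    · rw [if_pos h, if_pos h.symm, if_neg (h ▸ hj)]
    · rw [if_neg h, if_neg (Ne.symm h)]

end Lauricella
end

/-! ### Diagonalizing the form by partial sums -/

noncomputable section

namespace Lauricella

open MeasureTheory Filter Set

variable {n : ℕ}

section

variable (θ : ℕ → ℝ) (X : ℕ → ℂ)

/-- The partial sums of `sin θ_k X_k`. -/
def sinSum (k : ℕ) : ℂ := ∑ i ∈ Finset.range k, (Real.sin (θ i) : ℂ) * X i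

/-- The increments of the Hermitian form. -/
def increment (k : ℕ) : ℝ :=
  Real.cos (θ k) * (2 * (X k * conj (sinSum θ X k)).re + Real.sin (θ k) * Complex.normSq (X k))

theorem sinSum_succ (k : ℕ) : sinSum θ X (k + 1) = sinSum θ X k + Real.sin (θ k) * X k :=
  Finset.sum_range_succ _ _

theorem increment_eq (k : ℕ) : (increment θ X k : ℂ) = Real.cos (θ k) *
    (X k * conj (sinSum θ X k) + sinSum θ X (k + 1) * conj (X k)) := by
  have h1 : ((2 * (X k * conj (sinSum θ X k)).re : ℝ) : ℂ) =
      X k * conj (sinSum θ X k) + sinSum θ X k * conj (X k) := by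
    have h := Complex.add_conj (X k * conj (sinSum θ X k))
    rw [map_mul, Complex.conj_conj, mul_comm (conj (X k))] at h
    rw [h]
  rw [increment, sinSum_succ, Complex.ofReal_mul, Complex.ofReal_add, h1, Complex.ofReal_mul,
    ← Complex.mul_conj]
  ring

/-- Expand |S_k + sin θ_k X_k|². Where the sine does not vanish, the increment is therefore cot θ_k
times the difference of consecutive |S|². -/
theorem sin_mul_increment (k : ℕ) : Real.sin (θ k) * increment θ X k =
    Real.cos (θ k) * (Complex.normSq (sinSum θ X (k + 1)) - Complex.normSq (sinSum θ X k)) := by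
  have h := Complex.normSq_add (sinSum θ X k) (Real.sin (θ k) * X k)
  rw [Complex.normSq_mul, Complex.normSq_ofReal, map_mul, Complex.conj_ofReal] at h
  have h1 : (sinSum θ X k * (Real.sin (θ k) * conj (X k))).re =
      Real.sin (θ k) * (X k * conj (sinSum θ X k)).re := by
    rw [show sinSum θ X k * (Real.sin (θ k) * conj (X k)) =
      (Real.sin (θ k) : ℂ) * (sinSum θ X k * conj (X k)) by ring, Complex.re_ofReal_mul]
    simp only [Complex.mul_re, Complex.conj_re, Complex.conj_im]
    ring
  rw [sinSum_succ, h, h1, increment]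
  ring

/-- Proved by adding one index at a time. The correction term contains the full sum S_N, which is
the equation of Ã, so on Ã the form is the plain sum of the real increments. -/
theorem sum_sin_sub_eq (N : ℕ) :
    (∑ k ∈ Finset.range N, ∑ j ∈ Finset.range k,
      ((Real.sin (θ j) * Real.cos (θ k) - Real.cos (θ j) * Real.sin (θ k) : ℝ) : ℂ) * X k *
        conj (X j)) +
      sinSum θ X N * conj (∑ i ∈ Finset.range N, (Real.cos (θ i) : ℂ) * X i) =
    ∑ k ∈ Finset.range N, (increment θ X k : ℂ) := by
  induction N with
  | zero => simp [sinSum]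
  | succ N ih =>
    rw [Finset.sum_range_succ, Finset.sum_range_succ _ N, Finset.sum_range_succ _ N, ← ih,
      increment_eq, sinSum_succ]
    have h : ∑ j ∈ Finset.range N,
        ((Real.sin (θ j) * Real.cos (θ N) - Real.cos (θ j) * Real.sin (θ N) : ℝ) : ℂ) * X N *
          conj (X j) = Real.cos (θ N) * X N * conj (sinSum θ X N) -
          Real.sin (θ N) * X N * conj (∑ i ∈ Finset.range N, (Real.cos (θ i) : ℂ) * X i) := by
      rw [sinSum, map_sum, map_sum, Finset.mul_sum, Finset.mul_sum, ← Finset.sum_sub_distrib]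
      refine Finset.sum_congr rfl fun j _ => ?_
      simp only [map_mul, Complex.conj_ofReal]
      push_cast
      ring
    rw [h]
    simp only [map_add, map_mul, Complex.conj_ofReal]
    ring

/-- The cotangent of the `k`-th angle. -/
def cotAt (k : ℕ) : ℝ := Real.cos (θ k) / Real.sin (θ k)

theorem increment_of_sin_ne_zero {k : ℕ} (h : Real.sin (θ k) ≠ 0) : increment θ X k =
    cotAt θ k * (Complex.normSq (sinSum θ X (k + 1)) - Complex.normSq (sinSum θ X k)) := by
  rw [cotAt, div_mul_eq_mul_div, eq_div_iff h, ← sin_mul_increment, mul_comm]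

/-- The difference of cotangents is sin(θ_{k+1} - θ_k) / (sin θ_k sin θ_{k+1}): its sign changes
only when the angle passes a multiple of π. -/
theorem cotAt_sub_pos {k : ℕ} (h : 0 < Real.sin (θ k) * Real.sin (θ (k + 1)))
    (h' : 0 < Real.sin (θ (k + 1) - θ k)) : 0 < cotAt θ k - cotAt θ (k + 1) := by
  have h1 : Real.sin (θ k) ≠ 0 := left_ne_zero_of_mul h.ne'
  have h2 : Real.sin (θ (k + 1)) ≠ 0 := right_ne_zero_of_mul h.ne'
  have h3 : cotAt θ k - cotAt θ (k + 1) = Real.sin (θ (k + 1) - θ k) /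
      (Real.sin (θ k) * Real.sin (θ (k + 1))) := by
    rw [cotAt, cotAt, div_sub_div _ _ h1 h2, Real.sin_sub]
    ring
  rw [h3]
  exact div_pos h' h

/-- The diagonal part of a chain of increments. -/
def chain (a d : ℕ) : ℝ := ∑ k ∈ Finset.range d,
  (cotAt θ (a + k) - cotAt θ (a + k + 1)) * Complex.normSq (sinSum θ X (a + k + 1))

/-- Abel summation of cot θ_k (|S_{k+1}|² - |S_k|²) over a block of indices where no sine vanishes.
-/
theorem sum_increment (a d : ℕ) (hs : ∀ k ≤ d, Real.sin (θ (a + k)) ≠ 0) :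
    ∑ k ∈ Finset.range (d + 1), increment θ X (a + k) =
      cotAt θ (a + d) * Complex.normSq (sinSum θ X (a + d + 1)) -
        cotAt θ a * Complex.normSq (sinSum θ X a) + chain θ X a d := by
  induction d with
  | zero =>
    have := increment_of_sin_ne_zero θ X (hs 0 le_rfl)
    simp only [chain, zero_add, Finset.range_one, Finset.sum_singleton, Finset.range_zero,
      Finset.sum_empty, add_zero] at this ⊢
    rw [this]
    ring
  | succ d ih =>
    rw [Finset.sum_range_succ, ih fun k hk => hs k (hk.trans d.le_succ),
      increment_of_sin_ne_zero θ X (hs (d + 1) le_rfl), chain, chain, Finset.sum_range_succ]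
    rw [← add_assoc]
    ring

theorem chain_nonneg {a d : ℕ} (h : ∀ k < d, 0 < cotAt θ (a + k) - cotAt θ (a + k + 1)) :
    0 ≤ chain θ X a d :=
  Finset.sum_nonneg fun k hk =>
    mul_nonneg (h k (Finset.mem_range.1 hk)).le (Complex.normSq_nonneg _)

/-- A chain with positive coefficients is definite in the partial sums inside the block. With
`eq_zero_of_sinSum` this determines the coordinates. -/
theorem sinSum_eq_zero_of_chain {a d : ℕ}
    (h : ∀ k < d, 0 < cotAt θ (a + k) - cotAt θ (a + k + 1)) (h0 : chain θ X a d ≤ 0) :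
    ∀ k < d, sinSum θ X (a + k + 1) = 0 := by
  intro k hk
  have h1 := (Finset.sum_eq_zero_iff_of_nonneg fun k hk =>
    mul_nonneg (h k (Finset.mem_range.1 hk)).le (Complex.normSq_nonneg _)).1
      (le_antisymm h0 (chain_nonneg θ X h)) k (Finset.mem_range.2 hk)
  exact Complex.normSq_eq_zero.1 ((mul_eq_zero.1 h1).resolve_left (h k hk).ne')

theorem eq_zero_of_sinSum {k : ℕ} (h : Real.sin (θ k) ≠ 0) (h0 : sinSum θ X k = 0)
    (h1 : sinSum θ X (k + 1) = 0) : X k = 0 := by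
  rw [sinSum_succ, h0, zero_add] at h1
  exact (mul_eq_zero.1 h1).resolve_left (Complex.ofReal_ne_zero.2 h)

end

/-- The angles of the numbers `w`. -/
def angle (μ : Fin (n + 1) → ℝ) (k : ℕ) : ℝ := Real.pi * partialWeight μ k

/-- Extension of a tuple by zero. -/
def extend (x : Fin (n + 1) → ℂ) (k : ℕ) : ℂ := if h : k < n + 1 then x ⟨k, h⟩ else 0

theorem extend_val (x : Fin (n + 1) → ℂ) (k : Fin (n + 1)) : extend x k = x k := by
  rw [extend, dif_pos k.2]

section

variable {μ : Fin (n + 1) → ℝ}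

theorem sinSum_angle (μ : Fin (n + 1) → ℝ) (x : Fin (n + 1) → ℂ) {m : ℕ} (hm : m ≤ n + 1) :
    sinSum (angle μ) (extend x) m =
      ∑ k : Fin (n + 1), if k.val < m then ((w μ k).im : ℂ) * x k else 0 := by
  have h : ∀ k : Fin (n + 1), (if k.val < m then ((w μ k).im : ℂ) * x k else 0) =
      if k.val < m then (Real.sin (angle μ k) : ℂ) * extend x k else 0 := fun k => by
    rw [extend_val, w_im, angle]
  simp only [h]
  rw [Fin.sum_univ_eq_sum_range
    (fun k => if k < m then (Real.sin (angle μ k) : ℂ) * extend x k else 0), ← Finset.sum_filter,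
    sinSum]
  congr 1
  ext k
  simp only [Finset.mem_range, Finset.mem_filter]
  omega

theorem sinSum_angle_last (μ : Fin (n + 1) → ℝ) (x : Fin (n + 1) → ℂ) :
    sinSum (angle μ) (extend x) (n + 1) = tildeImForm μ x := by
  rw [sinSum_angle μ x le_rfl, tildeImForm_apply]
  exact Finset.sum_congr rfl fun k _ => if_pos k.2

theorem tildeH_self {x : Fin (n + 1) → ℂ} (hx : x ∈ hyperplaneTildeA μ) :
    tildeH μ x x = ((∑ k ∈ Finset.range (n + 1), increment (angle μ) (extend x) k : ℝ) : ℂ) := by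
  rw [Complex.ofReal_sum, ← sum_sin_sub_eq, sinSum_angle_last, mem_hyperplaneTildeA.1 hx, zero_mul,
    add_zero, tildeH_apply, Finset.sum_comm]
  have h : ∀ k j : Fin (n + 1), (if j < k then ((w μ j * conj (w μ k)).im : ℂ) * x k * conj (x j)
      else 0) = if j.val < k.val then ((Real.sin (angle μ j) * Real.cos (angle μ k) -
        Real.cos (angle μ j) * Real.sin (angle μ k) : ℝ) : ℂ) * extend x k * conj (extend x j)
      else 0 := by
    intro k j
    rw [w_mul_conj_im, w_im, w_im, w_re, w_re, extend_val, extend_val]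
    rfl
  simp only [h]
  have h1 : ∀ k : Fin (n + 1), ∑ j : Fin (n + 1), (if j.val < k.val then
      ((Real.sin (angle μ j) * Real.cos (angle μ k) -
        Real.cos (angle μ j) * Real.sin (angle μ k) : ℝ) : ℂ) * extend x k * conj (extend x j)
      else 0) = ∑ j ∈ Finset.range k.val, ((Real.sin (angle μ j) * Real.cos (angle μ k) -
        Real.cos (angle μ j) * Real.sin (angle μ k) : ℝ) : ℂ) * extend x k * conj (extend x j) := by
    intro k
    rw [Fin.sum_univ_eq_sum_range (fun j => if j < k.val then
      ((Real.sin (angle μ j) * Real.cos (angle μ k) -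
        Real.cos (angle μ j) * Real.sin (angle μ k) : ℝ) : ℂ) * extend x k * conj (extend x j)
      else 0), ← Finset.sum_filter]
    congr 1
    ext j
    simp only [Finset.mem_range, Finset.mem_filter]
    omega
  simp only [h1]
  exact Fin.sum_univ_eq_sum_range (fun k => ∑ j ∈ Finset.range k,
    ((Real.sin (angle μ j) * Real.cos (angle μ k) -
        Real.cos (angle μ j) * Real.sin (angle μ k) : ℝ) : ℂ) * extend x k * conj (extend x j)) _

theorem strictMono_partialWeight (hμ : ∀ j, 0 < μ j) {i k : ℕ} (hik : i < k) (hk : k < n + 1) :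
    partialWeight μ i < partialWeight μ k := by
  induction k with
  | zero => omega
  | succ k ih =>
    have h := hμ ⟨k + 1, hk⟩
    rw [partialWeight_succ μ hk]
    rcases Nat.lt_succ_iff_lt_or_eq.1 hik with h1 | h1
    · linarith [ih h1 (by omega)]
    · rw [h1]
      linarith

theorem sin_angle_pos (hμ : ∀ j, 0 < μ j) {k : ℕ} (hk : k < n + 1) (h : partialWeight μ k < 1) :
    0 < Real.sin (angle μ k) := by
  have h0 : 0 < partialWeight μ k := by
    have h1 : partialWeight μ 0 ≤ partialWeight μ k := by
      rcases Nat.eq_zero_or_pos k with h2 | h2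
      · rw [h2]
      · exact (strictMono_partialWeight hμ h2 hk).le
    rw [partialWeight_zero] at h1
    exact (hμ 0).trans_le h1
  refine Real.sin_pos_of_pos_of_lt_pi (mul_pos Real.pi_pos h0) ?_
  rw [angle]
  nlinarith [Real.pi_pos]

theorem sin_angle_neg {k : ℕ} (h : 1 < partialWeight μ k) (h' : partialWeight μ k < 2) :
    Real.sin (angle μ k) < 0 := by
  have h1 : 0 < Real.sin (angle μ k - Real.pi) := by
    refine Real.sin_pos_of_pos_of_lt_pi ?_ ?_ <;> rw [angle] <;> nlinarith [Real.pi_pos]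
  rw [Real.sin_sub_pi] at h1
  linarith

theorem sin_angle_sub_pos (hμ : ∀ j, μ j ∈ Ioo (0 : ℝ) 1) {k : ℕ} (hk : k + 1 < n + 1) :
    0 < Real.sin (angle μ (k + 1) - angle μ k) := by
  have h : angle μ (k + 1) - angle μ k = Real.pi * μ ⟨k + 1, hk⟩ := by
    rw [angle, angle, partialWeight_succ μ hk]
    ring
  have h1 := hμ ⟨k + 1, hk⟩
  rw [h]
  refine Real.sin_pos_of_pos_of_lt_pi (mul_pos Real.pi_pos h1.1) ?_
  nlinarith [Real.pi_pos, h1.2]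

theorem eq_zero_of_lift_eq_zero {x : Fin n → ℂ} (h : ∀ k < n, extend (lift μ x) k = 0) : x = 0 := by
  funext k
  rw [← lift_castSucc μ x k, ← extend_val (lift μ x)]
  exact h k k.2

theorem cotAt_angle_sub_pos_of_lt (hμ : ∀ j, μ j ∈ Ioo (0 : ℝ) 1) {k : ℕ} (hk : k + 1 < n + 1)
    (h : partialWeight μ (k + 1) < 1) : 0 < cotAt (angle μ) k - cotAt (angle μ) (k + 1) := by
  have hμ0 : ∀ j, 0 < μ j := fun j => (hμ j).1
  exact cotAt_sub_pos _ (mul_pos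
    (sin_angle_pos hμ0 (by omega)
      ((strictMono_partialWeight hμ0 (Nat.lt_succ_self k) (by omega)).trans h))
    (sin_angle_pos hμ0 (by omega) h)) (sin_angle_sub_pos hμ (by omega))

theorem cotAt_angle_sub_pos_of_gt (hμ : ∀ j, μ j ∈ Ioo (0 : ℝ) 1) {k : ℕ} (hk : k + 1 < n + 1)
    (h : 1 < partialWeight μ k) (h' : partialWeight μ (k + 1) < 2) :
    0 < cotAt (angle μ) k - cotAt (angle μ) (k + 1) := by
  have h1 := strictMono_partialWeight (fun j => (hμ j).1) (Nat.lt_succ_self k) hk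
  exact cotAt_sub_pos _ (mul_pos_of_neg_of_neg (sin_angle_neg h (h1.trans h'))
    (sin_angle_neg (h.trans h1) h')) (sin_angle_sub_pos hμ (by omega))

end

end Lauricella
end

/-! ### Signs of the form in the elliptic, parabolic and hyperbolic cases -/

noncomputable section

namespace Lauricella

open MeasureTheory Filter Set

variable {n : ℕ} {μ : Fin (n + 1) → ℝ}

theorem formH_self {x : Fin n → ℂ} (hx : x ∈ support μ) : (formH μ x x).re =
    ∑ k ∈ Finset.range (n + 1), increment (angle μ) (extend (lift μ x)) k := by
  rw [formH_apply, tildeH_self hx, Complex.ofReal_re]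

theorem sinSum_lift_last {x : Fin n → ℂ} (hx : x ∈ support μ) :
    sinSum (angle μ) (extend (lift μ x)) (n + 1) = 0 := by
  rw [sinSum_angle_last]
  exact hx

theorem sinSum_zero (θ : ℕ → ℝ) (X : ℕ → ℂ) : sinSum θ X 0 = 0 := rfl

theorem partialWeight_le (hμ : ∀ j, 0 < μ j) {k : ℕ} (hk : k ≤ n) :
    partialWeight μ k ≤ totalWeight μ := by
  rw [← partialWeight_last]
  rcases hk.eq_or_lt with h | h
  · rw [h]
  · exact (strictMono_partialWeight hμ h (Nat.lt_succ_self n)).le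

/-- The elliptic case. -/
theorem formH_pos_of_lt_one (hμ : ∀ j, μ j ∈ Ioo (0 : ℝ) 1) (hM : totalWeight μ < 1) {x : Fin n → ℂ}
    (hx : x ∈ support μ) (hx0 : x ≠ 0) : 0 < (formH μ x x).re := by
  have hμ0 : ∀ j, 0 < μ j := fun j => (hμ j).1
  set X := extend (lift μ x)
  set θ := angle μ
  have hsin : ∀ k < n + 1, 0 < Real.sin (θ k) := fun k hk => sin_angle_pos hμ0 hk
    ((partialWeight_le hμ0 (by omega)).trans_lt hM)
  have hcot : ∀ k < n, 0 < cotAt θ (0 + k) - cotAt θ (0 + k + 1) := fun k hk => by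
    rw [zero_add]
    exact cotAt_angle_sub_pos_of_lt hμ (by omega) ((partialWeight_le hμ0 (by omega)).trans_lt hM)
  -- Both boundary terms vanish: S_0 = 0 always, and S_{n+1} = 0 is the equation of Ã. Only the
  -- positive chain remains.
  have h := sum_increment θ X 0 n fun k hk => (hsin _ (by omega)).ne'
  have h0 : sinSum θ X (n + 1) = 0 := sinSum_lift_last hx
  simp only [zero_add, sinSum_zero, h0, map_zero, mul_zero, sub_zero] at h
  rw [formH_self hx, h]
  by_contra h1
  have h2 := sinSum_eq_zero_of_chain θ X hcot (not_lt.1 h1)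
  simp only [zero_add] at h2
  have h3 : ∀ k < n, sinSum θ X k = 0 := fun k hk => by
    rcases k with _ | k
    · rfl
    · exact h2 k (by omega)
  exact hx0 (eq_zero_of_lift_eq_zero fun k hk =>
    eq_zero_of_sinSum θ X (hsin k (by omega)).ne' (h3 k hk) (h2 k hk))

/-- The parabolic case. -/
theorem formH_pos_of_eq_one (hμ : ∀ j, μ j ∈ Ioo (0 : ℝ) 1) (hM : totalWeight μ = 1) {x : Fin n → ℂ}
    (hx : x ∈ support μ) (hx0 : x ≠ 0) : 0 < (formH μ x x).re := by
  have hμ0 : ∀ j, 0 < μ j := fun j => (hμ j).1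
  obtain ⟨d, rfl⟩ : ∃ d, n = d + 1 := Nat.exists_eq_succ_of_ne_zero fun h => by
    subst h
    exact hx0 (Subsingleton.elim _ _)
  -- For |μ| = 1 the last angle is π, where the cotangent is not defined; the lift has last
  -- coordinate 0, so the last increment vanishes and the chain ends one step earlier.
  have hlast : extend (lift μ x) (d + 1) = 0 := by
    refine (extend_val (lift μ x) (Fin.last (d + 1))).trans ?_
    rw [lift_last, if_pos ((w_last_im_eq_zero_iff μ).2 ⟨1, by rw [hM]; simp⟩)]
  have h0 := sinSum_lift_last hx
  set X := extend (lift μ x) with hX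
  set θ := angle μ
  have hlt : ∀ k < d + 1, partialWeight μ k < 1 := fun k hk => by
    rw [← hM, ← partialWeight_last]
    exact strictMono_partialWeight hμ0 hk (by omega)
  have hsin : ∀ k < d + 1, 0 < Real.sin (θ k) := fun k hk =>
    sin_angle_pos hμ0 (by omega) (hlt k hk)
  have hcot : ∀ k < d, 0 < cotAt θ (0 + k) - cotAt θ (0 + k + 1) := fun k hk => by
    rw [zero_add]
    exact cotAt_angle_sub_pos_of_lt hμ (by omega) (hlt _ (by omega))
  rw [sinSum_succ, hlast, mul_zero, add_zero] at h0
  have h := sum_increment θ X 0 d fun k hk => (hsin _ (by omega)).ne'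
  simp only [zero_add, sinSum_zero, h0, map_zero, mul_zero, sub_zero] at h
  have h' : increment θ X (d + 1) = 0 := by simp [increment, hlast]
  rw [formH_self hx, Finset.sum_range_succ, ← hX, h, h', add_zero]
  by_contra h1
  have h2 := sinSum_eq_zero_of_chain θ X hcot (not_lt.1 h1)
  simp only [zero_add] at h2
  have h3 : ∀ k < d + 1, sinSum θ X k = 0 := fun k hk => by
    rcases k with _ | k
    · rfl
    · exact h2 k (by omega)
  refine hx0 (eq_zero_of_lift_eq_zero fun k hk =>
    eq_zero_of_sinSum θ X (hsin k (by omega)).ne' (h3 k hk) ?_)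
  rcases Nat.lt_succ_iff_lt_or_eq.1 hk with h4 | h4
  · exact h2 k h4
  · rw [h4, h0]

/-- In the hyperbolic case, the form is positive definite on a hyperplane. -/
theorem exists_hyperplane_pos (hμ : ∀ j, μ j ∈ Ioo (0 : ℝ) 1) (hM : 1 < totalWeight μ)
    (hM2 : totalWeight μ < 2) : ∃ l : (Fin n → ℂ) →ₗ[ℂ] ℂ, ∀ x ∈ support μ, l x = 0 → x ≠ 0 →
      0 < (formH μ x x).re := by
  classical
  have hμ0 : ∀ j, 0 < μ j := fun j => (hμ j).1
  have hex : ∃ k, 1 ≤ partialWeight μ k := ⟨n, by rw [partialWeight_last]; exact hM.le⟩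
  -- The first index whose angle reaches π. All sines before it are positive and all sines after it
  -- are negative, as |μ| < 2. If the angle there equals π, it gets a block of its own.
  obtain ⟨m, hm1, hmin⟩ : ∃ m, 1 ≤ partialWeight μ m ∧ ∀ k < m, partialWeight μ k < 1 :=
    ⟨Nat.find hex, Nat.find_spec hex, fun k hk => not_le.1 (Nat.find_min hex hk)⟩
  have hmn : m ≤ n := by
    by_contra h
    have := hmin n (not_le.1 h)
    rw [partialWeight_last] at this
    linarith
  obtain ⟨d, rfl⟩ : ∃ d, m = d + 1 := Nat.exists_eq_succ_of_ne_zero fun h => by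
    rw [h, partialWeight_zero] at hm1
    exact absurd (hμ 0).2 (not_lt.2 hm1)
  set θ := angle μ with hθ
  have hsin : ∀ k < d + 1, 0 < Real.sin (θ k) := fun k hk =>
    sin_angle_pos hμ0 (by omega) (hmin k hk)
  have hcot : ∀ k < d, 0 < cotAt θ (0 + k) - cotAt θ (0 + k + 1) := fun k hk => by
    rw [zero_add]
    exact cotAt_angle_sub_pos_of_lt hμ (by omega) (hmin _ (by omega))
  have hgt : ∀ k, d + 1 < k → k ≤ n → 1 < partialWeight μ k := fun k hk hkn =>
    hm1.trans_lt (strictMono_partialWeight hμ0 hk (by omega))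
  have hlt2 : ∀ k ≤ n, partialWeight μ k < 2 := fun k hk => (partialWeight_le hμ0 hk).trans_lt hM2
  let l₀ : (Fin n → ℂ) →ₗ[ℂ] ℂ := (∑ k : Fin (n + 1),
    (if k.val < d + 1 then ((w μ k).im : ℂ) else 0) • LinearMap.proj k) ∘ₗ lift μ
  have hl₀ : ∀ x, l₀ x = sinSum θ (extend (lift μ x)) (d + 1) := fun x => by
    rw [sinSum_angle μ _ (by omega)]
    simp only [l₀, LinearMap.comp_apply, LinearMap.sum_apply, LinearMap.smul_apply,
      LinearMap.proj_apply, smul_eq_mul, ite_mul, zero_mul]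
  have hfirst : ∀ X : ℕ → ℂ, ∑ k ∈ Finset.range (d + 1), increment θ X k =
      cotAt θ d * Complex.normSq (sinSum θ X (d + 1)) + chain θ X 0 d := fun X => by
    have h := sum_increment θ X 0 d fun k hk => (hsin _ (by omega)).ne'
    simpa only [zero_add, sinSum_zero, map_zero, mul_zero, sub_zero] using h
  have hfirst0 : ∀ X : ℕ → ℂ, chain θ X 0 d ≤ 0 → sinSum θ X (d + 1) = 0 →
      ∀ k < d + 1, X k = 0 := fun X h1 h0 k hk => by
    have h2 := sinSum_eq_zero_of_chain θ X hcot h1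
    simp only [zero_add] at h2
    refine eq_zero_of_sinSum θ X (hsin k hk).ne' ?_ ?_
    · rcases k with _ | k
      · rfl
      · exact h2 k (by omega)
    · rcases Nat.lt_succ_iff_lt_or_eq.1 hk with h4 | h4
      · exact h2 k h4
      · rw [h4, h0]
  rcases hm1.eq_or_lt with hm | hm
  · have hsm : Real.sin (θ (d + 1)) = 0 := by
      rw [hθ, angle, ← hm, mul_one, Real.sin_pi]
    have hcm : Real.cos (θ (d + 1)) = -1 := by
      rw [hθ, angle, ← hm, mul_one, Real.cos_pi]
    have hmn' : d + 1 < n := lt_of_le_of_ne hmn fun h => by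
      rw [h, partialWeight_last] at hm
      linarith
    obtain ⟨e, rfl⟩ : ∃ e, n = d + 2 + e := Nat.exists_eq_add_of_le hmn'
    -- At the angle π the sine vanishes, so S_{d+2} = S_{d+1} and the increment is -2 Re(X_{d+1}
    -- S̄_{d+1}). On the hyperplane X_{d+1} = -K S_{d+1} it is 2K |S_{d+1}|². This K makes the total
    -- coefficient of |S_{d+1}|², namely cot θ_d + 2K - cot θ_{d+2}, equal to 1.
    set K : ℝ := (1 + cotAt θ (d + 2) - cotAt θ d) / 2 with hK
    refine ⟨LinearMap.proj ⟨d + 1, hmn'⟩ + (K : ℂ) • l₀, fun x hx hlx hx0 => ?_⟩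
    have hS := sinSum_lift_last hx
    rw [LinearMap.add_apply, LinearMap.smul_apply, hl₀, LinearMap.proj_apply, smul_eq_mul,
      ← lift_castSucc μ x, ← extend_val (lift μ x)] at hlx
    change extend (lift μ x) (d + 1) + K * sinSum θ (extend (lift μ x)) (d + 1) = 0 at hlx
    rw [formH_self hx]
    have hX := eq_zero_of_lift_eq_zero (μ := μ) (x := x)
    set X := extend (lift μ x)
    have hcot' : ∀ k < e, 0 < cotAt θ (d + 2 + k) - cotAt θ (d + 2 + k + 1) := fun k hk =>
      cotAt_angle_sub_pos_of_gt hμ (by omega) (hgt _ (by omega) (by omega)) (hlt2 _ (by omega))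
    have hsin' : ∀ k ≤ e, Real.sin (θ (d + 2 + k)) ≠ 0 := fun k hk =>
      (sin_angle_neg (hgt _ (by omega) (by omega)) (hlt2 _ (by omega))).ne
    have hSm : sinSum θ X (d + 2) = sinSum θ X (d + 1) := by
      rw [sinSum_succ, hsm, Complex.ofReal_zero, zero_mul, add_zero]
    have h1 := sum_increment θ X (d + 2) e hsin'
    rw [hS, map_zero, mul_zero, zero_sub, hSm] at h1
    have h2 : increment θ X (d + 1) = 2 * K * Complex.normSq (sinSum θ X (d + 1)) := by
      have h : X (d + 1) * conj (sinSum θ X (d + 1)) =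
          ((-(K * Complex.normSq (sinSum θ X (d + 1))) : ℝ) : ℂ) := by
        rw [eq_neg_of_add_eq_zero_left hlx, neg_mul, mul_assoc, Complex.mul_conj]
        push_cast
        ring
      rw [increment, hsm, hcm, h, Complex.ofReal_re]
      ring
    have h3 : ∑ k ∈ Finset.range (d + 2 + e + 1), increment θ X k =
        Complex.normSq (sinSum θ X (d + 1)) + chain θ X 0 d + chain θ X (d + 2) e := by
      rw [add_assoc (d + 2), Finset.sum_range_add, Finset.sum_range_succ, h1, h2, hfirst, hK]
      ring
    rw [h3]
    have h4 := chain_nonneg θ X hcot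
    have h5 := chain_nonneg θ X hcot'
    have h6 := Complex.normSq_nonneg (sinSum θ X (d + 1))
    by_contra hneg
    have h7 : sinSum θ X (d + 1) = 0 := Complex.normSq_eq_zero.1 (by linarith)
    have h8 := hfirst0 X (by linarith) h7
    have h9 := sinSum_eq_zero_of_chain θ X hcot' (by linarith)
    rw [h7, mul_zero, add_zero] at hlx
    refine hx0 (hX fun k hk => ?_)
    rcases lt_trichotomy k (d + 1) with h | h | h
    · exact h8 k h
    · rw [h, hlx]
    · obtain ⟨i, rfl⟩ : ∃ i, k = d + 2 + i := Nat.exists_eq_add_of_le h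
      refine eq_zero_of_sinSum θ X (hsin' i (by omega)) ?_ (h9 i (by omega))
      rcases i with _ | i
      · rw [add_zero, hSm, h7]
      · exact h9 i (by omega)
  · obtain ⟨e, rfl⟩ : ∃ e, n = d + 1 + e := Nat.exists_eq_add_of_le hmn
    -- When π is passed without being attained, S_{d+1} carries the only coefficient that is not of
    -- the form covered by the chains. On the hyperplane S_{d+1} = 0 the form is the sum of two
    -- positive chains.
    refine ⟨l₀, fun x hx hlx hx0 => ?_⟩
    have hS := sinSum_lift_last hx
    rw [hl₀] at hlx
    rw [formH_self hx]
    have hX := eq_zero_of_lift_eq_zero (μ := μ) (x := x)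
    set X := extend (lift μ x)
    have hgt' : ∀ k, 1 < partialWeight μ (d + 1 + k) ∨ d + 1 + e < d + 1 + k := fun k => by
      rcases Nat.eq_zero_or_pos k with h | h
      · rw [h]
        exact Or.inl hm
      · by_cases h' : k ≤ e
        · exact Or.inl (hgt _ (by omega) (by omega))
        · exact Or.inr (by omega)
    have hcot' : ∀ k < e, 0 < cotAt θ (d + 1 + k) - cotAt θ (d + 1 + k + 1) := fun k hk =>
      cotAt_angle_sub_pos_of_gt hμ (by omega) ((hgt' k).resolve_right (by omega)) (hlt2 _ (by omega))
    have hsin' : ∀ k ≤ e, Real.sin (θ (d + 1 + k)) ≠ 0 := fun k hk =>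
      (sin_angle_neg ((hgt' k).resolve_right (by omega)) (hlt2 _ (by omega))).ne
    have h1 := sum_increment θ X (d + 1) e hsin'
    rw [hS, hlx, map_zero, mul_zero, mul_zero, sub_zero, zero_add] at h1
    have h3 : ∑ k ∈ Finset.range (d + 1 + e + 1), increment θ X k =
        chain θ X 0 d + chain θ X (d + 1) e := by
      rw [add_assoc (d + 1), Finset.sum_range_add, h1, hfirst, hlx, map_zero, mul_zero, zero_add]
    rw [h3]
    have h4 := chain_nonneg θ X hcot
    have h5 := chain_nonneg θ X hcot'
    by_contra hneg
    have h8 := hfirst0 X (by linarith) hlx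
    have h9 := sinSum_eq_zero_of_chain θ X hcot' (by linarith)
    refine hx0 (hX fun k hk => ?_)
    rcases Nat.lt_or_ge k (d + 1) with h | h
    · exact h8 k h
    · obtain ⟨i, rfl⟩ : ∃ i, k = d + 1 + i := Nat.exists_eq_add_of_le h
      refine eq_zero_of_sinSum θ X (hsin' i (by omega)) ?_ (h9 i (by omega))
      rcases i with _ | i
      · rw [add_zero, hlx]
      · exact h9 i (by omega)

/-- The sign computation supplies the positive hyperplane; the negative vector v will be F([n]),
whose norm is minus an area. -/
theorem isHyperbolic_formH (hn : 0 < n) (hμ : ∀ j, μ j ∈ Ioo (0 : ℝ) 1) (hM : 1 < totalWeight μ)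
    (hM2 : totalWeight μ < 2) {v : Fin n → ℂ} (hv : (formH μ v v).re < 0) :
    IsHyperbolic (formH μ) := by
  have htop : support μ = ⊤ := support_eq_top fun ⟨m, hm⟩ => by
    rw [hm] at hM hM2
    have h1 : 1 < m := by exact_mod_cast hM
    have h2 : m < 2 := by exact_mod_cast hM2
    omega
  obtain ⟨l, hl⟩ := exists_hyperplane_pos hμ hM hM2
  have hH := isHermitianOn_support μ
  rw [htop] at hl hH
  obtain ⟨b, hb⟩ := exists_basis_of_neg_of_pos (Module.finrank_fin_fun ℂ) ⟨0, hn⟩ (formH μ)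
    (fun x y => hH x trivial y trivial) v hv l fun x => hl x trivial
  exact ⟨b, ⟨0, hn⟩, hb⟩

end Lauricella
end

/-! ### Analytic dependence of the periods on the weights -/

noncomputable section

namespace Lauricella

open MeasureTheory Filter Set

variable {n : ℕ}

/-- Domination by a real exponent α slightly larger than Re m: exp π absorbs the imaginary part of
m, and B² absorbs |b|^(α - Re m), whose exponent lies between 0 and 2. -/
theorem norm_cpow_neg_le {b m : ℂ} (hb : b ≠ 0) {B α : ℝ} (hB : 1 ≤ B) (hbB : ‖b‖ ≤ B)
    (h1 : -1 < m.re) (h2 : m.re < α) (hα : α < 1) (him : |m.im| < 1) :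
    ‖b ^ (-m)‖ ≤ Real.exp Real.pi * B ^ (2 : ℝ) * ‖b ^ (-(α : ℂ))‖ := by
  have hb0 : 0 < ‖b‖ := norm_pos_iff.2 hb
  rw [Complex.norm_cpow_of_ne_zero hb, Complex.norm_cpow_of_ne_zero hb, div_eq_mul_inv,
    ← Real.exp_neg]
  have h3 : Real.exp (-(b.arg * (-m).im)) ≤ Real.exp Real.pi := by
    refine Real.exp_le_exp.2 ?_
    have h4 : |b.arg * m.im| ≤ Real.pi * 1 := by
      rw [abs_mul]
      exact mul_le_mul (Complex.abs_arg_le_pi b) him.le (abs_nonneg _) Real.pi_pos.le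
    rw [Complex.neg_im, mul_neg, neg_neg]
    linarith [le_abs_self (b.arg * m.im)]
  have h4 : ‖b‖ ^ (-m).re ≤ B ^ (2 : ℝ) * ‖b‖ ^ (-(α : ℂ)).re := by
    have h5 : (-m).re = (α - m.re) + (-(α : ℂ)).re := by
      simp only [Complex.neg_re, Complex.ofReal_re]
      ring
    rw [h5, Real.rpow_add hb0]
    gcongr
    exact (Real.rpow_le_rpow hb0.le hbB (by linarith)).trans
      (Real.rpow_le_rpow_of_exponent_le hB (by linarith))
  have h6 : (-(α : ℂ)).im = 0 := by simp
  rw [h6, mul_zero, Real.exp_zero, div_one]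
  calc ‖b‖ ^ (-m).re * Real.exp (-(b.arg * (-m).im))
      ≤ (B ^ (2 : ℝ) * ‖b‖ ^ (-(α : ℂ)).re) * Real.exp Real.pi := by gcongr
    _ = _ := by ring

theorem norm_side_seg_le (k : Fin n) (z : Fin (n + 1) → ℂ) {t : ℝ} (ht : t ∈ Ioo (0 : ℝ) 1)
    (j : Fin (n + 1)) : ‖side k z (seg k z t) j‖ ≤ 1 + 4 * ‖z‖ := by
  have h1 : ‖side k z (seg k z t) j‖ = ‖seg k z t - z j‖ := by
    unfold side
    split_ifs
    · rfl
    · exact norm_sub_rev _ _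
  have h2 := norm_le_pi_norm z j
  have h3 := norm_le_pi_norm z k.castSucc
  have h4 := norm_le_pi_norm z k.succ
  have h5 : ‖(t : ℂ) * (z k.succ - z k.castSucc)‖ ≤ 1 * (‖z‖ + ‖z‖) := by
    rw [norm_mul, Complex.norm_real, Real.norm_eq_abs, abs_of_pos ht.1]
    exact mul_le_mul ht.2.le ((norm_sub_le _ _).trans (add_le_add h4 h3)) (norm_nonneg _) zero_le_one
  rw [h1, seg]
  have h6 := norm_sub_le (z k.castSucc + (t : ℂ) * (z k.succ - z k.castSucc)) (z j)
  have h7 := norm_add_le (z k.castSucc) ((t : ℂ) * (z k.succ - z k.castSucc))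
  linarith

theorem norm_phi_le {m : Fin (n + 1) → ℂ} {α : Fin (n + 1) → ℝ} (h1 : ∀ j, -1 < (m j).re)
    (h2 : ∀ j, (m j).re < α j) (hα : ∀ j, α j < 1) (him : ∀ j, |(m j).im| < 1)
    (S : Finset (Fin (n + 1))) (k : Fin n) {z : Fin (n + 1) → ℂ} (hz : z ∈ chamber n) {t : ℝ}
    (ht : t ∈ Ioo (0 : ℝ) 1) : ‖phi m S k z (seg k z t)‖ ≤
      (Real.exp Real.pi * (1 + 4 * ‖z‖) ^ (2 : ℝ)) ^ (n + 1) * ‖phi (cw α) S k z (seg k z t)‖ := by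
  have hB : (1 : ℝ) ≤ 1 + 4 * ‖z‖ := by linarith [norm_nonneg z]
  have h3 : ∏ j, ‖side k z (seg k z t) j ^ (-m j)‖ ≤
      (Real.exp Real.pi * (1 + 4 * ‖z‖) ^ (2 : ℝ)) ^ (n + 1) *
        ∏ j, ‖side k z (seg k z t) j ^ (-cw α j)‖ := by
    have h4 : (Real.exp Real.pi * (1 + 4 * ‖z‖) ^ (2 : ℝ)) ^ (n + 1) =
        ∏ _j : Fin (n + 1), Real.exp Real.pi * (1 + 4 * ‖z‖) ^ (2 : ℝ) := by simp
    rw [h4, ← Finset.prod_mul_distrib]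
    refine Finset.prod_le_prod (fun j _ => norm_nonneg _) fun j _ => ?_
    exact norm_cpow_neg_le (ne_zero_of_re_pos (side_re_pos hz k ht j)) hB
      (norm_side_seg_le k z ht j) (h1 j) (h2 j) (hα j) (him j)
  rw [phi, phi, norm_mul, norm_mul, norm_prod (f := fun j => side k z (seg k z t) j ^ (-m j)),
    norm_prod (f := fun j => side k z (seg k z t) j ^ (-cw α j)), mul_left_comm]
  exact mul_le_mul_of_nonneg_left h3 (norm_nonneg _)

theorem eventually_weight {m₀ v : Fin (n + 1) → ℂ} {s₀ : ℂ} {α : Fin (n + 1) → ℝ}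
    (h1 : ∀ j, -1 < (m₀ j + s₀ * v j).re) (h2 : ∀ j, (m₀ j + s₀ * v j).re < α j)
    (him : ∀ j, |(m₀ j + s₀ * v j).im| < 1) :
    ∀ᶠ s in 𝓝 s₀, ∀ j, -1 < (m₀ j + s * v j).re ∧ (m₀ j + s * v j).re < α j ∧
      |(m₀ j + s * v j).im| < 1 := by
  refine eventually_all.2 fun j => ?_
  have hc : Continuous fun s => m₀ j + s * v j := by fun_prop
  have hre : Continuous fun s => (m₀ j + s * v j).re := Complex.continuous_re.comp hc
  have hi : Continuous fun s => |(m₀ j + s * v j).im| := (Complex.continuous_im.comp hc).abs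
  exact (hre.continuousAt.eventually (lt_mem_nhds (h1 j))).and
    ((hre.continuousAt.eventually (gt_mem_nhds (h2 j))).and
      (hi.continuousAt.eventually (gt_mem_nhds (him j))))

/-- The periods depend analytically on the weights. -/
theorem analyticAt_period_weight {m₀ v : Fin (n + 1) → ℂ} {s₀ : ℂ}
    (h1 : ∀ j, -1 < (m₀ j + s₀ * v j).re) (h2 : ∀ j, (m₀ j + s₀ * v j).re < 1)
    (him : ∀ j, |(m₀ j + s₀ * v j).im| < 1) (S : Finset (Fin (n + 1))) (k : Fin n)
    {z : Fin (n + 1) → ℂ} (hz : z ∈ chamber n) :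
    AnalyticAt ℂ (fun s => period (fun j => m₀ j + s * v j) S k z) s₀ := by
  have hev := eventually_weight h1 h2 him
  rw [Complex.analyticAt_iff_eventually_differentiableAt]
  filter_upwards [hev] with s₁ hs₁
  -- The midpoint between Re m_j and 1 dominates all nearby weights and still gives a convergent
  -- integral.
  set α : Fin (n + 1) → ℝ := fun j => ((m₀ j + s₁ * v j).re + 1) / 2 with hα
  have hα1 : ∀ j, α j < 1 := fun j => by
    have := (hs₁ j).2.1
    simp only [hα]
    linarith
  have hev' := eventually_weight (α := α) (fun j => (hs₁ j).1)
    (fun j => by have := (hs₁ j).2.1; simp only [hα]; linarith) fun j => (hs₁ j).2.2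
  obtain ⟨r, hr, hball⟩ := Metric.eventually_nhds_iff_ball.1 hev'
  simp only [period_eq_integral_Ioo]
  set Δ := z k.succ - z k.castSucc
  set C := (Real.exp Real.pi * (1 + 4 * ‖z‖) ^ (2 : ℝ)) ^ (n + 1)
  refine (hasDerivAt_integral_of_holomorphic
    (q := fun s t => phi (fun j => m₀ j + s * v j) S k z (seg k z (t : ℝ)) * Δ) hr
    (bound := fun t => C * ‖phi (cw α) S k z (seg k z t)‖ * ‖Δ‖)
    (((integrableOn_phi_seg (cw_re_lt hα1) S k hz).norm.const_mul C).mul_const _)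
    (fun s hs => ?_) ?_ ?_).2.differentiableAt
  · exact (aestronglyMeasurable_phi_seg (fun j => (hball s hs j).2.1.trans (hα1 j)) S k hz).mul_const _
  · filter_upwards [ae_restrict_mem measurableSet_Ioo] with t ht
    have hne : ∀ j, side k z (seg k z t) j ≠ 0 := fun j =>
      ne_zero_of_re_pos (side_re_pos hz k ht j)
    intro s _
    refine DifferentiableAt.differentiableWithinAt ?_
    unfold phi
    refine DifferentiableAt.mul_const (DifferentiableAt.const_mul ?_ _) _
    refine DifferentiableAt.fun_finsetProd fun j _ => ?_
    exact DifferentiableAt.const_cpow (by fun_prop) (Or.inl (hne j))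
  · filter_upwards [ae_restrict_mem measurableSet_Ioo] with t ht s hs
    rw [norm_mul]
    gcongr
    exact norm_phi_le (fun j => (hball s hs j).1) (fun j => (hball s hs j).2.1) hα1
      (fun j => (hball s hs j).2.2) S k hz ht

/-- The periods in a chart depend real analytically on real weights. -/
theorem analyticAt_chartPeriod_weight {a v : Fin (n + 1) → ℝ} {s₀ : ℝ}
    (h : ∀ j, a j + s₀ * v j ∈ Ioo (0 : ℝ) 1) (u : ℂ) (σ : Equiv.Perm (Fin (n + 1))) (k : Fin n)
    (S : Finset (Fin (n + 1))) {z : Fin (n + 1) → ℂ} (hz : z ∈ chart u σ) :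
    AnalyticAt ℝ (fun s : ℝ => chartPeriod (cw fun j => a j + s * v j) u σ k S z) s₀ := by
  have hre : ∀ j, ((a (σ j) : ℂ) + (s₀ : ℂ) * v (σ j)).re = a (σ j) + s₀ * v (σ j) := fun j => by
    simp
  have h1 := analyticAt_period_weight (m₀ := fun j => (a (σ j) : ℂ)) (v := fun j => (v (σ j) : ℂ))
    (s₀ := s₀) (fun j => by rw [hre]; linarith [(h (σ j)).1]) (fun j => by rw [hre]; exact (h _).2)
    (fun j => by simp) (S.map σ.symm.toEmbedding) k hz
  have h2 := (h1.restrictScalars (𝕜 := ℝ)).comp (Complex.ofRealCLM.analyticAt s₀)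
  refine ((analyticAt_const (v := (u ^ S.card)⁻¹)).mul h2).congr (Eventually.of_forall fun s => ?_)
  simp only [chartPeriod, Function.comp_def, cw]
  push_cast
  rfl

end Lauricella
end

/-! ### Hyperbolic weights: transition matrices carry form to form -/

noncomputable section

namespace Lauricella

open MeasureTheory Filter Set

variable {n : ℕ}

theorem totalWeight_comp (μ : Fin (n + 1) → ℝ) (σ : Equiv.Perm (Fin (n + 1))) :
    totalWeight (μ ∘ σ) = totalWeight μ :=
  Equiv.sum_comp σ μ

theorem density_turn (μ : Fin (n + 1) → ℝ) {u : ℂ} (hu : ‖u‖ = 1) (σ : Equiv.Perm (Fin (n + 1)))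
    (z : Fin (n + 1) → ℂ) (ζ : ℂ) : density (μ ∘ σ) (turn u σ z) (u * ζ) = density μ z ζ := by
  rw [density, density, ← Equiv.prod_comp σ fun k => ‖z k - ζ‖ ^ (-2 * μ k)]
  refine Finset.prod_congr rfl fun k _ => ?_
  rw [turn, ← mul_sub, norm_mul, hu, one_mul]
  rfl

/-- Rotations preserve area and sorting only permutes the factors; hence N is the same function in
every chart. -/
theorem integrable_density_turn_iff (μ : Fin (n + 1) → ℝ) {u : ℂ} (hu : ‖u‖ = 1)
    (σ : Equiv.Perm (Fin (n + 1))) (z : Fin (n + 1) → ℂ) :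
    (Integrable (density (μ ∘ σ) (turn u σ z)) ↔ Integrable (density μ z)) ∧
      areaN (μ ∘ σ) (turn u σ z) = areaN μ z := by
  let e : ℂ ≃ₗᵢ[ℝ] ℂ := rotation ⟨u, by simp [Submonoid.unitSphere, hu]⟩
  have he : ∀ ζ, density (μ ∘ σ) (turn u σ z) (e ζ) = density μ z ζ := density_turn μ hu σ z
  have hpres : MeasurePreserving e := e.measurePreserving
  have hemb : MeasurableEmbedding e := e.toHomeomorph.measurableEmbedding
  constructor
  · rw [← hpres.integrable_comp_emb hemb,
      show density (μ ∘ σ) (turn u σ z) ∘ e = density μ z from funext he]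
  · rw [areaN, areaN, ← hpres.integral_comp hemb]
    simp only [he]

/-- The Lauricella functions in the coordinates of a chart. -/
def chartF (μ : Fin (n + 1) → ℝ) (u : ℂ) (σ : Equiv.Perm (Fin (n + 1))) (z : Fin (n + 1) → ℂ) :
    Fin n → ℂ := fun k => chartPeriod (cw μ) u σ k ∅ z

theorem chartF_eq (μ : Fin (n + 1) → ℝ) (u : ℂ) (σ : Equiv.Perm (Fin (n + 1)))
    (z : Fin (n + 1) → ℂ) : chartF μ u σ z = baseF (μ ∘ σ) (turn u σ z) := by
  funext k
  rw [baseF_eq_period, chartF, chartPeriod, Finset.card_empty, pow_zero, inv_one, one_mul,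
    Finset.map_empty]
  rfl

theorem chartF_one_refl (μ : Fin (n + 1) → ℝ) : chartF μ 1 (Equiv.refl _) = baseF μ := by
  funext z k
  rw [chartF, chartPeriod_one_refl, baseF_eq_period]
  rfl

theorem analyticAt_chartF {μ : Fin (n + 1) → ℝ} (hμ : ∀ j, μ j < 1) {u : ℂ}
    {σ : Equiv.Perm (Fin (n + 1))} {z : Fin (n + 1) → ℂ} (hz : z ∈ chart u σ) :
    AnalyticAt ℂ (chartF μ u σ) z := by
  rw [analyticAt_pi_iff]
  intro k
  exact analyticAt_const.mul ((analyticAt_period (fun j => cw_re_lt hμ (σ j)) _ k hz).comp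
    ((turnL u σ).analyticAt z))

section

variable {μ : Fin (n + 1) → ℝ} {z : Fin (n + 1) → ℂ}

theorem baseF_mem_support (hμ : ∀ j, μ j ∈ Ioo (0 : ℝ) 1) (hM : 1 < totalWeight μ)
    (hz : z ∈ chamber n) : baseF μ z ∈ support μ ∧ formH μ (baseF μ z) (baseF μ z) = areaN μ z := by
  obtain ⟨v, hv, h1, h2⟩ := exists_extended_period hμ hM hz
  rw [← h1, formH_init hv hv]
  exact ⟨init_mem_support hv, h2⟩

/-- The area formula for the turned and sorted configuration, whose weights are `μ ∘ σ`; the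
right-hand side is independent of the chart. -/
theorem formH_chartF (hμ : ∀ j, μ j ∈ Ioo (0 : ℝ) 1) (hM : 1 < totalWeight μ) {u : ℂ}
    (hu : ‖u‖ = 1) {σ : Equiv.Perm (Fin (n + 1))} (hz : z ∈ chart u σ) :
    Integrable (density μ z) ∧
      formH (μ ∘ σ) (chartF μ u σ z) (chartF μ u σ z) = areaN μ z := by
  have hμ' : ∀ j, (μ ∘ σ) j ∈ Ioo (0 : ℝ) 1 := fun j => hμ _
  rw [← totalWeight_comp μ σ] at hM
  have h := integrable_density_turn_iff μ hu σ z
  rw [chartF_eq, ← h.1, ← h.2]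
  exact ⟨(integrable_density_and_integral hμ' hM hz).1, (baseF_mem_support hμ' hM hz).2⟩

/-- The chart is connected and `turn` maps it onto the chamber, so a local relation between the
chart functions is a relation for the permuted weights. -/
theorem isRel_of_eventually (hμ : ∀ j, μ j < 1) {u : ℂ} (hu : u ≠ 0)
    {σ : Equiv.Perm (Fin (n + 1))} (hz : z ∈ chart u σ) {a : Fin n → ℂ}
    (h : ∀ᶠ y in 𝓝 z, ∑ k, a k * chartF μ u σ y k = 0) : IsRel (μ ∘ σ) a := by
  have han : AnalyticOnNhd ℂ (fun y => ∑ k, a k * chartF μ u σ y k) (chart u σ) := fun y hy =>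
    Finset.analyticAt_fun_sum _ fun k _ =>
      analyticAt_const.mul ((analyticAt_pi_iff.1 (analyticAt_chartF hμ hy)) k)
  have h1 := han.eqOn_zero_of_preconnected_of_eventuallyEq_zero
    (convex_chart u σ).isPreconnected hz h
  intro y hy
  have h2 : turn u σ (fun j => u⁻¹ * y (σ.symm j)) = y := by
    funext j
    simp [turn, mul_inv_cancel_left₀ hu]
  have h3 : ∑ k, a k * chartF μ u σ (fun j => u⁻¹ * y (σ.symm j)) k = 0 := h1 (by
    change turn u σ _ ∈ chamber n
    rwa [h2])
  simpa only [chartF_eq, h2] using h3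

end

/-- A sesquilinear form that vanishes on the diagonal along a spanning holomorphic map is zero. -/
theorem sesquilinear_eq_zero {E : Type*} [NormedAddCommGroup E] [NormedSpace ℂ E] {z₀ : E}
    {f : E → Fin n → ℂ} (hf : AnalyticAt ℂ f z₀)
    (hspan : ∀ a : Fin n → ℂ, (∀ᶠ z in 𝓝 z₀, ∑ k, a k * f z k = 0) → a = 0)
    (B : (Fin n → ℂ) →ₗ[ℂ] (Fin n → ℂ) →ₗ⋆[ℂ] ℂ) (h : ∀ᶠ z in 𝓝 z₀, B (f z) (f z) = 0) :
    B = 0 := by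
  have hB : ∀ x y, B x y = ∑ l, B x (Pi.single l 1) * conj (y l) := by
    intro x y
    conv_lhs => rw [pi_eq_sum_univ' y]
    rw [map_sum]
    refine Finset.sum_congr rfl fun l _ => ?_
    rw [map_smulₛₗ, smul_eq_mul, mul_comm]
  have hB' : ∀ x l, B x (Pi.single l 1) =
      ∑ k, B (Pi.single k 1) (Pi.single l 1) * x k := by
    intro x l
    conv_lhs => rw [pi_eq_sum_univ' x]
    rw [map_sum, LinearMap.sum_apply]
    refine Finset.sum_congr rfl fun k _ => ?_
    rw [map_smul, LinearMap.smul_apply, smul_eq_mul, mul_comm]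
  have hfk := analyticAt_pi_iff.1 hf
  -- Polarization separates the two arguments; the spanning property is then used twice, first in
  -- the second and then in the first argument.
  obtain ⟨r, hr, hpol⟩ := polarization (φ := fun l z => B (f z) (Pi.single l 1))
    (f := fun l z => f z l) (z₀ := z₀) (fun l => by
      refine (Finset.analyticAt_fun_sum Finset.univ fun k _ => (analyticAt_const
        (v := B (Pi.single k 1) (Pi.single l 1))).mul (hfk k)).congr
          (Eventually.of_forall fun z => (hB' (f z) l).symm)) hfk
    (by simpa only [← hB] using h)
  have hball := Metric.ball_mem_nhds z₀ hr
  have h1 : ∀ z ∈ Metric.ball z₀ r, ∀ l, B (f z) (Pi.single l 1) = 0 := by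
    intro z hz l
    have h2 := hspan (fun l => conj (B (f z) (Pi.single l 1))) (by
      filter_upwards [hball] with w hw
      have h3 := congrArg conj (hpol z hz w hw)
      simpa [map_sum] using h3)
    simpa using congrFun h2 l
  have h2 : ∀ l k, B (Pi.single k 1) (Pi.single l 1) = 0 := fun l k =>
    congrFun (hspan (fun k => B (Pi.single k 1) (Pi.single l 1)) (by
      filter_upwards [hball] with z hz
      rw [← hB']
      exact h1 z hz l)) k
  refine LinearMap.ext fun x => LinearMap.ext fun y => ?_
  rw [hB]
  refine Finset.sum_eq_zero fun l _ => ?_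
  rw [hB', Finset.sum_eq_zero fun k _ => by rw [h2, zero_mul], zero_mul]

/-- The matrix `M` maps the form of the weights `μ₂` to the form of the weights `μ₁`. -/
def IsTransfer (μ₁ μ₂ : Fin (n + 1) → ℝ) (M : Matrix (Fin n) (Fin n) ℂ) : Prop :=
  ∀ x ∈ support μ₂, M.mulVec x ∈ support μ₁ ∧
    ∀ y ∈ support μ₂, formH μ₁ (M.mulVec x) (M.mulVec y) = formH μ₂ x y

theorem not_int_of_one_lt_two {x : ℝ} (h1 : 1 < x) (h2 : x < 2) : ¬ ∃ m : ℤ, x = m := by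
  rintro ⟨m, rfl⟩
  have h3 : 1 < m := by exact_mod_cast h1
  have h4 : m < 2 := by exact_mod_cast h2
  omega

/-- Both forms evaluate to N(y) on the functions of their chart, so their difference, pulled back by
M, vanishes on the diagonal along F. As |μ| is not an integer, F satisfies no linear relation and
the difference is zero. -/
theorem isTransfer_of_hyperbolic {μ : Fin (n + 1) → ℝ} (hμ : ∀ j, μ j ∈ Ioo (0 : ℝ) 1)
    (hM1 : 1 < totalWeight μ) (hM2 : totalWeight μ < 2) {u u' : ℂ} (hu : ‖u‖ = 1) (hu' : ‖u'‖ = 1)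
    {σ σ' : Equiv.Perm (Fin (n + 1))} {z : Fin (n + 1) → ℂ} (hz : z ∈ chart u σ)
    (hz' : z ∈ chart u' σ') {M : Matrix (Fin n) (Fin n) ℂ}
    (hM : ∀ y ∈ chart u σ ∩ chart u' σ', chartF μ u σ y = M.mulVec (chartF μ u' σ' y)) :
    IsTransfer (μ ∘ σ) (μ ∘ σ') M := by
  have hμ1 : ∀ j, μ j < 1 := fun j => (hμ j).2
  have hu0 : u' ≠ 0 := fun h => by rw [h, norm_zero] at hu'; exact zero_ne_one hu'
  have htop : ∀ τ : Equiv.Perm (Fin (n + 1)), support (μ ∘ τ) = ⊤ := fun τ =>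
    support_eq_top (not_int_of_one_lt_two (by rwa [totalWeight_comp]) (by rwa [totalWeight_comp]))
  let B : (Fin n → ℂ) →ₗ[ℂ] (Fin n → ℂ) →ₗ⋆[ℂ] ℂ :=
    ((formH (μ ∘ σ)).comp M.mulVecLin).compl₂ M.mulVecLin - formH (μ ∘ σ')
  have hB : ∀ x y, B x y = formH (μ ∘ σ) (M.mulVec x) (M.mulVec y) - formH (μ ∘ σ') x y :=
    fun x y => rfl
  have h0 : B = 0 := by
    refine sesquilinear_eq_zero (analyticAt_chartF hμ1 hz') (fun a ha => ?_) B ?_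
    · refine (isRel_of_eventually hμ1 hu0 hz' ha).eq_zero (μ := μ ∘ σ') (fun j => hμ1 _) fun i hi hi1 hi2 => ?_
      rw [totalWeight_comp] at hi1
      exact absurd ⟨((i + 1 : ℕ) : ℤ), by rw [← hi1]; push_cast; rfl⟩
        (not_int_of_one_lt_two hM1 hM2)
    · filter_upwards [(isOpen_chart u σ).mem_nhds hz, (isOpen_chart u' σ').mem_nhds hz'] with y hy hy'
      rw [hB, ← hM y ⟨hy, hy'⟩, (formH_chartF hμ hM1 hu hy).2, (formH_chartF hμ hM1 hu' hy').2,
        sub_self]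
  intro x _
  refine ⟨by rw [htop]; trivial, fun y _ => sub_eq_zero.1 ?_⟩
  rw [← hB, h0]
  rfl

end Lauricella
end

/-! ### A multiple of the form that is analytic across integral |μ| -/

noncomputable section

namespace Lauricella

open MeasureTheory Filter Set

variable {n : ℕ}

/-- The part of `tildeH` that involves only the first `n` coordinates. -/
def coreForm (μ : Fin (n + 1) → ℝ) (x y : Fin n → ℂ) : ℂ :=
  ∑ j : Fin n, ∑ k : Fin n, if j < k then
    (((w μ j.castSucc).im * (w μ k.castSucc).re - (w μ j.castSucc).re * (w μ k.castSucc).im : ℝ) : ℂ) *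
      (x k * conj (y j)) else 0

/-- The linear form `∑ Re (w_k) F_k`. -/
def reForm (μ : Fin (n + 1) → ℝ) (x : Fin n → ℂ) : ℂ := ∑ k : Fin n, ((w μ k.castSucc).re : ℂ) * x k

/-- The form `coreForm`, corrected by a term that vanishes on `hyperplaneA`. -/
def coreForm' (μ : Fin (n + 1) → ℝ) (x y : Fin n → ℂ) : ℂ :=
  coreForm μ x y + imForm μ x * conj (reForm μ y)

/-- The form `sin (π |μ|) H`, extended to all weights. -/
def regForm (μ : Fin (n + 1) → ℝ) (x y : Fin n → ℂ) : ℂ :=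
  (w μ (Fin.last n)).im * coreForm' μ x y -
    (w μ (Fin.last n)).re * (imForm μ x * conj (imForm μ y))

/-- Separates the last coordinate of x, which is the only place where the lift, and with it the
denominator sin(π|μ|), enters. -/
theorem tildeH_eq_coreForm_add (μ : Fin (n + 1) → ℝ) (x y : Fin (n + 1) → ℂ) :
    tildeH μ x y = coreForm μ (Fin.init x) (Fin.init y) + x (Fin.last n) *
      ((w μ (Fin.last n)).re * conj (imForm μ (Fin.init y)) -
        (w μ (Fin.last n)).im * conj (reForm μ (Fin.init y))) := by
  have h1 : ∀ k : Fin n, ¬ Fin.last n < k.castSucc := fun k => (Fin.castSucc_lt_last k).le.not_gt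
  rw [tildeH_apply, Fin.sum_univ_castSucc]
  simp only [Fin.sum_univ_castSucc, h1, if_false, lt_irrefl, Finset.sum_const_zero, add_zero,
    Fin.castSucc_lt_last, if_true, Fin.castSucc_lt_castSucc_iff, Finset.sum_add_distrib]
  congr 1
  · refine Finset.sum_congr rfl fun j _ => Finset.sum_congr rfl fun k _ => ?_
    rw [w_mul_conj_im]
    split_ifs
    · rw [mul_assoc]
      rfl
    · rfl
  · rw [imForm_apply, reForm, map_sum, map_sum, Finset.mul_sum, Finset.mul_sum,
      ← Finset.sum_sub_distrib, Finset.mul_sum]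
    refine Finset.sum_congr rfl fun j _ => ?_
    rw [w_mul_conj_im]
    simp only [map_mul, Complex.conj_ofReal, Fin.init]
    push_cast
    ring

theorem regForm_eq {μ : Fin (n + 1) → ℝ} (h : (w μ (Fin.last n)).im ≠ 0) (x y : Fin n → ℂ) :
    regForm μ x y = (w μ (Fin.last n)).im * formH μ x y := by
  have h' : ((w μ (Fin.last n)).im : ℂ) ≠ 0 := Complex.ofReal_ne_zero.2 h
  rw [formH_apply, tildeH_eq_coreForm_add, init_lift, init_lift, lift_last, if_neg h, regForm,
    coreForm']
  field_simp
  ring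

/-- For integral |μ| the lift has last coordinate 0 and the correction in `coreForm'` vanishes on A.
-/
theorem formH_eq_coreForm {μ : Fin (n + 1) → ℝ} (h : (w μ (Fin.last n)).im = 0) {x : Fin n → ℂ}
    (hx : imForm μ x = 0) (y : Fin n → ℂ) : formH μ x y = coreForm' μ x y := by
  rw [formH_apply, tildeH_eq_coreForm_add, init_lift, init_lift, lift_last, if_pos h, coreForm', hx]
  ring

section

variable {a v : Fin (n + 1) → ℝ} {s₀ : ℝ}

theorem partialWeight_line (a v : Fin (n + 1) → ℝ) (k : ℕ) (s : ℝ) :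
    partialWeight (fun j => a j + s * v j) k = partialWeight a k + s * partialWeight v k := by
  simp only [partialWeight]
  rw [Finset.mul_sum, ← Finset.sum_add_distrib]
  refine Finset.sum_congr rfl fun j _ => ?_
  split_ifs <;> simp

theorem analyticAt_w (a v : Fin (n + 1) → ℝ) (s₀ : ℝ) (k : Fin (n + 1)) :
    AnalyticAt ℝ (fun s => (w (fun j => a j + s * v j) k).im) s₀ ∧
      AnalyticAt ℝ (fun s => (w (fun j => a j + s * v j) k).re) s₀ := by
  simp only [w_im, w_re, partialWeight_line]
  have h : AnalyticAt ℝ (fun s : ℝ => Real.pi * (partialWeight a k + s * partialWeight v k)) s₀ :=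
    analyticAt_const.mul (analyticAt_const.add (analyticAt_id.mul analyticAt_const))
  exact ⟨Real.analyticAt_sin.comp h, Real.analyticAt_cos.comp h⟩

theorem AnalyticAt.ofReal_comp {f : ℝ → ℝ} (hf : AnalyticAt ℝ f s₀) :
    AnalyticAt ℝ (fun s => (f s : ℂ)) s₀ :=
  (Complex.ofRealCLM.analyticAt _).comp hf

theorem AnalyticAt.conj_comp {f : ℝ → ℂ} (hf : AnalyticAt ℝ f s₀) :
    AnalyticAt ℝ (fun s => conj (f s)) s₀ :=
  ((Complex.conjCLE : ℂ →L[ℝ] ℂ).analyticAt _).comp hf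

variable {x y : ℝ → Fin n → ℂ}

theorem analyticAt_imForm (hx : ∀ k, AnalyticAt ℝ (fun s => x s k) s₀) :
    AnalyticAt ℝ (fun s => imForm (fun j => a j + s * v j) (x s)) s₀ := by
  simp only [imForm_apply]
  exact Finset.analyticAt_fun_sum _ fun k _ =>
    (AnalyticAt.ofReal_comp (analyticAt_w a v s₀ _).1).mul (hx k)

theorem analyticAt_coreForm' (hx : ∀ k, AnalyticAt ℝ (fun s => x s k) s₀)
    (hy : ∀ k, AnalyticAt ℝ (fun s => y s k) s₀) :
    AnalyticAt ℝ (fun s => coreForm' (fun j => a j + s * v j) (x s) (y s)) s₀ := by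
  have hw := analyticAt_w a v s₀
  refine AnalyticAt.add ?_ ((analyticAt_imForm hx).mul (AnalyticAt.conj_comp ?_))
  · refine Finset.analyticAt_fun_sum _ fun j _ => Finset.analyticAt_fun_sum _ fun k _ => ?_
    split_ifs
    · exact (AnalyticAt.ofReal_comp (((hw _).1.mul (hw _).2).sub ((hw _).2.mul (hw _).1))).mul
        ((hx k).mul (AnalyticAt.conj_comp (hy j)))
    · exact analyticAt_const
  · exact Finset.analyticAt_fun_sum _ fun k _ => (AnalyticAt.ofReal_comp (hw _).2).mul (hy k)

theorem analyticAt_regForm (hx : ∀ k, AnalyticAt ℝ (fun s => x s k) s₀)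
    (hy : ∀ k, AnalyticAt ℝ (fun s => y s k) s₀) :
    AnalyticAt ℝ (fun s => regForm (fun j => a j + s * v j) (x s) (y s)) s₀ := by
  have hw := analyticAt_w a v s₀ (Fin.last n)
  exact ((AnalyticAt.ofReal_comp hw.1).mul (analyticAt_coreForm' hx hy)).sub
    ((AnalyticAt.ofReal_comp hw.2).mul
      ((analyticAt_imForm hx).mul (AnalyticAt.conj_comp (analyticAt_imForm hy))))

/-- At a zero of `sin (π |μ|)`, the derivative of the regularized form is given by `coreForm'` on the
hyperplane. -/
theorem hasDerivAt_regForm (hx : ∀ k, AnalyticAt ℝ (fun s => x s k) s₀)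
    (hy : ∀ k, AnalyticAt ℝ (fun s => y s k) s₀)
    (h0 : (w (fun j => a j + s₀ * v j) (Fin.last n)).im = 0)
    (hx0 : imForm (fun j => a j + s₀ * v j) (x s₀) = 0)
    (hy0 : imForm (fun j => a j + s₀ * v j) (y s₀) = 0) :
    HasDerivAt (fun s => regForm (fun j => a j + s * v j) (x s) (y s))
      (Real.pi * totalWeight v * (w (fun j => a j + s₀ * v j) (Fin.last n)).re *
        coreForm' (fun j => a j + s₀ * v j) (x s₀) (y s₀)) s₀ := by
  have hw := analyticAt_w a v s₀ (Fin.last n)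
  have hd : HasDerivAt (fun s => ((w (fun j => a j + s * v j) (Fin.last n)).im : ℂ))
      ((Real.pi * totalWeight v * (w (fun j => a j + s₀ * v j) (Fin.last n)).re : ℝ) : ℂ) s₀ := by
    refine HasDerivAt.ofReal_comp ?_
    have h2 : ∀ s, totalWeight (fun j => a j + s * v j) = totalWeight a + s * totalWeight v :=
      fun s => by simpa only [partialWeight_last] using partialWeight_line a v n s
    simp only [w_im, w_re, Fin.val_last, partialWeight_last, h2]
    have h1 : HasDerivAt (fun s : ℝ => Real.pi * (totalWeight a + s * totalWeight v))
        (Real.pi * totalWeight v) s₀ := by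
      simpa using (((hasDerivAt_id s₀).mul_const (totalWeight v)).const_add
        (totalWeight a)).const_mul Real.pi
    simpa [mul_comm, mul_left_comm] using h1.sin
  have hcore := (analyticAt_coreForm' (a := a) (v := v) hx hy).differentiableAt.hasDerivAt
  have hcos := (AnalyticAt.ofReal_comp hw.2).differentiableAt.hasDerivAt
  have h1 := (analyticAt_imForm (a := a) (v := v) hx).differentiableAt.hasDerivAt
  have h2 := (AnalyticAt.conj_comp
    (analyticAt_imForm (a := a) (v := v) hy)).differentiableAt.hasDerivAt
  -- The second product contains two factors that vanish at s₀, so it does not contribute; in the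
  -- first, only the derivative of the sine survives.
  refine ((hd.mul hcore).sub (hcos.mul (h1.mul h2))).congr_deriv ?_
  simp only [Pi.mul_apply, h0, hx0, hy0, map_zero]
  push_cast
  ring

end

theorem w_last_comp (μ : Fin (n + 1) → ℝ) (σ : Equiv.Perm (Fin (n + 1))) :
    w (μ ∘ σ) (Fin.last n) = w μ (Fin.last n) := by
  rw [w_eq, w_eq, Fin.val_last, partialWeight_last, partialWeight_last, totalWeight_comp]

end Lauricella
end

/-! ### Extending the invariance from hyperbolic weights to all weights -/

noncomputable section

namespace Lauricella

open MeasureTheory Filter Set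

variable {n : ℕ}

/-- The vector of periods with coefficients `c`, in a chart. -/
def periodVec (μ : Fin (n + 1) → ℝ) (u : ℂ) (σ : Equiv.Perm (Fin (n + 1))) (z : Fin (n + 1) → ℂ)
    (c : Fin n → ℂ) : Fin n → ℂ := (periodMatrix (cw μ) u σ z).mulVec c

theorem periodVec_eq_mulVec {μ : Fin (n + 1) → ℝ} {u u' : ℂ} {σ σ' : Equiv.Perm (Fin (n + 1))}
    {z : Fin (n + 1) → ℂ} {M : Matrix (Fin n) (Fin n) ℂ}
    (hM : ∀ S ≠ Finset.univ, ∀ k, chartPeriod (cw μ) u σ k S z =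
      ∑ l, M k l * chartPeriod (cw μ) u' σ' l S z) (c : Fin n → ℂ) :
    periodVec μ u σ z c = M.mulVec (periodVec μ u' σ' z c) := by
  have h : periodMatrix (cw μ) u σ z = M * periodMatrix (cw μ) u' σ' z := by
    ext k i
    exact hM _ (initSet_ne_univ i.2) k
  rw [periodVec, h, periodVec, Matrix.mulVec_mulVec]

theorem exists_periodVec_eq {μ : Fin (n + 1) → ℝ} (hμ : ∀ j, μ j < 1) {u : ℂ} (hu : u ≠ 0)
    {σ : Equiv.Perm (Fin (n + 1))} {z : Fin (n + 1) → ℂ} (hz : z ∈ chart u σ) (x : Fin n → ℂ) :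
    ∃ c, periodVec μ u σ z c = x := by
  refine ⟨(periodMatrix (cw μ) u σ z)⁻¹.mulVec x, ?_⟩
  rw [periodVec, Matrix.mulVec_mulVec,
    Matrix.mul_nonsing_inv _ (det_periodMatrix_ne_zero hμ hu σ hz).isUnit, Matrix.one_mulVec]

theorem analyticAt_periodVec {a v : Fin (n + 1) → ℝ} {s₀ : ℝ}
    (h : ∀ j, a j + s₀ * v j ∈ Ioo (0 : ℝ) 1) (u : ℂ) (σ : Equiv.Perm (Fin (n + 1)))
    {z : Fin (n + 1) → ℂ} (hz : z ∈ chart u σ) (c : Fin n → ℂ) (k : Fin n) :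
    AnalyticAt ℝ (fun s : ℝ => periodVec (fun j => a j + s * v j) u σ z c k) s₀ :=
  Finset.analyticAt_fun_sum Finset.univ fun (i : Fin n) _ =>
    (analyticAt_chartPeriod_weight h u σ k (initSet n i) hz).mul (analyticAt_const (v := c i))

theorem ne_zero_of_norm_eq_one {u : ℂ} (hu : ‖u‖ = 1) : u ≠ 0 := fun h => by
  rw [h, norm_zero] at hu
  exact zero_ne_one hu

section

variable {a v : Fin (n + 1) → ℝ} {u u' : ℂ} {σ σ' : Equiv.Perm (Fin (n + 1))}
  {z : Fin (n + 1) → ℂ}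

/-- The regularized forms of two charts agree near hyperbolic weights. -/
theorem regForm_periodVec_of_hyperbolic {μ : Fin (n + 1) → ℝ} (hμ : ∀ j, μ j ∈ Ioo (0 : ℝ) 1)
    (hM1 : 1 < totalWeight μ) (hM2 : totalWeight μ < 2) (hu : ‖u‖ = 1) (hu' : ‖u'‖ = 1)
    (hz : z ∈ chart u σ) (hz' : z ∈ chart u' σ') (c d : Fin n → ℂ) :
    regForm (μ ∘ σ) (periodVec μ u σ z c) (periodVec μ u σ z d) =
      regForm (μ ∘ σ') (periodVec μ u' σ' z c) (periodVec μ u' σ' z d) := by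
  obtain ⟨M, -, hM⟩ := exists_transition (fun j => (hμ j).2) (ne_zero_of_norm_eq_one hu)
    (ne_zero_of_norm_eq_one hu') σ σ' hz hz'
  have hT := isTransfer_of_hyperbolic hμ hM1 hM2 hu hu' hz hz' (M := M) fun y hy => by
    funext k
    exact hM y hy ∅ (fun h => by simpa using congrArg Finset.card h) k
  have hint := not_int_of_one_lt_two hM1 hM2
  have htop : support (μ ∘ σ') = ⊤ := support_eq_top (by rwa [totalWeight_comp])
  rw [← w_last_im_eq_zero_iff] at hint
  have h1 := hM z ⟨hz, hz'⟩
  rw [regForm_eq (by rwa [w_last_comp]), regForm_eq (by rwa [w_last_comp]), w_last_comp, w_last_comp,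
    periodVec_eq_mulVec h1, periodVec_eq_mulVec h1,
    (hT _ (by rw [htop]; trivial)).2 _ (by rw [htop]; trivial)]

/-- Vectors are written as periods with fixed coefficients c, d. Both sides are then real analytic
along a segment of weights, and the dependence of the transition matrix on the weights need not be
followed. They agree near the hyperbolic start of the segment, hence on all of it. Agreement in a
neighbourhood of the end, and not only there, is needed for derivatives. -/
theorem regForm_periodVec (hn : 0 < n) {μ : Fin (n + 1) → ℝ} (hμ : ∀ j, μ j ∈ Ioo (0 : ℝ) 1)
    (hu : ‖u‖ = 1) (hu' : ‖u'‖ = 1) (hz : z ∈ chart u σ) (hz' : z ∈ chart u' σ')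
    (c d : Fin n → ℂ) :
    ∃ a v : Fin (n + 1) → ℝ, totalWeight a = 3 / 2 ∧ (fun j => a j + 1 * v j) = μ ∧
      ∀ᶠ s : ℝ in 𝓝 1, regForm ((fun j => a j + s * v j) ∘ σ)
        (periodVec (fun j => a j + s * v j) u σ z c) (periodVec (fun j => a j + s * v j) u σ z d) =
      regForm ((fun j => a j + s * v j) ∘ σ') (periodVec (fun j => a j + s * v j) u' σ' z c)
        (periodVec (fun j => a j + s * v j) u' σ' z d) := by
  -- Equal weights with sum 3/2; they are less than 1 because n ≥ 1.
  set a : Fin (n + 1) → ℝ := fun _ => 3 / (2 * (n + 1)) with ha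
  set v : Fin (n + 1) → ℝ := fun j => μ j - a j with hv
  have ha01 : ∀ j, a j ∈ Ioo (0 : ℝ) 1 := fun j => by
    have : (1 : ℝ) ≤ n := by exact_mod_cast hn
    refine ⟨by positivity, ?_⟩
    rw [ha, div_lt_one (by positivity)]
    linarith
  have hta : totalWeight a = 3 / 2 := by
    rw [totalWeight, ha, Finset.sum_const, Finset.card_univ, Fintype.card_fin, nsmul_eq_mul]
    push_cast
    field_simp
  set U : Set ℝ := {s | ∀ j, a j + s * v j ∈ Ioo (0 : ℝ) 1} with hU
  have hUo : IsOpen U := by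
    have h : U = ⋂ j, (fun s : ℝ => a j + s * v j) ⁻¹' Ioo 0 1 := by
      ext s
      simp [hU]
    rw [h]
    exact isOpen_iInter_of_finite fun j => isOpen_Ioo.preimage (by fun_prop)
  have hUc : Convex ℝ U := by
    intro s hs t ht α β hα hβ hab j
    have h := convex_Ioo (0 : ℝ) 1 (hs j) (ht j) hα hβ hab
    convert h using 1
    simp only [smul_eq_mul]
    linear_combination (-a j) * hab
  have h0U : (0 : ℝ) ∈ U := fun j => by simpa using ha01 j
  have h1U : (1 : ℝ) ∈ U := fun j => by simpa [hv] using hμ j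
  let g : ℝ → ℂ := fun s => regForm ((fun j => a j + s * v j) ∘ σ)
        (periodVec (fun j => a j + s * v j) u σ z c) (periodVec (fun j => a j + s * v j) u σ z d) -
      regForm ((fun j => a j + s * v j) ∘ σ') (periodVec (fun j => a j + s * v j) u' σ' z c)
        (periodVec (fun j => a j + s * v j) u' σ' z d)
  have hg : AnalyticOnNhd ℝ g U := fun s hs =>
    (analyticAt_regForm (a := a ∘ σ) (v := v ∘ σ) (analyticAt_periodVec hs u σ hz c)
      (analyticAt_periodVec hs u σ hz d)).sub
    (analyticAt_regForm (a := a ∘ σ') (v := v ∘ σ') (analyticAt_periodVec hs u' σ' hz' c)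
      (analyticAt_periodVec hs u' σ' hz' d))
  have htw : Continuous fun s : ℝ => totalWeight fun j => a j + s * v j := by
    unfold totalWeight
    fun_prop
  have htw0 : totalWeight (fun j => a j + (0 : ℝ) * v j) = 3 / 2 := by simpa using hta
  have hg0 : g =ᶠ[𝓝 0] 0 := by
    filter_upwards [hUo.mem_nhds h0U,
      htw.continuousAt.eventually (lt_mem_nhds (show (1 : ℝ) < _ by beta_reduce; rw [htw0]; norm_num)),
      htw.continuousAt.eventually (gt_mem_nhds (show _ < (2 : ℝ) by beta_reduce; rw [htw0]; norm_num))] with s hs h1 h2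
    exact sub_eq_zero.2 (regForm_periodVec_of_hyperbolic hs h1 h2 hu hu' hz hz' c d)
  have h := hg.eqOn_zero_of_preconnected_of_eventuallyEq_zero hUc.isPreconnected h0U hg0
  refine ⟨a, v, hta, by simp [hv], ?_⟩
  filter_upwards [hUo.mem_nhds h1U] with s hs
  exact sub_eq_zero.1 (h hs)

/-- The transition matrices preserve the Hermitian forms. -/
theorem isTransfer_of_transition (hn : 0 < n) {μ : Fin (n + 1) → ℝ}
    (hμ : ∀ j, μ j ∈ Ioo (0 : ℝ) 1) (hu : ‖u‖ = 1) (hu' : ‖u'‖ = 1) (hz : z ∈ chart u σ)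
    (hz' : z ∈ chart u' σ') {M : Matrix (Fin n) (Fin n) ℂ}
    (hM : ∀ S ≠ Finset.univ, ∀ k, chartPeriod (cw μ) u σ k S z =
      ∑ l, M k l * chartPeriod (cw μ) u' σ' l S z) : IsTransfer (μ ∘ σ) (μ ∘ σ') M := by
  have hex := exists_periodVec_eq (fun j => (hμ j).2) (ne_zero_of_norm_eq_one hu') hz'
  have hval : ∀ c d, regForm (μ ∘ σ) (M.mulVec (periodVec μ u' σ' z c))
      (M.mulVec (periodVec μ u' σ' z d)) =
      regForm (μ ∘ σ') (periodVec μ u' σ' z c) (periodVec μ u' σ' z d) := fun c d => by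
    obtain ⟨a, v, -, h1, h⟩ := regForm_periodVec hn hμ hu hu' hz hz' c d
    have h2 := h.self_of_nhds
    rw [h1] at h2
    rwa [← periodVec_eq_mulVec hM, ← periodVec_eq_mulVec hM]
  by_cases hint : ∃ m : ℤ, totalWeight μ = m
  · rw [IsTransfer, support_eq_hyperplaneA (by rwa [totalWeight_comp]),
      support_eq_hyperplaneA (by rwa [totalWeight_comp])]
    have him := (w_last_im_eq_zero_iff μ).2 hint
    have hre := w_re_sq_of_im_eq_zero him
    -- For integral |μ| the regularized form is -Re(w_{n+1}) times the rank-one form with kernel A,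
    -- and Re(w_{n+1}) ≠ 0; its invariance says that A is mapped into A.
    have hmem : ∀ x, imForm (μ ∘ σ') x = 0 → imForm (μ ∘ σ) (M.mulVec x) = 0 := by
      intro x hx
      obtain ⟨c, rfl⟩ := hex x
      have h := hval c c
      rw [regForm, regForm, w_last_comp, w_last_comp, him, hx] at h
      simp only [Complex.ofReal_zero, zero_mul, zero_sub, mul_zero, neg_zero, neg_eq_zero,
        mul_eq_zero, Complex.ofReal_eq_zero, hre, false_or, map_eq_zero, or_self] at h
      exact h
    intro x hx
    refine ⟨hmem x hx, fun y hy => ?_⟩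
    rw [formH_eq_coreForm (by rwa [w_last_comp]) (hmem x hx),
      formH_eq_coreForm (by rwa [w_last_comp]) hx]
    obtain ⟨c, rfl⟩ := hex x
    obtain ⟨d, rfl⟩ := hex y
    obtain ⟨a, v, hta, h1, h⟩ := regForm_periodVec hn hμ hu hu' hz hz' c d
    have hs : ∀ j, a j + 1 * v j ∈ Ioo (0 : ℝ) 1 := fun j => by
      rw [show a j + 1 * v j = μ j from congrFun h1 j]
      exact hμ j
    have hc : ∀ τ : Equiv.Perm (Fin (n + 1)),
        (fun j => (a ∘ τ) j + 1 * (v ∘ τ) j) = μ ∘ τ := fun τ => congrArg (fun f => f ∘ τ) h1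
    have hxy : ∀ c, M.mulVec (periodVec μ u' σ' z c) =
        periodVec (fun j => a j + 1 * v j) u σ z c := fun c => by
      rw [h1, periodVec_eq_mulVec hM]
    -- The value at the end of the segment says nothing about H on A; the derivative along the
    -- segment does, up to the common factor π |v| Re(w_{n+1}), where |v| is the sum of the v_j.
    have hd1 := hasDerivAt_regForm (a := a ∘ σ) (v := v ∘ σ) (analyticAt_periodVec hs u σ hz c)
      (analyticAt_periodVec hs u σ hz d) (by rwa [hc, w_last_comp])
      (by rw [hc, ← hxy]; exact hmem _ hx) (by rw [hc, ← hxy]; exact hmem _ hy)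
    have hd2 := hasDerivAt_regForm (a := a ∘ σ') (v := v ∘ σ')
      (analyticAt_periodVec hs u' σ' hz' c) (analyticAt_periodVec hs u' σ' hz' d)
      (by rwa [hc, w_last_comp]) (by rw [hc, h1]; exact hx) (by rw [hc, h1]; exact hy)
    have h2 := hd1.unique (hd2.congr_of_eventuallyEq h)
    rw [hc, hc, w_last_comp, w_last_comp, totalWeight_comp, totalWeight_comp, ← hxy, ← hxy, h1] at h2
    refine mul_left_cancel₀ ?_ h2
    have htv : totalWeight μ = 3 / 2 + totalWeight v := by
      rw [← hta, ← h1]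
      simp [totalWeight, Finset.sum_add_distrib]
    -- The segment runs from 3/2 to an integer, so the total weight varies along it.
    have htv0 : totalWeight v ≠ 0 := by
      intro h0
      obtain ⟨m, hm⟩ := hint
      rw [h0, hm, add_zero] at htv
      have h3 : 2 * m = 3 := by
        have : (2 : ℝ) * m = 3 := by rw [htv]; norm_num
        exact_mod_cast this
      omega
    refine mul_ne_zero (mul_ne_zero ?_ ?_) ?_
    · exact_mod_cast Real.pi_ne_zero
    · exact_mod_cast htv0
    · exact_mod_cast hre
  · rw [IsTransfer, support_eq_top (by rwa [totalWeight_comp]),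
      support_eq_top (by rwa [totalWeight_comp])]
    intro x _
    refine ⟨trivial, fun y _ => ?_⟩
    obtain ⟨c, rfl⟩ := hex x
    obtain ⟨d, rfl⟩ := hex y
    have h := hval c d
    rw [← w_last_im_eq_zero_iff] at hint
    rw [regForm_eq (by rwa [w_last_comp]), regForm_eq (by rwa [w_last_comp]), w_last_comp,
      w_last_comp] at h
    exact mul_left_cancel₀ (Complex.ofReal_ne_zero.2 hint) h

end

end Lauricella
end

/-! ### Continuation along paths and the monodromy group -/

noncomputable section

namespace Lauricella

open MeasureTheory Filter Set

variable {n : ℕ}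

section

variable {μ μ₁ μ₂ μ₃ : Fin (n + 1) → ℝ} {M N : Matrix (Fin n) (Fin n) ℂ}

theorem IsTransfer.mul (hM : IsTransfer μ₁ μ₂ M) (hN : IsTransfer μ₂ μ₃ N) :
    IsTransfer μ₁ μ₃ (M * N) := by
  intro x hx
  have h := hN x hx
  rw [← Matrix.mulVec_mulVec]
  refine ⟨(hM _ h.1).1, fun y hy => ?_⟩
  rw [← Matrix.mulVec_mulVec, (hM _ h.1).2 _ (hN y hy).1, h.2 y hy]

theorem isTransfer_one (μ : Fin (n + 1) → ℝ) : IsTransfer μ μ 1 := fun x hx =>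
  ⟨by rwa [Matrix.one_mulVec], fun y _ => by rw [Matrix.one_mulVec, Matrix.one_mulVec]⟩

/-- An injective endomorphism of the finite-dimensional subspace is surjective, so the inverse also
maps the subspace to itself. -/
theorem IsTransfer.inv {T : GL (Fin n) ℂ} (hT : IsTransfer μ μ T.val) :
    IsTransfer μ μ (T⁻¹).val := by
  have hTT : ∀ x : Fin n → ℂ, (T⁻¹).val.mulVec (T.val.mulVec x) = x := fun x => by
    rw [Matrix.mulVec_mulVec, ← Units.val_mul, inv_mul_cancel, Units.val_one, Matrix.one_mulVec]
  let f : support μ →ₗ[ℂ] support μ := T.val.mulVecLin.restrict fun x hx => (hT x hx).1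
  have hf : Function.Injective f := fun x y hxy => by
    have h := congrArg (fun x => (T⁻¹).val.mulVec (Subtype.val x)) hxy
    exact Subtype.ext (((hTT x).symm.trans h).trans (hTT y))
  have hsurj := LinearMap.injective_iff_surjective.1 hf
  have hex : ∀ x ∈ support μ, ∃ y ∈ support μ, T.val.mulVec y = x := fun x hx => by
    obtain ⟨y, hy⟩ := hsurj ⟨x, hx⟩
    exact ⟨y, y.2, congrArg Subtype.val hy⟩
  intro x hx
  obtain ⟨x', hx', rfl⟩ := hex x hx
  rw [hTT]
  refine ⟨hx', fun y hy => ?_⟩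
  obtain ⟨y', hy', rfl⟩ := hex y hy
  rw [hTT, (hT x' hx').2 y' hy']

/-- The germs at `z` that are isometric combinations of the Lauricella functions of a chart. -/
def IsGoodGerm (μ : Fin (n + 1) → ℝ) (z : Fin (n + 1) → ℂ)
    (g : (Fin (n + 1) → ℂ) → (Fin n → ℂ)) : Prop :=
  ∃ (u : ℂ) (σ : Equiv.Perm (Fin (n + 1))) (A : Matrix (Fin n) (Fin n) ℂ), ‖u‖ = 1 ∧
    z ∈ chart u σ ∧ A.det ≠ 0 ∧ IsTransfer μ (μ ∘ σ) A ∧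
      g =ᶠ[𝓝 z] fun y => A.mulVec (chartF μ u σ y)

/-- A good germ can be rewritten in any chart around z by composing with the transition matrix. The
new expression extends it over the whole chart, which is the local extension needed for continuation
along paths. -/
theorem IsGoodGerm.exists_chart (hn : 0 < n) (hμ : ∀ j, μ j ∈ Ioo (0 : ℝ) 1)
    {z : Fin (n + 1) → ℂ} {g : (Fin (n + 1) → ℂ) → (Fin n → ℂ)} (hg : IsGoodGerm μ z g) {u : ℂ}
    (hu : ‖u‖ = 1) {σ : Equiv.Perm (Fin (n + 1))} (hz : z ∈ chart u σ) :
    ∃ A : Matrix (Fin n) (Fin n) ℂ, A.det ≠ 0 ∧ IsTransfer μ (μ ∘ σ) A ∧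
      g =ᶠ[𝓝 z] fun y => A.mulVec (chartF μ u σ y) := by
  obtain ⟨u', σ', A, hu', hz', hA, hT, hg⟩ := hg
  obtain ⟨M, hM0, hM⟩ := exists_transition (fun j => (hμ j).2) (ne_zero_of_norm_eq_one hu')
    (ne_zero_of_norm_eq_one hu) σ' σ hz' hz
  refine ⟨A * M, by rw [Matrix.det_mul]; exact mul_ne_zero hA hM0,
    hT.mul (isTransfer_of_transition hn hμ hu' hu hz' hz (hM z ⟨hz', hz⟩)), ?_⟩
  filter_upwards [hg, (isOpen_chart u σ).mem_nhds hz, (isOpen_chart u' σ').mem_nhds hz']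
    with y h1 hy hy'
  rw [h1, ← Matrix.mulVec_mulVec]
  congr 1
  funext k
  exact hM y ⟨hy', hy⟩ ∅ (fun h => by simpa using congrArg Finset.card h) k

theorem isGoodGerm_baseF (μ : Fin (n + 1) → ℝ) : IsGoodGerm μ (basePoint n) (baseF μ) := by
  refine ⟨1, Equiv.refl _, 1, by simp, ?_, by simp, isTransfer_one μ, ?_⟩
  · rw [chart_one_refl]
    exact basePoint_mem_chamber
  · rw [chartF_one_refl]
    simp only [Matrix.one_mulVec]
    exact EventuallyEq.rfl

theorem IsGoodGerm.analyticAt (hμ : ∀ j, μ j ∈ Ioo (0 : ℝ) 1) {z : Fin (n + 1) → ℂ}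
    {g : (Fin (n + 1) → ℂ) → (Fin n → ℂ)} (hg : IsGoodGerm μ z g) : AnalyticAt ℂ g z := by
  obtain ⟨u, σ, A, -, hz, -, -, hg⟩ := hg
  refine AnalyticAt.congr ?_ hg.symm
  exact (A.mulVecLin.toContinuousLinearMap.analyticAt _).comp
    (analyticAt_chartF (fun j => (hμ j).2) hz)

theorem exists_continuation_baseF (hn : 0 < n) (hμ : ∀ j, μ j ∈ Ioo (0 : ℝ) 1)
    {z : Fin (n + 1) → ℂ} (γ : Path (basePoint n) z) (hγ : ∀ t, γ t ∈ configSpace n) :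
    ∃ Φ, IsAnalyticContinuation γ Φ ∧ Φ 0 =ᶠ[𝓝 (basePoint n)] baseF μ ∧ IsGoodGerm μ z (Φ 1) := by
  obtain ⟨Φ, h0, h1, h2⟩ := exists_continuation (γ := γ) γ.continuous (good := IsGoodGerm μ)
    (fun t => by
      obtain ⟨u, hu, σ, hz⟩ := exists_mem_chart (hγ t)
      refine ⟨chart u σ, (isOpen_chart u σ).mem_nhds hz, fun z₁ hz₁ g hg => ?_⟩
      obtain ⟨A, hA, hT, hgA⟩ := hg.exists_chart hn hμ hu hz₁
      exact ⟨_, hgA.symm, fun y hy => ⟨u, σ, A, hu, hy, hA, hT, EventuallyEq.rfl⟩⟩)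
    (g := baseF μ) (by rw [γ.source]; exact isGoodGerm_baseF μ)
  have hI : Icc (0 : unitInterval) 1 = univ := eq_univ_of_forall fun t => ⟨unitInterval.nonneg', unitInterval.le_one'⟩
  rw [hI] at h1 h2
  refine ⟨Φ, ⟨fun t => (h1 t trivial).analyticAt hμ, fun t => ?_⟩, by rwa [γ.source] at h0, ?_⟩
  · simpa only [nhdsWithin_univ] using h2 t trivial
  · simpa only [γ.target] using h1 1 trivial

/-- By uniqueness, an arbitrary continuation ends in the same germ as the one built from charts. -/
theorem IsContinuationOfF.isGoodGerm (hn : 0 < n) (hμ : ∀ j, μ j ∈ Ioo (0 : ℝ) 1)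
    {z : Fin (n + 1) → ℂ} {γ : Path (basePoint n) z} {G : (Fin (n + 1) → ℂ) → (Fin n → ℂ)}
    (h : IsContinuationOfF μ γ G) : IsGoodGerm μ z G := by
  obtain ⟨hγ, Ψ, hΨ, h0, rfl⟩ := h
  obtain ⟨Φ, hΦ, h0', u, σ, A, hu, hz, hA, hT, hg⟩ := exists_continuation_baseF hn hμ γ hγ
  have h1 := hΨ.unique hΦ (by rw [γ.source]; exact h0.trans h0'.symm) 1
  rw [γ.target] at h1
  exact ⟨u, σ, A, hu, hz, hA, hT, h1.trans hg⟩

theorem IsContinuationOfF.exists_mulVec (hn : 0 < n) (hμ : ∀ j, μ j ∈ Ioo (0 : ℝ) 1)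
    {γ : Path (basePoint n) (basePoint n)} {G : (Fin (n + 1) → ℂ) → (Fin n → ℂ)}
    (h : IsContinuationOfF μ γ G) : ∃ T : GL (Fin n) ℂ, IsTransfer μ μ T.val ∧
      G =ᶠ[𝓝 (basePoint n)] fun z => T.val.mulVec (baseF μ z) := by
  obtain ⟨A, hA, hT, hg⟩ := (h.isGoodGerm hn hμ).exists_chart hn hμ (u := 1) (by simp)
    (σ := Equiv.refl _) (by rw [chart_one_refl]; exact basePoint_mem_chamber)
  rw [chartF_one_refl] at hg
  exact ⟨Matrix.GeneralLinearGroup.mkOfDetNeZero A hA, hT, hg⟩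

theorem isRel_imForm (hμ : ∀ j, μ j ∈ Ioo (0 : ℝ) 1) (hint : ∃ m : ℤ, totalWeight μ = m)
    (hM : 1 < totalWeight μ) : IsRel μ fun k => ((w μ k.castSucc).im : ℂ) := by
  intro z hz
  rw [← imForm_apply, ← mem_hyperplaneA, ← support_eq_hyperplaneA hint]
  exact (baseF_mem_support hμ hM hz).1

/-- A linear relation between the Lauricella functions vanishes on the support of the form. -/
theorem IsRel.sum_eq_zero (hn : 0 < n) (hμ : ∀ j, μ j ∈ Ioo (0 : ℝ) 1) {a : Fin n → ℂ}
    (ha : IsRel μ a) {x : Fin n → ℂ} (hx : x ∈ support μ) : ∑ k, a k * x k = 0 := by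
  have hμ1 : ∀ j, μ j < 1 := fun j => (hμ j).2
  by_cases hint : 1 < totalWeight μ ∧ ∃ m : ℤ, totalWeight μ = m
  -- For integral |μ| > 1 the area formula puts F into A, so Im(w_k) are the coefficients of a
  -- relation; it is nonzero since sin(πμ_0) > 0. Every other relation is a multiple of it. In the
  -- remaining case there is no relation.
  · have hb := isRel_imForm hμ hint.2 hint.1
    have hb0 : (fun k : Fin n => ((w μ k.castSucc).im : ℂ)) ≠ 0 := fun h => by
      have h1 := congrFun h ⟨0, hn⟩
      simp only [Pi.zero_apply, Complex.ofReal_eq_zero] at h1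
      have h2 := sin_angle_pos (fun j => (hμ j).1) (Nat.succ_pos n)
        (by rw [partialWeight_zero]; exact hμ1 0)
      rw [w_im] at h1
      exact h2.ne' h1
    obtain ⟨c, rfl⟩ := ha.eq_smul hμ1 hb hb0
    rw [support_eq_hyperplaneA hint.2, mem_hyperplaneA, imForm_apply] at hx
    simp only [Pi.smul_apply, smul_eq_mul, mul_assoc]
    rw [← Finset.mul_sum, hx, mul_zero]
  · have h0 : a = 0 := ha.eq_zero hμ1 fun i _ hiM hi => by
      refine absurd ⟨?_, ((i + 1 : ℕ) : ℤ), ?_⟩ hint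
      · rw [← hiM]
        have : (1 : ℝ) ≤ i := by exact_mod_cast hi
        linarith
      · rw [← hiM]
        push_cast
        rfl
    simp [h0]

/-- Continuation yields one isometric matrix T₀, but T is only known to satisfy T F = T₀ F. The rows
of T - T₀ are relations between the F_k, hence vanish on the support of the form, and T acts there
as T₀. -/
theorem isTransfer_of_mem_monodromyMatrices (hn : 0 < n) (hμ : ∀ j, μ j ∈ Ioo (0 : ℝ) 1)
    {T : GL (Fin n) ℂ} (hT : T ∈ monodromyMatrices μ) : IsTransfer μ μ T.val := by
  obtain ⟨γ, G, hG, hGT⟩ := hT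
  obtain ⟨T₀, hT₀, hGT₀⟩ := hG.exists_mulVec hn hμ
  have hrel : ∀ k, IsRel μ fun l => T.val k l - T₀.val k l := fun k => by
    have h := isRel_of_eventually (μ := μ) (fun j => (hμ j).2) one_ne_zero (σ := Equiv.refl _)
      (z := basePoint n) (a := fun l => T.val k l - T₀.val k l)
      (by rw [chart_one_refl]; exact basePoint_mem_chamber) (by
        filter_upwards [hGT, hGT₀] with y h1 h2
        have h3 := congrFun (h1.symm.trans h2) k
        rw [chartF_one_refl]
        simp only [sub_mul, Finset.sum_sub_distrib]
        exact sub_eq_zero.2 h3)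
    exact h
  have heq : ∀ x ∈ support μ, T.val.mulVec x = T₀.val.mulVec x := fun x hx => by
    funext k
    have h := (hrel k).sum_eq_zero hn hμ hx
    simp only [sub_mul, Finset.sum_sub_distrib] at h
    exact sub_eq_zero.1 h
  intro x hx
  rw [heq x hx]
  refine ⟨(hT₀ x hx).1, fun y hy => ?_⟩
  rw [heq y hy, (hT₀ x hx).2 y hy]

theorem preservesOn_support (hn : 0 < n) (hμ : ∀ j, μ j ∈ Ioo (0 : ℝ) 1) :
    PreservesOn (monodromyGroup μ) (formH μ) (support μ) := by
  intro T hT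
  have h : IsTransfer μ μ T.val := by
    refine Subgroup.closure_induction (p := fun T _ => IsTransfer μ μ T.val) ?_ ?_ ?_ ?_ hT
    · intro T hT
      exact isTransfer_of_mem_monodromyMatrices hn hμ hT
    · rw [Units.val_one]
      exact isTransfer_one μ
    · intro S T _ _ hS hT
      rw [Units.val_mul]
      exact hS.mul hT
    · intro T _ hT
      exact hT.inv
  exact ⟨fun x hx => (h x hx).1, fun x hx => (h x hx).2⟩

/-- At z the continued germ is an isometric matrix applied to the chart functions, for which the
area formula is known. -/
theorem formH_value (hn : 0 < n) (hμ : ∀ j, μ j ∈ Ioo (0 : ℝ) 1) (hM : 1 < totalWeight μ)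
    (hM2 : totalWeight μ < 2) {z : Fin (n + 1) → ℂ} {γ : Path (basePoint n) z}
    {G : (Fin (n + 1) → ℂ) → (Fin n → ℂ)} (h : IsContinuationOfF μ γ G) :
    Integrable (density μ z) ∧ formH μ (G z) (G z) = areaN μ z ∧ areaN μ z < 0 := by
  obtain ⟨u, σ, A, hu, hz, -, hT, hg⟩ := h.isGoodGerm hn hμ
  have h1 := formH_chartF hμ hM hu hz
  have htop : support (μ ∘ σ) = ⊤ :=
    support_eq_top (not_int_of_one_lt_two (by rwa [totalWeight_comp]) (by rwa [totalWeight_comp]))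
  refine ⟨h1.1, ?_, areaN_neg h1.1⟩
  rw [hg.self_of_nhds, (hT _ (by rw [htop]; trivial)).2 _ (by rw [htop]; trivial), h1.2]

end

end Lauricella
end

/-! ### Assembly of the theorem -/

theorem mainTheorem6 (n : ℕ) (hn : 0 < n) (μ : Fin (n + 1) → ℝ)
    (hμ : ∀ k, μ k ∈ Set.Ioo (0 : ℝ) 1) :
    -- `F` continues along every path in the configuration space that starts at the base point
    (∀ (z : Fin (n + 1) → ℂ) (γ : Path (Lauricella.basePoint n) z),
      (∀ t, γ t ∈ Lauricella.configSpace n) → ∃ G, Lauricella.IsContinuationOfF μ γ G) ∧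
    -- and along every loop the continuation is given by a monodromy matrix
    (∀ (γ : Path (Lauricella.basePoint n) (Lauricella.basePoint n))
      (G : (Fin (n + 1) → ℂ) → (Fin n → ℂ)), Lauricella.IsContinuationOfF μ γ G →
        ∃ T : GL (Fin n) ℂ,
          G =ᶠ[𝓝 (Lauricella.basePoint n)] fun z => T.val.mulVec (Lauricella.baseF μ z)) ∧
    -- `H` is the form induced by the restriction of `H̃` to `Ã`
    (∀ x ∈ Lauricella.hyperplaneTildeA μ, ∀ y ∈ Lauricella.hyperplaneTildeA μ,
      Lauricella.formH μ (Fin.init x) (Fin.init y) = Lauricella.tildeH μ x y) ∧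
    -- invariance for all weight systems
    ((¬ ∃ m : ℤ, Lauricella.totalWeight μ = m) →
      Lauricella.IsHermitianOn (Lauricella.formH μ) ⊤ ∧
      Lauricella.PreservesOn (Lauricella.monodromyGroup μ) (Lauricella.formH μ) ⊤) ∧
    ((∃ m : ℤ, Lauricella.totalWeight μ = m) →
      Lauricella.IsHermitianOn (Lauricella.formH μ) (Lauricella.hyperplaneA μ) ∧
      Lauricella.PreservesOn (Lauricella.monodromyGroup μ) (Lauricella.formH μ)
        (Lauricella.hyperplaneA μ)) ∧
    -- elliptic case
    (Lauricella.totalWeight μ < 1 → Lauricella.IsPosDefOn (Lauricella.formH μ) ⊤) ∧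
    -- parabolic case
    (Lauricella.totalWeight μ = 1 →
      Lauricella.IsPosDefOn (Lauricella.formH μ) (Lauricella.hyperplaneA μ)) ∧
    -- hyperbolic case
    (1 < Lauricella.totalWeight μ → Lauricella.totalWeight μ < 2 →
      Lauricella.IsHyperbolic (Lauricella.formH μ) ∧
      ∀ (z : Fin (n + 1) → ℂ) (γ : Path (Lauricella.basePoint n) z)
        (G : (Fin (n + 1) → ℂ) → (Fin n → ℂ)), Lauricella.IsContinuationOfF μ γ G →
          MeasureTheory.Integrable (Lauricella.density μ z) ∧
          Lauricella.formH μ (G z) (G z) = (Lauricella.areaN μ z : ℂ) ∧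
          Lauricella.areaN μ z < 0) := by
  have hherm := Lauricella.isHermitianOn_support μ
  have hpres := Lauricella.preservesOn_support hn hμ
  refine ⟨fun z γ hγ => ?_, fun γ G hG => ?_, fun x hx y hy => Lauricella.formH_init hx hy,
    fun h => ?_, fun h => ?_, fun h => ?_, fun h => ?_, fun h h' => ?_⟩
  · obtain ⟨Φ, h1, h2, -⟩ := Lauricella.exists_continuation_baseF hn hμ γ hγ
    exact ⟨Φ 1, hγ, Φ, h1, h2, rfl⟩
  · obtain ⟨T, -, h⟩ := hG.exists_mulVec hn hμ
    exact ⟨T, h⟩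
  · rw [← Lauricella.support_eq_top h]
    exact ⟨hherm, hpres⟩
  · rw [← Lauricella.support_eq_hyperplaneA h]
    exact ⟨hherm, hpres⟩
  · have htop : Lauricella.support μ = ⊤ := Lauricella.support_eq_top (by
      rintro ⟨m, hm⟩
      have h0 : 0 < Lauricella.totalWeight μ :=
        Finset.sum_pos (fun j _ => (hμ j).1) Finset.univ_nonempty
      rw [hm] at h h0
      have h1 : 0 < m := by exact_mod_cast h0
      have h2 : m < 1 := by exact_mod_cast h
      omega)
    rw [← htop]
    exact ⟨hherm, fun x hx => Lauricella.formH_pos_of_lt_one hμ h hx⟩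
  · rw [← Lauricella.support_eq_hyperplaneA ⟨1, by rw [h]; simp⟩]
    exact ⟨hherm, fun x hx => Lauricella.formH_pos_of_eq_one hμ h hx⟩
  · refine ⟨?_, fun z γ G hG => Lauricella.formH_value hn hμ h h' hG⟩
    -- The negative vector is F([n]).
    have hz := Lauricella.basePoint_mem_chamber (n := n)
    refine Lauricella.isHyperbolic_formH hn hμ h h' (v := Lauricella.baseF μ (Lauricella.basePoint n)) ?_
    rw [(Lauricella.baseF_mem_support hμ h hz).2, Complex.ofReal_re]
    exact Lauricella.areaN_neg (Lauricella.integrable_density_and_integral hμ h hz).1
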